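/- All graphs are finite and simple. A split graph is a graph $G$ whose vertex set is partitioned into a clique $K$ and an independent set $I$; we always take $K$ to be a clique of maximum size in $G$. Let $V_a=\{u\in I : d_G(u)=2\}$, $V_b=N_G(V_a)$, and let $H$ be the bipartite subgraph of $G$ with vertex set $V_a\cup V_b$ whose edges are the edges of $G$ between $V_a$ and $V_b$. A short cycle of $G$ is an induced cycle $C$ of $H$ with $K\setminus V(C)\neq\emptyset$. Theorem. Let $G$ be a $2$-connected split graph with partition $(K,I)$ as above that has no induced subgraph isomorphic to $K_{1,4}$, and suppose that $|K|\ge|I|\ge 8$. Then $G$ has a Hamiltonian cycle if and only if $G$ has no short cycle. Further, there is an algorithm which, given the adjacency matrix of such a graph $G$ on $n$ vertices, runs in time polynomial in $n$ and outputs a Hamiltonian cycle of $G$ if $G$ has one, and reports that there is none, together with a short cycle of $G$, otherwise. -/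

import Mathlib

/-! ### Split graphs and short cycles -/

/-- `G` is 2-connected: it has more than two vertices and no set of fewer than two vertices
separates it (the empty set included, so `G` is connected). -/
def SimpleGraph.IsTwoConnected {V : Type*} [Fintype V] (G : SimpleGraph V) : Prop :=
  2 < Fintype.card V ∧ ∀ S : Finset V, S.card < 2 → (G.induce (S : Set V)ᶜ).Connected

/-- `G` contains no induced star with four leaves. -/
def SimpleGraph.IsK14Free {V : Type*} (G : SimpleGraph V) : Prop :=
  ¬ (completeBipartiteGraph (Fin 1) (Fin 4)).IsIndContained G

/-- `(K, I)` is a partition of the vertex set of `G` into a clique `K` and an independent set `I`,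
where `K` is a clique of maximum size in `G`. In particular, `G` is a split graph. -/
structure SimpleGraph.IsSplitPartition {V : Type*} [Fintype V] (G : SimpleGraph V)
    (K I : Finset V) : Prop where
  maxClique : G.IsMaximumClique K
  indep : G.IsIndepSet (I : Set V)
  disjoint : Disjoint K I
  cover : ∀ v : V, v ∈ K ∨ v ∈ I

/-- The graphs under consideration: 2-connected `K_{1,4}`-free split graphs with partition `(K, I)`,
`K` a maximum clique, and `|K| ≥ |I| ≥ 8`. -/
structure SimpleGraph.IsAdmissible {V : Type*} [Fintype V] (G : SimpleGraph V)
    (K I : Finset V) : Prop where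
  split : G.IsSplitPartition K I
  twoConnected : G.IsTwoConnected
  k14Free : G.IsK14Free
  eight_le : 8 ≤ I.card
  card_le : I.card ≤ K.card

/-- The vertices of `I` that have degree two in `G`. -/
def SimpleGraph.degTwoPart {V : Type*} (G : SimpleGraph V) (I : Finset V) : Set V :=
  {u | u ∈ I ∧ (G.neighborSet u).ncard = 2}

/-- The bipartite subgraph of `G` formed by the degree-two vertices of `I`, their neighbours, and
the edges of `G` between these two sets. All remaining vertices are kept as isolated vertices,
which does not affect the cycles. -/
def SimpleGraph.degTwoGraph {V : Type*} (G : SimpleGraph V) (I : Finset V) : SimpleGraph V where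
  Adj u v := G.Adj u v ∧ (u ∈ G.degTwoPart I ∨ v ∈ G.degTwoPart I)
  symm := ⟨fun _ _ h => ⟨h.1.symm, h.2.symm⟩⟩
  loopless := ⟨fun _ h => h.1.ne rfl⟩

/-- A short cycle: an induced cycle of `G.degTwoGraph I` that misses some vertex of `K`. -/
structure SimpleGraph.IsShortCycle {V : Type*} (G : SimpleGraph V) (K I : Finset V) {a : V}
    (c : (G.degTwoGraph I).Walk a a) : Prop where
  isCycle : c.IsCycle
  induced : ∀ u ∈ c.support, ∀ v ∈ c.support, (G.degTwoGraph I).Adj u v → s(u, v) ∈ c.edges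
  misses : ∃ k ∈ K, k ∉ c.support

/-! ### A random access machine with unit cost

Programs work on natural-number registers and on finitely many two-dimensional arrays with indirect
addressing. The only arithmetic is addition, truncated subtraction and comparison. There is no
multiplication, so in `t` steps the bit lengths of the numbers grow by `O(t)` only, and polynomial
time on this machine agrees with polynomial time on Turing machines. -/

namespace RAM

/-- A machine state: registers `reg x` and array cells `mem a i j` (array `a`, position `(i, j)`). -/
structure State where
  reg : ℕ → ℕ
  mem : ℕ → ℕ → ℕ → ℕ

/-- Expressions. -/
inductive Expr where
  | const (c : ℕ)
  | reg (x : ℕ)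
  | get (a : ℕ) (i j : Expr)
  | add (e f : Expr)
  | sub (e f : Expr)
  | lt (e f : Expr)
  | eq (e f : Expr)

/-- The value of an expression in a state. A comparison has the value `1` if true and `0` if not. -/
def Expr.eval (s : State) : Expr → ℕ
  | .const c => c
  | .reg x => s.reg x
  | .get a i j => s.mem a (i.eval s) (j.eval s)
  | .add e f => e.eval s + f.eval s
  | .sub e f => e.eval s - f.eval s
  | .lt e f => if e.eval s < f.eval s then 1 else 0
  | .eq e f => if e.eval s = f.eval s then 1 else 0

/-- Programs. -/
inductive Prog where
  | skip
  | assign (x : ℕ) (e : Expr)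
  | store (a : ℕ) (i j e : Expr)
  | seq (p q : Prog)
  | cond (e : Expr) (p q : Prog)
  | loop (e : Expr) (p : Prog)

/-- Write `v` into register `x`. -/
def State.setReg (s : State) (x v : ℕ) : State :=
  ⟨Function.update s.reg x v, s.mem⟩

/-- Write `v` into cell `(i, j)` of array `a`. -/
def State.setMem (s : State) (a i j v : ℕ) : State :=
  ⟨s.reg, fun a' i' j' => if a' = a ∧ i' = i ∧ j' = j then v else s.mem a' i' j'⟩

/-- `Exec p s s' t`: started in state `s`, the program `p` halts in state `s'` after `t` steps.
Every assignment, every array write and every evaluation of a test of a conditional or of a loop is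
one step; as the expressions of a program have a fixed size, this changes the number of elementary
operations by a constant factor only. A loop runs as long as its test is nonzero. -/
inductive Exec : Prog → State → State → ℕ → Prop where
  | skip (s : State) : Exec .skip s s 1
  | assign (s : State) (x : ℕ) (e : Expr) : Exec (.assign x e) s (s.setReg x (e.eval s)) 1
  | store (s : State) (a : ℕ) (i j e : Expr) :
      Exec (.store a i j e) s (s.setMem a (i.eval s) (j.eval s) (e.eval s)) 1
  | seq {p q : Prog} {s s' s'' : State} {t t' : ℕ} :
      Exec p s s' t → Exec q s' s'' t' → Exec (.seq p q) s s'' (t + t')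
  | cond_true {e : Expr} {p q : Prog} {s s' : State} {t : ℕ} :
      e.eval s ≠ 0 → Exec p s s' t → Exec (.cond e p q) s s' (t + 1)
  | cond_false {e : Expr} {p q : Prog} {s s' : State} {t : ℕ} :
      e.eval s = 0 → Exec q s s' t → Exec (.cond e p q) s s' (t + 1)
  | loop_done {e : Expr} {p : Prog} {s : State} :
      e.eval s = 0 → Exec (.loop e p) s s 1
  | loop_step {e : Expr} {p : Prog} {s s' s'' : State} {t t' : ℕ} :
      e.eval s ≠ 0 → Exec p s s' t → Exec (.loop e p) s' s'' t' →
      Exec (.loop e p) s s'' (t + t' + 1)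

open scoped Classical in
/-- The initial state for a graph on the vertices `0, …, n - 1`: register `0` holds `n`, array `0`
holds the adjacency matrix, everything else is zero. -/
noncomputable def input {n : ℕ} (G : SimpleGraph (Fin n)) : State where
  reg x := if x = 0 then n else 0
  mem a i j := if a = 0 ∧ ∃ u v : Fin n, (u : ℕ) = i ∧ (v : ℕ) = j ∧ G.Adj u v then 1 else 0

/-- The final state `s` presents the answer `b` (register `0`) and the list of vertices `l`: its
length is in register `1`, its entries are in the cells `(i, 0)` of array `1`. -/
def Outputs {n : ℕ} (s : State) (b : ℕ) (l : List (Fin n)) : Prop :=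
  s.reg 0 = b ∧ s.reg 1 = l.length ∧ ∀ (i : ℕ) (h : i < l.length), s.mem 1 i 0 = (l[i] : ℕ)

end RAM

/-! A Hamiltonian cycle uses both edges at every vertex of degree two. It therefore contains every
edge of a short cycle and can never leave it (`not_isShortCycle_of_isHamiltonian`).

For the converse, excluding `K_{1,4}` gives the two facts used throughout (`SplitFacts`): a clique
vertex has at most three neighbours in `I`, and if it has three, every clique vertex is adjacent to
one of them. Counting with these and `8 ≤ |I| ≤ |K|` yields Hall's condition for deleting one
incidence at each clique vertex with three neighbours in `I`. Hence `G` has a bipartite subgraph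
with degree two on `I` and degree at most two on `K` (`exists_two_factor`). Its components are
alternating cycles (rings) and alternating paths with both ends in `K` (rods).

Among all covers of the vertices by rings and rods, where rods may also use edges inside `K`, take
one with the fewest parts; the claim is that it has a single part, which then closes up to a
Hamiltonian cycle. Two rods can be joined by a clique edge. Without short cycles, a ring that misses
a vertex has a vertex of `I` with a neighbour outside the ring (`exists_outer_neighbor`). This
neighbour is not on a rod (`not_adj_rod`); if it is on a second ring, there is no third part
(`eq_or_eq`), and the second ring in turn has an edge leaving from its side of `I`, which is
impossible as well (`not_two_rings`, resting on `TwoRings.elim`). In each case the exchanges of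
edges that would merge parts are forbidden, so the second fact forces other adjacencies, until `I`
has fewer than eight vertices or some clique vertex has four neighbours in `I`.

The algorithm does not follow this proof; it presupposes a Hamiltonian cycle and reconstructs one
from bounded information. Once the edges of that cycle between `K` and `I` (less one of them if `|K|
= |I|`) are known at eleven suitable vertices, every clique vertex has at most two admissible edges
to `I` (`exists_guide`). A vertex of `I` with at most two admissible edges takes all of them; each
other one takes two greedily so that the selection stays acyclic. This never gets stuck: for three
candidates `g`, `h`, `k` the pairs `g, h` and `g, k` cannot both close a cycle, by parity
(`acyclic_addPair`). The selection is a system of paths whose ends are pairwise adjacent, so listing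
the paths one after the other gives a Hamiltonian cycle (`listing`). All values of the 37 variables
describing a guess are tried, and each list is verified before it is accepted. If none is accepted,
a minimal vertex set of minimum degree two in `degTwoGraph` is listed; it is a short cycle
(`SplitFacts.findCycle_run`). The programs are written in a total language with bounded loops, which
compiles to the machine at polynomial cost (`St.correct`). -/

/-! ### A structured language on top of the machine

Terms have bounded counting, statements have bounded loops. Both are total, and they compile to
machine programs whose running time is bounded by a polynomial. -/

namespace RAM

/-- The contents of the arrays. -/
abbrev Mem := ℕ → ℕ → ℕ → ℕ

/-- Terms; `cnt x t` counts the values `x < n` for which `t` is nonzero. -/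
inductive Tm where
  | const (c : ℕ)
  | size
  | var (x : ℕ)
  | get (a : ℕ) (i j : Tm)
  | add (e f : Tm)
  | sub (e f : Tm)
  | lt (e f : Tm)
  | eq (e f : Tm)
  | cnt (x : ℕ) (e : Tm)

/-- The value of a term. -/
def Tm.eval (n : ℕ) (m : Mem) : Tm → (ℕ → ℕ) → ℕ
  | .const c, _ => c
  | .size, _ => n
  | .var x, env => env x
  | .get a i j, env => m a (i.eval n m env) (j.eval n m env)
  | .add e f, env => e.eval n m env + f.eval n m env
  | .sub e f, env => e.eval n m env - f.eval n m env
  | .lt e f, env => if e.eval n m env < f.eval n m env then 1 else 0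
  | .eq e f, env => if e.eval n m env = f.eval n m env then 1 else 0
  | .cnt x e, env => ((Finset.range n).filter
      fun i => e.eval n m (Function.update env x i) ≠ 0).card

/-- Statements; `forN x p` runs `p` for `x = 0, …, n - 1`. -/
inductive St where
  | skip
  | put (a : ℕ) (i j e : Tm)
  | seq (p q : St)
  | ite (e : Tm) (p q : St)
  | forN (x : ℕ) (p : St)

/-- Write one array cell. -/
def Mem.upd (m : Mem) (a i j v : ℕ) : Mem :=
  fun b k l => if b = a ∧ k = i ∧ l = j then v else m b k l

/-- Run `f` for the indices `0, …, n - 1` in turn. -/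
def iterN {α : Type*} (f : ℕ → α → α) : ℕ → α → α
  | 0, a => a
  | n + 1, a => f n (iterN f n a)

/-- The effect of a statement on the arrays. -/
def St.run (n : ℕ) : St → (ℕ → ℕ) → Mem → Mem
  | .skip, _, m => m
  | .put a i j e, env, m => m.upd a (i.eval n m env) (j.eval n m env) (e.eval n m env)
  | .seq p q, env, m => q.run n env (p.run n env m)
  | .ite e p q, env, m => if e.eval n m env ≠ 0 then p.run n env m else q.run n env m
  | .forN x p, env, m => iterN (fun i m => p.run n (Function.update env x i) m) n m

/-- The register of a variable. -/
def vreg (x : ℕ) : ℕ := 2 * x + 2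

/-- The register of an intermediate result. -/
def sreg (r : ℕ) : ℕ := 2 * r + 1

/-- The values of the variables in a machine state. -/
def State.env (s : State) : ℕ → ℕ := fun x => s.reg (vreg x)

/-- Code that leaves the value of a term in the result register `r`. -/
def Tm.code : Tm → ℕ → Prog
  | .const c, r => .assign (sreg r) (.const c)
  | .size, r => .assign (sreg r) (.reg 0)
  | .var x, r => .assign (sreg r) (.reg (vreg x))
  | .get a i j, r => .seq (i.code r) (.seq (j.code (r + 1))
      (.assign (sreg r) (.get a (.reg (sreg r)) (.reg (sreg (r + 1))))))
  | .add e f, r => .seq (e.code r) (.seq (f.code (r + 1))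
      (.assign (sreg r) (.add (.reg (sreg r)) (.reg (sreg (r + 1))))))
  | .sub e f, r => .seq (e.code r) (.seq (f.code (r + 1))
      (.assign (sreg r) (.sub (.reg (sreg r)) (.reg (sreg (r + 1))))))
  | .lt e f, r => .seq (e.code r) (.seq (f.code (r + 1))
      (.assign (sreg r) (.lt (.reg (sreg r)) (.reg (sreg (r + 1))))))
  | .eq e f, r => .seq (e.code r) (.seq (f.code (r + 1))
      (.assign (sreg r) (.eq (.reg (sreg r)) (.reg (sreg (r + 1))))))
  | .cnt x e, r =>
      .seq (.assign (sreg r) (.const 0)) (.seq (.assign (sreg (r + 1)) (.reg (vreg x)))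
        (.seq (.assign (vreg x) (.const 0))
          (.seq (.loop (.lt (.reg (vreg x)) (.reg 0))
            (.seq (e.code (r + 2)) (.seq
              (.assign (sreg r) (.add (.reg (sreg r)) (.lt (.const 0) (.reg (sreg (r + 2))))))
              (.assign (vreg x) (.add (.reg (vreg x)) (.const 1))))))
            (.assign (vreg x) (.reg (sreg (r + 1)))))))

open Polynomial in
/-- A bound for the running time of the code of a term. -/
noncomputable def Tm.cost : Tm → ℕ[X]
  | .const _ => 1
  | .size => 1
  | .var _ => 1
  | .get _ i j => i.cost + j.cost + 1
  | .add e f => e.cost + f.cost + 1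
  | .sub e f => e.cost + f.cost + 1
  | .lt e f => e.cost + f.cost + 1
  | .eq e f => e.cost + f.cost + 1
  | .cnt _ e => X * (e.cost + 3) + 5

/-- `s'` agrees with `s` on the variables and on the results below `r`. -/
def Agree (r : ℕ) (s s' : State) : Prop :=
  s'.reg 0 = s.reg 0 ∧ (∀ x, s'.reg (vreg x) = s.reg (vreg x)) ∧
    ∀ q < r, s'.reg (sreg q) = s.reg (sreg q)

/-! ### Register layout: the input size, the variables and the result stack do not overlap. -/

lemma vreg_ne_zero (x : ℕ) : vreg x ≠ 0 := by simp [vreg]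
lemma sreg_ne_zero (x : ℕ) : sreg x ≠ 0 := by simp [sreg]
lemma vreg_ne_sreg (x r : ℕ) : vreg x ≠ sreg r := by unfold vreg sreg; omega
lemma sreg_ne_vreg (x r : ℕ) : sreg r ≠ vreg x := by unfold vreg sreg; omega
lemma sreg_inj {q r : ℕ} : sreg q = sreg r ↔ q = r := by unfold sreg; omega
lemma vreg_inj {q r : ℕ} : vreg q = vreg r ↔ q = r := by unfold vreg; omega

@[simp] lemma setReg_mem (s : State) (x v : ℕ) : (s.setReg x v).mem = s.mem := rfl

lemma setReg_reg (s : State) (x v y : ℕ) :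
    (s.setReg x v).reg y = if y = x then v else s.reg y := by
  simp [State.setReg, Function.update_apply]

lemma setReg_reg_self (s : State) (x v : ℕ) : (s.setReg x v).reg x = v := by
  simp [setReg_reg]

lemma setReg_reg_ne (s : State) {x y : ℕ} (v : ℕ) (h : y ≠ x) :
    (s.setReg x v).reg y = s.reg y := by
  simp [setReg_reg, h]

lemma Agree.refl (r : ℕ) (s : State) : Agree r s s := ⟨rfl, fun _ => rfl, fun _ _ => rfl⟩

lemma Agree.trans {r : ℕ} {s s' s'' : State} (h : Agree r s s') (h' : Agree r s' s'') :
    Agree r s s'' :=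
  ⟨h'.1.trans h.1, fun x => (h'.2.1 x).trans (h.2.1 x),
    fun q hq => (h'.2.2 q hq).trans (h.2.2 q hq)⟩

lemma Agree.mono {r r' : ℕ} {s s' : State} (h : Agree r' s s') (hr : r ≤ r') : Agree r s s' :=
  ⟨h.1, h.2.1, fun q hq => h.2.2 q (hq.trans_le hr)⟩

lemma Agree.setReg (s : State) {r q : ℕ} (hq : r ≤ q) (v : ℕ) :
    Agree r s (s.setReg (sreg q) v) := by
  refine ⟨setReg_reg_ne _ _ (sreg_ne_zero _).symm, fun x => setReg_reg_ne _ _ (vreg_ne_sreg _ _),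
    fun p hp => setReg_reg_ne _ _ ?_⟩
  rw [Ne, sreg_inj]
  omega

lemma Agree.env {r : ℕ} {s s' : State} (h : Agree r s s') : s'.env = s.env :=
  funext h.2.1

/-- The code of a term computes its value. -/
def Tm.Correct (e : Tm) : Prop :=
  ∀ (r : ℕ) (s : State), ∃ (s' : State) (t : ℕ), Exec (e.code r) s s' t ∧
    t ≤ e.cost.eval (s.reg 0) ∧ s'.mem = s.mem ∧ Agree r s s' ∧
    s'.reg (sreg r) = e.eval (s.reg 0) s.mem s.env

/-- The second operand is computed one level higher on the result stack, and its code promises to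
agree below `r + 1`. So the first operand is still in `sreg r` when the two are combined. -/
lemma Tm.binary_correct {e f : Tm} (he : e.Correct) (hf : f.Correct) (r : ℕ) (s : State)
    (g : Expr) (v : ℕ)
    (hg : ∀ s' : State, s'.mem = s.mem → s'.reg (sreg r) = e.eval (s.reg 0) s.mem s.env →
      s'.reg (sreg (r + 1)) = f.eval (s.reg 0) s.mem s.env → g.eval s' = v) :
    ∃ (s' : State) (t : ℕ),
      Exec (.seq (e.code r) (.seq (f.code (r + 1)) (.assign (sreg r) g))) s s' t ∧
      t ≤ (e.cost + f.cost + 1).eval (s.reg 0) ∧ s'.mem = s.mem ∧ Agree r s s' ∧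
      s'.reg (sreg r) = v := by
  obtain ⟨s₁, t₁, x₁, c₁, m₁, a₁, v₁⟩ := he r s
  obtain ⟨s₂, t₂, x₂, c₂, m₂, a₂, v₂⟩ := hf (r + 1) s₁
  rw [a₁.1] at c₂ v₂
  rw [m₁, a₁.env] at v₂
  refine ⟨_, _, .seq x₁ (.seq x₂ (.assign _ _ _)), ?_, ?_, ?_, ?_⟩
  · simp only [Polynomial.eval_add, Polynomial.eval_one]
    omega
  · rw [setReg_mem, m₂, m₁]
  · exact (a₁.trans (a₂.mono (Nat.le_succ r))).trans (Agree.setReg _ le_rfl _)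
  · rw [setReg_reg_self]
    exact hg _ (m₂.trans m₁) ((a₂.2.2 r (Nat.lt_succ_self r)).trans v₁) v₂

/-- Induction on the number `j` of rounds still to go, so that the loop variable holds `n - j`. Of
the results below `r + 2` only the accumulator `sreg r` changes; `sreg (r + 1)` must survive because
it holds the old value of the variable. A round costs the inner term, two assignments and one test.
-/
lemma Tm.cnt_loop {e : Tm} (he : e.Correct) (x r n : ℕ) (m : Mem) (env : ℕ → ℕ) :
    ∀ (j : ℕ) (s : State), s.reg 0 = n → s.mem = m → j ≤ n → s.reg (vreg x) = n - j →
      (∀ y, y ≠ x → s.reg (vreg y) = env y) →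
      ∃ (s' : State) (t : ℕ), Exec (.loop (.lt (.reg (vreg x)) (.reg 0))
            (.seq (e.code (r + 2)) (.seq
              (.assign (sreg r) (.add (.reg (sreg r)) (.lt (.const 0) (.reg (sreg (r + 2))))))
              (.assign (vreg x) (.add (.reg (vreg x)) (.const 1)))))) s s' t ∧
        t ≤ j * (e.cost.eval n + 3) + 1 ∧ s'.mem = m ∧ s'.reg 0 = n ∧
        (∀ y, y ≠ x → s'.reg (vreg y) = env y) ∧
        (∀ q < r + 2, q ≠ r → s'.reg (sreg q) = s.reg (sreg q)) ∧
        s'.reg (sreg r) = s.reg (sreg r) + ((Finset.Ico (n - j) n).filter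
          fun i => e.eval n m (Function.update env x i) ≠ 0).card := by
  intro j
  induction j with
  | zero =>
    intro s h0 hm _ hx hy
    refine ⟨s, 1, .loop_done ?_, by omega, hm, h0, hy, fun _ _ _ => rfl, by simp⟩
    simp [Expr.eval, hx, h0]
  | succ j ih =>
    intro s h0 hm hj hx hy
    obtain ⟨s₁, t₁, x₁, c₁, m₁, a₁, v₁⟩ := he (r + 2) s
    have henv : s.env = Function.update env x (n - (j + 1)) := by
      funext y
      by_cases h : y = x
      · subst h; simp [State.env, hx]
      · simp [State.env, h, hy]
    rw [h0, hm, henv] at v₁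
    set s₂ := s₁.setReg (sreg r)
      ((Expr.add (.reg (sreg r)) (.lt (.const 0) (.reg (sreg (r + 2))))).eval s₁) with hs₂
    set s₃ := s₂.setReg (vreg x) ((Expr.add (.reg (vreg x)) (.const 1)).eval s₂) with hs₃
    have e2x : s₂.reg (vreg x) = n - (j + 1) := by
      rw [hs₂, setReg_reg_ne _ _ (vreg_ne_sreg _ _), a₁.2.1, hx]
    obtain ⟨s', t', x', c', m', z', y', q', v'⟩ := ih s₃
      (by rw [hs₃, setReg_reg_ne _ _ (vreg_ne_zero _).symm, hs₂,
            setReg_reg_ne _ _ (sreg_ne_zero _).symm, a₁.1, h0])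
      (by rw [hs₃, setReg_mem, hs₂, setReg_mem, m₁, hm]) (by omega)
      (by rw [hs₃, setReg_reg_self]; simp only [Expr.eval, e2x]; omega)
      (fun y hyx => by
        rw [hs₃, setReg_reg_ne _ _ (by rwa [Ne, vreg_inj]), hs₂,
          setReg_reg_ne _ _ (vreg_ne_sreg _ _), a₁.2.1, hy y hyx])
    refine ⟨s', _, .loop_step ?_ (.seq x₁ (.seq (.assign _ _ _) (.assign _ _ _))) x', ?_, m', z',
      y', fun q hq hqr => ?_, ?_⟩
    · simp only [Expr.eval, hx, h0]
      rw [if_pos (by omega)]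
      exact one_ne_zero
    · rw [h0] at c₁
      have : (j + 1) * (e.cost.eval n + 3) = j * (e.cost.eval n + 3) + (e.cost.eval n + 3) := by ring
      omega
    · rw [q' q hq hqr, hs₃, setReg_reg_ne _ _ (sreg_ne_vreg _ _), hs₂,
        setReg_reg_ne _ _ (by rwa [Ne, sreg_inj]), a₁.2.2 q hq]
    · rw [v', hs₃, setReg_reg_ne _ _ (sreg_ne_vreg _ _), hs₂, setReg_reg_self]
      change s₁.reg (sreg r) + (if 0 < s₁.reg (sreg (r + 2)) then 1 else 0) + _ = _
      rw [a₁.2.2 r (by omega), v₁]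
      have hI : Finset.Ico (n - (j + 1)) n = insert (n - (j + 1)) (Finset.Ico (n - j) n) := by
        ext i; simp only [Finset.mem_Ico, Finset.mem_insert]; omega
      rw [hI, Finset.filter_insert]
      by_cases hz : e.eval n m (Function.update env x (n - (j + 1))) = 0
      · simp [hz]
      · rw [if_pos (Nat.pos_of_ne_zero hz), if_pos hz, Finset.card_insert_of_notMem]
        · omega
        · simp only [Finset.mem_filter, Finset.mem_Ico]; omega

lemma Tm.cnt_correct {e : Tm} (he : e.Correct) (x : ℕ) : (Tm.cnt x e).Correct := by
  intro r s
  set s₁ := s.setReg (sreg r) ((Expr.const 0).eval s) with hs₁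
  set s₂ := s₁.setReg (sreg (r + 1)) ((Expr.reg (vreg x)).eval s₁) with hs₂
  set s₃ := s₂.setReg (vreg x) ((Expr.const 0).eval s₂) with hs₃
  have h0 : s₃.reg 0 = s.reg 0 := by
    rw [hs₃, setReg_reg_ne _ _ (vreg_ne_zero _).symm, hs₂,
      setReg_reg_ne _ _ (sreg_ne_zero _).symm, hs₁, setReg_reg_ne _ _ (sreg_ne_zero _).symm]
  obtain ⟨s', t', x', c', m', z', y', q', v'⟩ := Tm.cnt_loop he x r (s.reg 0) s.mem s.env
    (s.reg 0) s₃ h0 rfl le_rfl (by rw [hs₃, setReg_reg_self, Nat.sub_self]; rfl)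
    (fun y hy => by
      rw [hs₃, setReg_reg_ne _ _ (by rwa [Ne, vreg_inj]), hs₂,
        setReg_reg_ne _ _ (vreg_ne_sreg _ _), hs₁, setReg_reg_ne _ _ (vreg_ne_sreg _ _)]
      rfl)
  refine ⟨_, _, .seq (.assign _ _ _) (.seq (.assign _ _ _) (.seq (.assign _ _ _)
    (.seq x' (.assign _ _ _)))), ?_, m', ⟨?_, fun y => ?_, fun q hq => ?_⟩, ?_⟩
  -- The constant `5` consists of three assignments before the loop, its last test, and the
  -- assignment that restores the variable.
  · simp only [Tm.cost, Polynomial.eval_add, Polynomial.eval_mul, Polynomial.eval_X,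
      Polynomial.eval_ofNat]
    omega
  · rw [setReg_reg_ne _ _ (vreg_ne_zero _).symm, z']
  · by_cases hy : y = x
    · subst hy
      rw [setReg_reg_self]
      simp only [Expr.eval]
      rw [q' (r + 1) (by omega) (by omega), hs₃, setReg_reg_ne _ _ (sreg_ne_vreg _ _), hs₂,
        setReg_reg_self]
      simp only [Expr.eval]
      rw [hs₁, setReg_reg_ne _ _ (vreg_ne_sreg _ _)]
    · rw [setReg_reg_ne _ _ (by rwa [Ne, vreg_inj]), y' y hy]
      rfl
  · rw [setReg_reg_ne _ _ (sreg_ne_vreg _ _), q' q (by omega) (by omega), hs₃,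
      setReg_reg_ne _ _ (sreg_ne_vreg _ _), hs₂,
      setReg_reg_ne _ _ (by rw [Ne, sreg_inj]; omega), hs₁,
      setReg_reg_ne _ _ (by rw [Ne, sreg_inj]; omega)]
  · rw [setReg_reg_ne _ _ (sreg_ne_vreg _ _), v', hs₃, setReg_reg_ne _ _ (sreg_ne_vreg _ _), hs₂,
      setReg_reg_ne _ _ (by rw [Ne, sreg_inj]; omega), hs₁, setReg_reg_self, Nat.sub_self]
    change 0 + _ = _
    rw [zero_add, Tm.eval, Finset.range_eq_Ico]

theorem Tm.correct (e : Tm) : e.Correct := by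
  induction e with
  | const c =>
    exact fun r s => ⟨_, _, .assign _ _ _, by simp [Tm.cost], rfl, Agree.setReg _ le_rfl _,
      setReg_reg_self _ _ _⟩
  | size =>
    exact fun r s => ⟨_, _, .assign _ _ _, by simp [Tm.cost], rfl, Agree.setReg _ le_rfl _,
      setReg_reg_self _ _ _⟩
  | var x =>
    exact fun r s => ⟨_, _, .assign _ _ _, by simp [Tm.cost], rfl, Agree.setReg _ le_rfl _,
      setReg_reg_self _ _ _⟩
  | get a e f he hf =>
    exact fun r s => Tm.binary_correct he hf r s _ _ fun s' hm h h' => by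
      simp [Expr.eval, Tm.eval, hm, h, h']
  | add e f he hf =>
    exact fun r s => Tm.binary_correct he hf r s _ _ fun s' hm h h' => by
      simp [Expr.eval, Tm.eval, h, h']
  | sub e f he hf =>
    exact fun r s => Tm.binary_correct he hf r s _ _ fun s' hm h h' => by
      simp [Expr.eval, Tm.eval, h, h']
  | lt e f he hf =>
    exact fun r s => Tm.binary_correct he hf r s _ _ fun s' hm h h' => by
      simp [Expr.eval, Tm.eval, h, h']
  | eq e f he hf =>
    exact fun r s => Tm.binary_correct he hf r s _ _ fun s' hm h h' => by
      simp [Expr.eval, Tm.eval, h, h']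
  | cnt x e he => exact Tm.cnt_correct he x

/-- Code for a statement; it may use the result registers from `r` on. -/
def St.code : St → ℕ → Prog
  | .skip, _ => .skip
  | .put a i j e, r => .seq (i.code r) (.seq (j.code (r + 1)) (.seq (e.code (r + 2))
      (.store a (.reg (sreg r)) (.reg (sreg (r + 1))) (.reg (sreg (r + 2))))))
  | .seq p q, r => .seq (p.code r) (q.code r)
  | .ite e p q, r => .seq (e.code r) (.cond (.reg (sreg r)) (p.code r) (q.code r))
  | .forN x p, r =>
      .seq (.assign (sreg r) (.reg (vreg x))) (.seq (.assign (vreg x) (.const 0))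
        (.seq (.loop (.lt (.reg (vreg x)) (.reg 0))
          (.seq (p.code (r + 1)) (.assign (vreg x) (.add (.reg (vreg x)) (.const 1)))))
          (.assign (vreg x) (.reg (sreg r)))))

open Polynomial in
/-- A bound for the running time of the code of a statement. -/
noncomputable def St.cost : St → ℕ[X]
  | .skip => 1
  | .put _ i j e => i.cost + j.cost + e.cost + 1
  | .seq p q => p.cost + q.cost
  | .ite e p q => e.cost + p.cost + q.cost + 1
  | .forN _ p => X * (p.cost + 2) + 4

/-- The code of a statement has the intended effect. -/
def St.Correct (p : St) : Prop :=
  ∀ (r : ℕ) (s : State), ∃ (s' : State) (t : ℕ), Exec (p.code r) s s' t ∧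
    t ≤ p.cost.eval (s.reg 0) ∧ s'.mem = p.run (s.reg 0) s.env s.mem ∧ Agree r s s'

/-- The bound of the loop is register `0`, which the body preserves, and so is the loop variable
between the increments. The number of rounds is thus fixed in advance, and a polynomial bound for
the body gives one for the loop. -/
lemma St.for_loop {p : St} (hp : p.Correct) (x r n : ℕ) (env : ℕ → ℕ) (m : Mem) :
    ∀ (j : ℕ) (s : State), s.reg 0 = n → j ≤ n → s.reg (vreg x) = n - j →
      s.mem = iterN (fun i m => p.run n (Function.update env x i) m) (n - j) m →
      (∀ y, y ≠ x → s.reg (vreg y) = env y) →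
      ∃ (s' : State) (t : ℕ), Exec (.loop (.lt (.reg (vreg x)) (.reg 0))
          (.seq (p.code (r + 1)) (.assign (vreg x) (.add (.reg (vreg x)) (.const 1))))) s s' t ∧
        t ≤ j * (p.cost.eval n + 2) + 1 ∧
        s'.mem = iterN (fun i m => p.run n (Function.update env x i) m) n m ∧ s'.reg 0 = n ∧
        (∀ y, y ≠ x → s'.reg (vreg y) = env y) ∧
        (∀ q < r + 1, s'.reg (sreg q) = s.reg (sreg q)) := by
  intro j
  induction j with
  | zero =>
    intro s h0 _ hx hm hy
    refine ⟨s, 1, .loop_done ?_, by omega, hm, h0, hy, fun _ _ => rfl⟩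
    simp [Expr.eval, hx, h0]
  | succ j ih =>
    intro s h0 hj hx hm hy
    obtain ⟨s₁, t₁, x₁, c₁, m₁, a₁⟩ := hp (r + 1) s
    have henv : s.env = Function.update env x (n - (j + 1)) := by
      funext y
      by_cases h : y = x
      · subst h; simp [State.env, hx]
      · simp [State.env, h, hy]
    rw [h0, hm, henv] at m₁
    set s₂ := s₁.setReg (vreg x) ((Expr.add (.reg (vreg x)) (.const 1)).eval s₁) with hs₂
    have hn : n - j = n - (j + 1) + 1 := by omega
    obtain ⟨s', t', x', c', m', z', y', q'⟩ := ih s₂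
      (by rw [hs₂, setReg_reg_ne _ _ (vreg_ne_zero _).symm, a₁.1, h0]) (by omega)
      (by rw [hs₂, setReg_reg_self]; simp only [Expr.eval, a₁.2.1, hx]; omega)
      (by rw [hs₂, setReg_mem, m₁, hn]; rfl)
      (fun y hyx => by
        rw [hs₂, setReg_reg_ne _ _ (by rwa [Ne, vreg_inj]), a₁.2.1, hy y hyx])
    refine ⟨s', _, .loop_step ?_ (.seq x₁ (.assign _ _ _)) x', ?_, m', z', y', fun q hq => ?_⟩
    · simp only [Expr.eval, hx, h0]
      rw [if_pos (by omega)]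
      exact one_ne_zero
    · rw [h0] at c₁
      have : (j + 1) * (p.cost.eval n + 2) = j * (p.cost.eval n + 2) + (p.cost.eval n + 2) := by ring
      omega
    · rw [q' q hq, hs₂, setReg_reg_ne _ _ (sreg_ne_vreg _ _), a₁.2.2 q hq]

lemma St.for_correct {p : St} (hp : p.Correct) (x : ℕ) : (St.forN x p).Correct := by
  intro r s
  set s₁ := s.setReg (sreg r) ((Expr.reg (vreg x)).eval s) with hs₁
  set s₂ := s₁.setReg (vreg x) ((Expr.const 0).eval s₁) with hs₂
  obtain ⟨s', t', x', c', m', z', y', q'⟩ := St.for_loop hp x r (s.reg 0) s.env s.mem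
    (s.reg 0) s₂
    (by rw [hs₂, setReg_reg_ne _ _ (vreg_ne_zero _).symm, hs₁,
          setReg_reg_ne _ _ (sreg_ne_zero _).symm]) le_rfl
    (by rw [hs₂, setReg_reg_self, Nat.sub_self]; rfl)
    (by rw [Nat.sub_self]; rfl)
    (fun y hy => by
      rw [hs₂, setReg_reg_ne _ _ (by rwa [Ne, vreg_inj]), hs₁,
        setReg_reg_ne _ _ (vreg_ne_sreg _ _)]
      rfl)
  refine ⟨_, _, .seq (.assign _ _ _) (.seq (.assign _ _ _) (.seq x' (.assign _ _ _))), ?_, m',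
    ⟨?_, fun y => ?_, fun q hq => ?_⟩⟩
  · simp only [St.cost, Polynomial.eval_add, Polynomial.eval_mul, Polynomial.eval_X,
      Polynomial.eval_ofNat]
    omega
  · rw [setReg_reg_ne _ _ (vreg_ne_zero _).symm, z']
  · by_cases hy : y = x
    · subst hy
      rw [setReg_reg_self]
      simp only [Expr.eval]
      rw [q' r (by omega), hs₂, setReg_reg_ne _ _ (sreg_ne_vreg _ _), hs₁, setReg_reg_self]
      rfl
    · rw [setReg_reg_ne _ _ (by rwa [Ne, vreg_inj]), y' y hy]
      rfl
  · rw [setReg_reg_ne _ _ (sreg_ne_vreg _ _), q' q (by omega), hs₂,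
      setReg_reg_ne _ _ (sreg_ne_vreg _ _), hs₁, setReg_reg_ne _ _ (by rw [Ne, sreg_inj]; omega)]

theorem St.correct (p : St) : p.Correct := by
  induction p with
  | skip => exact fun r s => ⟨s, 1, .skip s, by simp [St.cost], rfl, Agree.refl r s⟩
  | put a i j e =>
    intro r s
    obtain ⟨s₁, t₁, x₁, c₁, m₁, a₁, v₁⟩ := i.correct r s
    obtain ⟨s₂, t₂, x₂, c₂, m₂, a₂, v₂⟩ := j.correct (r + 1) s₁
    obtain ⟨s₃, t₃, x₃, c₃, m₃, a₃, v₃⟩ := e.correct (r + 2) s₂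
    rw [a₂.1, a₁.1] at c₃ v₃
    rw [a₁.1] at c₂ v₂
    rw [m₂, m₁, a₂.env, a₁.env] at v₃
    rw [m₁, a₁.env] at v₂
    refine ⟨_, _, .seq x₁ (.seq x₂ (.seq x₃ (.store _ _ _ _ _))), ?_, ?_, ?_⟩
    · simp only [St.cost, Polynomial.eval_add, Polynomial.eval_one]
      omega
    · change Mem.upd s₃.mem a (s₃.reg (sreg r)) (s₃.reg (sreg (r + 1)))
        (s₃.reg (sreg (r + 2))) = _
      rw [St.run, m₃, m₂, m₁, v₃, a₃.2.2 (r + 1) (by omega), v₂, a₃.2.2 r (by omega),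
        a₂.2.2 r (by omega), v₁]
    · have := (a₁.trans (a₂.mono (Nat.le_succ r))).trans (a₃.mono (show r ≤ r + 2 by omega))
      exact this
  | seq p q hp hq =>
    intro r s
    obtain ⟨s₁, t₁, x₁, c₁, m₁, a₁⟩ := hp r s
    obtain ⟨s₂, t₂, x₂, c₂, m₂, a₂⟩ := hq r s₁
    rw [a₁.1] at c₂ m₂
    rw [m₁, a₁.env] at m₂
    refine ⟨_, _, .seq x₁ x₂, ?_, m₂, a₁.trans a₂⟩
    simp only [St.cost, Polynomial.eval_add]
    omega
  | ite e p q hp hq =>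
    intro r s
    obtain ⟨s₁, t₁, x₁, c₁, m₁, a₁, v₁⟩ := e.correct r s
    by_cases h : e.eval (s.reg 0) s.mem s.env = 0
    · obtain ⟨s₂, t₂, x₂, c₂, m₂, a₂⟩ := hq r s₁
      rw [a₁.1] at c₂ m₂
      rw [m₁, a₁.env] at m₂
      refine ⟨_, _, .seq x₁ (.cond_false (by simp [Expr.eval, v₁, h]) x₂), ?_, ?_, a₁.trans a₂⟩
      · simp only [St.cost, Polynomial.eval_add, Polynomial.eval_one]
        omega
      · simp [St.run, h, m₂]
    · obtain ⟨s₂, t₂, x₂, c₂, m₂, a₂⟩ := hp r s₁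
      rw [a₁.1] at c₂ m₂
      rw [m₁, a₁.env] at m₂
      refine ⟨_, _, .seq x₁ (.cond_true (by simp [Expr.eval, v₁, h]) x₂), ?_, ?_, a₁.trans a₂⟩
      · simp only [St.cost, Polynomial.eval_add, Polynomial.eval_one]
        omega
      · simp [St.run, h, m₂]
  | forN x p hp => exact St.for_correct hp x

end RAM

/-! ### What the hypotheses say about neighbourhoods -/

namespace SimpleGraph

variable {V : Type*}

/-- The facts about `K_{1,4}`-free 2-connected split graphs that are used below, in terms of
adjacency only. -/
structure SplitFacts (G : SimpleGraph V) (K I : Finset V) : Prop where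
  cover : ∀ v, v ∈ K ∨ v ∈ I
  notMem : ∀ v ∈ K, v ∉ I
  clique : ∀ a ∈ K, ∀ b ∈ K, a ≠ b → G.Adj a b
  indep : ∀ a ∈ I, ∀ b ∈ I, ¬ G.Adj a b
  four : ∀ g ∈ K, ∀ a ∈ I, ∀ b ∈ I, ∀ c ∈ I, ∀ d ∈ I, G.Adj g a → G.Adj g b → G.Adj g c →
    G.Adj g d → a ≠ b → a ≠ c → b ≠ c → d = a ∨ d = b ∨ d = c
  hit : ∀ g ∈ K, ∀ a ∈ I, ∀ b ∈ I, ∀ c ∈ I, G.Adj g a → G.Adj g b → G.Adj g c →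
    a ≠ b → a ≠ c → b ≠ c → ∀ h ∈ K, G.Adj h a ∨ G.Adj h b ∨ G.Adj h c
  two : ∀ u ∈ I, ∃ a ∈ K, ∃ b ∈ K, a ≠ b ∧ G.Adj u a ∧ G.Adj u b
  miss : ∀ u ∈ I, ∃ g ∈ K, ¬ G.Adj g u
  eight_le : 8 ≤ I.card
  card_le : I.card ≤ K.card

lemma not_isK14Free {G : SimpleGraph V} (g a b c d : V)
    (ha : G.Adj g a) (hb : G.Adj g b) (hc : G.Adj g c) (hd : G.Adj g d)
    (hab : a ≠ b) (hac : a ≠ c) (had : a ≠ d) (hbc : b ≠ c) (hbd : b ≠ d) (hcd : c ≠ d)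
    (nab : ¬ G.Adj a b) (nac : ¬ G.Adj a c) (nad : ¬ G.Adj a d) (nbc : ¬ G.Adj b c)
    (nbd : ¬ G.Adj b d) (ncd : ¬ G.Adj c d) : ¬ G.IsK14Free := by
  intro h
  refine h ⟨⟨⟨Sum.elim (fun _ => g) ![a, b, c, d], ?_⟩, ?_⟩⟩
  · have := ha.ne
    have := hb.ne
    have := hc.ne
    have := hd.ne
    rintro (x | x) (y | y) hxy <;> fin_cases x <;> fin_cases y <;> simp_all
  · have n1 := mt (fun h => G.adj_symm h) nab
    have n2 := mt (fun h => G.adj_symm h) nac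
    have n3 := mt (fun h => G.adj_symm h) nad
    have n4 := mt (fun h => G.adj_symm h) nbc
    have n5 := mt (fun h => G.adj_symm h) nbd
    have n6 := mt (fun h => G.adj_symm h) ncd
    have m1 := ha.symm
    have m2 := hb.symm
    have m3 := hc.symm
    have m4 := hd.symm
    intro x y
    change G.Adj (Sum.elim (fun _ => g) ![a, b, c, d] x) (Sum.elim (fun _ => g) ![a, b, c, d] y) ↔ _
    rcases x with x | x <;> rcases y with y | y <;> fin_cases x <;> fin_cases y <;>
      simp_all [completeBipartiteGraph]

/-- Everything after this lemma about graphs uses only these consequences. Two-connectedness enters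
as minimum degree two on `I`, and maximality of the clique as the existence of a non-neighbour in
`K` for each vertex of `I`. -/
lemma IsAdmissible.splitFacts [Fintype V] {G : SimpleGraph V} {K I : Finset V}
    (h : G.IsAdmissible K I) : G.SplitFacts K I := by
  classical
  obtain ⟨⟨⟨hK, hmax⟩, hI, hdis, hcov⟩, hconn, hfree, h8, hle⟩ := h
  have hnm : ∀ v ∈ K, v ∉ I := fun v hv hv' => Finset.disjoint_left.mp hdis hv hv'
  have hcl : ∀ a ∈ K, ∀ b ∈ K, a ≠ b → G.Adj a b := fun a ha b hb hab =>
    hK (by exact_mod_cast ha) (by exact_mod_cast hb) hab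
  have hind : ∀ a ∈ I, ∀ b ∈ I, ¬ G.Adj a b := fun a ha b hb hab =>
    hI (by exact_mod_cast ha) (by exact_mod_cast hb) hab.ne hab
  -- After deleting at most one vertex there is still a path from `u` to `K`; its first step leads
  -- into `K` since `I` is independent.
  have hnb : ∀ u ∈ I, ∀ S : Finset V, S.card < 2 → ∃ a ∈ K, a ∉ S ∧ (u ∉ S → G.Adj u a) := by
    intro u hu S hS
    by_cases huS : u ∈ S
    · obtain ⟨a, ha, haS⟩ : ∃ a ∈ K, a ∉ S := by
        by_contra hcon
        push Not at hcon
        have := Finset.card_le_card hcon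
        omega
      exact ⟨a, ha, haS, fun h => absurd huS h⟩
    · have hc := (hconn.2 S hS).preconnected
      obtain ⟨a, ha, haS⟩ : ∃ a ∈ K, a ∉ S := by
        by_contra hcon
        push Not at hcon
        have := Finset.card_le_card hcon
        omega
      have hne : (⟨u, by simpa using huS⟩ : ((S : Set V)ᶜ : Set V)) ≠ ⟨a, by simpa using haS⟩ := by
        intro h
        have h' := congrArg Subtype.val h
        simp only at h'
        exact hnm a ha (h' ▸ hu)
      obtain ⟨w, hw⟩ := (hc ⟨u, by simpa using huS⟩ ⟨a, by simpa using haS⟩).exists_isPath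
      cases w with
      | nil => exact absurd rfl hne
      | @cons _ b _ hadj _ =>
        have hadj' : G.Adj u b.1 := hadj
        refine ⟨b.1, (hcov b.1).resolve_right fun hb => hind u hu _ hb hadj', ?_, fun _ => hadj'⟩
        exact fun hbS => b.2 (by exact_mod_cast hbS)
  refine ⟨hcov, hnm, hcl, hind, ?_, ?_, ?_, ?_, h8, hle⟩
  · intro g hg a ha b hb c hc d hd ga gb gc gd hab hac hbc
    by_contra hcon
    push Not at hcon
    exact not_isK14Free g a b c d ga gb gc gd hab hac hcon.1.symm hbc hcon.2.1.symm hcon.2.2.symm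
      (hind a ha b hb) (hind a ha c hc) (hind a ha d hd) (hind b hb c hc) (hind b hb d hd)
      (hind c hc d hd) hfree
  -- A clique vertex `h` missing all three neighbours of `g` would itself be the fourth leaf of an
  -- induced star at `g`.
  · intro g hg a ha b hb c hc ga gb gc hab hac hbc h hh
    by_contra hcon
    push Not at hcon
    have hgh : g ≠ h := fun e => hcon.1 (e ▸ ga)
    exact not_isK14Free g a b c h ga gb gc (hcl g hg h hh hgh) hab hac
      (fun e => hnm h hh (e ▸ ha)) hbc (fun e => hnm h hh (e ▸ hb)) (fun e => hnm h hh (e ▸ hc))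
      (hind a ha b hb) (hind a ha c hc) (fun e => hcon.1 e.symm) (hind b hb c hc)
      (fun e => hcon.2.1 e.symm) (fun e => hcon.2.2 e.symm) hfree
  · intro u hu
    obtain ⟨a, ha, -, hua⟩ := hnb u hu ∅ (by simp)
    obtain ⟨b, hb, hba, hub⟩ := hnb u hu {a} (by simp)
    have hua' : u ∉ ({a} : Finset V) := fun h => hnm a ha (Finset.mem_singleton.mp h ▸ hu)
    exact ⟨a, ha, b, hb, fun e => hba (by simp [e]), hua (by simp), hub hua'⟩
  -- A vertex of `I` adjacent to all of `K` would enlarge the maximum clique.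
  · intro u hu
    by_contra hcon
    push Not at hcon
    have huK : u ∉ K := fun h => hnm u h hu
    have hc : G.IsClique (insert u K : Finset V) := by
      rw [Finset.coe_insert, isClique_insert]
      exact ⟨hK, fun b hb _ => (hcon b (by exact_mod_cast hb)).symm⟩
    have := hmax _ hc
    rw [Finset.card_insert_of_notMem huK] at this
    omega

/-- The vertices of the clique have large degree. -/
lemma SplitFacts.degTwoPart_eq [Fintype V] {G : SimpleGraph V} {K I : Finset V}
    (h : G.SplitFacts K I) : G.degTwoPart I = {u | (G.neighborSet u).ncard = 2} := by
  classical
  ext u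
  simp only [degTwoPart, Set.mem_ofPred_eq, and_iff_right_iff_imp]
  intro hu
  refine (h.cover u).resolve_left fun hK => ?_
  have hsub : ((K.erase u : Finset V) : Set V) ⊆ G.neighborSet u := by
    intro x hx
    rw [Finset.mem_coe, Finset.mem_erase] at hx
    exact h.clique u hK x hx.2 hx.1.symm
  have := Set.ncard_le_ncard hsub (Set.toFinite _)
  rw [Set.ncard_coe_finset, Finset.card_erase_of_mem hK] at this
  have := h.eight_le
  have := h.card_le
  omega

end SimpleGraph

/-! ### A spanning subgraph with degree two on the independent set -/

namespace SimpleGraph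

variable {V : Type*} {G : SimpleGraph V} {K I : Finset V}

open scoped Classical in
lemma sum_card_filter_adj (S : Finset V) :
    ∑ u ∈ S, (K.filter fun g => G.Adj g u).card = ∑ g ∈ K, (S.filter fun u => G.Adj g u).card := by
  simp only [Finset.card_filter]
  exact Finset.sum_comm

open scoped Classical in
lemma SplitFacts.two_le_card (h : G.SplitFacts K I) {u : V} (hu : u ∈ I) :
    2 ≤ (K.filter fun g => G.Adj g u).card := by
  obtain ⟨a, ha, b, hb, hab, h1, h2⟩ := h.two u hu
  exact Finset.one_lt_card.mpr ⟨a, by simp [ha, h1.symm], b, by simp [hb, h2.symm], hab⟩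

open scoped Classical in
lemma SplitFacts.card_filter_le_three (h : G.SplitFacts K I) {g : V} (hg : g ∈ K) {S : Finset V}
    (hS : S ⊆ I) : (S.filter fun u => G.Adj g u).card ≤ 3 := by
  by_contra hcon
  obtain ⟨t, ht, hc⟩ := Finset.exists_subset_card_eq
    (show 3 ≤ (S.filter fun u => G.Adj g u).card by omega)
  obtain ⟨a, b, c, hab, hac, hbc, rfl⟩ := Finset.card_eq_three.mp hc
  obtain ⟨d, hd, hdt⟩ := Finset.exists_mem_notMem_of_card_lt_card
    (show ({a, b, c} : Finset V).card < (S.filter fun u => G.Adj g u).card by omega)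
  simp only [Finset.insert_subset_iff, Finset.singleton_subset_iff, Finset.mem_filter] at ht hd
  apply hdt
  simpa using h.four g hg a (hS ht.1.1) b (hS ht.2.1.1) c (hS ht.2.2.1) d (hS hd.1) ht.1.2 ht.2.1.2
    ht.2.2.2 hd.2 hab hac hbc

open scoped Classical in
lemma SplitFacts.exists_adj_of_card_eq_three (h : G.SplitFacts K I) {g : V} (hg : g ∈ K)
    {S : Finset V} (hS : S ⊆ I) (hc : (S.filter fun u => G.Adj g u).card = 3) {k : V} (hk : k ∈ K) :
    ∃ u ∈ S, G.Adj g u ∧ G.Adj k u := by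
  obtain ⟨a, b, c, hab, hac, hbc, he⟩ := Finset.card_eq_three.mp hc
  have ha : a ∈ S.filter fun u => G.Adj g u := by simp [he]
  have hb : b ∈ S.filter fun u => G.Adj g u := by simp [he]
  have hc : c ∈ S.filter fun u => G.Adj g u := by simp [he]
  rw [Finset.mem_filter] at ha hb hc
  rcases h.hit g hg a (hS ha.1) b (hS hb.1) c (hS hc.1) ha.2 hb.2 hc.2 hab hac hbc k hk with
    hk | hk | hk
  exacts [⟨a, ha.1, ha.2, hk⟩, ⟨b, hb.1, hb.2, hk⟩, ⟨c, hc.1, hc.2, hk⟩]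

open scoped Classical in
/-- The counting behind Hall's condition. -/
lemma SplitFacts.two_mul_card_add_le (h : G.SplitFacts K I) {S : Finset V} (hS : S ⊆ I) {v : V}
    (hv : v ∈ K) (hvS : (S.filter fun u => G.Adj v u).card = 3) :
    2 * S.card + (K.filter fun g => (S.filter fun u => G.Adj g u).card = 3).card ≤
      ∑ g ∈ K, (S.filter fun u => G.Adj g u).card := by
  by_contra hcon
  push Not at hcon
  have hσ := Finset.card_le_card hS
  have h8 := h.eight_le
  have hk := h.card_le
  obtain ⟨f, hf⟩ : ∃ f : V → ℕ, ∀ g, f g = (S.filter fun u => G.Adj g u).card :=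
    ⟨_, fun _ => rfl⟩
  simp only [← hf] at hcon
  have hf3 : (K.filter fun g => f g = 3).card = ∑ g ∈ K, if f g = 3 then 1 else 0 :=
    Finset.card_filter _ _
  have hpos : ∀ g ∈ K, 1 ≤ f g := by
    intro g hg
    obtain ⟨u, hu, -, hgu⟩ := h.exists_adj_of_card_eq_three hv hS hvS hg
    exact hf g ▸ Finset.card_pos.mpr ⟨u, by simp [hu, hgu]⟩
  have hdeg : ∀ S' ⊆ S, 2 * S'.card ≤ ∑ g ∈ K, (S'.filter fun u => G.Adj g u).card := by
    intro S' hS'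
    rw [← sum_card_filter_adj, mul_comm, ← smul_eq_mul]
    exact Finset.card_nsmul_le_sum _ _ _ fun u hu => h.two_le_card (hS (hS' hu))
  -- Apply the degree count to `S` without the three neighbours of `v`. Every clique vertex loses at
  -- least one neighbour and `v` loses three, so the sum of all `f g` is at least `2 (|S| - 3) + |K|
  -- + 2`. Compared with `hcon`, at most three clique vertices have fewer than three neighbours in
  -- `S`.
  have hcard3 : K.card ≤ (K.filter fun g => f g = 3).card + 3 := by
    have h1 := hdeg (S.filter fun u => ¬ G.Adj v u) (Finset.filter_subset _ _)
    have h2 := Finset.card_filter_add_card_filter_not (s := S) (fun u => G.Adj v u)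
    have h3 : ∑ g ∈ K, (((S.filter fun u => ¬ G.Adj v u).filter fun u => G.Adj g u).card + 1 +
        if g = v then 2 else 0) ≤ ∑ g ∈ K, f g := by
      refine Finset.sum_le_sum fun g hg => ?_
      by_cases hgv : g = v
      · subst hgv
        rw [Finset.filter_filter, if_pos rfl]
        have : (S.filter fun u => ¬ G.Adj g u ∧ G.Adj g u) = ∅ := by
          ext; simp
        rw [this, hf, hvS, Finset.card_empty]
      · rw [if_neg hgv, add_zero]
        obtain ⟨u, hu, hvu, hgu⟩ := h.exists_adj_of_card_eq_three hv hS hvS hg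
        rw [hf]
        refine Nat.succ_le_of_lt (Finset.card_lt_card ?_)
        refine Finset.ssubset_iff_of_subset ?_ |>.mpr ⟨u, by simp [hu, hgu], by simp [hvu]⟩
        exact Finset.filter_subset_filter _ (Finset.filter_subset _ _)
    rw [Finset.sum_add_distrib, Finset.sum_add_distrib, Finset.sum_ite_eq' K v, if_pos hv,
      Finset.sum_const, smul_eq_mul, mul_one] at h3
    omega
  -- If all values were at least two, the sum would be at least `2 |K|` plus the number of threes,
  -- which suffices because `|S| ≤ |I| ≤ |K|`.
  obtain ⟨g₁, hg₁, hf₁⟩ : ∃ g ∈ K, f g = 1 := by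
    by_contra hno
    push Not at hno
    have : ∑ g ∈ K, (2 + if f g = 3 then 1 else 0) ≤ ∑ g ∈ K, f g := by
      refine Finset.sum_le_sum fun g hg => ?_
      have := hno g hg
      have := hpos g hg
      split_ifs <;> omega
    rw [Finset.sum_add_distrib, ← hf3, Finset.sum_const, smul_eq_mul] at this
    omega
  obtain ⟨p, hp⟩ := Finset.card_eq_one.mp (hf g₁ ▸ hf₁)
  have hp' : p ∈ S ∧ G.Adj g₁ p := by
    have : p ∈ S.filter fun u => G.Adj g₁ u := by simp [hp]
    simpa using this
  -- The three neighbours of `g` must include a neighbour of `g₁`, and `p` is the only one in `S`.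
  have hall : ∀ g ∈ K, f g = 3 → G.Adj g p := by
    intro g hg hg3
    obtain ⟨u, hu, hgu, hu'⟩ := h.exists_adj_of_card_eq_three hg hS (hf g ▸ hg3) hg₁
    have : u ∈ S.filter fun u => G.Adj g₁ u := by simp [hu, hu']
    rw [hp, Finset.mem_singleton] at this
    exact this ▸ hgu
  obtain ⟨g₂, hg₂, hg₂p⟩ := h.miss p (hS hp'.1)
  have hf₂ : f g₂ ≤ 2 := by
    have h1 : f g₂ ≠ 3 := fun e => hg₂p (hall g₂ hg₂ e)
    have h2 := h.card_filter_le_three hg₂ hS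
    rw [← hf] at h2
    omega
  -- Removing `D` costs at most three vertices, but every clique vertex with value three loses two
  -- neighbours: `p`, and one shared with `g₂`, which is not `p`. With one more unit for `g₂`
  -- itself, the sum is at least `2 |S| - 5` plus twice the number of threes. So there are at most
  -- four threes, whence `|K| ≤ 7`.
  set D : Finset V := insert p (S.filter fun u => G.Adj g₂ u) with hD
  have hDc : D.card ≤ 3 := (Finset.card_insert_le _ _).trans (by rw [hf] at hf₂; omega)
  have hDS : D ⊆ S := Finset.insert_subset hp'.1 (Finset.filter_subset _ _)
  have h1 := hdeg (S \ D) Finset.sdiff_subset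
  have h2 := Finset.card_sdiff_add_card_eq_card hDS
  have h3 : ∑ g ∈ K, (((S \ D).filter fun u => G.Adj g u).card + (if f g = 3 then 1 else 0) +
      (if f g = 3 then 1 else 0) + if g = g₂ then 1 else 0) ≤ ∑ g ∈ K, f g := by
    refine Finset.sum_le_sum fun g hg => ?_
    by_cases hgg : g = g₂
    · subst hgg
      have hem : ((S \ D).filter fun u => G.Adj g u) = ∅ := by
        ext u
        simp only [hD, Finset.mem_filter, Finset.mem_sdiff, Finset.mem_insert, Finset.notMem_empty,
          iff_false]
        tauto
      have := hpos g hg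
      rw [if_neg (by omega), hem]
      simpa using this
    · rw [if_neg hgg, add_zero]
      split_ifs with hg3
      · obtain ⟨u, hu, hgu, hu'⟩ := h.exists_adj_of_card_eq_three hg hS (hf g ▸ hg3) hg₂
        have hpu : p ≠ u := fun e => hg₂p (e ▸ hu')
        have hsub : ((S \ D).filter fun u => G.Adj g u) ⊆
            ((S.filter fun u => G.Adj g u).erase p).erase u := by
          intro x hx
          simp only [hD, Finset.mem_filter, Finset.mem_sdiff, Finset.mem_insert, not_or,
            not_and] at hx
          simp only [Finset.mem_erase, Finset.mem_filter]
          exact ⟨fun e => hx.1.2.2 hx.1.1 (e ▸ hu'), hx.1.2.1, hx.1.1, hx.2⟩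
        have := Finset.card_le_card hsub
        rw [Finset.card_erase_of_mem (by simp [hu, hgu, hpu.symm]),
          Finset.card_erase_of_mem (by simp [hp'.1, hall g hg hg3])] at this
        rw [← hf] at this
        omega
      · rw [hf]
        exact Finset.card_le_card (Finset.filter_subset_filter _ Finset.sdiff_subset)
  rw [Finset.sum_add_distrib, Finset.sum_add_distrib, Finset.sum_add_distrib,
    Finset.sum_ite_eq' K g₂, if_pos hg₂, ← hf3] at h3
  omega

open scoped Classical in
/-- One incidence can be deleted at each clique vertex with three neighbours in `I`, so that every
vertex of `I` keeps two neighbours. -/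
lemma SplitFacts.exists_deletion (h : G.SplitFacts K I) :
    ∃ del : V → V, (∀ g ∈ K, (I.filter fun u => G.Adj g u).card = 3 → G.Adj g (del g) ∧ del g ∈ I) ∧
      ∀ u ∈ I, 2 ≤ (K.filter fun g => G.Adj g u ∧
        ¬ ((I.filter fun u => G.Adj g u).card = 3 ∧ del g = u)).card := by
  set T := K.filter fun g => (I.filter fun u => G.Adj g u).card = 3 with hT
  set d : V → ℕ := fun u => (K.filter fun g => G.Adj g u).card with hd
  -- A vertex `u` of `I` can spare `d u - 2` incidences, represented by that many tokens. Each
  -- clique vertex with three neighbours has to get a token of its own at one of them.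
  let t : T → Finset (Σ _ : V, ℕ) := fun g =>
    (I.filter fun u => G.Adj g.1 u).sigma fun u => Finset.range (d u - 2)
  have hall : ∀ s : Finset T, s.card ≤ (s.biUnion t).card := by
    intro s
    rcases s.eq_empty_or_nonempty with rfl | ⟨v, hv⟩
    · simp
    set S : Finset V := s.biUnion fun g => I.filter fun u => G.Adj g.1 u with hS
    have hSI : S ⊆ I := Finset.biUnion_subset.mpr fun g _ => Finset.filter_subset _ _
    have hst : s.biUnion t = S.sigma fun u => Finset.range (d u - 2) := by
      ext ⟨u, i⟩
      simp only [hS, t, Finset.mem_biUnion, Finset.mem_sigma]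
      constructor
      · rintro ⟨g, hg, h1, h2⟩
        exact ⟨⟨g, hg, h1⟩, h2⟩
      · rintro ⟨⟨g, hg, h1⟩, h2⟩
        exact ⟨g, hg, h1, h2⟩
    have hfull : ∀ g ∈ s, (S.filter fun u => G.Adj g.1 u) = I.filter fun u => G.Adj g.1 u := by
      intro g hg
      ext u
      simp only [Finset.mem_filter]
      refine ⟨fun hu => ⟨hSI hu.1, hu.2⟩, fun hu => ⟨?_, hu.2⟩⟩
      exact Finset.mem_biUnion.mpr ⟨g, hg, by simpa using hu⟩
    have hmem : ∀ g : T, g.1 ∈ K ∧ (I.filter fun u => G.Adj g.1 u).card = 3 := fun g =>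
      Finset.mem_filter.mp g.2
    -- For `S` the neighbourhood of `s` in `I`, the tokens over `S` number the degree sum of `S`
    -- less `2 |S|`, and the members of `s` have all three neighbours in `S`.
    have key := h.two_mul_card_add_le hSI (hmem v).1 (by rw [hfull v hv]; exact (hmem v).2)
    have hs3 : s.card ≤ (K.filter fun g => (S.filter fun u => G.Adj g u).card = 3).card := by
      rw [← Finset.card_map (Function.Embedding.subtype _)]
      refine Finset.card_le_card fun g hg => ?_
      obtain ⟨g', hg', rfl⟩ := Finset.mem_map.mp hg
      rw [Finset.mem_filter]
      refine ⟨(hmem g').1, ?_⟩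
      change (S.filter fun u => G.Adj g'.1 u).card = 3
      rw [hfull g' hg']
      exact (hmem g').2
    rw [← sum_card_filter_adj] at key
    rw [hst, Finset.card_sigma]
    simp only [Finset.card_range]
    have h2 : ∑ u ∈ S, (d u - 2) + 2 * S.card = ∑ u ∈ S, d u := by
      rw [mul_comm, ← smul_eq_mul, ← Finset.sum_const, ← Finset.sum_add_distrib]
      refine Finset.sum_congr rfl fun u hu => ?_
      have := h.two_le_card (hSI hu)
      simp only [hd]
      omega
    simp only [hd] at h2 ⊢
    omega
  obtain ⟨e, he, het⟩ := (Finset.all_card_le_biUnion_card_iff_exists_injective t).mp hall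
  simp only [t, Finset.mem_sigma, Finset.mem_filter, Finset.mem_range] at het
  have hTm : ∀ {g}, g ∈ T ↔ g ∈ K ∧ (I.filter fun u => G.Adj g u).card = 3 := by
    intro g; simp [hT]
  refine ⟨fun g => if hg : g ∈ T then (e ⟨g, hg⟩).1 else g, ?_, ?_⟩
  · intro g hg hg3
    have hgT : g ∈ T := hTm.mpr ⟨hg, hg3⟩
    simp only [hgT, dite_true]
    exact ⟨(het ⟨g, hgT⟩).1.2, (het ⟨g, hgT⟩).1.1⟩
  · intro u hu
    set del : V → V := fun g => if hg : g ∈ T then (e ⟨g, hg⟩).1 else g with hdel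
    -- Distinct clique vertices deleting at `u` hold distinct tokens of `u`.
    have hle : (T.filter fun g => del g = u).card ≤ d u - 2 := by
      have : ∀ g ∈ T.filter fun g => del g = u,
          (if hg : g ∈ T then (e ⟨g, hg⟩).2 else 0) ∈ Finset.range (d u - 2) := by
        intro g hg
        rw [Finset.mem_filter] at hg
        have h1 := (het ⟨g, hg.1⟩).2
        have h2 : (e ⟨g, hg.1⟩).1 = u := by simpa [hdel, hg.1] using hg.2
        rw [h2] at h1
        simpa [hg.1] using h1
      rw [← Finset.card_range (d u - 2)]
      refine Finset.card_le_card_of_injOn _ this ?_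
      intro g hg g' hg' heq
      rw [Finset.mem_coe, Finset.mem_filter] at hg hg'
      have h1 : (e ⟨g, hg.1⟩).1 = u := by simpa [hdel, hg.1] using hg.2
      have h2 : (e ⟨g', hg'.1⟩).1 = u := by simpa [hdel, hg'.1] using hg'.2
      simp only [hg.1, hg'.1, dite_true] at heq
      have := he (Sigma.ext (h1.trans h2.symm) (heq_of_eq heq))
      simpa using this
    have hsub : (K.filter fun g => G.Adj g u) ⊆ (K.filter fun g => G.Adj g u ∧
        ¬ ((I.filter fun u => G.Adj g u).card = 3 ∧ del g = u)) ∪ (T.filter fun g => del g = u) := by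
      intro g hg
      simp only [Finset.mem_union, Finset.mem_filter, hTm] at hg ⊢
      tauto
    have h1 := (Finset.card_le_card hsub).trans (Finset.card_union_le _ _)
    have h2 := h.two_le_card hu
    simp only [hd] at hle
    omega

/-- The edges between the clique and the independent set. -/
def crossAdj (G : SimpleGraph V) (K I : Finset V) (a b : V) : Prop :=
  G.Adj a b ∧ (a ∈ I ∧ b ∈ K ∨ a ∈ K ∧ b ∈ I)

lemma crossAdj.symm {a b : V} (h : G.crossAdj K I a b) : G.crossAdj K I b a :=
  ⟨h.1.symm, h.2.symm.imp And.symm And.symm⟩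

/-- After the deletion every clique vertex keeps at most two incidences and every vertex of `I` at
least two. It remains to keep exactly two at each vertex of `I`. -/
lemma SplitFacts.exists_two_factor (h : G.SplitFacts K I) :
    ∃ F : V → V → Prop, (∀ x y, F x y → F y x) ∧ (∀ x y, F x y → G.crossAdj K I x y) ∧
      (∀ u ∈ I, ∃ a b, a ≠ b ∧ F u a ∧ F u b) ∧
      (∀ x a b c, F x a → F x b → F x c → a = b ∨ a = c ∨ b = c) := by
  classical
  obtain ⟨del, hdel, htwo⟩ := h.exists_deletion
  have hch : ∀ u, ∃ a b, u ∈ I → a ≠ b ∧ (a ∈ K ∧ G.Adj a u ∧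
        ¬ ((I.filter fun u => G.Adj a u).card = 3 ∧ del a = u)) ∧ (b ∈ K ∧ G.Adj b u ∧
        ¬ ((I.filter fun u => G.Adj b u).card = 3 ∧ del b = u)) := by
    intro u
    by_cases hu : u ∈ I
    · obtain ⟨a, ha, b, hb, hab⟩ := Finset.one_lt_card.mp (htwo u hu)
      exact ⟨a, b, fun _ => ⟨hab, by simpa using ha, by simpa using hb⟩⟩
    · exact ⟨u, u, fun h => absurd h hu⟩
  choose p q hpq using hch
  have hI : ∀ {x}, x ∈ I → x ∉ K := fun hx hK => h.notMem _ hK hx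
  refine ⟨fun x y => (x ∈ I ∧ (y = p x ∨ y = q x)) ∨ (y ∈ I ∧ (x = p y ∨ x = q y)),
    fun x y hxy => hxy.symm, ?_, ?_, ?_⟩
  · rintro x y (⟨hx, rfl | rfl⟩ | ⟨hy, rfl | rfl⟩)
    · exact ⟨(hpq x hx).2.1.2.1.symm, .inl ⟨hx, (hpq x hx).2.1.1⟩⟩
    · exact ⟨(hpq x hx).2.2.2.1.symm, .inl ⟨hx, (hpq x hx).2.2.1⟩⟩
    · exact ⟨(hpq y hy).2.1.2.1, .inr ⟨(hpq y hy).2.1.1, hy⟩⟩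
    · exact ⟨(hpq y hy).2.2.2.1, .inr ⟨(hpq y hy).2.2.1, hy⟩⟩
  · exact fun u hu => ⟨p u, q u, (hpq u hu).1, .inl ⟨hu, .inl rfl⟩, .inl ⟨hu, .inr rfl⟩⟩
  · intro x a b c ha hb hc
    by_cases hx : x ∈ I
    · have hno : ∀ y, y ∈ I → x ≠ p y ∧ x ≠ q y := fun y hy =>
        ⟨fun e => hI hx (e ▸ (hpq y hy).2.1.1), fun e => hI hx (e ▸ (hpq y hy).2.2.1)⟩
      have hred : ∀ y, ((x ∈ I ∧ (y = p x ∨ y = q x)) ∨ (y ∈ I ∧ (x = p y ∨ x = q y))) →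
          y = p x ∨ y = q x := by
        rintro y (h1 | h1)
        · exact h1.2
        · exact absurd h1.2 (not_or.mpr (hno y h1.1))
      rcases hred a ha with rfl | rfl <;> rcases hred b hb with rfl | rfl <;>
        rcases hred c hc with rfl | rfl <;> simp
    · have hred : ∀ y, ((x ∈ I ∧ (y = p x ∨ y = q x)) ∨ (y ∈ I ∧ (x = p y ∨ x = q y))) →
          y ∈ I ∧ G.Adj x y ∧ ¬ ((I.filter fun u => G.Adj x u).card = 3 ∧ del x = y) := by
        rintro y (h1 | ⟨hy, rfl | rfl⟩)
        · exact absurd h1.1 hx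
        · exact ⟨hy, (hpq y hy).2.1.2⟩
        · exact ⟨hy, (hpq y hy).2.2.2⟩
      by_contra hcon
      push Not at hcon
      obtain ⟨ha1, ha2, ha3⟩ := hred a ha
      obtain ⟨hb1, hb2, hb3⟩ := hred b hb
      obtain ⟨hc1, hc2, hc3⟩ := hred c hc
      have hxK := (h.cover x).resolve_right hx
      have h3 : (I.filter fun u => G.Adj x u).card = 3 := by
        refine le_antisymm (h.card_filter_le_three hxK subset_rfl) ?_
        rw [← Finset.card_eq_three.mpr ⟨a, b, c, hcon.1, hcon.2.1, hcon.2.2, rfl⟩]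
        refine Finset.card_le_card ?_
        simp [Finset.insert_subset_iff, *]
      -- Three remaining neighbours would be all neighbours of `x` in `I`, including the deleted
      -- one.
      obtain ⟨hd1, hd2⟩ := hdel x hxK h3
      rcases h.four x hxK a ha1 b hb1 c hc1 _ hd2 ha2 hb2 hc2 hd1 hcon.1 hcon.2.1 hcon.2.2 with
        e | e | e
      exacts [ha3 ⟨h3, e⟩, hb3 ⟨h3, e⟩, hc3 ⟨h3, e⟩]

end SimpleGraph

/-! ### Lists of vertices, cycles and Hamiltonian cycles -/

/-- `l` is a nonempty chain for `R` from `a` to `b`. -/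
def Seg {V : Type*} (R : V → V → Prop) (a b : V) (l : List V) : Prop :=
  l.IsChain R ∧ l.head? = some a ∧ l.getLast? = some b

namespace Seg

variable {V : Type*} {R : V → V → Prop} {a b c d : V} {l l' : List V}

lemma single (a : V) : Seg R a a [a] := ⟨List.isChain_singleton a, rfl, rfl⟩

lemma ne_nil (h : Seg R a b l) : l ≠ [] := by
  rintro rfl
  simpa using h.2.1

lemma append (h : Seg R a b l) (h' : Seg R c d l') (hbc : R b c) : Seg R a d (l ++ l') := by
  refine ⟨?_, ?_, ?_⟩
  · rw [List.isChain_append]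
    refine ⟨h.1, h'.1, fun x hx y hy => ?_⟩
    rw [h.2.2, Option.mem_some_iff] at hx
    rw [h'.2.1, Option.mem_some_iff] at hy
    exact hx ▸ hy ▸ hbc
  · rw [List.head?_append, h.2.1, Option.some_or]
  · rw [List.getLast?_append, h'.2.2, Option.some_or]

lemma cons (h : Seg R b c l) (hab : R a b) : Seg R a c (a :: l) := (single a).append h hab

lemma reverse (hR : ∀ x y, R x y → R y x) (h : Seg R a b l) : Seg R b a l.reverse :=
  ⟨List.isChain_reverse.mpr (h.1.imp fun x y => hR x y), by simp [h.2.2], by simp [h.2.1]⟩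

lemma mono {S : V → V → Prop} (hRS : ∀ x y, R x y → S x y) (h : Seg R a b l) : Seg S a b l :=
  ⟨h.1.imp fun x y => hRS x y, h.2⟩

lemma head_mem (h : Seg R a b l) : a ∈ l := List.mem_of_mem_head? h.2.1

lemma last_mem (h : Seg R a b l) : b ∈ l := List.mem_of_getLast? h.2.2

lemma exists_cons (h : Seg R a b l) : ∃ t, l = a :: t := by
  cases l with
  | nil => exact absurd rfl h.ne_nil
  | cons x t =>
    have := h.2.1
    simp only [List.head?_cons, Option.some.injEq] at this
    exact ⟨t, by rw [this]⟩

lemma split (h : Seg R a b (l ++ l')) (hl : l ≠ []) (hl' : l' ≠ []) :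
    ∃ y x, Seg R a y l ∧ Seg R x b l' ∧ R y x := by
  obtain ⟨y, hy⟩ : ∃ y, l.getLast? = some y := ⟨_, List.getLast?_eq_some_getLast hl⟩
  obtain ⟨x, hx⟩ : ∃ x, l'.head? = some x := ⟨_, List.head?_eq_some_head hl'⟩
  obtain ⟨z, hz⟩ : ∃ z, l.head? = some z := ⟨_, List.head?_eq_some_head hl⟩
  obtain ⟨w, hw⟩ : ∃ w, l'.getLast? = some w := ⟨_, List.getLast?_eq_some_getLast hl'⟩
  have h1 := List.isChain_append.mp h.1
  have h2 := h.2.1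
  have h3 := h.2.2
  rw [List.head?_append, hz, Option.some_or] at h2
  rw [List.getLast?_append, hw, Option.some_or] at h3
  exact ⟨y, x, ⟨h1.1, hz.trans h2, hy⟩, ⟨h1.2.1, hx, hw.trans h3⟩, h1.2.2 y hy x hx⟩

lemma tail (h : Seg R a b (a :: l)) (hl : l ≠ []) : ∃ x, Seg R x b l ∧ R a x := by
  obtain ⟨y, x, h1, h2, h3⟩ := split (l := [a]) (l' := l) h (by simp) hl
  have := h1.2.2
  simp only [List.getLast?_singleton, Option.some.injEq] at this
  exact ⟨x, h2, this ▸ h3⟩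

lemma head_ne_last (h : Seg R a b l) (hn : l.Nodup) (h2 : 2 ≤ l.length) : a ≠ b := by
  obtain ⟨t, rfl⟩ := h.exists_cons
  have ht : t ≠ [] := by
    rintro rfl
    simp at h2
  obtain ⟨x, hx, -⟩ := h.tail ht
  exact fun e => (List.nodup_cons.mp hn).1 (e ▸ hx.last_mem)

/-- A closed chain can be opened at each of its members. -/
lemma rotate (h : Seg R a b l) (hba : R b a) {x : V} (hx : x ∈ l) :
    ∃ t y, (x :: t).Perm l ∧ Seg R x y (x :: t) ∧ R y x := by
  obtain ⟨l₁, l₂, rfl⟩ := List.append_of_mem hx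
  by_cases hl : l₁ = []
  · subst hl
    have := h.2.1
    simp only [List.nil_append, List.head?_cons, Option.some.injEq] at this
    subst this
    exact ⟨l₂, b, .refl _, h, hba⟩
  · obtain ⟨y, z, h1, h2, h3⟩ := h.split hl (by simp)
    have := h2.2.1
    simp only [List.head?_cons, Option.some.injEq] at this
    subst this
    exact ⟨l₂ ++ l₁, y, List.perm_append_comm (l₁ := x :: l₂), h2.append h1 hba, h3⟩

end Seg

namespace SimpleGraph

variable {V : Type*} {G : SimpleGraph V} {K I : Finset V}

lemma exists_isCycle_of_list {a b : V} {l : List V} (h : Seg G.Adj a b l)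
    (hba : G.Adj b a) (hn : l.Nodup) (h3 : 3 ≤ l.length) :
    ∃ c : G.Walk a a, c.IsCycle ∧ c.support = l ++ [a] := by
  have hs : Seg G.Adj a a (l ++ [a]) := h.append (Seg.single a) hba
  obtain ⟨t, rfl⟩ := h.exists_cons
  let c := Walk.ofSupport (a :: t ++ [a]) hs.ne_nil hs.1
  have hsupp : c.support = a :: t ++ [a] := Walk.support_ofSupport _ _
  have hhead : (a :: t ++ [a]).head hs.ne_nil = a := by simp
  have hlast : (a :: t ++ [a]).getLast hs.ne_nil = a := by simp
  refine ⟨c.copy hhead hlast, ?_, by rw [Walk.support_copy, hsupp]⟩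
  have hsupp' : (c.copy hhead hlast).support = a :: t ++ [a] := by rw [Walk.support_copy, hsupp]
  generalize c.copy hhead hlast = c' at hsupp'
  rw [Walk.isCycle_iff_isPath_tail_and_le_length]
  have hlen : c'.length + 1 = (a :: t ++ [a]).length := by rw [← hsupp', Walk.length_support]
  have hlen' : 3 ≤ c'.length := by
    simp only [List.length_append, List.length_cons, List.length_nil] at hlen h3
    omega
  refine ⟨?_, hlen'⟩
  rw [Walk.isPath_def, Walk.support_tail_of_not_nil, hsupp']
  · simp only [List.cons_append, List.tail_cons]
    exact (List.perm_append_comm (l₁ := [a])).nodup_iff.mp hn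
  · intro hnil
    rw [← Walk.length_eq_zero_iff] at hnil
    omega

/-- A closed chain through all vertices gives a Hamiltonian cycle. -/
lemma exists_isHamiltonianCycle_of_list [DecidableEq V] {a b : V} {l : List V} (h : Seg G.Adj a b l)
    (hba : G.Adj b a) (hn : l.Nodup) (h3 : 3 ≤ l.length) (hall : ∀ v, v ∈ l) :
    ∃ c : G.Walk a a, c.IsHamiltonianCycle ∧ c.support = l ++ [a] := by
  obtain ⟨c, hc, hs⟩ := exists_isCycle_of_list h hba hn h3
  refine ⟨c, ?_, hs⟩
  rw [Walk.isHamiltonianCycle_iff_isCycle_and_support_count_tail_eq_one]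
  refine ⟨hc, fun x => ?_⟩
  obtain ⟨t, rfl⟩ := h.exists_cons
  rw [hs]
  simp only [List.cons_append, List.tail_cons]
  rw [(List.perm_append_comm (l₁ := t) (l₂ := [a])).count_eq]
  exact List.count_eq_one_of_mem hn (hall x)

/-- A cycle of the graph of degree-two vertices is induced. -/
lemma mem_edges_of_isCycle_degTwoGraph {a : V} {c : (G.degTwoGraph I).Walk a a} (hc : c.IsCycle)
    {u v : V} (hu : u ∈ c.support) (hv : v ∈ c.support) (huv : (G.degTwoGraph I).Adj u v) :
    s(u, v) ∈ c.edges := by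
  have key : ∀ {u v : V}, u ∈ c.support → (G.degTwoGraph I).Adj u v → u ∈ G.degTwoPart I →
      s(u, v) ∈ c.edges := by
    intro u v hu huv hd
    have h2 := hc.ncard_neighborSet_toSubgraph_eq_two hu
    have hsub : c.toSubgraph.neighborSet u ⊆ G.neighborSet u := fun x hx =>
      (c.toSubgraph.adj_sub hx).1
    have heq := Set.eq_of_subset_of_ncard_le hsub (by rw [h2, hd.2])
      (Set.finite_of_ncard_ne_zero (by rw [hd.2]; omega))
    have : v ∈ c.toSubgraph.neighborSet u := heq ▸ huv.1
    exact Walk.adj_toSubgraph_iff_mem_edges.mp this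
  rcases huv.2 with h | h
  · exact key hu huv h
  · rw [Sym2.eq_swap]
    exact key hv huv.symm h

end SimpleGraph

/-! ### Covering a split graph by closed alternating chains and paths with ends in the clique -/

namespace SimpleGraph

variable {V : Type*} {G : SimpleGraph V} {K I : Finset V}

lemma SplitFacts.mem_right (h : G.SplitFacts K I) {a b : V} (hab : G.crossAdj K I a b)
    (ha : a ∈ I) : b ∈ K := by
  rcases hab.2 with h1 | h1
  · exact h1.2
  · exact absurd ha (h.notMem _ h1.1)

lemma SplitFacts.mem_right' (h : G.SplitFacts K I) {a b : V} (hab : G.crossAdj K I a b)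
    (ha : a ∈ K) : b ∈ I := by
  rcases hab.2 with h1 | h1
  · exact absurd h1.1 (h.notMem _ ha)
  · exact h1.2

lemma SplitFacts.mem_left (h : G.SplitFacts K I) {a b : V} (hab : G.crossAdj K I a b)
    (hb : b ∈ I) : a ∈ K := h.mem_right hab.symm hb

lemma SplitFacts.mem_left' (h : G.SplitFacts K I) {a b : V} (hab : G.crossAdj K I a b)
    (hb : b ∈ K) : a ∈ I := h.mem_right' hab.symm hb

lemma crossAdj_of_mem {g u : V} (hg : g ∈ K) (hu : u ∈ I) (hgu : G.Adj g u) :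
    G.crossAdj K I g u := ⟨hgu, .inr ⟨hg, hu⟩⟩

/-- An alternating chain balances the two sides, up to its ends. -/
lemma SplitFacts.countP_eq [DecidableEq V] (h : G.SplitFacts K I) {b : V} : ∀ {l : List V} {a : V},
    Seg (G.crossAdj K I) a b l →
      l.countP (· ∈ I) + 1 = l.countP (· ∈ K) + (if a ∈ I then 1 else 0) + if b ∈ I then 1 else 0 := by
  have hIK : ∀ x, x ∈ I → x ∉ K := fun x hx hK => h.notMem x hK hx
  intro l
  induction l with
  | nil => exact fun hs => absurd rfl hs.ne_nil
  | cons x t ih =>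
    intro a hs
    have hx := hs.2.1
    simp only [List.head?_cons, Option.some.injEq] at hx
    subst hx
    by_cases ht : t = []
    · subst ht
      have hb := hs.2.2
      simp only [List.getLast?_singleton, Option.some.injEq] at hb
      subst hb
      rcases h.cover x with hx | hx
      · simp [hx, h.notMem x hx]
      · simp [hx, hIK x hx]
    · obtain ⟨y, hy, hxy⟩ := hs.tail ht
      have := ih hy
      rcases hxy.2 with ⟨h1, h2⟩ | ⟨h1, h2⟩
      · have h3 := hIK _ h1
        have h4 := h.notMem _ h2
        simp only [List.countP_cons, h1, h3, h4, decide_true, decide_false, if_true, if_false] at this ⊢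
        simp at this ⊢
        omega
      · have h3 := hIK _ h2
        have h4 := h.notMem _ h1
        simp only [List.countP_cons, h1, h2, h4, decide_true, decide_false, if_true, if_false] at this ⊢
        simp at this ⊢
        omega

/-- A closed alternating chain has equally many vertices on both sides. If it contains all of `K`,
it contains `|K| ≥ |I|` vertices of `I`, hence all of them. -/
lemma SplitFacts.mem_of_forall_mem (h : G.SplitFacts K I) {a b : V} {l : List V}
    (hs : Seg (G.crossAdj K I) a b l) (hba : G.crossAdj K I b a) (hn : l.Nodup)
    (hK : ∀ g ∈ K, g ∈ l) (v : V) : v ∈ l := by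
  classical
  have hcount := h.countP_eq hs
  have hab : (if a ∈ I then 1 else 0) + (if b ∈ I then 1 else 0) = 1 := by
    rcases hba.2 with ⟨h1, h2⟩ | ⟨h1, h2⟩
    · simp [h1, h.notMem _ h2]
    · simp [h2, h.notMem _ h1]
  have e1 : l.countP (· ∈ K) = (l.toFinset ∩ K).card := by
    rw [List.countP_eq_length_filter, ← List.toFinset_card_of_nodup (hn.filter _)]
    congr 1
    ext x
    simp
  have e2 : l.countP (· ∈ I) = (l.toFinset ∩ I).card := by
    rw [List.countP_eq_length_filter, ← List.toFinset_card_of_nodup (hn.filter _)]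
    congr 1
    ext x
    simp
  have h1 : l.toFinset ∩ K = K := Finset.inter_eq_right.mpr fun g hg => List.mem_toFinset.mpr (hK g hg)
  have h2 : l.toFinset ∩ I = I := by
    refine Finset.eq_of_subset_of_card_le Finset.inter_subset_right ?_
    rw [h1] at e1
    have := h.card_le
    omega
  rcases h.cover v with hv | hv
  · exact hK v hv
  · rw [← h2] at hv
    simpa using (Finset.mem_inter.mp hv).1

/-- If there is no short cycle, a closed alternating chain that misses a vertex has a neighbour
outside. -/
lemma SplitFacts.exists_outer_neighbor (h : G.SplitFacts K I)
    (hshort : ¬ ∃ (a : V) (c : (G.degTwoGraph I).Walk a a), G.IsShortCycle K I c)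
    {a b : V} {l : List V} (hs : Seg (G.crossAdj K I) a b l) (hba : G.crossAdj K I b a)
    (hn : l.Nodup) (h3 : 3 ≤ l.length) {w : V} (hw : w ∉ l) :
    ∃ u ∈ l, u ∈ I ∧ ∃ v ∈ K, v ∉ l ∧ G.Adj v u := by
  by_contra hcon
  push Not at hcon
  have hin : ∀ u ∈ l, u ∈ I → ∀ v ∈ K, G.Adj v u → v ∈ l := fun u hu hI v hv hvu => by
    by_contra hvl
    exact hcon u hu hI v hv hvl hvu
  -- If a clique vertex had three neighbours in `I` on the chain, every clique vertex would be
  -- adjacent to one of them and so lie on the chain, which would then contain every vertex.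
  have hthree : ∀ g ∈ K, ∀ x ∈ l, ∀ y ∈ l, ∀ z ∈ l, x ∈ I → y ∈ I → z ∈ I →
      G.Adj g x → G.Adj g y → G.Adj g z → x ≠ y → x ≠ z → y ≠ z → False := by
    intro g hg x hx y hy z hz hxI hyI hzI gx gy gz hxy hxz hyz
    refine hw (h.mem_of_forall_mem hs hba hn (fun k hk => ?_) w)
    rcases h.hit g hg x hxI y hyI z hzI gx gy gz hxy hxz hyz k hk with hk' | hk' | hk'
    exacts [hin x hx hxI k hk hk', hin y hy hyI k hk hk', hin z hz hzI k hk hk']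
  have hdeg : ∀ u ∈ l, u ∈ I → u ∈ G.degTwoPart I := by
    intro u hu huI
    obtain ⟨t, y, hp, ht, hyu⟩ := hs.rotate hba hu
    have hnt : (u :: t).Nodup := hp.nodup_iff.mpr hn
    have htl : 2 ≤ t.length := by
      have := hp.length_eq
      simp only [List.length_cons] at this
      omega
    obtain ⟨x, hx, hux⟩ := ht.tail (by rintro rfl; simp at htl)
    have hxy : x ≠ y := hx.head_ne_last (List.nodup_cons.mp hnt).2 htl
    refine ⟨huI, ?_⟩
    have : G.neighborSet u = {x, y} := by
      ext g
      simp only [mem_neighborSet, Set.mem_insert_iff, Set.mem_singleton_iff]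
      refine ⟨fun hug => ?_, ?_⟩
      · by_contra hg
        push Not at hg
        have hgK : g ∈ K := (h.cover g).resolve_right fun hgI => h.indep u huI g hgI hug
        have hgl := hin u hu huI g hgK hug.symm
        have hgt : g ∈ t := by
          have := hp.mem_iff.mpr hgl
          rcases List.mem_cons.mp this with e | e
          · exact absurd e.symm hug.ne
          · exact e
        -- A third neighbour `g` of `u` lies on the chain away from `u`, so `u` and the two
        -- neighbours of `g` along the chain contradict `hthree`.
        obtain ⟨t₁, t₂, rfl⟩ := List.append_of_mem hgt
        have ht₁ : t₁ ≠ [] := by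
          rintro rfl
          have := hx.2.1
          simp at this
          exact hg.1 this
        have ht₂ : t₂ ≠ [] := by
          rintro rfl
          have := hx.2.2
          simp at this
          exact hg.2 this
        obtain ⟨p, q, s1, s2, hpq⟩ := hx.split ht₁ (by simp)
        have hq := s2.2.1
        simp only [List.head?_cons, Option.some.injEq] at hq
        subst hq
        obtain ⟨r, s3, hgr⟩ := s2.tail ht₂
        have m1 := s1.last_mem
        have m2 := s3.head_mem
        have hnt' := hnt
        simp only [List.nodup_cons, List.nodup_append, List.mem_append, List.mem_cons, not_or] at hnt'
        refine hthree g hgK u hu p (hp.subset (by simp [m1])) r (hp.subset (by simp [m2])) huI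
          (h.mem_left' hpq hgK) (h.mem_right' hgr hgK) hug.symm hpq.1.symm hgr.1 ?_ ?_ ?_
        · exact fun e => hnt'.1.1 (e ▸ m1)
        · exact fun e => hnt'.1.2.2 (e ▸ m2)
        · exact fun e => hnt'.2.2.2 p m1 r (Or.inr m2) e
      · rintro (rfl | rfl)
        · exact hux.1
        · exact hyu.1.symm
    rw [this, Set.ncard_pair hxy]
  have hs' : Seg (G.degTwoGraph I).Adj a b l := by
    refine ⟨hs.1.imp_of_mem_imp fun x y hx hy hxy => ⟨hxy.1, ?_⟩, hs.2⟩
    rcases hxy.2 with h1 | h1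
    · exact .inl (hdeg x hx h1.1)
    · exact .inr (hdeg y hy h1.2)
  have hba' : (G.degTwoGraph I).Adj b a := by
    refine ⟨hba.1, ?_⟩
    rcases hba.2 with h1 | h1
    · exact .inl (hdeg b hs.last_mem h1.1)
    · exact .inr (hdeg a hs.head_mem h1.2)
  obtain ⟨c, hc, hsupp⟩ := exists_isCycle_of_list hs' hba' hn h3
  refine hshort ⟨a, c, hc, fun u hu v hv huv => mem_edges_of_isCycle_degTwoGraph hc hu hv huv, ?_⟩
  by_contra hno
  push Not at hno
  refine hw (h.mem_of_forall_mem hs hba hn (fun k hk => ?_) w)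
  have := hno k hk
  rw [hsupp, List.mem_append, List.mem_singleton] at this
  exact this.elim id fun e => e ▸ hs.head_mem

/-- Steps of a path cover: edges across, or any step inside the clique. -/
def looseAdj (G : SimpleGraph V) (K I : Finset V) (a b : V) : Prop :=
  G.crossAdj K I a b ∨ a ∈ K ∧ b ∈ K

lemma looseAdj.symm {a b : V} (h : G.looseAdj K I a b) : G.looseAdj K I b a :=
  h.imp crossAdj.symm And.symm

/-- The vertices of `l` can be arranged into a closed alternating chain. -/
def IsRing (G : SimpleGraph V) (K I : Finset V) (l : List V) : Prop :=
  ∃ a b l', l'.Perm l ∧ Seg (G.crossAdj K I) a b l' ∧ G.crossAdj K I b a ∧ 3 ≤ l'.length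

/-- The vertices of `l` can be arranged into a path with both ends in the clique. -/
def IsRod (G : SimpleGraph V) (K I : Finset V) (l : List V) : Prop :=
  ∃ a b l', l'.Perm l ∧ Seg (G.looseAdj K I) a b l' ∧ a ∈ K ∧ b ∈ K

/-- A partition of the vertices into rings and rods. -/
structure IsCover (G : SimpleGraph V) (K I : Finset V) (L : List (List V)) : Prop where
  nodup : L.flatten.Nodup
  mem : ∀ v, v ∈ L.flatten
  good : ∀ l ∈ L, G.IsRing K I l ∨ G.IsRod K I l

/-- A longest chain of a relation with degrees at most two, inside a closed set, is closed. -/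
lemma SplitFacts.exists_closed_list (h : G.SplitFacts K I) {F : V → V → Prop}
    (hsymm : ∀ x y, F x y → F y x) (hF : ∀ x y, F x y → G.crossAdj K I x y)
    (htwo : ∀ u ∈ I, ∃ a b, a ≠ b ∧ F u a ∧ F u b)
    (hdeg : ∀ x a b c, F x a → F x b → F x c → a = b ∨ a = c ∨ b = c)
    (U : Finset V) (hU : ∀ x ∈ U, ∀ y, F x y → y ∈ U) (hne : U.Nonempty) :
    ∃ l : List V, l ≠ [] ∧ l.Nodup ∧ (∀ x ∈ l, x ∈ U) ∧ (∀ x ∈ l, ∀ y, F x y → y ∈ l) ∧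
      (G.IsRing K I l ∨ G.IsRod K I l) := by
  classical
  set S : Set ℕ := {n | ∃ l : List V, l.Nodup ∧ (∀ x ∈ l, x ∈ U) ∧ l.IsChain F ∧ l.length = n} with hS
  have hbdd : BddAbove S := by
    refine ⟨U.card, ?_⟩
    rintro n ⟨l, hl, hlU, -, rfl⟩
    rw [← List.toFinset_card_of_nodup hl]
    exact Finset.card_le_card fun x hx => hlU x (List.mem_toFinset.mp hx)
  have hmem : sSup S ∈ S := Nat.sSup_mem ⟨0, [], by simp⟩ hbdd
  obtain ⟨l, hn, hlU, hch, hlen⟩ := hmem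
  have hmax : ∀ l' : List V, l'.Nodup → (∀ x ∈ l', x ∈ U) → l'.IsChain F → l'.length ≤ l.length := by
    intro l' h1 h2 h3
    rw [hlen]
    exact le_csSup hbdd ⟨l', h1, h2, h3, rfl⟩
  have hl : l ≠ [] := by
    rintro rfl
    obtain ⟨x, hx⟩ := hne
    have := hmax [x] (by simp) (by simpa using hx) (by simp)
    simp at this
  obtain ⟨a, ha⟩ : ∃ a, l.head? = some a := ⟨_, List.head?_eq_some_head hl⟩
  obtain ⟨b, hb⟩ : ∃ b, l.getLast? = some b := ⟨_, List.getLast?_eq_some_getLast hl⟩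
  have hs : Seg F a b l := ⟨hch, ha, hb⟩
  -- A neighbour of an end outside the chain would extend it beyond the maximal length.
  have hend : ∀ {a b : V} {l' : List V}, l'.Perm l → Seg F a b l' → ∀ y, F a y → y ∈ l := by
    intro a b l' hp hs y hay
    by_contra hy
    have hs' := hs.cons (hsymm _ _ hay)
    have := hmax (y :: l') (List.nodup_cons.mpr ⟨fun e => hy (hp.subset e), hp.nodup_iff.mpr hn⟩)
      (fun x hx => by
        rcases List.mem_cons.mp hx with rfl | hx
        · exact hU a (hlU a (hp.subset hs.head_mem)) x hay
        · exact hlU x (hp.subset hx)) hs'.1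
    rw [List.length_cons, hp.length_eq] at this
    omega
  have hrev : Seg F b a l.reverse := hs.reverse hsymm
  have hinner : ∀ {l₁ l₂ : List V} {x : V}, l = l₁ ++ x :: l₂ → l₁ ≠ [] → l₂ ≠ [] →
      ∃ p ∈ l₁, ∃ q ∈ l₂, F x p ∧ F x q ∧ ∀ y, F x y → y = p ∨ y = q := by
    intro l₁ l₂ x e h1 h2
    rw [e] at hs hn
    obtain ⟨p, q, s1, s2, hpq⟩ := hs.split h1 (by simp)
    have hq := s2.2.1
    simp only [List.head?_cons, Option.some.injEq] at hq
    subst hq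
    obtain ⟨r, s3, hxr⟩ := s2.tail h2
    have hpr : p ≠ r := fun e => by
      simp only [List.nodup_append, List.mem_cons] at hn
      exact hn.2.2 p s1.last_mem r (Or.inr s3.head_mem) e
    refine ⟨p, s1.last_mem, r, s3.head_mem, hsymm _ _ hpq, hxr, fun y hy => ?_⟩
    rcases hdeg x y p r hy (hsymm _ _ hpq) hxr with e | e | e
    exacts [.inl e, .inr e, absurd e hpr]
  refine ⟨l, hl, hn, hlU, fun x hx y hxy => ?_, ?_⟩
  · obtain ⟨l₁, l₂, e⟩ := List.append_of_mem hx
    by_cases h1 : l₁ = []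
    · subst h1
      rw [e] at ha
      simp only [List.nil_append, List.head?_cons, Option.some.injEq] at ha
      subst ha
      exact hend (.refl _) hs y hxy
    by_cases h2 : l₂ = []
    · subst h2
      rw [e] at hb
      simp only [List.getLast?_append, List.getLast?_singleton, Option.some_or,
        Option.some.injEq] at hb
      subst hb
      exact hend (List.reverse_perm _) hrev y hxy
    obtain ⟨p, hp, q, hq, -, -, hpq⟩ := hinner e h1 h2
    rcases hpq y hxy with rfl | rfl
    · simp [e, hp]
    · simp [e, hq]
  -- An end `a` in `I` has a second neighbour, which lies on the chain. It can only be the other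
  -- end, as an inner vertex already has two neighbours along the chain besides `a`.
  · have hring : ∀ {a b : V} {l' : List V}, l'.Perm l → Seg F a b l' → a ∈ I → G.IsRing K I l := by
      intro a b l' hp hs haI
      obtain ⟨c, d, hcd, hac, had⟩ := htwo a haI
      have hnl : l'.Nodup := hp.nodup_iff.mpr hn
      obtain ⟨t, rfl⟩ := hs.exists_cons
      have hmemt : ∀ y, F a y → y ∈ t := fun y hy => by
        have := hp.mem_iff.mpr (hend hp hs y hy)
        rcases List.mem_cons.mp this with e | e
        · exact absurd e.symm (hF a y hy).1.ne
        · exact e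
      have ht : t ≠ [] := List.ne_nil_of_mem (hmemt c hac)
      obtain ⟨x, hx, hax⟩ := hs.tail ht
      obtain ⟨y, hyx, hay⟩ : ∃ y, y ≠ x ∧ F a y := by
        by_cases hc : c = x
        · exact ⟨d, fun e => hcd (hc.trans e.symm), had⟩
        · exact ⟨c, hc, hac⟩
      have hyt := hmemt y hay
      have hyb : y = b := by
        by_contra hyb
        obtain ⟨t₁, t₂, rfl⟩ := List.append_of_mem hyt
        have ht₁ : t₁ ≠ [] := by
          rintro rfl
          have := hx.2.1
          simp at this
          exact hyx this
        have ht₂ : t₂ ≠ [] := by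
          rintro rfl
          have := hx.2.2
          simp at this
          exact hyb this
        obtain ⟨p, q, s1, s2, hpq⟩ := hx.split ht₁ (by simp)
        have hq := s2.2.1
        simp only [List.head?_cons, Option.some.injEq] at hq
        subst hq
        obtain ⟨r, s3, hyr⟩ := s2.tail ht₂
        have m1 := s1.last_mem
        have m2 := s3.head_mem
        simp only [List.nodup_cons, List.nodup_append, List.mem_append, List.mem_cons, not_or] at hnl
        rcases hdeg y a p r (hsymm _ _ hay) (hsymm _ _ hpq) hyr with e | e | e
        · exact hnl.1.1 (e ▸ m1)
        · exact hnl.1.2.2 (e ▸ m2)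
        · exact hnl.2.2.2 p m1 r (Or.inr m2) e
      subst hyb
      refine ⟨a, y, a :: t, hp, hs.mono hF, (hF _ _ hay).symm, ?_⟩
      have : 2 ≤ t.length := by
        by_contra hlt
        obtain ⟨t', rfl⟩ := hx.exists_cons
        have : t' = [] := by
          rw [← List.length_eq_zero_iff]
          simp only [List.length_cons] at hlt
          omega
        subst this
        have e1 := hx.2.1
        have e2 := hx.2.2
        simp at e1 e2
        exact hyx e2.symm
      simpa using this
    by_cases haI : a ∈ I
    · exact .inl (hring (.refl _) hs haI)
    by_cases hbI : b ∈ I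
    · exact .inl (hring (List.reverse_perm _) hrev hbI)
    exact .inr ⟨a, b, l, .refl _, hs.mono fun x y hxy => .inl (hF x y hxy),
      (h.cover a).resolve_right haI, (h.cover b).resolve_right hbI⟩

/-- The components of the subgraph from `exists_two_factor` are split off one at a time; what
remains is again closed under its edges. -/
lemma SplitFacts.exists_cover [Fintype V] (h : G.SplitFacts K I) : ∃ L, G.IsCover K I L := by
  classical
  obtain ⟨F, hsymm, hF, htwo, hdeg⟩ := h.exists_two_factor
  have key : ∀ (n : ℕ) (U : Finset V), U.card = n → (∀ x ∈ U, ∀ y, F x y → y ∈ U) →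
      ∃ L : List (List V), L.flatten.Nodup ∧ (∀ v, v ∈ L.flatten ↔ v ∈ U) ∧
        ∀ l ∈ L, G.IsRing K I l ∨ G.IsRod K I l := by
    intro n
    induction n using Nat.strong_induction_on with
    | _ n ih =>
      intro U hUn hU
      rcases U.eq_empty_or_nonempty with rfl | hne
      · exact ⟨[], by simp⟩
      obtain ⟨l, hl, hn, hlU, hcl, hgood⟩ := h.exists_closed_list hsymm hF htwo hdeg U hU hne
      have hss : U \ l.toFinset ⊂ U := by
        refine Finset.ssubset_iff_of_subset Finset.sdiff_subset |>.mpr ?_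
        obtain ⟨x, hx⟩ := List.exists_mem_of_ne_nil l hl
        exact ⟨x, hlU x hx, by simp [hx]⟩
      obtain ⟨L, h1, h2, h3⟩ := ih _ (hUn ▸ Finset.card_lt_card hss) _ rfl (by
        intro x hx y hxy
        simp only [Finset.mem_sdiff, List.mem_toFinset] at hx ⊢
        exact ⟨hU x hx.1 y hxy, fun hy => hx.2 (hcl y hy x (hsymm _ _ hxy))⟩)
      refine ⟨l :: L, ?_, fun v => ?_, ?_⟩
      · rw [List.flatten_cons, List.nodup_append]
        refine ⟨hn, h1, fun x hx y hy e => ?_⟩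
        rw [h2] at hy
        subst e
        simp [hx] at hy
      · rw [List.flatten_cons, List.mem_append, h2]
        simp only [Finset.mem_sdiff, List.mem_toFinset]
        constructor
        · rintro (hv | hv)
          exacts [hlU v hv, hv.1]
        · intro hv
          by_cases hvl : v ∈ l
          exacts [.inl hvl, .inr ⟨hv, hvl⟩]
      · intro l' hl'
        rcases List.mem_cons.mp hl' with rfl | hl'
        exacts [hgood, h3 l' hl']
  obtain ⟨L, h1, h2, h3⟩ := key _ Finset.univ rfl (by simp)
  exact ⟨L, h1, fun v => (h2 v).mpr (Finset.mem_univ v), h3⟩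

end SimpleGraph

/-! ### Covers with a minimal number of parts -/

namespace SimpleGraph

variable {V : Type*} {G : SimpleGraph V} {K I : Finset V}

/-- A cover by as few rings and rods as possible. -/
structure IsMinCover (G : SimpleGraph V) (K I : Finset V) (L : List (List V)) : Prop
    extends G.IsCover K I L where
  le : ∀ L', G.IsCover K I L' → L.length ≤ L'.length

lemma SplitFacts.exists_minCover [Fintype V] (h : G.SplitFacts K I) :
    ∃ L, G.IsMinCover K I L := by
  classical
  obtain ⟨L, hL⟩ := h.exists_cover
  have hex : ∃ n, ∃ L, G.IsCover K I L ∧ L.length = n := ⟨_, L, hL, rfl⟩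
  obtain ⟨L₀, h1, h2⟩ := Nat.find_spec hex
  exact ⟨L₀, h1, fun L' h' => h2 ▸ Nat.find_min' hex ⟨L', h', rfl⟩⟩

lemma IsMinCover.perm {L L' : List (List V)} (h : G.IsMinCover K I L) (p : L.Perm L') :
    G.IsMinCover K I L' :=
  ⟨⟨p.flatten.nodup_iff.mp h.nodup, fun v => p.flatten.mem_iff.mp (h.mem v),
    fun l hl => h.good l (p.mem_iff.mpr hl)⟩, fun L₀ h₀ => p.length_eq ▸ h.le L₀ h₀⟩

/-- This is the only use of minimality: rearranging several parts into one would lower the number of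
parts. All exchange arguments below end here. -/
lemma IsMinCover.not_merge {M L : List (List V)} (h : G.IsMinCover K I (M ++ L))
    (hM : 2 ≤ M.length) {l : List V} (p : l.Perm M.flatten) :
    ¬ (G.IsRing K I l ∨ G.IsRod K I l) := by
  intro hl
  have p' : (l :: L).flatten.Perm (M ++ L).flatten := by
    rw [List.flatten_cons, List.flatten_append]
    exact p.append_right _
  have := h.le (l :: L) ⟨p'.nodup_iff.mpr h.nodup, fun v => p'.mem_iff.mpr (h.mem v), fun l' hl' => by
    rcases List.mem_cons.mp hl' with rfl | hl'
    · exact hl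
    · exact h.good l' (List.mem_append_right _ hl')⟩
  simp only [List.length_append, List.length_cons] at this
  omega

lemma IsMinCover.not_merge_two {L : List (List V)} (h : G.IsMinCover K I L) {l₁ l₂ l : List V}
    (h₁ : l₁ ∈ L) (h₂ : l₂ ∈ L) (h12 : l₁ ≠ l₂) (p : l.Perm (l₁ ++ l₂)) :
    ¬ (G.IsRing K I l ∨ G.IsRod K I l) := by
  classical
  have e1 := List.perm_cons_erase h₁
  have e2 := List.perm_cons_erase ((List.mem_erase_of_ne h12.symm).mpr h₂)
  exact (h.perm (e1.trans (e2.cons _))).not_merge (M := [l₁, l₂]) (by simp) (by simpa using p)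

lemma IsMinCover.not_merge_three {L : List (List V)} (h : G.IsMinCover K I L) {l₁ l₂ l₃ l : List V}
    (h₁ : l₁ ∈ L) (h₂ : l₂ ∈ L) (h₃ : l₃ ∈ L) (h12 : l₁ ≠ l₂) (h13 : l₁ ≠ l₃) (h23 : l₂ ≠ l₃)
    (p : l.Perm (l₁ ++ l₂ ++ l₃)) :
    ¬ (G.IsRing K I l ∨ G.IsRod K I l) := by
  classical
  have e1 := List.perm_cons_erase h₁
  have e2 := List.perm_cons_erase ((List.mem_erase_of_ne h12.symm).mpr h₂)
  have e3 := List.perm_cons_erase ((List.mem_erase_of_ne h23.symm).mpr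
    ((List.mem_erase_of_ne h13.symm).mpr h₃))
  exact (h.perm (e1.trans ((e2.trans (e3.cons _)).cons _))).not_merge (M := [l₁, l₂, l₃]) (by simp)
    (by simpa using p)

lemma IsCover.ne_nil {L : List (List V)} (h : G.IsCover K I L) {l : List V} (hl : l ∈ L) :
    l ≠ [] := by
  rintro rfl
  rcases h.good [] hl with ⟨a, b, l', hp, -, -, h3⟩ | ⟨a, b, l', hp, hs, -⟩
  · rw [hp.eq_nil] at h3
    simp at h3
  · exact hs.ne_nil hp.eq_nil

lemma IsCover.disjoint {L : List (List V)} (h : G.IsCover K I L) {l₁ l₂ : List V} (h₁ : l₁ ∈ L)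
    (h₂ : l₂ ∈ L) (h12 : l₁ ≠ l₂) : l₁.Disjoint l₂ := by
  have : Std.Symm (List.Disjoint (α := V)) := ⟨fun _ _ h => h.symm⟩
  exact (List.nodup_flatten.mp h.nodup).2.forall h₁ h₂ h12

lemma IsCover.nodup_of_mem {L : List (List V)} (h : G.IsCover K I L) {l : List V} (hl : l ∈ L) :
    l.Nodup := (List.nodup_flatten.mp h.nodup).1 l hl

lemma IsRing.exists_open {l : List V} (h : G.IsRing K I l) {x : V} (hx : x ∈ l) (hn : l.Nodup) :
    ∃ t a b, (x :: t).Perm l ∧ Seg (G.crossAdj K I) a b t ∧ G.crossAdj K I x a ∧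
      G.crossAdj K I b x ∧ a ≠ b := by
  obtain ⟨a, b, l', hp, hs, hba, h3⟩ := h
  obtain ⟨t, y, hp', ht, hyx⟩ := hs.rotate hba (hp.mem_iff.mpr hx)
  have h2 : 2 ≤ t.length := by
    have := hp'.length_eq
    simp only [List.length_cons] at this
    omega
  obtain ⟨z, hz, hxz⟩ := ht.tail (by rintro rfl; simp at h2)
  have hnt : (x :: t).Nodup := (hp'.trans hp).nodup_iff.mpr hn
  exact ⟨t, z, y, hp'.trans hp, hz, hxz, hyx, hz.head_ne_last (List.nodup_cons.mp hnt).2 h2⟩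

lemma IsRing.of_seg {l : List V} {a b : V} (hs : Seg (G.crossAdj K I) a b l)
    (hba : G.crossAdj K I b a) (h3 : 3 ≤ l.length) : G.IsRing K I l :=
  ⟨a, b, l, .refl _, hs, hba, h3⟩

lemma IsRod.of_seg {l : List V} {a b : V} (hs : Seg (G.looseAdj K I) a b l) (ha : a ∈ K)
    (hb : b ∈ K) : G.IsRod K I l := ⟨a, b, l, .refl _, hs, ha, hb⟩

lemma crossAdj.loose {a b : V} (h : G.crossAdj K I a b) : G.looseAdj K I a b := .inl h

lemma crossAdj.of_adj_symm {g u : V} (hg : g ∈ K) (hu : u ∈ I) (hgu : G.Adj g u) :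
    G.crossAdj K I u g := (crossAdj_of_mem hg hu hgu).symm

/-- The end of a rod has no neighbour on a ring of a minimal cover. -/
lemma IsMinCover.not_adj_end {L : List (List V)} (h : G.IsMinCover K I L) (hf : G.SplitFacts K I)
    {C Q q : List V} (hC : C ∈ L) (hQ : Q ∈ L) (hCQ : C ≠ Q) (hr : G.IsRing K I C) {a b : V}
    (hq : q.Perm Q) (hs : Seg (G.looseAdj K I) a b q) (ha : a ∈ K) (hb : b ∈ K) {u : V} (hu : u ∈ C)
    (huI : u ∈ I) : ¬ G.Adj a u := by
  intro hau
  obtain ⟨t, c, d, hp, ht, huc, hdu, -⟩ := hr.exists_open hu (h.nodup_of_mem hC)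
  have hR := fun x y => looseAdj.symm (G := G) (K := K) (I := I) (a := x) (b := y)
  -- The ring opened at `u` is traversed so that it ends in `u`, and the rod is attached there. The
  -- free end `d` is a ring neighbour of `u`, hence in `K`.
  have s1 := ((ht.mono fun _ _ => crossAdj.loose).cons huc.loose).reverse hR
  have s2 := s1.append hs (crossAdj.of_adj_symm ha huI hau).loose
  refine h.not_merge_two hC hQ hCQ (l := (u :: t).reverse ++ q) ?_ (.inr (.of_seg s2
    (hf.mem_left hdu huI) hb))
  exact ((List.reverse_perm _).trans hp).append hq

end SimpleGraph

/-! ### A minimal cover with a rod next to a ring -/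

namespace SimpleGraph

variable {V : Type*} {G : SimpleGraph V} {K I : Finset V}

lemma looseAdj.of_clique {a b : V} (ha : a ∈ K) (hb : b ∈ K) : G.looseAdj K I a b := .inr ⟨ha, hb⟩

/-- A ring `u, …, c` and a rod `l₁, v, l₂` with `v` adjacent to `u`, which cannot be merged into
one rod. -/
structure RodConfig (G : SimpleGraph V) (K I : Finset V) (u c c' : V) (t : List V) (a b v : V)
    (l₁ l₂ : List V) : Prop where
  facts : G.SplitFacts K I
  ring : Seg (G.crossAdj K I) c c' t
  adj_first : G.crossAdj K I u c
  adj_last : G.crossAdj K I c' u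
  mem_u : u ∈ I
  rod : Seg (G.looseAdj K I) a b (l₁ ++ v :: l₂)
  mem_a : a ∈ K
  mem_b : b ∈ K
  mem_v : v ∈ K
  adj : G.crossAdj K I u v
  nodup : ((u :: t) ++ (l₁ ++ v :: l₂)).Nodup
  merge : ∀ x y l, l.Perm ((u :: t) ++ (l₁ ++ v :: l₂)) → Seg (G.looseAdj K I) x y l → x ∈ K →
    y ∈ K → False

namespace RodConfig

variable {u c c' : V} {t : List V} {a b v : V} {l₁ l₂ : List V}

lemma flip (h : RodConfig G K I u c c' t a b v l₁ l₂) :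
    RodConfig G K I u c c' t b a v l₂.reverse l₁.reverse := by
  have e : l₂.reverse ++ v :: l₁.reverse = (l₁ ++ v :: l₂).reverse := by simp
  refine ⟨h.facts, h.ring, h.adj_first, h.adj_last, h.mem_u, ?_, h.mem_b, h.mem_a, h.mem_v, h.adj, ?_,
    ?_⟩
  · rw [e]
    exact h.rod.reverse fun x y => looseAdj.symm
  · rw [e]
    exact ((List.reverse_perm _).append_left _).nodup_iff.mpr h.nodup
  · intro x y l hp
    rw [e] at hp
    exact h.merge x y l (hp.trans ((List.reverse_perm _).append_left _))

lemma mem_c (h : RodConfig G K I u c c' t a b v l₁ l₂) : c ∈ K := h.facts.mem_right h.adj_first h.mem_u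

lemma mem_c' (h : RodConfig G K I u c c' t a b v l₁ l₂) : c' ∈ K := h.facts.mem_left h.adj_last h.mem_u

lemma ringL (h : RodConfig G K I u c c' t a b v l₁ l₂) : Seg (G.looseAdj K I) c c' t :=
  h.ring.mono fun _ _ => crossAdj.loose

/-- If `v` is the first vertex of the rod, or its predecessor is in `K`, the ring opened at `u` can
be inserted right before `v`, using a clique step from the predecessor to `c'` in the second case.
-/
lemma left (h : RodConfig G K I u c c' t a b v l₁ l₂) :
    ∃ w ∈ I, Seg (G.looseAdj K I) a w l₁ ∧ G.crossAdj K I w v := by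
  classical
  have hR := fun x y => looseAdj.symm (G := G) (K := K) (I := I) (a := x) (b := y)
  by_cases h1 : l₁ = []
  · exfalso
    subst h1
    have e := h.rod.2.1
    simp only [List.nil_append, List.head?_cons, Option.some.injEq] at e
    subst e
    refine h.merge _ _ ((u :: t).reverse ++ v :: l₂) ?_
      (((h.ringL.cons h.adj_first.loose).reverse hR).append h.rod h.adj.loose) h.mem_c' h.mem_b
    exact (List.reverse_perm _).append_right _
  · obtain ⟨w, x, s1, s2, hwx⟩ := h.rod.split h1 (by simp)
    have e := s2.2.1
    simp only [List.head?_cons, Option.some.injEq] at e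
    subst e
    rcases h.facts.cover w with hw | hw
    · exfalso
      refine h.merge _ _ (l₁ ++ ((u :: t).reverse ++ v :: l₂)) ?_ (s1.append
        (((h.ringL.cons h.adj_first.loose).reverse hR).append s2 h.adj.loose)
        (.of_clique hw h.mem_c')) h.mem_a h.mem_b
      simp only [List.perm_iff_count, List.count_append, List.count_reverse]
      intro; omega
    · refine ⟨w, hw, s1, hwx.resolve_right fun e => h.facts.notMem w e.1 hw⟩

end RodConfig

lemma isChain_cross_of_loose {l : List V} (hl : l.IsChain (G.looseAdj K I))
    (h : ∀ p q r s, l = p ++ [q] ++ ([r] ++ s) → q ∈ K → r ∈ K → False) :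
    l.IsChain (G.crossAdj K I) := by
  rw [List.isChain_iff_forall_rel_of_append_cons_cons] at hl ⊢
  intro a b p q e
  exact (hl e).resolve_right fun hab => h p a b q (by simp [e]) hab.1 hab.2

namespace RodConfig

variable {u c c' : V} {t : List V} {a b v : V} {l₁ l₂ : List V}

lemma hit (h : RodConfig G K I u c c' t a b v l₁ l₂) {w w' : V} (hw : w ∈ I) (hw' : w' ∈ I)
    (hwv : G.crossAdj K I w v) (hwv' : G.crossAdj K I v w') (m : w ∈ l₁) (m' : w' ∈ l₂) (g : V)
    (hg : g ∈ K) : G.Adj g u ∨ G.Adj g w ∨ G.Adj g w' := by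
  have hn := h.nodup
  simp only [List.nodup_append, List.nodup_cons, List.mem_append, List.mem_cons] at hn
  refine h.facts.hit v h.mem_v u h.mem_u w hw w' hw' h.adj.1.symm hwv.1.symm hwv'.1 ?_ ?_ ?_ g hg
  · exact hn.2.2 _ (.inl rfl) _ (.inl m)
  · exact hn.2.2 _ (.inl rfl) _ (.inr (.inr m'))
  · exact hn.2.1.2.2 _ m _ (.inr m')

/-- A step inside the clique on the rod before `v` would be a place where the rod can be cut and
reassembled together with the ring. -/
lemma left_cross (h : RodConfig G K I u c c' t a b v l₁ l₂) :
    ∃ w ∈ I, Seg (G.crossAdj K I) a w l₁ ∧ G.crossAdj K I w v := by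
  classical
  have hR := fun x y => looseAdj.symm (G := G) (K := K) (I := I) (a := x) (b := y)
  obtain ⟨w, hw, s1, hwv⟩ := h.left
  obtain ⟨w', hw', s2, hwv'⟩ := h.flip.left
  replace s2 := s2.reverse hR
  rw [List.reverse_reverse] at s2
  refine ⟨w, hw, ⟨isChain_cross_of_loose s1.1 ?_, s1.2⟩, hwv⟩
  intro p q r s e hq hr
  have hX : ∃ z y, Seg (G.looseAdj K I) a z (p ++ [q]) ∧ Seg (G.looseAdj K I) y w ([r] ++ s) ∧
      z = q ∧ y = r := by
    rw [e] at s1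
    obtain ⟨z, y, t1, t2, -⟩ := s1.split (by simp) (by simp)
    refine ⟨z, y, t1, t2, ?_, ?_⟩
    · simpa using t1.2.2.symm
    · simpa using t2.2.1.symm
  obtain ⟨z, y, t1, t2, rfl, rfl⟩ := hX
  have hC := h.ringL.cons h.adj_first.loose
  have hv2 := s2.cons hwv'.symm.loose
  -- The clique vertex `z` before such a step `z, y` sees `u`, `w` or `w'`. The three merged rods
  -- are `a…z u…c' y…w v…b`, then `a…z w…y c'…u v…b`, and `a…z w'…b y…w v u…c'`.
  rcases h.hit hw hw' hwv hwv'.symm s1.last_mem s2.head_mem z hq with e1 | e1 | e1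
  · refine h.merge _ _ ((p ++ [z]) ++ ((u :: t) ++ (([y] ++ s) ++ (v :: l₂)))) ?_
      (t1.append (hC.append (t2.append hv2 hwv.loose) (.of_clique h.mem_c' hr))
        (crossAdj_of_mem hq h.mem_u e1).loose) h.mem_a h.mem_b
    rw [e]
    simp only [List.perm_iff_count, List.count_append]
    intro; omega
  · refine h.merge _ _ ((p ++ [z]) ++ (([y] ++ s).reverse ++ ((u :: t).reverse ++ (v :: l₂)))) ?_
      (t1.append ((t2.reverse hR).append ((hC.reverse hR).append hv2 h.adj.loose)
        (.of_clique hr h.mem_c')) (crossAdj_of_mem hq hw e1).loose) h.mem_a h.mem_b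
    rw [e]
    simp only [List.perm_iff_count, List.count_append, List.count_reverse]
    intro; omega
  · refine h.merge _ _ ((p ++ [z]) ++ (l₂ ++ (([y] ++ s) ++ ([v] ++ (u :: t))))) ?_
      (t1.append (s2.append (t2.append (hC.cons h.adj.symm.loose) hwv.loose)
        (.of_clique h.mem_b hr)) (crossAdj_of_mem hq hw' e1).loose) h.mem_a h.mem_c'
    rw [e, ← List.singleton_append (x := v) (l := l₂)]
    simp only [List.perm_iff_count, List.count_append]
    intro; omega

/-- Otherwise `c'…u v w'…b w…a` is a merged rod. -/
lemma not_adj_end_left (h : RodConfig G K I u c c' t a b v l₁ l₂) {w : V} (hw : w ∈ I)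
    (s1 : Seg (G.looseAdj K I) a w l₁) {w' : V}
    (s2 : Seg (G.looseAdj K I) w' b l₂) (hwv' : G.crossAdj K I v w') : ¬ G.Adj b w := by
  classical
  have hR := fun x y => looseAdj.symm (G := G) (K := K) (I := I) (a := x) (b := y)
  intro hbw
  have hC := h.ringL.cons h.adj_first.loose
  refine h.merge _ _ ((u :: t).reverse ++ ([v] ++ (l₂ ++ l₁.reverse))) ?_ ((hC.reverse hR).append
    ((s2.append (s1.reverse hR) (crossAdj_of_mem h.mem_b hw hbw).loose).cons hwv'.loose) h.adj.loose)
    h.mem_c' h.mem_a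
  rw [← List.singleton_append (x := v) (l := l₂)]
  simp only [List.perm_iff_count, List.count_append, List.count_reverse]
  intro; omega

/-- Since `b` is adjacent to `w'`, the part `l₂` is a closed chain and can be opened at `y`. An edge
from `a` to `y` would give the merged rod `c'…u v w…a y…d`. -/
lemma not_adj_end_right (h : RodConfig G K I u c c' t a b v l₁ l₂) {w : V}
    (s1 : Seg (G.crossAdj K I) a w l₁) (hwv : G.crossAdj K I w v) {w' : V}
    (s2 : Seg (G.crossAdj K I) w' b l₂) (hb : G.crossAdj K I b w') {y : V} (hy : y ∈ l₂)
    (hyI : y ∈ I) : ¬ G.Adj a y := by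
  classical
  have hR := fun x y => looseAdj.symm (G := G) (K := K) (I := I) (a := x) (b := y)
  intro hay
  have hC := h.ringL.cons h.adj_first.loose
  obtain ⟨r, d, hp, sr, hd⟩ := s2.rotate hb hy
  replace s1 := (s1.mono fun _ _ => crossAdj.loose).reverse hR
  replace sr := sr.mono fun _ _ => crossAdj.loose
  refine h.merge _ _ ((u :: t).reverse ++ ([v] ++ (l₁.reverse ++ (y :: r)))) ?_ ((hC.reverse hR).append
    ((s1.append sr (crossAdj_of_mem h.mem_a hyI hay).loose).cons hwv.symm.loose) h.adj.loose)
    h.mem_c' (h.facts.mem_left hd hyI)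
  rw [← List.singleton_append (x := v) (l := l₂)]
  rw [List.perm_iff_count] at hp
  simp only [List.perm_iff_count, List.count_append, List.count_reverse]
  intro x
  have := hp x
  omega

end RodConfig

/-- An alternating chain starting in the independent set is short, or some vertex has two
neighbours on it apart from the first vertex. -/
lemma SplitFacts.short_or_exists (h : G.SplitFacts K I) {x y : V} {t : List V}
    (hs : Seg (G.crossAdj K I) x y (x :: t)) (hx : x ∈ I) (hn : (x :: t).Nodup) :
    (∃ z, ∀ i ∈ x :: t, i ∈ I → i = x ∨ i = z) ∨
      ∃ g ∈ K, ∃ z ∈ t, ∃ z' ∈ t, z ∈ I ∧ z' ∈ I ∧ z ≠ z' ∧ G.Adj g z ∧ G.Adj g z' := by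
  have hch := hs.1
  match t, hch, hn with
  | [], _, _ => exact .inl ⟨x, by simp⟩
  | [a], hch, _ =>
    simp only [List.isChain_cons_cons] at hch
    have := h.notMem _ (h.mem_right hch.1 hx)
    refine .inl ⟨x, ?_⟩
    rintro i hi hiI
    simp only [List.mem_cons, List.not_mem_nil, or_false] at hi
    rcases hi with rfl | rfl
    exacts [.inl rfl, absurd hiI this]
  | [a, b], hch, _ =>
    simp only [List.isChain_cons_cons] at hch
    have := h.notMem _ (h.mem_right hch.1 hx)
    refine .inl ⟨b, ?_⟩
    rintro i hi hiI
    simp only [List.mem_cons, List.not_mem_nil, or_false] at hi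
    rcases hi with rfl | rfl | rfl
    exacts [.inl rfl, absurd hiI this, .inr rfl]
  | [a, b, c], hch, _ =>
    simp only [List.isChain_cons_cons] at hch
    have h1 := h.mem_right hch.1 hx
    have h2 := h.mem_right' hch.2.1 h1
    have h3 := h.notMem _ (h.mem_right hch.2.2.1 h2)
    replace h1 := h.notMem _ h1
    refine .inl ⟨b, ?_⟩
    rintro i hi hiI
    simp only [List.mem_cons, List.not_mem_nil, or_false] at hi
    rcases hi with rfl | rfl | rfl | rfl
    exacts [.inl rfl, absurd hiI h1, .inr rfl, absurd hiI h3]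
  | a :: b :: c :: d :: r, hch, hn =>
    simp only [List.isChain_cons_cons] at hch
    have h1 := h.mem_right hch.1 hx
    have h2 := h.mem_right' hch.2.1 h1
    have h3 := h.mem_right hch.2.2.1 h2
    have h4 := h.mem_right' hch.2.2.2.1 h3
    -- The clique vertex `c` lies between `b` and `d`, both different from the first vertex.
    refine .inr ⟨c, h3, b, by simp, d, by simp, h2, h4, ?_, hch.2.2.1.1.symm, hch.2.2.2.1.1⟩
    rintro rfl
    simp at hn

end SimpleGraph

/-! ### Rods are not adjacent to rings. -/

namespace SimpleGraph

variable {V : Type*} {G : SimpleGraph V} {K I : Finset V}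

/-- In a minimal cover, no clique vertex of a rod has a neighbour on a ring. -/
lemma IsMinCover.not_adj_rod {L : List (List V)} (h : G.IsMinCover K I L) (hf : G.SplitFacts K I)
    {C Q : List V} (hC : C ∈ L) (hQ : Q ∈ L) (hCQ : C ≠ Q) (hr : G.IsRing K I C)
    (hq : G.IsRod K I Q) {u v : V} (hu : u ∈ C) (huI : u ∈ I) (hv : v ∈ Q) (hvK : v ∈ K) :
    ¬ G.Adj v u := by
  classical
  intro hvu
  have hR := fun x y => looseAdj.symm (G := G) (K := K) (I := I) (a := x) (b := y)
  have hB := fun x y => crossAdj.symm (G := G) (K := K) (I := I) (a := x) (b := y)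
  obtain ⟨t, c, c', hpC, hring, huc, hcu, -⟩ := hr.exists_open hu (h.nodup_of_mem hC)
  obtain ⟨a, b, q, hpQ, hrod, ha, hb⟩ := hq
  obtain ⟨l₁, l₂, rfl⟩ := List.append_of_mem (hpQ.mem_iff.mpr hv)
  have hp : ((u :: t) ++ (l₁ ++ v :: l₂)).Perm (C ++ Q) := hpC.append hpQ
  have cfg : RodConfig G K I u c c' t a b v l₁ l₂ := by
    refine ⟨hf, hring, huc, hcu, huI, hrod, ha, hb, hvK, crossAdj.of_adj_symm hvK huI hvu, ?_, ?_⟩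
    · rw [hp.nodup_iff, List.nodup_append]
      exact ⟨h.nodup_of_mem hC, h.nodup_of_mem hQ, fun x hx y hy e =>
        h.disjoint hC hQ hCQ hx (e ▸ hy)⟩
    · exact fun x y l hl hs hx hy => h.not_merge_two hC hQ hCQ (hl.trans hp) (.inr (.of_seg hs hx hy))
  obtain ⟨w₁, hw₁, s₁, hv₁⟩ := cfg.left_cross
  obtain ⟨w₂, hw₂, s₂', hv₂⟩ := cfg.flip.left_cross
  have s₂ := s₂'.reverse hB
  rw [List.reverse_reverse] at s₂
  have hhit := cfg.hit hw₁ hw₂ hv₁ hv₂.symm s₁.last_mem s₂.head_mem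
  have hrev : (l₁ ++ v :: l₂).reverse.Perm Q := (List.reverse_perm _).trans hpQ
  have hrodr := hrod.reverse hR
  -- Two rods could be joined by a clique step between their ends.
  have hother : ∀ S ∈ L, S ≠ Q → G.IsRing K I S := fun S hS hSQ => by
    refine (h.good S hS).resolve_right ?_
    rintro ⟨x, y, l, hl, hs, hx, hy⟩
    exact h.not_merge_two hS hQ hSQ (hl.append hpQ) (.inr (.of_seg
      (hs.append hrod (.of_clique hy ha)) hx hb))
  have hnu : ∀ k ∈ K, k = a ∨ k = b → ¬ G.Adj k u := by
    rintro k - (rfl | rfl)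
    exacts [h.not_adj_end hf hC hQ hCQ hr hpQ hrod ha hb hu huI,
      h.not_adj_end hf hC hQ hCQ hr hrev hrodr hb ha hu huI]
  -- Of the three vertices `u`, `w₁`, `w₂` the end `b` can see only `w₂`, and likewise `a` only
  -- `w₁`. So both halves of the rod close up to alternating chains.
  have hb2 : G.Adj b w₂ := by
    rcases hhit b hb with e | e | e
    · exact absurd e (hnu b hb (.inr rfl))
    · exact absurd e (cfg.not_adj_end_left hw₁ (s₁.mono fun _ _ => crossAdj.loose)
        (s₂.mono fun _ _ => crossAdj.loose) hv₂.symm)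
    · exact e
  have ha1 : G.Adj a w₁ := by
    rcases hhit a ha with e | e | e
    · exact absurd e (hnu a ha (.inl rfl))
    · exact e
    · exact absurd e (cfg.flip.not_adj_end_left hw₂ (s₂'.mono fun _ _ => crossAdj.loose)
        ((s₁.reverse hB).mono fun _ _ => crossAdj.loose) hv₁.symm)
  -- Thus the neighbours of `a` in `I` are confined to the first half of the rod, and those of `b`
  -- to the second.
  have hA : ∀ x ∈ I, G.Adj a x → x ∈ l₁ := by
    intro x hx hax
    obtain ⟨S, hS, hxS⟩ := List.mem_flatten.mp (h.mem x)
    by_cases hSQ : S = Q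
    · subst hSQ
      have := hpQ.mem_iff.mpr hxS
      simp only [List.mem_append, List.mem_cons] at this
      rcases this with e | e | e
      · exact e
      · exact absurd hx (hf.notMem _ (e ▸ hvK))
      · exact absurd hax (cfg.not_adj_end_right s₁ hv₁ s₂ (crossAdj_of_mem hb hw₂ hb2) e hx)
    · exact absurd hax (h.not_adj_end hf hS hQ hSQ (hother S hS hSQ) hpQ hrod ha hb hxS hx)
  have hBe : ∀ x ∈ I, G.Adj b x → x ∈ l₂ := by
    intro x hx hbx
    obtain ⟨S, hS, hxS⟩ := List.mem_flatten.mp (h.mem x)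
    by_cases hSQ : S = Q
    · subst hSQ
      have := hpQ.mem_iff.mpr hxS
      simp only [List.mem_append, List.mem_cons] at this
      rcases this with e | e | e
      · exact absurd hbx (cfg.flip.not_adj_end_right s₂' hv₂ (s₁.reverse hB)
          (crossAdj_of_mem ha hw₁ ha1) (List.mem_reverse.mpr e) hx)
      · exact absurd hx (hf.notMem _ (e ▸ hvK))
      · exact e
    · exact absurd hbx (h.not_adj_end hf hS hQ hSQ (hother S hS hSQ) hrev hrodr hb ha hxS hx)
  have hn := cfg.nodup
  simp only [List.nodup_append, List.nodup_cons, List.mem_append, List.mem_cons] at hn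
  have hl12 : ∀ x ∈ l₁, x ∉ l₂ := fun x h1 h2 => hn.2.1.2.2 x h1 x (.inr h2) rfl
  have hCl : ∀ x, x = u ∨ x ∈ t → x ∉ l₁ ∧ x ∉ l₂ := fun x hx =>
    ⟨fun e => hn.2.2 x hx x (.inl e) rfl, fun e => hn.2.2 x hx x (.inr (.inr e)) rfl⟩
  -- the second neighbour of `c` on the ring
  obtain ⟨u', hu', hu'I, huu', hcu'⟩ : ∃ u' ∈ t, u' ∈ I ∧ u' ≠ u ∧ G.Adj c u' := by
    obtain ⟨t', rfl⟩ := hring.exists_cons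
    have ht' : t' ≠ [] := by
      rintro rfl
      obtain ⟨x, y, l, hl, -, -, h3⟩ := hr
      have e2 := hpC.length_eq
      have e3 := hl.length_eq
      simp at e2
      omega
    obtain ⟨y, hy, hcy⟩ := hring.tail ht'
    refine ⟨y, by simp [hy.head_mem], hf.mem_right' hcy cfg.mem_c, ?_, hcy.1⟩
    rintro rfl
    exact hn.1.1 (by simp [hy.head_mem])
  have hcK := cfg.mem_c
  -- A clique vertex `g` also sees some `p` among `u`, `w₁`, `w₂`, so every clique vertex is
  -- adjacent to `z`, `z'` or `p`. For `a` and `b` this puts a member of the triple into each half.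
  -- If `z` and `z'` lie in one half, `p` lies in the other, and then `c` sees none of the three; if
  -- they lie outside both, `p` would be in both halves.
  have hkey : ∀ g ∈ K, ∀ z ∈ I, ∀ z' ∈ I, G.Adj g z → G.Adj g z' → z ≠ z' →
      z ∉ ({u, w₁, w₂} : Set V) → z' ∉ ({u, w₁, w₂} : Set V) →
      (z ∈ l₁ ∧ z' ∈ l₁ ∨ z ∈ l₂ ∧ z' ∈ l₂ ∨ z ∉ l₁ ∧ z' ∉ l₁ ∧ z ∉ l₂ ∧ z' ∉ l₂) → False := by
    intro g hg z hz z' hz' gz gz' hzz h1 h2 hpart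
    obtain ⟨p, hpu, hpI, hgp⟩ : ∃ p ∈ ({u, w₁, w₂} : Set V), p ∈ I ∧ G.Adj g p := by
      rcases hhit g hg with e | e | e
      exacts [⟨u, by simp, huI, e⟩, ⟨w₁, by simp, hw₁, e⟩, ⟨w₂, by simp, hw₂, e⟩]
    have hT := hf.hit g hg z hz z' hz' p hpI gz gz' hgp hzz (fun e => h1 (e ▸ hpu))
      (fun e => h2 (e ▸ hpu))
    have i1 : z ∈ l₁ ∨ z' ∈ l₁ ∨ p ∈ l₁ :=
      (hT a ha).imp (hA z hz) (Or.imp (hA z' hz') (hA p hpI))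
    have i2 : z ∈ l₂ ∨ z' ∈ l₂ ∨ p ∈ l₂ :=
      (hT b hb).imp (hBe z hz) (Or.imp (hBe z' hz') (hBe p hpI))
    -- The ring neighbours `u`, `u'` of `c` are invisible to `a` and `b`. With a third neighbour `y`
    -- of `c`, both would have to see `y`, placing it in both halves.
    have i3 : ∀ y ∈ I, y ∈ l₁ ∨ y ∈ l₂ → ¬ G.Adj c y := by
      intro y hy hyl hcy
      have n1 := hCl u (.inl rfl)
      have n2 := hCl u' (.inr hu')
      have hT := hf.hit c hcK u huI u' hu'I y hy huc.1.symm hcu' hcy huu'.symm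
        (fun e => hyl.elim (e ▸ n1.1) (e ▸ n1.2)) (fun e => hyl.elim (e ▸ n2.1) (e ▸ n2.2))
      have j1 := (hT a ha).imp (hA u huI) (Or.imp (hA u' hu'I) (hA y hy))
      have j2 := (hT b hb).imp (hBe u huI) (Or.imp (hBe u' hu'I) (hBe y hy))
      exact hl12 y ((j1.resolve_left n1.1).resolve_left n2.1) ((j2.resolve_left n1.2).resolve_left n2.2)
    have m1 := hl12 z
    have m2 := hl12 z'
    have m3 := hl12 p
    have hc := hT c hcK
    have n1 := i3 z hz
    have n2 := i3 z' hz'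
    have n3 := i3 p hpI
    rcases hpart with ⟨e, e'⟩ | ⟨e, e'⟩ | ⟨e1, e2, e3, e4⟩
    · have hp2 := (i2.resolve_left (m1 e)).resolve_left (m2 e')
      exact hc.elim (n1 (.inl e)) (Or.elim · (n2 (.inl e')) (n3 (.inr hp2)))
    · have hp1 := (i1.resolve_left fun x => m1 x e).resolve_left fun x => m2 x e'
      exact hc.elim (n1 (.inr e)) (Or.elim · (n2 (.inr e')) (n3 (.inl hp1)))
    · exact m3 ((i1.resolve_left e1).resolve_left e2) ((i2.resolve_left e3).resolve_left e4)
  -- On any further ring, a clique vertex with its two ring neighbours contradicts `hkey`.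
  have honly : ∀ x ∈ I, x ∈ u :: t ∨ x ∈ l₁ ∨ x ∈ l₂ := by
    intro x hx
    obtain ⟨S, hS, hxS⟩ := List.mem_flatten.mp (h.mem x)
    by_cases hSQ : S = Q
    · subst hSQ
      have := hpQ.mem_iff.mpr hxS
      simp only [List.mem_append, List.mem_cons] at this
      rcases this with e | e | e
      · exact .inr (.inl e)
      · exact absurd hx (hf.notMem _ (e ▸ hvK))
      · exact .inr (.inr e)
    by_cases hSC : S = C
    · subst hSC
      exact .inl (hpC.mem_iff.mpr hxS)
    exfalso
    have hSr := hother S hS hSQ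
    obtain ⟨g, hgS, hgK⟩ : ∃ g ∈ S, g ∈ K := by
      obtain ⟨r, k, k', hpS, sk, hxk, -, -⟩ := hSr.exists_open hxS (h.nodup_of_mem hS)
      exact ⟨k, hpS.subset (by simp [sk.head_mem]), hf.mem_right hxk hx⟩
    obtain ⟨r, z, z', hpS, sz, hgz, hzg, hzz⟩ := hSr.exists_open hgS (h.nodup_of_mem hS)
    have mz : ∀ y, y ∈ r → y ≠ u ∧ y ∉ l₁ ∧ y ∉ l₂ := by
      intro y hy
      have hyS := hpS.subset (List.mem_cons_of_mem _ hy)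
      refine ⟨fun e => h.disjoint hS hC hSC hyS (e ▸ hu), fun e => ?_, fun e => ?_⟩
      · exact h.disjoint hS hQ hSQ hyS (hpQ.subset (by simp [e]))
      · exact h.disjoint hS hQ hSQ hyS (hpQ.subset (by simp [e]))
    obtain ⟨a1, a2, a3⟩ := mz z sz.head_mem
    obtain ⟨b1, b2, b3⟩ := mz z' sz.last_mem
    have m1 := s₁.last_mem
    have m2 := s₂.head_mem
    refine hkey g hgK z (hf.mem_right' hgz hgK) z' (hf.mem_left' hzg hgK) hgz.1 hzg.1.symm hzz ?_ ?_
      (.inr (.inr ⟨a2, b2, a3, b3⟩))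
    · simp only [Set.mem_insert_iff, Set.mem_singleton_iff, not_or]
      exact ⟨a1, fun e => a2 (e ▸ m1), fun e => a3 (e ▸ m2)⟩
    · simp only [Set.mem_insert_iff, Set.mem_singleton_iff, not_or]
      exact ⟨b1, fun e => b2 (e ▸ m1), fun e => b3 (e ▸ m2)⟩
  -- The ring and the two halves of the rod carry at most two vertices of `I` each: on a longer
  -- chain some clique vertex has two neighbours in it apart from `u`, `w₁` or `w₂`, against `hkey`.
  -- This leaves at most six vertices in `I`.
  have p0 : ∃ z, ∀ i ∈ u :: t, i ∈ I → i = u ∨ i = z := by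
    refine (hf.short_or_exists (hring.cons huc) huI (List.nodup_cons.mpr hn.1)).resolve_right ?_
    rintro ⟨g, hg, z, hz, z', hz', hzI, hzI', hzz, gz, gz'⟩
    have nz := hCl z (.inr hz)
    have nz' := hCl z' (.inr hz')
    refine hkey g hg z hzI z' hzI' gz gz' hzz ?_ ?_ (.inr (.inr ⟨nz.1, nz'.1, nz.2, nz'.2⟩))
    · simp only [Set.mem_insert_iff, Set.mem_singleton_iff, not_or]
      exact ⟨fun e => hn.1.1 (e ▸ hz), fun e => nz.1 (e ▸ s₁.last_mem), fun e => nz.2 (e ▸ s₂.head_mem)⟩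
    · simp only [Set.mem_insert_iff, Set.mem_singleton_iff, not_or]
      exact ⟨fun e => hn.1.1 (e ▸ hz'), fun e => nz'.1 (e ▸ s₁.last_mem),
        fun e => nz'.2 (e ▸ s₂.head_mem)⟩
  have p1 : ∃ z, ∀ i ∈ l₁, i ∈ I → i = w₁ ∨ i = z := by
    have sr := s₁.reverse hB
    have hnr : l₁.reverse.Nodup := List.nodup_reverse.mpr hn.2.1.1
    obtain ⟨r, hr1⟩ := sr.exists_cons
    rw [hr1] at sr hnr
    have mr : ∀ y ∈ r, y ∈ l₁ := fun y hy => List.mem_reverse.mp (by rw [hr1]; simp [hy])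
    refine ((hf.short_or_exists sr hw₁ hnr).resolve_right ?_).imp fun z hz i hi =>
      hz i (by rw [← hr1]; simpa using hi)
    rintro ⟨g, hg, z, hz, z', hz', hzI, hzI', hzz, gz, gz'⟩
    have hcl := hCl u (.inl rfl)
    refine hkey g hg z hzI z' hzI' gz gz' hzz ?_ ?_ (.inl ⟨mr z hz, mr z' hz'⟩)
    · simp only [Set.mem_insert_iff, Set.mem_singleton_iff, not_or]
      exact ⟨fun e => hcl.1 (e ▸ mr z hz), fun e => (List.nodup_cons.mp hnr).1 (e ▸ hz),
        fun e => hl12 z (mr z hz) (e ▸ s₂.head_mem)⟩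
    · simp only [Set.mem_insert_iff, Set.mem_singleton_iff, not_or]
      exact ⟨fun e => hcl.1 (e ▸ mr z' hz'), fun e => (List.nodup_cons.mp hnr).1 (e ▸ hz'),
        fun e => hl12 z' (mr z' hz') (e ▸ s₂.head_mem)⟩
  have p2 : ∃ z, ∀ i ∈ l₂, i ∈ I → i = w₂ ∨ i = z := by
    have hnr : l₂.Nodup := hn.2.1.2.1.2
    obtain ⟨r, hr1⟩ := s₂.exists_cons
    have sr := s₂
    rw [hr1] at sr hnr
    have mr : ∀ y ∈ r, y ∈ l₂ := fun y hy => by rw [hr1]; simp [hy]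
    refine ((hf.short_or_exists sr hw₂ hnr).resolve_right ?_).imp fun z hz i hi =>
      hz i (by rw [← hr1]; simpa using hi)
    rintro ⟨g, hg, z, hz, z', hz', hzI, hzI', hzz, gz, gz'⟩
    have hcl := hCl u (.inl rfl)
    refine hkey g hg z hzI z' hzI' gz gz' hzz ?_ ?_ (.inr (.inl ⟨mr z hz, mr z' hz'⟩))
    · simp only [Set.mem_insert_iff, Set.mem_singleton_iff, not_or]
      exact ⟨fun e => hcl.2 (e ▸ mr z hz), fun e => hl12 w₁ s₁.last_mem (e ▸ mr z hz),
        fun e => (List.nodup_cons.mp hnr).1 (e ▸ hz)⟩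
    · simp only [Set.mem_insert_iff, Set.mem_singleton_iff, not_or]
      exact ⟨fun e => hcl.2 (e ▸ mr z' hz'), fun e => hl12 w₁ s₁.last_mem (e ▸ mr z' hz'),
        fun e => (List.nodup_cons.mp hnr).1 (e ▸ hz')⟩
  obtain ⟨z₀, p0⟩ := p0
  obtain ⟨z₁, p1⟩ := p1
  obtain ⟨z₂, p2⟩ := p2
  have hsub : I ⊆ {u, z₀, w₁, z₁, w₂, z₂} := by
    intro x hx
    simp only [Finset.mem_insert, Finset.mem_singleton]
    rcases honly x hx with e | e | e
    · rcases p0 x e hx with e | e <;> simp [e]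
    · rcases p1 x e hx with e | e <;> simp [e]
    · rcases p2 x e hx with e | e <;> simp [e]
  have := (Finset.card_le_card hsub).trans Finset.card_le_six
  have := hf.eight_le
  omega

end SimpleGraph

/-! ### Two rings: the positions of the third neighbours -/

namespace SimpleGraph

variable {V : Type*} {G : SimpleGraph V} {K I : Finset V}

lemma SplitFacts.eq_of_adj (h : G.SplitFacts K I) {g a b e e' : V} (hg : g ∈ K) (ha : a ∈ I)
    (hb : b ∈ I) (he : e ∈ I) (he' : e' ∈ I) (ga : G.Adj g a) (gb : G.Adj g b) (ge : G.Adj g e)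
    (ge' : G.Adj g e') (hab : a ≠ b) (hea : e ≠ a) (heb : e ≠ b) (hea' : e' ≠ a) (heb' : e' ≠ b) :
    e = e' := by
  rcases h.four g hg a ha b hb e he e' he' ga gb ge ge' hab hea.symm heb.symm with h1 | h1 | h1
  exacts [absurd h1 hea', absurd h1 heb', h1.symm]

/-- Two rings `U 0, c 0, U 1, …, c (ℓ - 1)` and `v, x 0, q 0, x 1, …, x (s - 1)` with `v` adjacent to
`U 0` and `c i` adjacent to `x 0`, and the non-adjacencies that follow from the rings not being
mergeable. -/
structure TwoRings (G : SimpleGraph V) (K I : Finset V) (ℓ s i : ℕ) (U c x q : ℕ → V) (v : V) :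
    Prop where
  memU : ∀ j < ℓ, U j ∈ I
  memc : ∀ j < ℓ, c j ∈ K
  adjc : ∀ j < ℓ, G.Adj (c j) (U j)
  adjc' : ∀ j, j + 1 < ℓ → G.Adj (c j) (U (j + 1))
  closed : G.Adj (c (ℓ - 1)) (U 0)
  memx : ∀ j < s, x j ∈ I
  memq : ∀ j, j + 1 < s → q j ∈ K
  adjq : ∀ j, j + 1 < s → G.Adj (q j) (x j)
  adjq' : ∀ j, j + 1 < s → G.Adj (q j) (x (j + 1))
  memv : v ∈ K
  adjv : G.Adj v (x 0)
  adjv' : G.Adj v (x (s - 1))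
  adjU : G.Adj v (U 0)
  injU : ∀ j < ℓ, ∀ k < ℓ, U j = U k → j = k
  injx : ∀ j < s, ∀ k < s, x j = x k → j = k
  ne : ∀ j < ℓ, ∀ k < s, U j ≠ x k
  two_le : 2 ≤ s
  one_le : 1 ≤ i
  add_two_le : i + 2 ≤ ℓ
  adj : G.Adj (c i) (x 0)
  card_le : I.card ≤ ℓ + s
  first : ¬ G.Adj (c 0) (x 0)
  first' : ¬ G.Adj (c 0) (x (s - 1))
  last : ¬ G.Adj (c (ℓ - 1)) (x 0)
  last' : ¬ G.Adj (c (ℓ - 1)) (x (s - 1))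
  cross : ∀ j, 1 ≤ j → j + 2 ≤ ℓ → G.Adj (c j) (x 0) → ¬ G.Adj (c 0) (U (j + 1))
  cross' : ∀ j, 1 ≤ j → j + 2 ≤ ℓ → G.Adj (c j) (x 0) → ¬ G.Adj (c (ℓ - 1)) (U j)
  chord : ∀ j, 1 ≤ j → j + 1 < s → G.Adj (q j) (x 0) → ¬ G.Adj (c 0) (x j)
  chord' : ∀ j, 1 ≤ j → j + 1 < s → G.Adj (q j) (x 0) → ¬ G.Adj (c (ℓ - 1)) (x j)

namespace TwoRings

variable {ℓ s i : ℕ} {U c x q : ℕ → V} {v : V}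

lemma hit_v (h : TwoRings G K I ℓ s i U c x q v) (hf : G.SplitFacts K I) {g : V} (hg : g ∈ K) :
    G.Adj g (U 0) ∨ G.Adj g (x 0) ∨ G.Adj g (x (s - 1)) := by
  have h1 := h.add_two_le
  have h2 := h.two_le
  refine hf.hit v h.memv _ (h.memU 0 (by omega)) _ (h.memx 0 (by omega)) _ (h.memx (s - 1) (by omega))
    h.adjU h.adjv h.adjv' (h.ne _ (by omega) _ (by omega)) (h.ne _ (by omega) _ (by omega)) ?_ g hg
  intro e
  have := h.injx _ (by omega) _ (by omega) e
  omega

lemma hit_c (h : TwoRings G K I ℓ s i U c x q v) (hf : G.SplitFacts K I) {g : V} (hg : g ∈ K) {j : ℕ}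
    (hj : j + 1 < ℓ) {y : V} (hy : y ∈ I) (hj' : G.Adj (c j) y) (hyU : y ≠ U j)
    (hyU' : y ≠ U (j + 1)) : G.Adj g (U j) ∨ G.Adj g (U (j + 1)) ∨ G.Adj g y := by
  refine hf.hit (c j) (h.memc j (by omega)) _ (h.memU j (by omega)) _ (h.memU (j + 1) hj) _ hy
    (h.adjc j (by omega)) (h.adjc' j hj) hj' ?_ hyU.symm hyU'.symm g hg
  intro e
  have := h.injU _ (by omega) _ (by omega) e
  omega

/-- `c j` has the neighbours `U j` and `U (j + 1)` on its own ring, so it has at most one further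
neighbour in `I`. Most contradictions below exhibit two such further neighbours; `eq_last` and
`eq_q` are the versions for `c (ℓ - 1)` and for the other ring. -/
lemma eq_c (h : TwoRings G K I ℓ s i U c x q v) (hf : G.SplitFacts K I) {j : ℕ} (hj : j + 1 < ℓ)
    {e e' : V} (he : e ∈ I) (he' : e' ∈ I) (h1 : G.Adj (c j) e) (h2 : G.Adj (c j) e')
    (n1 : e ≠ U j) (n2 : e ≠ U (j + 1)) (n3 : e' ≠ U j) (n4 : e' ≠ U (j + 1)) : e = e' := by
  refine hf.eq_of_adj (h.memc j (by omega)) (h.memU j (by omega)) (h.memU (j + 1) hj) he he'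
    (h.adjc j (by omega)) (h.adjc' j hj) h1 h2 ?_ n1 n2 n3 n4
  intro e
  have := h.injU _ (by omega) _ (by omega) e
  omega

lemma eq_last (h : TwoRings G K I ℓ s i U c x q v) (hf : G.SplitFacts K I)
    {e e' : V} (he : e ∈ I) (he' : e' ∈ I) (h1 : G.Adj (c (ℓ - 1)) e) (h2 : G.Adj (c (ℓ - 1)) e')
    (n1 : e ≠ U (ℓ - 1)) (n2 : e ≠ U 0) (n3 : e' ≠ U (ℓ - 1)) (n4 : e' ≠ U 0) : e = e' := by
  have := h.add_two_le
  refine hf.eq_of_adj (h.memc (ℓ - 1) (by omega)) (h.memU (ℓ - 1) (by omega)) (h.memU 0 (by omega))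
    he he' (h.adjc (ℓ - 1) (by omega)) h.closed h1 h2 ?_ n1 n2 n3 n4
  intro e
  have := h.injU _ (by omega) _ (by omega) e
  omega

lemma eq_q (h : TwoRings G K I ℓ s i U c x q v) (hf : G.SplitFacts K I) {j : ℕ} (hj : j + 1 < s)
    {e e' : V} (he : e ∈ I) (he' : e' ∈ I) (h1 : G.Adj (q j) e) (h2 : G.Adj (q j) e')
    (n1 : e ≠ x j) (n2 : e ≠ x (j + 1)) (n3 : e' ≠ x j) (n4 : e' ≠ x (j + 1)) : e = e' := by
  refine hf.eq_of_adj (h.memq j hj) (h.memx j (by omega)) (h.memx (j + 1) hj) he he'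
    (h.adjq j hj) (h.adjq' j hj) h1 h2 ?_ n1 n2 n3 n4
  intro e
  have := h.injx _ (by omega) _ (by omega) e
  omega

lemma neU (h : TwoRings G K I ℓ s i U c x q v) {j k : ℕ} (hj : j < ℓ) (hk : k < ℓ) (hjk : j ≠ k) :
    U j ≠ U k := fun e => hjk (h.injU j hj k hk e)

lemma nex (h : TwoRings G K I ℓ s i U c x q v) {j k : ℕ} (hj : j < s) (hk : k < s) (hjk : j ≠ k) :
    x j ≠ x k := fun e => hjk (h.injx j hj k hk e)

lemma hit_i (h : TwoRings G K I ℓ s i U c x q v) (hf : G.SplitFacts K I) {g : V} (hg : g ∈ K) :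
    G.Adj g (U i) ∨ G.Adj g (U (i + 1)) ∨ G.Adj g (x 0) := by
  have h1 := h.add_two_le
  have h2 := h.two_le
  exact h.hit_c hf hg (by omega) (h.memx 0 (by omega)) h.adj (h.ne _ (by omega) _ (by omega)).symm
    (h.ne _ (by omega) _ (by omega)).symm

/-- The triples of `v` and of `c i` must both contain a neighbour of `q j`, and `q j` has room for
one beyond `x j` and `x (j + 1)`; only `x 0` serves both. Then the triple of `q j` must contain a
neighbour of `c 0` and one of `c (ℓ - 1)`, and the exchange conditions leave only `x (j + 1)`. -/
lemma chord_adj (h : TwoRings G K I ℓ s i U c x q v) (hf : G.SplitFacts K I) {j : ℕ} (hj : 1 ≤ j)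
    (hjs : j + 2 < s) : G.Adj (c 0) (x (j + 1)) ∧ G.Adj (c (ℓ - 1)) (x (j + 1)) := by
  have h1 := h.add_two_le
  have h2 := h.one_le
  have hq : G.Adj (q j) (x 0) := by
    by_contra hno
    have hK := h.memq j (by omega)
    obtain ⟨a, ha, hqa⟩ : ∃ a, (a = i ∨ a = i + 1) ∧ G.Adj (q j) (U a) := by
      rcases h.hit_i hf hK with e | e | e
      exacts [⟨_, .inl rfl, e⟩, ⟨_, .inr rfl, e⟩, absurd e hno]
    have ha' : a < ℓ := by omega
    rcases h.hit_v hf hK with e | e | e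
    · have := h.injU _ ha' _ (by omega) (h.eq_q hf (by omega) (h.memU a ha') (h.memU 0 (by omega)) hqa e
        (h.ne _ ha' _ (by omega)) (h.ne _ ha' _ (by omega)) (h.ne _ (by omega) _ (by omega))
        (h.ne _ (by omega) _ (by omega)))
      omega
    · exact hno e
    · exact h.ne _ ha' _ (by omega) (h.eq_q hf (by omega) (h.memU a ha') (h.memx _ (by omega)) hqa e
        (h.ne _ ha' _ (by omega)) (h.ne _ ha' _ (by omega)) (h.nex (by omega) (by omega) (by omega))
        (h.nex (by omega) (by omega) (by omega)))
  have hT : ∀ g ∈ K, G.Adj g (x j) ∨ G.Adj g (x (j + 1)) ∨ G.Adj g (x 0) :=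
    hf.hit (q j) (h.memq j (by omega)) _ (h.memx j (by omega)) _ (h.memx _ (by omega)) _
      (h.memx _ (by omega)) (h.adjq j (by omega)) (h.adjq' j (by omega)) hq
      (h.nex (by omega) (by omega) (by omega)) (h.nex (by omega) (by omega) (by omega))
      (h.nex (by omega) (by omega) (by omega))
  constructor
  · rcases hT (c 0) (h.memc _ (by omega)) with e | e | e
    exacts [absurd e (h.chord j hj (by omega) hq), e, absurd e h.first]
  · rcases hT (c (ℓ - 1)) (h.memc _ (by omega)) with e | e | e
    exacts [absurd e (h.chord' j hj (by omega) hq), e, absurd e h.last]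

/-- For `s ≥ 5`, `c 0` would see `x 2` and `x 3` besides its two ring neighbours. For `s = 4`, `c 0`
and `c (ℓ - 1)` use up their third neighbour on `x 2`, so they can meet the triple of `c i` only in
their own ring neighbours. This gives `i = 1` and `ℓ = 3`, and `|I| ≤ 7`. -/
lemma le_three (h : TwoRings G K I ℓ s i U c x q v) (hf : G.SplitFacts K I) : s ≤ 3 := by
  by_contra hs
  have h1 := h.add_two_le
  have h2 := h.one_le
  have h3 := h.chord_adj hf (j := 1) (by omega) (by omega)
  by_cases hs5 : 5 ≤ s
  · have h4 := h.chord_adj hf (j := 2) (by omega) (by omega)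
    exact h.nex (j := 2) (k := 3) (by omega) (by omega) (by omega) (h.eq_c hf (j := 0) (by omega)
      (h.memx _ (by omega)) (h.memx _ (by omega)) h3.1 h4.1
      (h.ne _ (by omega) _ (by omega)).symm (h.ne _ (by omega) _ (by omega)).symm
      (h.ne _ (by omega) _ (by omega)).symm (h.ne _ (by omega) _ (by omega)).symm)
  have hi1 : i = 1 := by
    by_contra hi
    obtain ⟨a, ha, hqa⟩ : ∃ a, (a = i ∨ a = i + 1) ∧ G.Adj (c 0) (U a) := by
      rcases h.hit_i hf (h.memc 0 (by omega)) with e | e | e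
      exacts [⟨_, .inl rfl, e⟩, ⟨_, .inr rfl, e⟩, absurd e h.first]
    exact h.ne a (by omega) 2 (by omega) (h.eq_c hf (j := 0) (by omega) (h.memU _ (by omega))
      (h.memx _ (by omega)) hqa h3.1 (h.neU (by omega) (by omega) (by omega))
      (h.neU (by omega) (by omega) (by omega))
      (h.ne _ (by omega) _ (by omega)).symm (h.ne _ (by omega) _ (by omega)).symm)
  have hi2 : i + 2 = ℓ := by
    by_contra hi
    obtain ⟨a, ha, hqa⟩ : ∃ a, (a = i ∨ a = i + 1) ∧ G.Adj (c (ℓ - 1)) (U a) := by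
      rcases h.hit_i hf (h.memc (ℓ - 1) (by omega)) with e | e | e
      exacts [⟨_, .inl rfl, e⟩, ⟨_, .inr rfl, e⟩, absurd e h.last]
    exact h.ne a (by omega) 2 (by omega) (h.eq_last hf (h.memU _ (by omega))
      (h.memx _ (by omega)) hqa h3.2 (h.neU (by omega) (by omega) (by omega))
      (h.neU (by omega) (by omega) (by omega))
      (h.ne _ (by omega) _ (by omega)).symm (h.ne _ (by omega) _ (by omega)).symm)
  have := h.card_le
  have := hf.eight_le
  omega

/-- The condition on `j` and `i` says that `U i`, `U (i + 1)` are not the ring neighbours of `c j`,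
unless `j = i`. If `c j` did not see `x 0`, the triples of `c i` and of `v` would give it two
different further neighbours. -/
lemma adj_x (h : TwoRings G K I ℓ s i U c x q v) (hf : G.SplitFacts K I) {j : ℕ} (hj : 1 ≤ j)
    (hjl : j + 2 ≤ ℓ) (hji : j + 1 < i ∨ i + 1 < j ∨ j = i) : G.Adj (c j) (x 0) := by
  have h1 := h.add_two_le
  have h2 := h.two_le
  have h3 := h.one_le
  by_contra hno
  have hK := h.memc j (by omega)
  have hji' : j ≠ i := fun e => hno (e ▸ h.adj)
  obtain ⟨a, ha, hqa⟩ : ∃ a, (a = i ∨ a = i + 1) ∧ G.Adj (c j) (U a) := by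
    rcases h.hit_i hf hK with e | e | e
    exacts [⟨_, .inl rfl, e⟩, ⟨_, .inr rfl, e⟩, absurd e hno]
  have ha' : a < ℓ := by omega
  rcases h.hit_v hf hK with e | e | e
  · have := h.injU _ ha' _ (by omega) (h.eq_c hf (by omega) (h.memU a ha') (h.memU 0 (by omega)) hqa e
      (h.neU (by omega) (by omega) (by omega)) (h.neU (by omega) (by omega) (by omega))
      (h.neU (by omega) (by omega) (by omega)) (h.neU (by omega) (by omega) (by omega)))
    omega
  · exact hno e
  · exact h.ne _ ha' _ (by omega) (h.eq_c hf (by omega) (h.memU a ha') (h.memx (s - 1) (by omega)) hqa e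
      (h.neU (by omega) (by omega) (by omega)) (h.neU (by omega) (by omega) (by omega))
      (h.ne _ (by omega) _ (by omega)).symm (h.ne _ (by omega) _ (by omega)).symm)

/-- By `adj_x` the vertex `c j` has the triple `U j`, `U (j + 1)`, `x 0`. The exchange conditions
keep `c 0` from the last two, so it sees the first; for `c (ℓ - 1)` it is the second. -/
lemma adj_first (h : TwoRings G K I ℓ s i U c x q v) (hf : G.SplitFacts K I) {j : ℕ} (hj : 1 ≤ j)
    (hjl : j + 2 ≤ ℓ) (hji : j + 1 < i ∨ i + 1 < j ∨ j = i) : G.Adj (c 0) (U j) := by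
  have h1 := h.add_two_le
  have h2 := h.two_le
  have hx := h.adj_x hf hj hjl hji
  rcases h.hit_c hf (h.memc 0 (by omega)) (j := j) (by omega) (h.memx 0 (by omega)) hx
    (h.ne _ (by omega) _ (by omega)).symm (h.ne _ (by omega) _ (by omega)).symm with e | e | e
  exacts [e, absurd e (h.cross j hj hjl hx), absurd e h.first]

lemma adj_last (h : TwoRings G K I ℓ s i U c x q v) (hf : G.SplitFacts K I) {j : ℕ} (hj : 1 ≤ j)
    (hjl : j + 2 ≤ ℓ) (hji : j + 1 < i ∨ i + 1 < j ∨ j = i) : G.Adj (c (ℓ - 1)) (U (j + 1)) := by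
  have h1 := h.add_two_le
  have h2 := h.two_le
  have hx := h.adj_x hf hj hjl hji
  rcases h.hit_c hf (h.memc (ℓ - 1) (by omega)) (j := j) (by omega) (h.memx 0 (by omega)) hx
    (h.ne _ (by omega) _ (by omega)).symm (h.ne _ (by omega) _ (by omega)).symm with e | e | e
  exacts [absurd e (h.cross' j hj hjl hx), e, absurd e h.last]

lemma not_two_first (h : TwoRings G K I ℓ s i U c x q v) (hf : G.SplitFacts K I) {j k : ℕ}
    (hj : 2 ≤ j) (hjk : j < k) (hk : k < ℓ) (h1 : G.Adj (c 0) (U j)) (h2 : G.Adj (c 0) (U k)) :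
    False :=
  h.neU (j := j) (k := k) (by omega) (by omega) (by omega) (h.eq_c hf (j := 0) (by omega)
    (h.memU _ (by omega)) (h.memU _ (by omega)) h1 h2 (h.neU (by omega) (by omega) (by omega))
    (h.neU (by omega) (by omega) (by omega)) (h.neU (by omega) (by omega) (by omega))
    (h.neU (by omega) (by omega) (by omega)))

lemma not_two_last (h : TwoRings G K I ℓ s i U c x q v) (hf : G.SplitFacts K I) {j k : ℕ}
    (hj : 1 ≤ j) (hjk : j < k) (hk : k + 1 < ℓ) (h1 : G.Adj (c (ℓ - 1)) (U j))
    (h2 : G.Adj (c (ℓ - 1)) (U k)) : False :=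
  h.neU (j := j) (k := k) (by omega) (by omega) (by omega) (h.eq_last hf
    (h.memU _ (by omega)) (h.memU _ (by omega)) h1 h2 (h.neU (by omega) (by omega) (by omega))
    (h.neU (by omega) (by omega) (by omega)) (h.neU (by omega) (by omega) (by omega))
    (h.neU (by omega) (by omega) (by omega)))

/-- The triples of `c 0` and `c 4` meet only in `U 0`, and `q 1` has room for one neighbour on the
first ring. So `q 1` sees `U 0`, and nothing is left for the triple of `c i`. -/
lemma not_both (h : TwoRings G K I ℓ s i U c x q v) (hf : G.SplitFacts K I) (hs : s = 3) (hl : ℓ = 5)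
    {a b : ℕ} (ha : G.Adj (c 0) (U a)) (hb : G.Adj (c 4) (U b))
    (hab : a = 2 ∧ b = 3 ∨ a = 3 ∧ b = 2) : False := by
  subst hs hl
  have h1 := h.add_two_le
  have h2 := h.one_le
  have hcl : G.Adj (c 4) (U 0) := h.closed
  have hqK := h.memq 1 (by omega)
  have ha' : a < 5 := by omega
  have hb' : b < 5 := by omega
  have e1 := h.hit_c hf hqK (j := 0) (by omega) (h.memU a ha') ha
    (h.neU (by omega) (by omega) (by omega)) (h.neU (by omega) (by omega) (by omega))
  have e2 := hf.hit (c 4) (h.memc 4 (by omega)) _ (h.memU 4 (by omega)) _ (h.memU 0 (by omega)) _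
    (h.memU b hb') (h.adjc 4 (by omega)) hcl hb (h.neU (by omega) (by omega) (by omega))
    (h.neU (by omega) (by omega) (by omega)) (h.neU (by omega) (by omega) (by omega)) _ hqK
  have key : ∀ j < 5, ∀ k < 5, G.Adj (q 1) (U j) → G.Adj (q 1) (U k) → j = k := fun j hj k hk h1 h2 =>
    h.injU j hj k hk (h.eq_q hf (by omega) (h.memU j hj) (h.memU k hk) h1 h2
      (h.ne _ (by omega) _ (by omega)) (h.ne _ (by omega) _ (by omega))
      (h.ne _ (by omega) _ (by omega)) (h.ne _ (by omega) _ (by omega)))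
  have h0 : G.Adj (q 1) (U 0) := by
    rcases e1 with e | e | e
    · exact e
    · rcases e2 with f | f | f
      · have := key _ (by omega) _ (by omega) e f; omega
      · exact f
      · have := key _ (by omega) _ (by omega) e f; omega
    · rcases e2 with f | f | f
      · have := key _ (by omega) _ (by omega) e f; omega
      · exact f
      · have := key _ (by omega) _ (by omega) e f; omega
  rcases h.hit_i hf hqK with e | e | e
  · have := key _ (by omega) _ (by omega) h0 e; omega
  · have := key _ (by omega) _ (by omega) h0 e; omega
  · exact h.ne 0 (by omega) 0 (by omega) (h.eq_q hf (j := 1) (by omega) (h.memU 0 (by omega))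
      (h.memx 0 (by omega)) h0 e (h.ne _ (by omega) _ (by omega)) (h.ne _ (by omega) _ (by omega))
      (h.nex (by omega) (by omega) (by omega)) (h.nex (by omega) (by omega) (by omega)))

/-- By `adj_first` and `adj_last`, every suitable index `j` uses up the one further neighbour of `c
0` on `U j` (for `j ≥ 2`) and that of `c (ℓ - 1)` on `U (j + 1)` (for `j + 2 < ℓ`). Two such indices
contradict each other unless `i ≤ 3` and `ℓ = 5`, so `s = 3` because `|I| ≥ 8`. This last case is
`not_both`. -/
lemma elim (h : TwoRings G K I ℓ s i U c x q v) (hf : G.SplitFacts K I) : False := by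
  have h1 := h.add_two_le
  have h2 := h.one_le
  have h3 := h.le_three hf
  have h4 := h.card_le
  have h5 := hf.eight_le
  have h6 : i ≤ 3 := by
    by_contra hi
    exact h.not_two_first hf (j := i - 2) (k := i) (by omega) (by omega) (by omega)
      (h.adj_first hf (by omega) (by omega) (by omega)) (h.adj_first hf (by omega) (by omega) (by omega))
  have h7 : ℓ ≤ i + 4 := by
    by_contra hi
    exact h.not_two_last hf (j := i + 1) (k := i + 2 + 1) (by omega) (by omega) (by omega)
      (h.adj_last hf (by omega) (by omega) (by omega)) (h.adj_last hf (by omega) (by omega) (by omega))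
  have h8 : ℓ = 5 := by
    by_contra hl
    obtain rfl | rfl : i = 3 ∨ i = 2 := by omega
    · exact h.not_two_last hf (j := 1 + 1) (k := 3 + 1) (by omega) (by omega) (by omega)
        (h.adj_last hf (by omega) (by omega) (by omega))
        (h.adj_last hf (by omega) (by omega) (by omega))
    · exact h.not_two_first hf (j := 2) (k := 4) (by omega) (by omega) (by omega)
        (h.adj_first hf (by omega) (by omega) (by omega))
        (h.adj_first hf (by omega) (by omega) (by omega))
  subst h8
  by_cases hi : i = 2
  · exact h.not_both hf (by omega) rfl (a := 2) (b := 3)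
      (h.adj_first hf (by omega) (by omega) (by omega))
      (h.adj_last hf (j := 2) (by omega) (by omega) (by omega)) (by omega)
  · exact h.not_both hf (by omega) rfl (a := 3) (b := 2)
      (h.adj_first hf (by omega) (by omega) (by omega))
      (h.adj_last hf (j := 1) (by omega) (by omega) (by omega)) (by omega)

end TwoRings

end SimpleGraph

/-! ### A minimal cover with several rings -/

namespace SimpleGraph

variable {V : Type*} {G : SimpleGraph V} {K I : Finset V}

lemma crossAdj_swap (x y : V) (h : G.crossAdj K I x y) : G.crossAdj K I y x := h.symm

/-- A ring `u, t` and a ring `v, s` with `v` adjacent to `u`, which cannot be merged into one ring. -/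
structure RingConfig (G : SimpleGraph V) (K I : Finset V) (u c c' : V) (t : List V) (v w w' : V)
    (s : List V) : Prop where
  facts : G.SplitFacts K I
  ring : Seg (G.crossAdj K I) c c' t
  adj_first : G.crossAdj K I u c
  adj_last : G.crossAdj K I c' u
  mem_u : u ∈ I
  ring' : Seg (G.crossAdj K I) w w' s
  adj_first' : G.crossAdj K I v w
  adj_last' : G.crossAdj K I w' v
  mem_v : v ∈ K
  ne : w ≠ w'
  adj : G.crossAdj K I v u
  nodup : ((u :: t) ++ (v :: s)).Nodup
  merge : ∀ x y l, l.Perm ((u :: t) ++ (v :: s)) → Seg (G.crossAdj K I) x y l → ¬ G.crossAdj K I y x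

namespace RingConfig

variable {u c c' : V} {t : List V} {v w w' : V} {s : List V}

lemma flip (h : RingConfig G K I u c c' t v w w' s) : RingConfig G K I u c' c t.reverse v w w' s := by
  have p : ((u :: t.reverse) ++ (v :: s)).Perm ((u :: t) ++ (v :: s)) :=
    ((List.reverse_perm t).cons u).append_right _
  exact ⟨h.facts, h.ring.reverse crossAdj_swap, h.adj_last.symm, h.adj_first.symm, h.mem_u, h.ring',
    h.adj_first', h.adj_last', h.mem_v, h.ne, h.adj, p.nodup_iff.mpr h.nodup,
    fun x y l hl => h.merge x y l (hl.trans p)⟩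

lemma flip' (h : RingConfig G K I u c c' t v w w' s) : RingConfig G K I u c c' t v w' w s.reverse := by
  have p : ((u :: t) ++ (v :: s.reverse)).Perm ((u :: t) ++ (v :: s)) :=
    ((List.reverse_perm s).cons v).append_left _
  exact ⟨h.facts, h.ring, h.adj_first, h.adj_last, h.mem_u, h.ring'.reverse crossAdj_swap,
    h.adj_last'.symm, h.adj_first'.symm, h.mem_v, h.ne.symm, h.adj, p.nodup_iff.mpr h.nodup,
    fun x y l hl => h.merge x y l (hl.trans p)⟩

lemma mem_c (h : RingConfig G K I u c c' t v w w' s) : c ∈ K := h.facts.mem_right h.adj_first h.mem_u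

lemma mem_w (h : RingConfig G K I u c c' t v w w' s) : w ∈ I := h.facts.mem_right' h.adj_first' h.mem_v

lemma ne_of_mem (h : RingConfig G K I u c c' t v w w' s) {x y : V} (hx : x ∈ u :: t) (hy : y ∈ s) :
    x ≠ y := (List.nodup_append.mp h.nodup).2.2 x hx y (List.mem_cons_of_mem _ hy)

lemma hit (h : RingConfig G K I u c c' t v w w' s) {g : V} (hg : g ∈ K) :
    G.Adj g u ∨ G.Adj g w ∨ G.Adj g w' :=
  h.facts.hit v h.mem_v u h.mem_u w h.mem_w w' h.flip'.mem_w h.adj.1 h.adj_first'.1 h.adj_last'.1.symm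
    (h.ne_of_mem (by simp) h.ring'.head_mem) (h.ne_of_mem (by simp) h.ring'.last_mem) h.ne g hg

lemma eq_of_adj (h : RingConfig G K I u c c' t v w w' s) {x : V} (hx : x ∈ I) (hv : G.Adj v x) :
    x = u ∨ x = w ∨ x = w' :=
  h.facts.four v h.mem_v u h.mem_u w h.mem_w w' h.flip'.mem_w x hx h.adj.1 h.adj_first'.1
    h.adj_last'.1.symm hv (h.ne_of_mem (by simp) h.ring'.head_mem)
    (h.ne_of_mem (by simp) h.ring'.last_mem) h.ne

/-- Exchanging the edges `uc` and `vw` for `vu` and `cw` would merge the two rings. -/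
lemma not_adj (h : RingConfig G K I u c c' t v w w' s) : ¬ G.Adj c w := by
  classical
  intro hcw
  refine h.merge _ _ ((u :: t.reverse) ++ (s ++ [v])) ?_ ((h.flip.ring.cons h.flip.adj_first).append
    (h.ring'.append (.single v) h.adj_last') (crossAdj_of_mem h.mem_c h.mem_w hcw)) h.adj
  rw [← List.singleton_append (x := u) (l := t), ← List.singleton_append (x := v) (l := s),
    ← List.singleton_append (x := u) (l := t.reverse)]
  simp only [List.perm_iff_count, List.count_append, List.count_reverse]
  intro; omega

/-- Otherwise `u c'…y c…g w…w' v` is a merged ring, closed by the edge `vu`. -/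
lemma cross_split (h : RingConfig G K I u c c' t v w w' s) {p r : List V} (e : t = p ++ r) {g y : V}
    (hp : Seg (G.crossAdj K I) c g p) (hr : Seg (G.crossAdj K I) y c' r) (hg : g ∈ K) (hy : y ∈ I)
    (hgw : G.Adj g w) : ¬ G.Adj c y := by
  classical
  intro hcy
  refine h.merge _ _ ([u] ++ (r.reverse ++ (p ++ (s ++ [v])))) ?_ (((hr.reverse crossAdj_swap).append
    (hp.append (h.ring'.append (.single v) h.adj_last') (crossAdj_of_mem hg h.mem_w hgw))
      (crossAdj.of_adj_symm h.mem_c hy hcy)).cons h.adj_last.symm) h.adj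
  rw [← List.singleton_append (x := u) (l := t), ← List.singleton_append (x := v) (l := s), e]
  simp only [List.perm_iff_count, List.count_append, List.count_reverse]
  intro; omega

lemma cross_split' (h : RingConfig G K I u c c' t v w w' s) {p r : List V} (e : t = p ++ r) {g y : V}
    (hp : Seg (G.crossAdj K I) c y p) (hr : Seg (G.crossAdj K I) g c' r) (hg : g ∈ K) (hy : y ∈ I)
    (hgw : G.Adj g w) : ¬ G.Adj c' y :=
  h.flip.cross_split (p := r.reverse) (r := p.reverse) (by simp [e]) (hr.reverse crossAdj_swap)
    (hp.reverse crossAdj_swap) hg hy hgw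

/-- Otherwise `c…c' u v w'…g w…y` is a merged ring, closed by the edge `yc`. -/
lemma chord_split (h : RingConfig G K I u c c' t v w w' s) {p r : List V} (e : s = p ++ r) {g y : V}
    (hp : Seg (G.crossAdj K I) w y p) (hr : Seg (G.crossAdj K I) g w' r) (hg : g ∈ K) (hy : y ∈ I)
    (hgw : G.Adj g w) : ¬ G.Adj c y := by
  classical
  intro hcy
  refine h.merge _ _ ((t ++ [u]) ++ ([v] ++ (r.reverse ++ p))) ?_
    ((h.ring.append (.single u) h.adj_last).append ((((hr.reverse crossAdj_swap).append hp
      (crossAdj_of_mem hg h.mem_w hgw))).cons h.adj_last'.symm) h.adj.symm)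
      (crossAdj.of_adj_symm h.mem_c hy hcy)
  rw [← List.singleton_append (x := u) (l := t), ← List.singleton_append (x := v) (l := s), e]
  simp only [List.perm_iff_count, List.count_append, List.count_reverse]
  intro; omega

end RingConfig

/-- On an alternating chain the side of a vertex is the parity of its position. This is what
translates lists into the sequences of `TwoRings`. -/
lemma SplitFacts.getElem_mem (h : G.SplitFacts K I) {l : List V} (hl : l.IsChain (G.crossAdj K I))
    (h0 : 0 < l.length) (hI : l[0] ∈ I) :
    ∀ (k : ℕ) (hk : k < l.length), (k % 2 = 0 → l[k] ∈ I) ∧ (k % 2 = 1 → l[k] ∈ K) := by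
  intro k
  induction k with
  | zero => exact fun _ => ⟨fun _ => hI, by simp⟩
  | succ k ih =>
    intro hk
    have h1 := List.isChain_iff_getElem.mp hl k hk
    obtain ⟨i1, i2⟩ := ih (by omega)
    refine ⟨fun hm => ?_, fun hm => ?_⟩
    · exact h.mem_right' h1 (i2 (by omega))
    · exact h.mem_right h1 (i1 (by omega))

end SimpleGraph

lemma Seg.getElem_zero {V : Type*} {R : V → V → Prop} {a b : V} {l : List V} (h : Seg R a b l)
    (h0 : 0 < l.length) : l[0] = a := by
  obtain ⟨t, rfl⟩ := h.exists_cons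
  rfl

lemma Seg.getElem_last {V : Type*} {R : V → V → Prop} {a b : V} {l : List V} (h : Seg R a b l)
    (h0 : l.length - 1 < l.length) : l[l.length - 1] = b := by
  have := h.2.2
  rw [List.getLast?_eq_getElem?, List.getElem?_eq_getElem h0] at this
  simpa using this

lemma Seg.take_drop {V : Type*} {R : V → V → Prop} {a b : V} {l : List V} (h : Seg R a b l) (k : ℕ)
    (hk : k + 1 < l.length) :
    Seg R a (l[k]) (l.take (k + 1)) ∧ Seg R (l[k + 1]) b (l.drop (k + 1)) := by
  have e := List.take_append_drop (k + 1) l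
  rw [← e] at h
  obtain ⟨y, x, h1, h2, -⟩ := h.split (by
    rw [ne_eq, List.take_eq_nil_iff]
    rintro (h | h)
    · omega
    · simp [h] at hk) (by
    rw [ne_eq, List.drop_eq_nil_iff]
    omega)
  have e1 := h1.getElem_last (by simp; omega)
  have e2 := h2.getElem_zero (by simp; omega)
  simp only [List.getElem_take, List.length_take] at e1
  simp only [List.getElem_drop, Nat.add_zero] at e2
  have : min (k + 1) l.length - 1 = k := by omega
  simp only [this] at e1
  exact ⟨e1 ▸ h1, e2 ▸ h2⟩

/-! ### From lists to the indexed form of two rings. -/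

namespace SimpleGraph

variable {V : Type*} {G : SimpleGraph V} {K I : Finset V}

namespace RingConfig

variable {u c c' : V} {t : List V} {v w w' : V} {s : List V}

/-- The two ring neighbours of `k` and `y` form a triple that must contain a neighbour of `v`. The
only neighbours of `v` in `I` are `u`, `w`, `w'`, and neither ring neighbour of `k` is `u`, so `y`
is `w` or `w'`. -/
lemma adj_or (h : RingConfig G K I u c c' t v w w' s) {k y : V} (hk : k ∈ t) (hkK : k ∈ K)
    (h1 : k ≠ c) (h2 : k ≠ c') (hy : y ∈ s) (hyI : y ∈ I) (hky : G.Adj k y) :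
    G.Adj k w ∨ G.Adj k w' := by
  obtain ⟨t₁, t₂, rfl⟩ := List.append_of_mem hk
  have ht₁ : t₁ ≠ [] := by
    rintro rfl
    have := h.ring.2.1
    simp at this
    exact h1 this
  have ht₂ : t₂ ≠ [] := by
    rintro rfl
    have := h.ring.2.2
    simp at this
    exact h2 this
  obtain ⟨p, q, s1, s2, hpq⟩ := h.ring.split ht₁ (by simp)
  have hq := s2.2.1
  simp only [List.head?_cons, Option.some.injEq] at hq
  subst hq
  obtain ⟨r, s3, hgr⟩ := s2.tail ht₂
  have m1 := s1.last_mem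
  have m2 := s3.head_mem
  have hn := h.nodup
  simp only [List.nodup_append, List.nodup_cons, List.mem_append, List.mem_cons] at hn
  have hpr : p ≠ r := hn.1.2.2.2 p m1 r (.inr m2)
  have hpu : p ≠ u := fun e => hn.1.1 (e ▸ .inl m1)
  have hru : r ≠ u := fun e => hn.1.1 (e ▸ .inr (.inr m2))
  have np : ∀ z ∈ s, p ≠ z := fun z => h.ne_of_mem (by simp [m1])
  have nr : ∀ z ∈ s, r ≠ z := fun z => h.ne_of_mem (by simp [m2])
  have pI := h.facts.mem_left' hpq hkK
  have rI := h.facts.mem_right' hgr hkK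
  rcases h.facts.hit k hkK p pI r rI y hyI hpq.1.symm hgr.1 hky hpr (np y hy) (nr y hy) v h.mem_v with
    e | e | e
  · rcases h.eq_of_adj pI e with e | e | e
    exacts [absurd e hpu, absurd e (np _ h.ring'.head_mem), absurd e (np _ h.ring'.last_mem)]
  · rcases h.eq_of_adj rI e with e | e | e
    exacts [absurd e hru, absurd e (nr _ h.ring'.head_mem), absurd e (nr _ h.ring'.last_mem)]
  · rcases h.eq_of_adj hyI e with rfl | rfl | rfl
    exacts [absurd rfl (h.ne_of_mem (by simp) hy), .inl hky, .inr hky]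

lemma elim_of_adj (h : RingConfig G K I u c c' t v w w' s) (hall : ∀ x ∈ I, x ∈ u :: t ∨ x ∈ v :: s)
    {k : V} (hk : k ∈ t) (hkK : k ∈ K) (h1 : k ≠ c) (h2 : k ≠ c') (hkw : G.Adj k w) : False := by
  classical
  have hf := h.facts
  have hC := h.ring.cons h.adj_first
  have hn := List.nodup_append.mp h.nodup
  have hnt : (u :: t).Nodup := hn.1
  have hns : s.Nodup := (List.nodup_cons.mp hn.2.1).2
  have hl0 : 0 < t.length := List.length_pos_of_mem hk
  have hs0 : 0 < s.length := List.length_pos_of_mem h.ring'.head_mem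
  have altC := hf.getElem_mem hC.1 (by simp) h.mem_u
  have altQ := hf.getElem_mem h.ring'.1 hs0 (by rw [h.ring'.getElem_zero]; exact h.mem_w)
  have lastC := hC.getElem_last (by simp)
  have lastQ := h.ring'.getElem_last (by omega)
  have firstQ := h.ring'.getElem_zero hs0
  have hclen : (u :: t).length % 2 = 0 := by
    by_contra hodd
    have := (altC ((u :: t).length - 1) (by simp)).1 (by omega)
    rw [lastC] at this
    exact hf.notMem _ h.flip.mem_c this
  have hslen : s.length % 2 = 1 := by
    by_contra hodd
    have := (altQ (s.length - 1) (by omega)).2 (by omega)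
    rw [lastQ] at this
    exact hf.notMem _ this h.flip'.mem_w
  -- Even positions of `u :: t` hold the `U j` and odd ones the `c j`. The list `s` starts and ends
  -- in `I`, so it has odd length, with the `x j` at even positions and the `q j` between them.
  obtain ⟨ℓ, hℓ⟩ : ∃ ℓ, (u :: t).length = 2 * ℓ := ⟨(u :: t).length / 2, by omega⟩
  obtain ⟨n, hn'⟩ : ∃ n, s.length = 2 * n + 1 := ⟨s.length / 2, by omega⟩
  have hs3 : 1 ≤ n := by
    by_contra hlt
    obtain rfl : n = 0 := by omega
    simp only [hn', Nat.mul_zero, Nat.zero_add, Nat.sub_self] at lastQ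
    exact h.ne (firstQ.symm.trans lastQ)
  have hℓt : t.length + 1 = 2 * ℓ := by simpa using hℓ
  obtain ⟨m, hm, hmk⟩ := List.mem_iff_getElem.mp hk
  have hcg : ∀ (j : ℕ) (hj : j < t.length), t[j] = (u :: t)[j + 1]'(by simpa using hj) :=
    fun j hj => rfl
  have hm2 : m % 2 = 0 := by
    by_contra hodd
    have := (altC (m + 1) (by simpa using hm)).1 (by omega)
    rw [← hcg m hm, hmk] at this
    exact hf.notMem _ hkK this
  obtain ⟨i, hi⟩ : ∃ i, m = 2 * i := ⟨m / 2, by omega⟩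
  have hi1 : 1 ≤ i := by
    by_contra hlt
    obtain rfl : m = 0 := by omega
    exact h1 (hmk.symm.trans (h.ring.getElem_zero hl0))
  have hi2 : i + 2 ≤ ℓ := by
    by_contra hlt
    obtain rfl : m = t.length - 1 := by omega
    exact h2 (hmk.symm.trans (h.ring.getElem_last hm))
  have eC : ∀ (j : ℕ) (hj : j < (u :: t).length), (u :: t).getD j u = (u :: t)[j] :=
    fun j hj => List.getD_eq_getElem _ _ hj
  have eQ : ∀ (j : ℕ) (hj : j < s.length), s.getD j v = s[j] := fun j hj => List.getD_eq_getElem _ _ hj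
  have chC : ∀ j (hj : j + 1 < (u :: t).length), G.Adj ((u :: t)[j]) ((u :: t)[j + 1]) := fun j hj =>
    (List.isChain_iff_getElem.mp hC.1 j hj).1
  have chQ : ∀ j (hj : j + 1 < s.length), G.Adj (s[j]) (s[j + 1]) := fun j hj =>
    (List.isChain_iff_getElem.mp h.ring'.1 j hj).1
  have c0 : (u :: t).getD 1 u = c := by
    rw [eC _ (by omega)]
    exact h.ring.getElem_zero hl0
  have cl : (u :: t).getD (2 * (ℓ - 1) + 1) u = c' := by
    rw [eC _ (by omega)]
    have : 2 * (ℓ - 1) + 1 = (u :: t).length - 1 := by omega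
    simp only [this]
    exact lastC
  have x0 : s.getD 0 v = w := by rw [eQ _ hs0]; exact firstQ
  have xl : s.getD (2 * n) v = w' := by
    rw [eQ _ (by omega)]
    have : 2 * n = s.length - 1 := by omega
    simp only [this]
    exact lastQ
  refine TwoRings.elim (ℓ := ℓ) (s := n + 1) (i := i) (U := fun j => (u :: t).getD (2 * j) u)
    (c := fun j => (u :: t).getD (2 * j + 1) u) (x := fun j => s.getD (2 * j) v)
    (q := fun j => s.getD (2 * j + 1) v) (v := v) ?_ hf
  constructor
  · intro j hj
    simp only [eC _ (show 2 * j < (u :: t).length by omega)]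
    exact (altC _ _).1 (by omega)
  · intro j hj
    simp only [eC _ (show 2 * j + 1 < (u :: t).length by omega)]
    exact (altC _ _).2 (by omega)
  · intro j hj
    simp only [eC _ (show 2 * j < (u :: t).length by omega),
      eC _ (show 2 * j + 1 < (u :: t).length by omega)]
    exact (chC (2 * j) (by omega)).symm
  · intro j hj
    simp only [eC _ (show 2 * j + 1 < (u :: t).length by omega),
      eC _ (show 2 * (j + 1) < (u :: t).length by omega)]
    exact chC (2 * j + 1) (by omega)
  · simp only [cl]
    exact h.adj_last.1
  · intro j hj
    simp only [eQ _ (show 2 * j < s.length by omega)]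
    exact (altQ _ _).1 (by omega)
  · intro j hj
    simp only [eQ _ (show 2 * j + 1 < s.length by omega)]
    exact (altQ _ _).2 (by omega)
  · intro j hj
    simp only [eQ _ (show 2 * j < s.length by omega), eQ _ (show 2 * j + 1 < s.length by omega)]
    exact (chQ (2 * j) (by omega)).symm
  · intro j hj
    simp only [eQ _ (show 2 * j + 1 < s.length by omega), eQ _ (show 2 * (j + 1) < s.length by omega)]
    exact chQ (2 * j + 1) (by omega)
  · exact h.mem_v
  · simp only [Nat.mul_zero, x0]
    exact h.adj_first'.1
  · simp only [Nat.add_sub_cancel, xl]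
    exact h.adj_last'.1.symm
  · exact h.adj.1
  · intro j hj k hk e
    simp only [eC _ (show 2 * j < (u :: t).length by omega),
      eC _ (show 2 * k < (u :: t).length by omega)] at e
    have := hnt.getElem_inj_iff.mp e
    omega
  · intro j hj k hk e
    simp only [eQ _ (show 2 * j < s.length by omega), eQ _ (show 2 * k < s.length by omega)] at e
    have := hns.getElem_inj_iff.mp e
    omega
  · intro j hj k hk
    simp only [eC _ (show 2 * j < (u :: t).length by omega), eQ _ (show 2 * k < s.length by omega)]
    exact h.ne_of_mem (List.getElem_mem _) (List.getElem_mem _)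
  · omega
  · exact hi1
  · exact hi2
  · simp only [Nat.mul_zero, x0, eC _ (show 2 * i + 1 < (u :: t).length by omega)]
    rw [← hcg _ (by omega)]
    subst hi
    rwa [hmk]
  · have hsub : I ⊆ (Finset.range ℓ).image (fun j => (u :: t).getD (2 * j) u) ∪
        (Finset.range (n + 1)).image (fun j => s.getD (2 * j) v) := by
      intro x hx
      simp only [Finset.mem_union, Finset.mem_image, Finset.mem_range]
      rcases hall x hx with hx' | hx'
      · left
        obtain ⟨a, ha, hax⟩ := List.mem_iff_getElem.mp hx'
        have ha2 : a % 2 = 0 := by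
          by_contra hodd
          have := (altC a ha).2 (by omega)
          rw [hax] at this
          exact hf.notMem _ this hx
        refine ⟨a / 2, by omega, ?_⟩
        have e : 2 * (a / 2) = a := by omega
        rw [e, eC a ha, hax]
      · right
        rcases List.mem_cons.mp hx' with rfl | hx'
        · exact absurd hx (hf.notMem _ h.mem_v)
        obtain ⟨a, ha, hax⟩ := List.mem_iff_getElem.mp hx'
        have ha2 : a % 2 = 0 := by
          by_contra hodd
          have := (altQ a ha).2 (by omega)
          rw [hax] at this
          exact hf.notMem _ this hx
        refine ⟨a / 2, by omega, ?_⟩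
        have e : 2 * (a / 2) = a := by omega
        rw [e, eQ a ha, hax]
    refine (Finset.card_le_card hsub).trans ((Finset.card_union_le _ _).trans ?_)
    exact add_le_add (Finset.card_image_le.trans (by simp)) (Finset.card_image_le.trans (by simp))
  · simp only [Nat.mul_zero, Nat.zero_add, c0, x0]
    exact h.not_adj
  · simp only [Nat.mul_zero, Nat.zero_add, c0, Nat.add_sub_cancel, xl]
    exact h.flip'.not_adj
  · simp only [cl, Nat.mul_zero, x0]
    exact h.flip.not_adj
  · simp only [cl, Nat.add_sub_cancel, xl]
    exact h.flip.flip'.not_adj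
  · intro j hj hjl
    simp only [Nat.mul_zero, Nat.zero_add, c0, x0, eC _ (show 2 * j + 1 < (u :: t).length by omega),
      eC _ (show 2 * (j + 1) < (u :: t).length by omega)]
    obtain ⟨d1, d2⟩ := h.ring.take_drop (2 * j) (by omega)
    exact h.cross_split (List.take_append_drop _ _).symm d1 d2 ((altC (2 * j + 1) (by omega)).2
      (by omega)) ((altC (2 * j + 2) (by omega)).1 (by omega))
  · intro j hj hjl
    simp only [cl, Nat.mul_zero, x0, eC _ (show 2 * j + 1 < (u :: t).length by omega),
      eC _ (show 2 * j < (u :: t).length by omega)]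
    -- Positions in `t` are one less than in `u :: t`, so this cut separates `U j` from `c j`.
    obtain ⟨d1, d2⟩ := h.ring.take_drop (2 * j - 1) (by omega)
    have e1 : t[2 * j - 1]'(by omega) = (u :: t)[2 * j]'(by omega) := by
      rw [hcg]
      congr 1
      omega
    have e2 : t[2 * j - 1 + 1]'(by omega) = (u :: t)[2 * j + 1]'(by omega) := by
      rw [hcg]
      congr 1
      omega
    rw [e1] at d1
    rw [e2] at d2
    exact h.cross_split' (List.take_append_drop _ _).symm d1 d2 ((altC (2 * j + 1) (by omega)).2
      (by omega)) ((altC (2 * j) (by omega)).1 (by omega))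
  · intro j hj hjl
    simp only [Nat.mul_zero, Nat.zero_add, c0, x0, eQ _ (show 2 * j + 1 < s.length by omega),
      eQ _ (show 2 * j < s.length by omega)]
    obtain ⟨d1, d2⟩ := h.ring'.take_drop (2 * j) (by omega)
    exact h.chord_split (List.take_append_drop _ _).symm d1 d2 ((altQ (2 * j + 1) (by omega)).2
      (by omega)) ((altQ (2 * j) (by omega)).1 (by omega))
  · intro j hj hjl
    simp only [cl, Nat.mul_zero, x0, eQ _ (show 2 * j + 1 < s.length by omega),
      eQ _ (show 2 * j < s.length by omega)]
    obtain ⟨d1, d2⟩ := h.ring'.take_drop (2 * j) (by omega)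
    exact h.flip.chord_split (List.take_append_drop _ _).symm d1 d2 ((altQ (2 * j + 1) (by omega)).2
      (by omega)) ((altQ (2 * j) (by omega)).1 (by omega))

lemma elim (h : RingConfig G K I u c c' t v w w' s) (hall : ∀ x ∈ I, x ∈ u :: t ∨ x ∈ v :: s)
    {k y : V} (hk : k ∈ t) (hkK : k ∈ K) (h1 : k ≠ c) (h2 : k ≠ c') (hy : y ∈ s) (hyI : y ∈ I)
    (hky : G.Adj k y) : False := by
  rcases h.adj_or hk hkK h1 h2 hy hyI hky with e | e
  · exact h.elim_of_adj hall hk hkK h1 h2 e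
  · exact h.flip'.elim_of_adj (fun x hx => (hall x hx).imp_right fun hx => by simpa using hx)
      hk hkK h1 h2 e

end RingConfig

end SimpleGraph

/-! ### A minimal cover has one part only -/

namespace SimpleGraph

variable {V : Type*} {G : SimpleGraph V} {K I : Finset V}

lemma IsMinCover.ringConfig {L : List (List V)} (h : G.IsMinCover K I L) (hf : G.SplitFacts K I)
    {C Q : List V} (hC : C ∈ L) (hQ : Q ∈ L) (hCQ : C ≠ Q) {u v c c' w w' : V} {t s : List V}
    (huI : u ∈ I) (hvK : v ∈ K) (hvu : G.Adj v u)
    (hpC : (u :: t).Perm C) (ht : Seg (G.crossAdj K I) c c' t) (huc : G.crossAdj K I u c)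
    (hcu : G.crossAdj K I c' u) (hpQ : (v :: s).Perm Q) (hs : Seg (G.crossAdj K I) w w' s)
    (hvw : G.crossAdj K I v w) (hwv : G.crossAdj K I w' v) (hww : w ≠ w') :
    RingConfig G K I u c c' t v w w' s := by
  have p := hpC.append hpQ
  refine ⟨hf, ht, huc, hcu, huI, hs, hvw, hwv, hvK, hww, crossAdj_of_mem hvK huI hvu, ?_, ?_⟩
  · rw [p.nodup_iff, List.nodup_append]
    exact ⟨h.nodup_of_mem hC, h.nodup_of_mem hQ, fun x hx y hy e =>
      h.disjoint hC hQ hCQ hx (e ▸ hy)⟩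
  · intro x y l hl hxy hyx
    refine h.not_merge_two hC hQ hCQ (hl.trans p) (.inl (.of_seg hxy hyx ?_))
    rw [hl.length_eq]
    have := List.length_pos_of_mem ht.head_mem
    simp only [List.length_append, List.length_cons]
    omega

/-- Clique vertices on further rings are adjacent to `u`. -/
lemma IsMinCover.adj_of_third {L : List (List V)} (h : G.IsMinCover K I L) (hf : G.SplitFacts K I)
    {C Q S : List V} (hC : C ∈ L) (hQ : Q ∈ L) (hS : S ∈ L) (hCQ : C ≠ Q) (hCS : C ≠ S) (hQS : Q ≠ S)
    (rC : G.IsRing K I C) (rQ : G.IsRing K I Q) (rS : G.IsRing K I S) {u v g : V} (hu : u ∈ C)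
    (huI : u ∈ I) (hv : v ∈ Q) (hvK : v ∈ K) (hvu : G.Adj v u) (hg : g ∈ S) (hgK : g ∈ K) :
    G.Adj g u := by
  classical
  by_contra hgu
  obtain ⟨t, c, c', hpC, ht, huc, hcu, -⟩ := rC.exists_open hu (h.nodup_of_mem hC)
  -- An edge from `c'` to the ring neighbour `z` of `g` would allow merging three rings at once, as
  -- `u…c' z…g w…w' v`.
  have aux : ∀ {z w w' : V} {s r : List V}, (v :: s).Perm Q → Seg (G.crossAdj K I) w w' s →
      G.crossAdj K I v w → G.crossAdj K I w' v → (g :: r).Perm S →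
      Seg (G.crossAdj K I) g z (g :: r) → G.crossAdj K I z g → G.Adj g w → ¬ G.Adj c' z := by
    intro z w w' s r hpQ hs hvw hwv hpS hr hzg hgw hcz
    have hzI := hf.mem_left' hzg hgK
    refine h.not_merge_three hC hQ hS hCQ hCS hQS (l := (u :: t) ++ ((g :: r).reverse ++ (s ++ [v]))) ?_
      (.inl (.of_seg ((ht.cons huc).append ((hr.reverse crossAdj_swap).append
        (hs.append (.single v) hwv) (crossAdj_of_mem hgK (hf.mem_right' hvw hvK) hgw))
        (crossAdj_of_mem (hf.mem_left hcu huI) hzI hcz)) (crossAdj_of_mem hvK huI hvu) ?_))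
    · rw [← List.singleton_append (x := v) (l := s)] at hpQ
      rw [List.perm_iff_count] at hpC hpQ hpS ⊢
      intro x
      have e1 := hpC x
      have e2 := hpQ x
      have e3 := hpS x
      simp only [List.count_append, List.count_reverse] at e2 ⊢
      omega
    · simp only [List.length_append, List.length_reverse, List.length_cons]
      omega
  obtain ⟨r, z', z, hpS, hr, hgz', hzg, hzz⟩ := rS.exists_open hg (h.nodup_of_mem hS)
  have hr2 : (g :: r.reverse).Perm S := ((List.reverse_perm r).cons g).trans hpS
  have aux2 : ∀ {w w' : V} {s : List V}, (v :: s).Perm Q → Seg (G.crossAdj K I) w w' s →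
      G.crossAdj K I v w → G.crossAdj K I w' v → w ≠ w' → ¬ G.Adj g w := by
    intro w w' s hpQ hs hvw hwv hww hgw
    have cfg := h.ringConfig hf hC hQ hCQ huI hvK hvu hpC ht huc hcu hpQ hs hvw hwv hww
    have mw : w ∈ Q := hpQ.subset (by simp [hs.head_mem])
    have mz : z ∈ S := hpS.subset (by simp [hr.last_mem])
    have mz' : z' ∈ S := hpS.subset (by simp [hr.head_mem])
    -- If `g` sees `w`, its triple `z`, `z'`, `w` must contain a neighbour of `c'`. The first two
    -- merge three rings, the last one merges two.
    rcases hf.hit g hgK z (hf.mem_left' hzg hgK) z' (hf.mem_right' hgz' hgK) w cfg.mem_w hzg.1.symm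
      hgz'.1 hgw hzz.symm (fun e => h.disjoint hQ hS hQS mw (e ▸ mz))
      (fun e => h.disjoint hQ hS hQS mw (e ▸ mz')) c' cfg.flip.mem_c with e | e | e
    · exact aux hpQ hs hvw hwv hpS (hr.cons hgz') hzg hgw e
    · exact aux hpQ hs hvw hwv hr2 ((hr.reverse crossAdj_swap).cons hzg.symm) hgz'.symm hgw e
    · exact cfg.flip.not_adj e
  obtain ⟨s, w, w', hpQ, hs, hvw, hwv, hww⟩ := rQ.exists_open hv (h.nodup_of_mem hQ)
  have cfg := h.ringConfig hf hC hQ hCQ huI hvK hvu hpC ht huc hcu hpQ hs hvw hwv hww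
  rcases cfg.hit hgK with e | e | e
  · exact hgu e
  · exact aux2 hpQ hs hvw hwv hww e
  · exact aux2 (((List.reverse_perm s).cons v).trans hpQ) (hs.reverse crossAdj_swap) hwv.symm hvw.symm
      hww.symm e

lemma IsRing.exists_mem_clique {S : List V} (h : G.IsRing K I S) :
    ∃ g ∈ S, g ∈ K := by
  obtain ⟨a, b, l, hp, hs, hba, -⟩ := h
  rcases hba.2 with e | e
  · exact ⟨a, hp.subset hs.head_mem, e.2⟩
  · exact ⟨b, hp.subset hs.last_mem, e.1⟩

/-- There are no further parts besides two adjacent rings. -/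
lemma IsMinCover.eq_or_eq {L : List (List V)} (h : G.IsMinCover K I L) (hf : G.SplitFacts K I)
    {C Q : List V} (hC : C ∈ L) (hQ : Q ∈ L) (hCQ : C ≠ Q)
    (rC : G.IsRing K I C) (rQ : G.IsRing K I Q) {u v : V} (hu : u ∈ C)
    (huI : u ∈ I) (hv : v ∈ Q) (hvK : v ∈ K) (hvu : G.Adj v u) {S : List V} (hS : S ∈ L) :
    S = C ∨ S = Q := by
  by_contra hcon
  push Not at hcon
  obtain ⟨t, c, c', hpC, ht, huc, hcu, -⟩ := rC.exists_open hu (h.nodup_of_mem hC)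
  obtain ⟨s, w, w', hpQ, hs, hvw, hwv, hww⟩ := rQ.exists_open hv (h.nodup_of_mem hQ)
  have cfg := h.ringConfig hf hC hQ hCQ huI hvK hvu hpC ht huc hcu hpQ hs hvw hwv hww
  have mw : w ∈ Q := hpQ.subset (by simp [hs.head_mem])
  have mw' : w' ∈ Q := hpQ.subset (by simp [hs.last_mem])
  -- The end of a rod would be adjacent to `u`, `w` or `w'`, all of which lie on rings.
  have hring : ∀ S ∈ L, S ≠ C → S ≠ Q → G.IsRing K I S := by
    intro S hS h1 h2
    refine (h.good S hS).resolve_right fun hrod => ?_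
    obtain ⟨a, b, l, hp, hl, ha, -⟩ := id hrod
    have maS := hp.subset hl.head_mem
    rcases cfg.hit ha with e | e | e
    · exact h.not_adj_rod hf hC hS (Ne.symm h1) rC hrod hu huI maS ha e
    · exact h.not_adj_rod hf hQ hS (Ne.symm h2) rQ hrod mw cfg.mem_w maS ha e
    · exact h.not_adj_rod hf hQ hS (Ne.symm h2) rQ hrod mw' cfg.flip'.mem_w maS ha e
  have rS := hring S hS hcon.1 hcon.2
  obtain ⟨g, hg, hgK⟩ := rS.exists_mem_clique
  have hgu := h.adj_of_third hf hC hQ hS hCQ (Ne.symm hcon.1) (Ne.symm hcon.2) rC rQ rS hu huI hv hvK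
    hvu hg hgK
  obtain ⟨r, z, z', hpS, hr, hgz, hzg, hzz⟩ := rS.exists_open hg (h.nodup_of_mem hS)
  have cfg' := h.ringConfig hf hC hS (Ne.symm hcon.1) huI hgK hgu hpC ht huc hcu hpS hr hgz hzg hzz
  have mz : z ∈ S := hpS.subset (by simp [hr.head_mem])
  have mz' : z' ∈ S := hpS.subset (by simp [hr.last_mem])
  -- Clique vertices outside `C` all see `u` by `adj_of_third`, using `Q` or `S` as the second ring.
  -- A clique vertex on `C` not seeing `u` must have a neighbour on each of `Q` and `S`, in addition
  -- to its two ring neighbours.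
  obtain ⟨k, hk, hku⟩ := hf.miss u huI
  obtain ⟨P, hP, hkP⟩ := List.mem_flatten.mp (h.mem k)
  by_cases hPC : P = C
  · subst hPC
    obtain ⟨r', p, p', hpp, hr', hkp, hpk, hpp'⟩ := rC.exists_open hkP (h.nodup_of_mem hC)
    have mp : p ∈ P := hpp.subset (by simp [hr'.head_mem])
    have mp' : p' ∈ P := hpp.subset (by simp [hr'.last_mem])
    obtain ⟨x, hxQ, hxI, hkx⟩ : ∃ x ∈ Q, x ∈ I ∧ G.Adj k x := by
      rcases cfg.hit hk with e | e | e
      exacts [absurd e hku, ⟨w, mw, cfg.mem_w, e⟩, ⟨w', mw', cfg.flip'.mem_w, e⟩]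
    obtain ⟨y, hyS, hyI, hky⟩ : ∃ y ∈ S, y ∈ I ∧ G.Adj k y := by
      rcases cfg'.hit hk with e | e | e
      exacts [absurd e hku, ⟨z, mz, cfg'.mem_w, e⟩, ⟨z', mz', cfg'.flip'.mem_w, e⟩]
    have d1 := h.disjoint hQ hP (Ne.symm hCQ)
    have d2 := h.disjoint hS hP hcon.1
    exact h.disjoint hS hQ hcon.2 hyS ((hf.eq_of_adj hk (hf.mem_right' hkp hk) (hf.mem_left' hpk hk) hyI
      hxI hkp.1 hpk.1.symm hky hkx hpp' (fun e => d2 hyS (e ▸ mp)) (fun e => d2 hyS (e ▸ mp'))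
      (fun e => d1 hxQ (e ▸ mp)) (fun e => d1 hxQ (e ▸ mp'))) ▸ hxQ)
  by_cases hPQ : P = Q
  · subst hPQ
    exact hku (h.adj_of_third hf hC hS hP (Ne.symm hcon.1) hCQ hcon.2 rC rS rQ hu huI hg hgK hgu hkP hk)
  · exact hku (h.adj_of_third hf hC hQ hP hCQ (Ne.symm hPC) (Ne.symm hPQ) rC rQ (hring P hP hPC hPQ) hu
      huI hv hvK hvu hkP hk)

/-- The clique vertex `v'` is either no ring neighbour of `u`, and `RingConfig.elim` applies to it
directly, or it is one. In that case `u'` is no ring neighbour of `v`, since otherwise the rings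
could be merged, and `RingConfig.elim` applies with the roles of the rings exchanged. -/
lemma IsMinCover.not_two_rings {L : List (List V)} (h : G.IsMinCover K I L) (hf : G.SplitFacts K I)
    {C Q : List V} (hC : C ∈ L) (hQ : Q ∈ L) (hCQ : C ≠ Q)
    (rC : G.IsRing K I C) (rQ : G.IsRing K I Q) {u v u' v' : V} (hu : u ∈ C)
    (huI : u ∈ I) (hv : v ∈ Q) (hvK : v ∈ K) (hvu : G.Adj v u) (hu' : u' ∈ Q) (huI' : u' ∈ I)
    (hv' : v' ∈ C) (hvK' : v' ∈ K) (hvu' : G.Adj v' u') : False := by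
  have hall : ∀ x, x ∈ C ∨ x ∈ Q := by
    intro x
    obtain ⟨S, hS, hx⟩ := List.mem_flatten.mp (h.mem x)
    rcases h.eq_or_eq hf hC hQ hCQ rC rQ hu huI hv hvK hvu hS with rfl | rfl
    exacts [.inl hx, .inr hx]
  have mem_tail : ∀ {x y : V} {l l' : List V}, (x :: l).Perm l' → y ∈ l' → y ≠ x → y ∈ l :=
    fun hp hy hne => (List.mem_cons.mp (hp.mem_iff.mpr hy)).resolve_left hne
  have hIK : ∀ {x y : V}, x ∈ K → y ∈ I → x ≠ y := fun hx hy e => hf.notMem _ hx (e ▸ hy)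
  obtain ⟨t, c, c', hpC, ht, huc, hcu, -⟩ := rC.exists_open hu (h.nodup_of_mem hC)
  obtain ⟨s, w, w', hpQ, hs, hvw, hwv, hww⟩ := rQ.exists_open hv (h.nodup_of_mem hQ)
  have cfg := h.ringConfig hf hC hQ hCQ huI hvK hvu hpC ht huc hcu hpQ hs hvw hwv hww
  by_cases hcase : v' = c ∨ v' = c'
  · have hne : u' ≠ w ∧ u' ≠ w' := by
      rcases hcase with rfl | rfl
      · exact ⟨fun e => cfg.not_adj (e ▸ hvu'), fun e => cfg.flip'.not_adj (e ▸ hvu')⟩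
      · exact ⟨fun e => cfg.flip.not_adj (e ▸ hvu'), fun e => cfg.flip.flip'.not_adj (e ▸ hvu')⟩
    have hnv : ¬ G.Adj v u' := fun e => by
      rcases cfg.eq_of_adj huI' e with e | e | e
      exacts [h.disjoint hC hQ hCQ hu (e ▸ hu'), hne.1 e, hne.2 e]
    obtain ⟨t', d, d', hpQ', ht', hud, hdu, -⟩ := rQ.exists_open hu' (h.nodup_of_mem hQ)
    obtain ⟨s', x, x', hpC', hs', hvx, hxv, hxx⟩ := rC.exists_open hv' (h.nodup_of_mem hC)
    have cfg' := h.ringConfig hf hQ hC hCQ.symm huI' hvK' hvu' hpQ' ht' hud hdu hpC' hs' hvx hxv hxx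
    refine cfg'.elim (fun y _ => (hall y).symm.imp hpQ'.mem_iff.mpr hpC'.mem_iff.mpr)
      (mem_tail hpQ' hv (hIK hvK huI')) hvK ?_ ?_ (mem_tail hpC' hu (hIK hvK' huI).symm) huI hvu
    · rintro rfl
      exact hnv hud.1.symm
    · rintro rfl
      exact hnv hdu.1
  · push Not at hcase
    exact cfg.elim (fun y _ => (hall y).imp hpC.mem_iff.mpr hpQ.mem_iff.mpr)
      (mem_tail hpC hv' (hIK hvK' huI)) hvK' hcase.1 hcase.2 (mem_tail hpQ hu' (hIK hvK huI').symm) huI'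
      hvu'

/-- With two parts, not both can be rods, so there is a ring, and it has an edge from its side of
`I` to another part. A rod is excluded there, and a second ring has such an edge too, which must
lead back to the first. -/
lemma IsMinCover.length_eq_one {L : List (List V)} (h : G.IsMinCover K I L) (hf : G.SplitFacts K I)
    (hshort : ¬ ∃ (a : V) (c : (G.degTwoGraph I).Walk a a), G.IsShortCycle K I c) :
    L.length ≤ 1 := by
  by_contra hlen
  obtain ⟨l₁, l₂, L', rfl⟩ : ∃ l₁ l₂ L', L = l₁ :: l₂ :: L' := by
    match L, hlen with
    | [], h => simp at h
    | [_], h => simp at h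
    | l₁ :: l₂ :: L', _ => exact ⟨_, _, _, rfl⟩
  have hne : l₁ ≠ l₂ := by
    rintro rfl
    have hn := h.nodup
    obtain ⟨x, hx⟩ := List.exists_mem_of_ne_nil _ (h.ne_nil (l := l₁) (by simp))
    simp only [List.flatten_cons, List.nodup_append, List.mem_append] at hn
    exact hn.2.2 x hx x (.inl hx) rfl
  have outer : ∀ C ∈ l₁ :: l₂ :: L', G.IsRing K I C →
      ∃ u ∈ C, u ∈ I ∧ ∃ v ∈ K, v ∉ C ∧ G.Adj v u := by
    intro C hC rC
    obtain ⟨x, hx⟩ : ∃ x, x ∉ C := by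
      by_cases e : C = l₁
      · obtain ⟨x, hx⟩ := List.exists_mem_of_ne_nil _ (h.ne_nil (l := l₂) (by simp))
        exact ⟨x, fun hx' => h.disjoint (by simp) (by simp) hne (e ▸ hx') hx⟩
      · obtain ⟨x, hx⟩ := List.exists_mem_of_ne_nil _ (h.ne_nil (l := l₁) (by simp))
        exact ⟨x, fun hx' => h.disjoint hC (by simp) e hx' hx⟩
    obtain ⟨a, b, l, hp, hs, hba, h3⟩ := rC
    obtain ⟨u, hu, huI, v, hv, hvl, hvu⟩ := hf.exists_outer_neighbor hshort hs hba
      (hp.nodup_iff.mpr (h.nodup_of_mem hC)) h3 (fun e => hx (hp.subset e))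
    exact ⟨u, hp.subset hu, huI, v, hv, fun e => hvl (hp.mem_iff.mpr e), hvu⟩
  obtain ⟨C, hC, rC⟩ : ∃ C ∈ l₁ :: l₂ :: L', G.IsRing K I C := by
    by_contra hcon
    push Not at hcon
    obtain ⟨a, b, l, hp, hs, ha, hb⟩ := (h.good l₁ (by simp)).resolve_left (hcon _ (by simp))
    obtain ⟨a', b', l', hp', hs', ha', hb'⟩ := (h.good l₂ (by simp)).resolve_left (hcon _ (by simp))
    exact h.not_merge_two (by simp) (by simp) hne (hp.append hp') (.inr (.of_seg
      (hs.append hs' (.of_clique hb ha')) ha hb'))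
  obtain ⟨u, hu, huI, v, hvK, hvC, hvu⟩ := outer C hC rC
  obtain ⟨Q, hQ, hv⟩ := List.mem_flatten.mp (h.mem v)
  have hCQ : C ≠ Q := fun e => hvC (e ▸ hv)
  rcases h.good Q hQ with rQ | rQ
  · obtain ⟨u', hu', huI', v', hvK', hvQ', hvu'⟩ := outer Q hQ rQ
    obtain ⟨S, hS, hv'⟩ := List.mem_flatten.mp (h.mem v')
    rcases h.eq_or_eq hf hC hQ hCQ rC rQ hu huI hv hvK hvu hS with rfl | rfl
    · exact h.not_two_rings hf hC hQ hCQ rC rQ hu huI hv hvK hvu hu' huI' hv' hvK' hvu'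
    · exact hvQ' hv'
  · exact h.not_adj_rod hf hC hQ hCQ rC rQ hu huI hv hvK hvu

/-- A graph without short cycles has a closed chain through all vertices. -/
lemma SplitFacts.isHamiltonian [Fintype V] [DecidableEq V] (hf : G.SplitFacts K I)
    (hshort : ¬ ∃ (a : V) (c : (G.degTwoGraph I).Walk a a), G.IsShortCycle K I c) :
    G.IsHamiltonian := by
  obtain ⟨L, hL⟩ := hf.exists_minCover
  have hlen := hL.length_eq_one hf hshort
  obtain ⟨l, rfl⟩ : ∃ l, L = [l] := by
    match L, hlen with
    | [], _ =>
      have := hf.eight_le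
      obtain ⟨x, -⟩ := Finset.card_pos.mp (show 0 < I.card by omega)
      simpa using hL.mem x
    | [l], _ => exact ⟨l, rfl⟩
    | _ :: _ :: _, h => simp at h
  have hn : l.Nodup := hL.nodup_of_mem (by simp)
  have hmem : ∀ v, v ∈ l := fun v => by simpa using hL.mem v
  have h3 : 3 ≤ l.length := by
    have h1 : I ⊆ l.toFinset := fun x _ => List.mem_toFinset.mpr (hmem x)
    have h2 := Finset.card_le_card h1
    rw [List.toFinset_card_of_nodup hn] at h2
    have := hf.eight_le
    omega
  have key : ∀ {a b : V} {l' : List V}, l'.Perm l → Seg G.Adj a b l' → G.Adj b a → G.IsHamiltonian := by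
    intro a b l' hp hs hba _
    obtain ⟨c, hc, -⟩ := exists_isHamiltonianCycle_of_list hs hba (hp.nodup_iff.mpr hn)
      (by rw [hp.length_eq]; exact h3) fun v => hp.mem_iff.mpr (hmem v)
    exact ⟨a, c, hc⟩
  rcases hL.good l (by simp) with ⟨a, b, l', hp, hs, hba, -⟩ | ⟨a, b, l', hp, hs, ha, hb⟩
  · exact key hp (hs.mono fun x y h => h.1) hba.1
  · have hn' := hp.nodup_iff.mpr hn
    refine key hp (b := b) ⟨?_, hs.2⟩ ?_
    · rw [List.isChain_iff_getElem]
      intro i hi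
      rcases List.isChain_iff_getElem.mp hs.1 i hi with e | e
      · exact e.1
      · refine hf.clique _ e.1 _ e.2 fun he => ?_
        have := hn'.getElem_inj_iff.mp he
        omega
    · exact hf.clique _ hb _ ha (hs.head_ne_last hn' (by rw [hp.length_eq]; omega)).symm

end SimpleGraph

/-! ### Hamiltonian graphs have no short cycle -/

namespace SimpleGraph

variable {V : Type*} {G : SimpleGraph V} {K I : Finset V}

lemma Walk.mem_of_closed_edges {S : Set V} {u w : V} (p : G.Walk u w) (hu : u ∈ S)
    (h : ∀ x y, s(x, y) ∈ p.edges → x ∈ S → y ∈ S) : ∀ x ∈ p.support, x ∈ S := by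
  induction p with
  | nil => simpa using hu
  | cons hadj p ih =>
    intro x hx
    rw [Walk.support_cons, List.mem_cons] at hx
    rcases hx with rfl | hx
    · exact hu
    · refine ih (h _ _ (by simp) hu) (fun a b hab => h a b ?_) x hx
      rw [Walk.edges_cons]
      exact List.mem_cons_of_mem _ hab

/-- At a degree-two vertex the short cycle and the Hamiltonian cycle use the same two edges. Any
other vertex of the short cycle has only degree-two neighbours on it, so there the two cycles agree
as well. Hence the Hamiltonian cycle cannot leave the short one to reach the missed vertex. -/
lemma not_isShortCycle_of_isHamiltonian [Fintype V] [DecidableEq V] (hH : G.IsHamiltonian)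
    (hcard : 1 < Fintype.card V) {a : V} {c : (G.degTwoGraph I).Walk a a} :
    ¬ G.IsShortCycle K I c := by
  rintro ⟨hc, -, k, -, hk⟩
  obtain ⟨b, p, hp⟩ := hH (by omega)
  have hpc := hp.isCycle
  have hall : ∀ v, v ∈ p.support := fun v => hp.mem_support v
  have hsub : ∀ v, p.toSubgraph.neighborSet v ⊆ G.neighborSet v := fun v x hx => p.toSubgraph.adj_sub hx
  have hsub' : ∀ v, c.toSubgraph.neighborSet v ⊆ G.neighborSet v := fun v x hx =>
    (c.toSubgraph.adj_sub hx).1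
  have h2 : ∀ v, (p.toSubgraph.neighborSet v).ncard = 2 := fun v =>
    hpc.ncard_neighborSet_toSubgraph_eq_two (hall v)
  have h2' : ∀ v ∈ c.support, (c.toSubgraph.neighborSet v).ncard = 2 := fun v hv =>
    hc.ncard_neighborSet_toSubgraph_eq_two hv
  have key : ∀ v ∈ c.support, v ∈ G.degTwoPart I →
      c.toSubgraph.neighborSet v = p.toSubgraph.neighborSet v := by
    intro v hv hd
    rw [Set.eq_of_subset_of_ncard_le (hsub' v) (by rw [h2' v hv, hd.2]),
      Set.eq_of_subset_of_ncard_le (hsub v) (by rw [h2 v, hd.2])]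
  have key' : ∀ v ∈ c.support, c.toSubgraph.neighborSet v = p.toSubgraph.neighborSet v := by
    intro v hv
    by_cases hd : v ∈ G.degTwoPart I
    · exact key v hv hd
    · refine Set.eq_of_subset_of_ncard_le (fun x hx => ?_) (by rw [h2' v hv, h2 v])
      have hxd : x ∈ G.degTwoPart I := (c.toSubgraph.adj_sub hx).2.resolve_left hd
      have hxs : x ∈ c.support := c.mem_verts_toSubgraph.mp (c.toSubgraph.edge_vert hx.symm)
      have : v ∈ p.toSubgraph.neighborSet x := key x hxs hxd ▸ hx.symm
      exact this.symm
  have hclosed : ∀ x y, p.toSubgraph.Adj x y → x ∈ c.support → y ∈ c.support := by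
    intro x y hxy hx
    have : y ∈ c.toSubgraph.neighborSet x := key' x hx ▸ hxy
    exact c.mem_verts_toSubgraph.mp (c.toSubgraph.edge_vert this.symm)
  have ha := hall a
  refine hk (Walk.mem_of_closed_edges (S := {x | x ∈ c.support}) (p.rotate a ha) c.start_mem_support
    (fun x y hxy => hclosed x y ?_) k (by rw [Walk.mem_support_rotate_iff]; exact hall k))
  rw [Walk.adj_toSubgraph_iff_mem_edges]
  exact (p.rotate_edges a ha).mem_iff.mp hxy

theorem SplitFacts.isHamiltonian_iff [Fintype V] [DecidableEq V] (hf : G.SplitFacts K I) :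
    G.IsHamiltonian ↔ ¬ ∃ (a : V) (c : (G.degTwoGraph I).Walk a a), G.IsShortCycle K I c := by
  refine ⟨?_, hf.isHamiltonian⟩
  rintro h ⟨a, c, hc⟩
  have h1 := Finset.card_le_univ I
  have h2 := hf.eight_le
  exact not_isShortCycle_of_isHamiltonian h (by omega) hc

end SimpleGraph

/-! ### Reasoning about structured programs -/

namespace RAM

open scoped Classical in
/-- The number of `i < n` with `p i`. -/
noncomputable def cn (n : ℕ) (p : ℕ → Prop) : ℕ := ((Finset.range n).filter p).card

lemma cn_congr {n : ℕ} {p q : ℕ → Prop} (h : ∀ i < n, p i ↔ q i) : cn n p = cn n q := by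
  unfold cn
  congr 1
  ext i
  simp only [Finset.mem_filter, Finset.mem_range]
  exact ⟨fun ⟨a, b⟩ => ⟨a, (h i a).mp b⟩, fun ⟨a, b⟩ => ⟨a, (h i a).mpr b⟩⟩

lemma cn_mono {n : ℕ} {p q : ℕ → Prop} (h : ∀ i < n, p i → q i) : cn n p ≤ cn n q := by
  unfold cn
  refine Finset.card_le_card fun i => ?_
  simp only [Finset.mem_filter, Finset.mem_range]
  exact fun ⟨a, b⟩ => ⟨a, h i a b⟩

lemma cn_pos {n : ℕ} {p : ℕ → Prop} : 0 < cn n p ↔ ∃ i < n, p i := by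
  unfold cn
  rw [Finset.card_pos]
  constructor
  · rintro ⟨i, hi⟩
    simp only [Finset.mem_filter, Finset.mem_range] at hi
    exact ⟨i, hi⟩
  · rintro ⟨i, hi⟩
    exact ⟨i, by simpa using hi⟩

lemma two_le_cn {n : ℕ} {p : ℕ → Prop} : 2 ≤ cn n p ↔ ∃ i < n, ∃ j < n, i ≠ j ∧ p i ∧ p j := by
  unfold cn
  constructor
  · intro h
    obtain ⟨i, hi, j, hj, hij⟩ := Finset.one_lt_card.mp h
    simp only [Finset.mem_filter, Finset.mem_range] at hi hj
    exact ⟨i, hi.1, j, hj.1, hij, hi.2, hj.2⟩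
  · rintro ⟨i, hi, j, hj, hij, h1, h2⟩
    exact Finset.one_lt_card.mpr ⟨i, by simp [hi, h1], j, by simp [hj, h2], hij⟩

lemma three_le_cn {n : ℕ} {p : ℕ → Prop} : 3 ≤ cn n p ↔
    ∃ i < n, ∃ j < n, ∃ k < n, i ≠ j ∧ i ≠ k ∧ j ≠ k ∧ p i ∧ p j ∧ p k := by
  unfold cn
  constructor
  · intro h
    obtain ⟨i, j, k, hi, hj, hk, h1, h2, h3⟩ := Finset.two_lt_card_iff.mp h
    simp only [Finset.mem_filter, Finset.mem_range] at hi hj hk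
    exact ⟨i, hi.1, j, hj.1, k, hk.1, h1, h2, h3, hi.2, hj.2, hk.2⟩
  · rintro ⟨i, hi, j, hj, k, hk, h1, h2, h3, p1, p2, p3⟩
    exact Finset.two_lt_card_iff.mpr ⟨i, j, k, by simp [hi, p1], by simp [hj, p2], by simp [hk, p3],
      h1, h2, h3⟩

/-! ### Logical connectives and the dependence of terms on memory. -/

namespace Tm

variable {n : ℕ} {m : Mem} {env : ℕ → ℕ}

lemma eval_cnt (x : ℕ) (e : Tm) :
    (cnt x e).eval n m env = cn n fun i => e.eval n m (Function.update env x i) ≠ 0 := by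
  unfold cn
  rw [Tm.eval]
  congr

/-- Negation. -/
def not (e : Tm) : Tm := .eq e (.const 0)

/-- Conjunction. -/
def and (e f : Tm) : Tm := not (.add (not e) (not f))

/-- Bounded existence. -/
def ex (x : ℕ) (e : Tm) : Tm := .cnt x e

/-- Bounded universality. -/
def all (x : ℕ) (e : Tm) : Tm := not (ex x (not e))

/-- The conjunction of a list. -/
def conj : List Tm → Tm
  | [] => .const 1
  | e :: l => and e (conj l)

/-- The term is true, that is, nonzero. -/
def tr (n : ℕ) (m : Mem) (env : ℕ → ℕ) (e : Tm) : Prop := e.eval n m env ≠ 0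

@[simp] lemma tr_not (e : Tm) : tr n m env (not e) ↔ ¬ tr n m env e := by
  unfold tr not
  simp only [Tm.eval]
  by_cases h : e.eval n m env = 0 <;> simp [h]

@[simp] lemma tr_and (e f : Tm) : tr n m env (and e f) ↔ tr n m env e ∧ tr n m env f := by
  rw [and, tr_not]
  unfold tr not
  simp only [Tm.eval]
  by_cases h : e.eval n m env = 0 <;> by_cases h' : f.eval n m env = 0 <;> simp [h, h']

@[simp] lemma tr_add (e f : Tm) : tr n m env (.add e f) ↔ tr n m env e ∨ tr n m env f := by
  simp only [tr, Tm.eval]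
  omega

@[simp] lemma tr_eq (e f : Tm) : tr n m env (.eq e f) ↔ e.eval n m env = f.eval n m env := by
  simp [tr, Tm.eval]

@[simp] lemma tr_lt (e f : Tm) : tr n m env (.lt e f) ↔ e.eval n m env < f.eval n m env := by
  simp [tr, Tm.eval]

@[simp] lemma tr_get (a : ℕ) (e f : Tm) :
    tr n m env (.get a e f) ↔ m a (e.eval n m env) (f.eval n m env) ≠ 0 := Iff.rfl

@[simp] lemma eval_const (c : ℕ) : (const c).eval n m env = c := rfl

@[simp] lemma eval_size : size.eval n m env = n := rfl

@[simp] lemma eval_var (x : ℕ) : (var x).eval n m env = env x := rfl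

@[simp] lemma eval_get (a : ℕ) (i j : Tm) :
    (get a i j).eval n m env = m a (i.eval n m env) (j.eval n m env) := rfl

@[simp] lemma eval_add (e f : Tm) : (add e f).eval n m env = e.eval n m env + f.eval n m env := rfl

@[simp] lemma eval_sub (e f : Tm) : (sub e f).eval n m env = e.eval n m env - f.eval n m env := rfl

@[simp] lemma eval_cnt_tr (x : ℕ) (e : Tm) :
    (cnt x e).eval n m env = cn n fun i => tr n m (Function.update env x i) e := eval_cnt x e

@[simp] lemma tr_ex (x : ℕ) (e : Tm) :
    tr n m env (ex x e) ↔ ∃ i < n, tr n m (Function.update env x i) e := by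
  rw [tr, ex, eval_cnt_tr, ← Nat.pos_iff_ne_zero, cn_pos]

@[simp] lemma tr_all (x : ℕ) (e : Tm) :
    tr n m env (all x e) ↔ ∀ i < n, tr n m (Function.update env x i) e := by
  simp [all]

lemma tr_conj (l : List Tm) : tr n m env (conj l) ↔ ∀ e ∈ l, tr n m env e := by
  induction l with
  | nil => simp [conj, tr]
  | cons e l ih => simp [conj, ih]

/-- The arrays that a term reads. -/
def reads : Tm → List ℕ
  | .const _ => []
  | .size => []
  | .var _ => []
  | .get a i j => a :: (i.reads ++ j.reads)
  | .add e f => e.reads ++ f.reads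
  | .sub e f => e.reads ++ f.reads
  | .lt e f => e.reads ++ f.reads
  | .eq e f => e.reads ++ f.reads
  | .cnt _ e => e.reads

/-- Allows the condition of a filling loop to be evaluated in the memory before the loop, as long as
the array being written is not read. -/
lemma eval_congr {m' : Mem} (e : Tm) : ∀ env, (∀ a ∈ e.reads, m' a = m a) →
    e.eval n m' env = e.eval n m env := by
  induction e with
  | const => exact fun _ _ => rfl
  | size => exact fun _ _ => rfl
  | var => exact fun _ _ => rfl
  | get a i j hi hj =>
    intro env h
    simp only [reads, List.mem_cons, List.mem_append] at h
    simp only [Tm.eval]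
    rw [hi env fun b hb => h b (.inr (.inl hb)), hj env fun b hb => h b (.inr (.inr hb)),
      h a (.inl rfl)]
  | add e f he hf =>
    intro env h
    simp only [reads, List.mem_append] at h
    simp only [Tm.eval]
    rw [he env fun b hb => h b (.inl hb), hf env fun b hb => h b (.inr hb)]
  | sub e f he hf =>
    intro env h
    simp only [reads, List.mem_append] at h
    simp only [Tm.eval]
    rw [he env fun b hb => h b (.inl hb), hf env fun b hb => h b (.inr hb)]
  | lt e f he hf =>
    intro env h
    simp only [reads, List.mem_append] at h
    simp only [Tm.eval]
    rw [he env fun b hb => h b (.inl hb), hf env fun b hb => h b (.inr hb)]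
  | eq e f he hf =>
    intro env h
    simp only [reads, List.mem_append] at h
    simp only [Tm.eval]
    rw [he env fun b hb => h b (.inl hb), hf env fun b hb => h b (.inr hb)]
  | cnt x e he =>
    intro env h
    simp only [eval_cnt]
    exact cn_congr fun i _ => by rw [he _ h]

end Tm

lemma iterN_induct {α : Type*} {f : ℕ → α → α} {n : ℕ} {a : α} (P : ℕ → α → Prop) (h0 : P 0 a)
    (hs : ∀ i < n, ∀ b, P i b → P (i + 1) (f i b)) : P n (iterN f n a) := by
  have : ∀ k ≤ n, P k (iterN f k a) := by
    intro k
    induction k with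
    | zero => exact fun _ => h0
    | succ k ih => exact fun hk => hs k hk _ (ih (by omega))
  exact this n le_rfl

/-- The arrays that a statement writes. -/
def St.writes : St → List ℕ
  | .skip => []
  | .put a _ _ _ => [a]
  | .seq p q => p.writes ++ q.writes
  | .ite _ p q => p.writes ++ q.writes
  | .forN _ p => p.writes

lemma St.run_eq {n a : ℕ} (p : St) : ∀ env m, a ∉ p.writes → p.run n env m a = m a := by
  induction p with
  | skip => exact fun _ _ _ => rfl
  | put b i j e =>
    intro env m h
    simp only [St.writes, List.mem_singleton] at h
    funext x y
    simp [St.run, Mem.upd, h]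
  | seq p q hp hq =>
    intro env m h
    simp only [St.writes, List.mem_append, not_or] at h
    rw [St.run, hq _ _ h.2, hp _ _ h.1]
  | ite e p q hp hq =>
    intro env m h
    simp only [St.writes, List.mem_append, not_or] at h
    rw [St.run]
    split
    · exact hp _ _ h.1
    · exact hq _ _ h.2
  | forN x p hp =>
    intro env m h
    rw [St.run]
    exact iterN_induct (fun _ (m' : Mem) => m' a = m a) rfl fun i _ b hb => by rw [hp _ _ h, hb]

lemma Mem.upd_apply (m : Mem) (a i j v a' i' j' : ℕ) :
    m.upd a i j v a' i' j' = if a' = a ∧ i' = i ∧ j' = j then v else m a' i' j' := rfl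

lemma St.run_ite_pos {n : ℕ} {e : Tm} {p q : St} {env : ℕ → ℕ} {m : Mem} (h : e.tr n m env) :
    (St.ite e p q).run n env m = p.run n env m := by
  rw [St.run]
  exact if_pos h

lemma St.run_ite_neg {n : ℕ} {e : Tm} {p q : St} {env : ℕ → ℕ} {m : Mem} (h : ¬ e.tr n m env) :
    (St.ite e p q).run n env m = q.run n env m := by
  rw [St.run]
  exact if_neg h

/-- Fill the column `0` of an array. -/
def St.fill (a x : ℕ) (e : Tm) : St := .forN x (.put a (.var x) (.const 0) e)

lemma St.fill_run {a x n : ℕ} {e : Tm} {env : ℕ → ℕ} {m : Mem} (ha : a ∉ e.reads) :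
    (∀ b, b ≠ a → (St.fill a x e).run n env m b = m b) ∧
      ∀ i < n, (St.fill a x e).run n env m a i 0 = e.eval n m (Function.update env x i) := by
  refine ⟨fun b hb => St.run_eq _ _ _ (by simpa [St.fill, St.writes] using hb), ?_⟩
  rw [St.fill, St.run]
  refine (iterN_induct (fun k (m' : Mem) => (∀ b, b ≠ a → m' b = m b) ∧
    ∀ i < k, m' a i 0 = e.eval n m (Function.update env x i)) (by simp) ?_).2
  rintro k - m' ⟨h1, h2⟩
  have he : e.eval n m' (Function.update env x k) = e.eval n m (Function.update env x k) :=
    Tm.eval_congr _ _ fun b hb => h1 b fun h => ha (h ▸ hb)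
  refine ⟨fun b hb => ?_, fun i hi => ?_⟩
  · rw [← h1 b hb]
    funext i j
    simp [St.run, Mem.upd_apply, hb]
  · simp only [St.run, Mem.upd_apply, Tm.eval, Function.update_self, true_and, and_true, he]
    by_cases hik : i = k
    · simp [hik]
    · rw [if_neg hik, h2 i (by omega)]

/-- Fill an array. -/
def St.fillTable (a x y : ℕ) (e : Tm) : St := .forN x (.forN y (.put a (.var x) (.var y) e))

lemma St.fillTable_run {a x y n : ℕ} {e : Tm} {env : ℕ → ℕ} {m : Mem} (ha : a ∉ e.reads)
    (hxy : x ≠ y) :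
    (∀ b, b ≠ a → (St.fillTable a x y e).run n env m b = m b) ∧
      ∀ i < n, ∀ j < n, (St.fillTable a x y e).run n env m a i j =
        e.eval n m (Function.update (Function.update env x i) y j) := by
  refine ⟨fun b hb => St.run_eq _ _ _ (by simpa [St.fillTable, St.writes] using hb), ?_⟩
  rw [St.fillTable, St.run]
  refine (iterN_induct (fun k (m' : Mem) => (∀ b, b ≠ a → m' b = m b) ∧
    ∀ i < k, ∀ j < n, m' a i j = e.eval n m (Function.update (Function.update env x i) y j))
    (by simp) ?_).2
  rintro k - m' ⟨h1, h2⟩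
  rw [St.run]
  have := iterN_induct (f := fun j m₁ => (St.put a (.var x) (.var y) e).run n
    (Function.update (Function.update env x k) y j) m₁) (n := n) (a := m')
    (fun l (m₁ : Mem) => (∀ b, b ≠ a → m₁ b = m b) ∧
    (∀ i < k, ∀ j < n, m₁ a i j = e.eval n m (Function.update (Function.update env x i) y j)) ∧
    ∀ j < l, m₁ a k j = e.eval n m (Function.update (Function.update env x k) y j))
    ⟨h1, h2, by simp⟩ ?_
  · refine ⟨this.1, fun i hi j hj => ?_⟩
    by_cases hik : i = k
    · subst hik
      exact this.2.2 j hj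
    · exact this.2.1 i (by omega) j hj
  rintro l - m₁ ⟨g1, g2, g3⟩
  have he : e.eval n m₁ (Function.update (Function.update env x k) y l) =
      e.eval n m (Function.update (Function.update env x k) y l) :=
    Tm.eval_congr _ _ fun b hb => g1 b fun h => ha (h ▸ hb)
  have hx : Function.update (Function.update env x k) y l x = k := by
    rw [Function.update_of_ne hxy, Function.update_self]
  refine ⟨fun b hb => ?_, fun i hi j hj => ?_, fun j hj => ?_⟩
  · rw [← g1 b hb]
    funext i j
    simp [St.run, Mem.upd_apply, hb]
  · simp only [St.run, Mem.upd_apply, Tm.eval, hx]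
    rw [if_neg (by omega), g2 i hi j hj]
  · simp only [St.run, Mem.upd_apply, Tm.eval, Function.update_self, hx, true_and, he]
    by_cases hjl : j = l
    · simp [hjl]
    · rw [if_neg hjl, g3 j (by omega)]

/-- Write some `y < n` with property `e` into the cell `(x, 0)`. -/
def St.choose (a x y : ℕ) (e : Tm) : St :=
  .forN y (.ite e (.put a (.var x) (.const 0) (.var y)) .skip)

/-- The term may read the array it writes to, as happens when a list is extended. It only must not
depend on the cell being filled. -/
lemma St.choose_run {a x y n : ℕ} {e : Tm} {env : ℕ → ℕ} {m : Mem} (hxy : x ≠ y)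
    (he : ∀ m' : Mem, (∀ b i j, ¬ (b = a ∧ i = env x ∧ j = 0) → m' b i j = m b i j) → ∀ k < n,
      (e.tr n m' (Function.update env y k) ↔ e.tr n m (Function.update env y k))) :
    (∀ b i j, ¬ (b = a ∧ i = env x ∧ j = 0) → (St.choose a x y e).run n env m b i j = m b i j) ∧
      ((∃ k < n, e.tr n m (Function.update env y k)) →
        (St.choose a x y e).run n env m a (env x) 0 < n ∧
        e.tr n m (Function.update env y ((St.choose a x y e).run n env m a (env x) 0))) := by
  rw [St.choose, St.run]
  have := iterN_induct (f := fun k m₁ => (St.ite e (.put a (.var x) (.const 0) (.var y)) .skip).run n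
    (Function.update env y k) m₁) (n := n) (a := m)
    (fun l (m₁ : Mem) => (∀ b i j, ¬ (b = a ∧ i = env x ∧ j = 0) → m₁ b i j = m b i j) ∧
    ((∃ k < l, e.tr n m (Function.update env y k)) →
        m₁ a (env x) 0 < n ∧ e.tr n m (Function.update env y (m₁ a (env x) 0)))) ⟨by simp, by simp⟩ ?_
  · exact this
  rintro l hl m₁ ⟨h1, h2⟩
  have hx : Function.update env y l x = env x := Function.update_of_ne hxy _ _
  by_cases hc : e.tr n m (Function.update env y l)
  · have hc' := (he m₁ h1 l hl).mpr hc
    rw [St.run_ite_pos hc']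
    refine ⟨fun b i j hb => ?_, fun _ => ?_⟩
    · simp only [St.run, Mem.upd_apply, Tm.eval, hx]
      rw [if_neg hb, h1 b i j hb]
    · simp only [St.run, Mem.upd_apply, Tm.eval, hx, and_self, if_true, Function.update_self]
      exact ⟨hl, hc⟩
  · have hc' := fun h => hc ((he m₁ h1 l hl).mp h)
    rw [St.run_ite_neg hc', St.run]
    refine ⟨h1, ?_⟩
    rintro ⟨k, hk, hk'⟩
    refine h2 ⟨k, ?_, hk'⟩
    by_contra hlt
    obtain rfl : k = l := by omega
    exact hc hk'

end RAM

/-! ### Pruning vertices of degree at most one -/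

namespace RAM

/-- Every member of `S` has at least two neighbours in `S`. -/
def TwoClosed (n : ℕ) (R : ℕ → ℕ → Prop) (S : Finset ℕ) : Prop :=
  ∀ x ∈ S, 2 ≤ cn n fun y => y ∈ S ∧ R x y

lemma TwoClosed.mono {n : ℕ} {R R' : ℕ → ℕ → Prop} {S : Finset ℕ} (h : TwoClosed n R S)
    (hR : ∀ x ∈ S, ∀ y ∈ S, R x y → R' x y) : TwoClosed n R' S := fun x hx =>
  (h x hx).trans (cn_mono fun y _ hy => ⟨hy.1, hR x hx y hy.1 hy.2⟩)

/-- The relation stored in array `a`. -/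
def rel (m : Mem) (a x y : ℕ) : Prop := m a x y ≠ 0

/-- Keep in the set of array `5` only the members with two neighbours in it, for the relation of
array `4`. -/
def St.pruneStep : St :=
  .put 5 (.var 50) (.const 0) (.and (.get 5 (.var 50) (.const 0))
    (.lt (.const 1) (.cnt 52 (.and (.get 5 (.var 52) (.const 0)) (.get 4 (.var 50) (.var 52))))))

/-- Compute in array `5` the largest subset of the set `e` in which all degrees are at least two. -/
def St.core (e : Tm) : St := .seq (.fill 5 50 e) (.forN 51 (.forN 50 .pruneStep))

/-- Array `5` represents `S`. -/
def Rep (n : ℕ) (m : Mem) (S : Finset ℕ) : Prop :=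
  S ⊆ Finset.range n ∧ ∀ i < n, m 5 i 0 ≠ 0 ↔ i ∈ S

/-- Discarding a vertex with at most one neighbour in the set loses no subset of minimum degree two.
If nothing was discarded, the degree condition has been checked at `x`. -/
lemma St.pruneStep_run {n x : ℕ} {m : Mem} {env : ℕ → ℕ} {S : Finset ℕ} (hS : Rep n m S)
    (hx : x < n) : ∃ S', Rep n (St.pruneStep.run n (Function.update env 50 x) m) S' ∧ S' ⊆ S ∧
      (∀ T ⊆ S, TwoClosed n (rel m 4) T → T ⊆ S') ∧
      (S' = S → x ∈ S → 2 ≤ cn n fun y => y ∈ S ∧ rel m 4 x y) := by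
  have hcn : cn n (fun y => m 5 y 0 ≠ 0 ∧ m 4 x y ≠ 0) = cn n fun y => y ∈ S ∧ rel m 4 x y :=
    cn_congr fun i hi => by rw [hS.2 i hi]; rfl
  set b := Tm.and (.get 5 (.var 50) (.const 0))
    (.lt (.const 1) (.cnt 52 (.and (.get 5 (.var 52) (.const 0)) (.get 4 (.var 50) (.var 52)))))
    with hb
  have htr : b.eval n m (Function.update env 50 x) ≠ 0 ↔
      x ∈ S ∧ 2 ≤ cn n fun y => y ∈ S ∧ rel m 4 x y := by
    change Tm.tr n m _ b ↔ _
    rw [hb]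
    simp only [Tm.tr_and, Tm.tr_get, Tm.eval_var, Function.update_self, Tm.eval_const, hS.2 x hx, Tm.tr_lt,
      Tm.eval_cnt_tr, ← hcn]
    exact Iff.rfl
  have hrun : ∀ i < n, (St.pruneStep.run n (Function.update env 50 x) m) 5 i 0 ≠ 0 ↔
      (if i = x then x ∈ S ∧ 2 ≤ cn n fun y => y ∈ S ∧ rel m 4 x y else i ∈ S) := by
    intro i hi
    rw [St.pruneStep, ← hb, St.run, Mem.upd_apply]
    simp only [Tm.eval, Function.update_self, true_and, and_true]
    by_cases h : i = x
    · rw [if_pos h, if_pos h, htr]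
    · rw [if_neg h, if_neg h, hS.2 i hi]
  by_cases hc : x ∈ S → 2 ≤ cn n fun y => y ∈ S ∧ rel m 4 x y
  · refine ⟨S, ⟨hS.1, fun i hi => ?_⟩, subset_rfl, fun T hT _ => hT, fun _ => hc⟩
    rw [hrun i hi]
    split_ifs with h
    · subst h; exact ⟨fun h => h.1, fun h => ⟨h, hc h⟩⟩
    · rfl
  · refine ⟨S.erase x, ⟨(Finset.erase_subset _ _).trans hS.1, fun i hi => ?_⟩, Finset.erase_subset _ _,
      fun T hT h2 => ?_, fun h hxS => ?_⟩
    · rw [hrun i hi, Finset.mem_erase]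
      split_ifs with h
      · simp only [h, ne_eq, not_true_eq_false, false_and, iff_false]
        exact fun h' => hc fun _ => h'.2
      · simp [h]
    · refine Finset.subset_erase.mpr ⟨hT, fun hxT => hc fun _ => (h2 x hxT).trans ?_⟩
      exact cn_mono fun y _ hy => ⟨hT hy.1, hy.2⟩
    · rw [← h] at hxS
      simp at hxS

lemma St.pruneRound_run {n : ℕ} {m : Mem} {env : ℕ → ℕ} {S : Finset ℕ} (hS : Rep n m S) :
    ∃ S', Rep n ((St.forN 50 St.pruneStep).run n env m) S' ∧ S' ⊆ S ∧
      (∀ T ⊆ S, TwoClosed n (rel m 4) T → T ⊆ S') ∧ (S' = S → TwoClosed n (rel m 4) S) := by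
  rw [St.run]
  have := iterN_induct (f := fun i m => St.pruneStep.run n (Function.update env 50 i) m) (n := n)
    (a := m) (fun k (m' : Mem) => m' 4 = m 4 ∧ ∃ S', Rep n m' S' ∧ S' ⊆ S ∧
      (∀ T ⊆ S, TwoClosed n (rel m 4) T → T ⊆ S') ∧
      (S' = S → ∀ x < k, x ∈ S → 2 ≤ cn n fun y => y ∈ S ∧ rel m 4 x y))
    ⟨rfl, S, hS, subset_rfl, fun T hT _ => hT, by simp⟩ ?_
  · obtain ⟨-, S', h1, h2, h3, h4⟩ := this
    exact ⟨S', h1, h2, h3, fun e x hx => h4 e x (Finset.mem_range.mp (hS.1 hx)) hx⟩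
  rintro k hk m' ⟨h0, S', h1, h2, h3, h4⟩
  have h0' : rel m' 4 = rel m 4 := by
    funext x y
    rw [rel, rel, h0]
  obtain ⟨S'', g1, g2, g3, g4⟩ := St.pruneStep_run (env := env) h1 hk
  rw [h0'] at g3 g4
  refine ⟨?_, S'', g1, g2.trans h2, fun T hT hc => g3 T (h3 T hT hc) hc, ?_⟩
  · rw [St.run_eq _ _ _ (by simp [St.pruneStep, St.writes]), h0]
  · intro e x hx hxS
    have e1 : S' = S := h2.antisymm (e ▸ g2)
    have e2 : S'' = S' := e.trans e1.symm
    rcases Nat.lt_succ_iff_lt_or_eq.mp hx with hx | rfl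
    · exact h4 e1 x hx hxS
    · have := g4 e2 (e1 ▸ hxS)
      rwa [e1] at this

lemma St.core_run {n : ℕ} {m : Mem} {env : ℕ → ℕ} {e : Tm} (he : 5 ∉ e.reads) :
    (∀ b, b ≠ 5 → (St.core e).run n env m b = m b) ∧
    ((∃ i < n, (St.core e).run n env m 5 i 0 ≠ 0) ↔
      ∃ S ⊆ Finset.range n, S.Nonempty ∧ (∀ i ∈ S, e.tr n m (Function.update env 50 i)) ∧
        TwoClosed n (rel m 4) S) := by
  classical
  obtain ⟨f1, f2⟩ := St.fill_run (n := n) (m := m) (env := env) (x := 50) he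
  refine ⟨fun b hb => ?_, ?_⟩
  · exact St.run_eq _ _ _ (by simp [St.core, St.fill, St.pruneStep, St.writes, hb])
  set m₀ := (St.fill 5 50 e).run n env m with hm₀
  set S₀ := (Finset.range n).filter fun i => e.tr n m (Function.update env 50 i) with hS₀
  have hrep : Rep n m₀ S₀ := by
    refine ⟨Finset.filter_subset _ _, fun i hi => ?_⟩
    rw [f2 i hi, hS₀, Finset.mem_filter, Finset.mem_range]
    exact ⟨fun h => ⟨hi, h⟩, fun h => h.2⟩
  have h4 : rel m₀ 4 = rel m 4 := by
    funext x y
    rw [rel, rel, f1 4 (by decide)]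
  -- A round without removals shows that the set is final, and every other round removes a vertex,
  -- so `n` rounds suffice.
  have := iterN_induct (f := fun i m => (St.forN 50 St.pruneStep).run n (Function.update env 51 i) m)
    (n := n) (a := m₀) (fun k (m' : Mem) => m' 4 = m₀ 4 ∧ ∃ S', Rep n m' S' ∧ S' ⊆ S₀ ∧
      (∀ T ⊆ S₀, TwoClosed n (rel m 4) T → T ⊆ S') ∧
      (TwoClosed n (rel m 4) S' ∨ S'.card + k ≤ n))
    ⟨rfl, S₀, hrep, subset_rfl, fun T hT _ => hT, .inr (by
      have := Finset.card_le_card hrep.1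
      simpa using this)⟩ ?_
  · obtain ⟨-, S, r1, r2, r3, r4⟩ := this
    have hcl : TwoClosed n (rel m 4) S := by
      refine r4.elim id fun h x hx => ?_
      have : S.card = 0 := by omega
      rw [Finset.card_eq_zero.mp this] at hx
      simp at hx
    constructor
    · rintro ⟨i, hi, h⟩
      have hiS : i ∈ S := (r1.2 i hi).mp h
      exact ⟨S, r1.1, ⟨i, hiS⟩, fun j hj => (Finset.mem_filter.mp (r2 hj)).2, hcl⟩
    · rintro ⟨T, hT, ⟨i, hi⟩, hTe, hTc⟩
      have hTS := r3 T (fun j hj => Finset.mem_filter.mpr ⟨hT hj, hTe j hj⟩) hTc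
      exact ⟨i, Finset.mem_range.mp (hT hi), (r1.2 i (Finset.mem_range.mp (hT hi))).mpr (hTS hi)⟩
  rintro k hk m' ⟨g0, S', g1, g2, g3, g4⟩
  have g0' : rel m' 4 = rel m 4 := by
    rw [← h4]
    funext x y
    rw [rel, rel, g0]
  obtain ⟨S'', r1, r2, r3, r4⟩ := St.pruneRound_run (env := Function.update env 51 k) g1
  rw [g0'] at r3 r4
  refine ⟨?_, S'', r1, r2.trans g2, fun T hT hc => r3 T (g3 T hT hc) hc, ?_⟩
  · rw [St.run_eq _ _ _ (by simp [St.pruneStep, St.writes]), g0]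
  · by_cases e : S'' = S'
    · exact .inl (e ▸ r4 e)
    · rcases g4 with g4 | g4
      · exact absurd (r2.antisymm (r3 S' subset_rfl g4)) e
      · have := Finset.card_lt_card (Finset.ssubset_iff_subset_ne.mpr ⟨r2, e⟩)
        exact .inr (by omega)

end RAM

/-! ### Acyclic relations and greedy listings -/

namespace RAM

lemma cn_le_one {n : ℕ} {p : ℕ → Prop} : cn n p ≤ 1 ↔ ∀ i < n, ∀ j < n, p i → p j → i = j := by
  constructor
  · intro h i hi j hj h1 h2
    by_contra hij
    have := two_le_cn.mpr ⟨i, hi, j, hj, hij, h1, h2⟩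
    omega
  · intro h
    by_contra hc
    obtain ⟨i, hi, j, hj, hij, h1, h2⟩ := two_le_cn.mp (show 2 ≤ cn n p by omega)
    exact hij (h i hi j hj h1 h2)

lemma cn_le_two {n : ℕ} {p : ℕ → Prop} (h : cn n p ≤ 2) {i j k : ℕ} (hi : i < n) (hj : j < n)
    (hk : k < n) (h1 : p i) (h2 : p j) (h3 : p k) (hij : i ≠ j) : k = i ∨ k = j := by
  by_contra hc
  push Not at hc
  have := three_le_cn.mpr ⟨i, hi, j, hj, k, hk, hij, hc.1.symm, hc.2.symm, h1, h2, h3⟩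
  omega

lemma forall_of_cn_le {n : ℕ} {p q : ℕ → Prop} (h : cn n q ≤ cn n fun i => p i ∧ q i) :
    ∀ i < n, q i → p i := by
  classical
  intro i hi hq
  unfold cn at h
  have hsub : (Finset.range n).filter (fun i => p i ∧ q i) ⊆ (Finset.range n).filter q := fun j => by
    simp only [Finset.mem_filter]
    exact fun h => ⟨h.1, h.2.2⟩
  have := Finset.eq_of_subset_of_card_le hsub (by convert h)
  have hm : i ∈ (Finset.range n).filter q := by simp [hi, hq]
  rw [← this] at hm
  exact (Finset.mem_filter.mp hm).2.1

/-- There is no nonempty set in which all degrees are at least two. -/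
def Acyclic (n : ℕ) (R : ℕ → ℕ → Prop) : Prop :=
  ∀ S ⊆ Finset.range n, S.Nonempty → ¬ TwoClosed n R S

-- The handshake lemma for a relation restricted to a finite set.
open scoped Classical in
lemma even_sum_card {R : ℕ → ℕ → Prop} (D : Finset ℕ) (hs : ∀ x ∈ D, ∀ y ∈ D, R x y → R y x)
    (hi : ∀ x ∈ D, ¬ R x x) : Even (∑ x ∈ D, (D.filter (R x)).card) := by
  induction D using Finset.induction_on with
  | empty => simp
  | insert a D ha ih =>
    have hD := ih (fun x hx y hy => hs x (by simp [hx]) y (by simp [hy])) fun x hx => hi x (by simp [hx])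
    rw [Finset.sum_insert ha]
    have e1 : (insert a D).filter (R a) = D.filter (R a) := by
      rw [Finset.filter_insert, if_neg (hi a (by simp))]
    have e2 : ∀ x ∈ D, ((insert a D).filter (R x)).card =
        (D.filter (R x)).card + if R a x then 1 else 0 := by
      intro x hx
      rw [Finset.filter_insert]
      by_cases h : R x a
      · rw [if_pos h, if_pos (hs x (by simp [hx]) a (by simp) h), Finset.card_insert_of_notMem]
        simp [ha]
      · rw [if_neg h, if_neg fun h' => h (hs a (by simp) x (by simp [hx]) h'), Nat.add_zero]
    have e3 : ∑ x ∈ D, (if R a x then 1 else 0) = (D.filter (R a)).card := (Finset.card_filter _ _).symm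
    rw [Finset.sum_congr rfl e2, e1, Finset.sum_add_distrib, e3]
    obtain ⟨k, hk⟩ := hD
    exact ⟨k + (D.filter (R a)).card, by omega⟩

/-- Add the two edges from `u` to `g` and `h`. -/
def addPair (R : ℕ → ℕ → Prop) (u g h x y : ℕ) : Prop :=
  R x y ∨ x = u ∧ (y = g ∨ y = h) ∨ y = u ∧ (x = g ∨ x = h)

/-- A cycle created by the two new edges consists of `u` and a path of `R` from `g` to `h`. Such a
path is a whole component of `R`, since the degrees are at most two and those of `g` and `h` at most
one; this is expressed by closure and degrees. -/
lemma TwoClosed.of_addPair {n u g h : ℕ} {R : ℕ → ℕ → Prop} {S : Finset ℕ}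
    (hac : Acyclic n R) (hdeg : ∀ x < n, cn n (R x) ≤ 2) (hu : ∀ y < n, ¬ R u y)
    (hg1 : cn n (R g) ≤ 1) (hh1 : cn n (R h) ≤ 1) (hS : S ⊆ Finset.range n) (hne : S.Nonempty)
    (h2 : TwoClosed n (addPair R u g h) S) :
    u ∈ S ∧ g ∈ S ∧ h ∈ S ∧ (∀ x ∈ S, x ≠ u → ∀ y < n, R x y → y ∈ S) ∧
      (∀ x ∈ S, x ≠ u → x ≠ g → x ≠ h → cn n (R x) = 2) ∧ (h ≠ u → cn n (R h) = 1) := by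
  have huS : u ∈ S := by
    by_contra huS
    refine hac S hS hne (h2.mono fun x hx y hy hxy => ?_)
    rcases hxy with e | e | e
    · exact e
    · exact absurd (e.1 ▸ hx) huS
    · exact absurd (e.1 ▸ hy) huS
  have hgh : g ∈ S ∧ h ∈ S := by
    obtain ⟨i, hi, j, hj, hij, ⟨hiS, h3⟩, hjS, h4⟩ := two_le_cn.mp (h2 u huS)
    have key : ∀ y < n, y ∈ S → addPair R u g h u y → y = g ∨ y = h ∨ y = u ∧ (u = g ∨ u = h) := by
      rintro y hy - (e | e | e)
      · exact absurd e (hu y hy)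
      · exact e.2.imp_right Or.inl
      · exact .inr (.inr e)
    rcases key i hi hiS h3 with rfl | rfl | ⟨rfl, e⟩ <;> rcases key j hj hjS h4 with rfl | rfl | ⟨rfl, e'⟩ <;>
      grind
  have hle : ∀ x ∈ S, x ≠ u → (x ≠ g → x ≠ h → 2 ≤ cn n fun y => y ∈ S ∧ R x y) ∧
      1 ≤ cn n fun y => y ∈ S ∧ R x y := by
    intro x hx hxu
    obtain ⟨i, hi, j, hj, hij, ⟨hiS, h3⟩, hjS, h4⟩ := two_le_cn.mp (h2 x hx)
    have key : ∀ y, addPair R u g h x y → R x y ∨ y = u ∧ (x = g ∨ x = h) := by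
      rintro y (e | e | e)
      · exact .inl e
      · exact absurd e.1 hxu
      · exact .inr e
    refine ⟨fun n1 n2 => ?_, ?_⟩
    · refine two_le_cn.mpr ⟨i, hi, j, hj, hij, ⟨hiS, (key i h3).resolve_right ?_⟩, hjS,
        (key j h4).resolve_right ?_⟩
      · exact fun e => e.2.elim n1 n2
      · exact fun e => e.2.elim n1 n2
    · refine Nat.succ_le_iff.mpr (cn_pos.mpr ?_)
      rcases key i h3 with e | e
      · exact ⟨i, hi, hiS, e⟩
      · rcases key j h4 with e' | e'
        · exact ⟨j, hj, hjS, e'⟩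
        · exact absurd (e.1.trans e'.1.symm) hij
  have hmono : ∀ x, cn n (fun y => y ∈ S ∧ R x y) ≤ cn n (R x) := fun x => cn_mono fun y _ hy => hy.2
  refine ⟨huS, hgh.1, hgh.2, fun x hx hxu => forall_of_cn_le ?_, fun x hx hxu n1 n2 => ?_, fun hhu => ?_⟩
  · have := hle x hx hxu
    by_cases e1 : x = g
    · subst e1; omega
    by_cases e2 : x = h
    · subst e2; omega
    have := this.1 e1 e2
    have := hdeg x (Finset.mem_range.mp (hS hx))
    omega
  · have := (hle x hx hxu).1 n1 n2
    have := hmono x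
    have := hdeg x (Finset.mem_range.mp (hS hx))
    omega
  · have := (hle h hgh.2 hhu).2
    have := hmono h
    omega

/-- Among three possible neighbours two can be chosen without closing a cycle. -/
lemma acyclic_addPair {n u g h k : ℕ} {R : ℕ → ℕ → Prop} (hac : Acyclic n R)
    (hsymm : ∀ x < n, ∀ y < n, R x y → R y x) (hirr : ∀ x < n, ¬ R x x)
    (hdeg : ∀ x < n, cn n (R x) ≤ 2) (hu : ∀ y < n, ¬ R u y) (hhu : h ≠ u)
    (hg1 : cn n (R g) ≤ 1) (hh1 : cn n (R h) ≤ 1) (hk1 : cn n (R k) ≤ 1)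
    (hgh : g ≠ h) (hhk : h ≠ k) :
    Acyclic n (addPair R u g h) ∨ Acyclic n (addPair R u g k) := by
  classical
  by_contra hcon
  simp only [Acyclic, not_or, not_forall, not_not] at hcon
  obtain ⟨⟨S, hS, hne, h2⟩, T, hT, hne', h2'⟩ := hcon
  obtain ⟨a1, a2, a3, a4, a5, a6⟩ := h2.of_addPair hac hdeg hu hg1 hh1 hS hne
  obtain ⟨b1, b2, b3, b4, b5, b6⟩ := h2'.of_addPair hac hdeg hu hg1 hk1 hT hne'
  -- In `T` the vertices of degree one are `g` and `k` only.
  have hhT : h ∉ T := fun e => by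
    have := b5 h e hhu hgh.symm hhk
    omega
  have hlt : ∀ {x}, x ∈ S \ T → x < n := fun hx => Finset.mem_range.mp (hS (Finset.mem_sdiff.mp hx).1)
  -- Both sets are closed under `R` away from the isolated vertex `u`, so no edge leaves the
  -- difference. In it `h` is the only vertex of degree one and all others have degree two,
  -- contradicting the handshake lemma.
  have hcard : ∀ x ∈ S \ T, ((S \ T).filter (R x)).card = if x = h then 1 else 2 := by
    intro x hx
    have hx' := Finset.mem_sdiff.mp hx
    have hxu : x ≠ u := fun e => hx'.2 (e ▸ b1)
    have : ((S \ T).filter (R x)).card = cn n (R x) := by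
      unfold cn
      congr 1
      ext y
      simp only [Finset.mem_filter, Finset.mem_range]
      refine ⟨fun hy => ⟨hlt hy.1, hy.2⟩, fun hy => ⟨?_, hy.2⟩⟩
      refine Finset.mem_sdiff.mpr ⟨a4 x hx'.1 hxu y hy.1 hy.2, fun hyT => hx'.2 ?_⟩
      refine b4 y hyT ?_ x (hlt hx) (hsymm x (hlt hx) y hy.1 hy.2)
      rintro rfl
      exact hu x (hlt hx) (hsymm x (hlt hx) y hy.1 hy.2)
    rw [this]
    split_ifs with e
    · rw [e]; exact a6 hhu
    · exact a5 x hx'.1 hxu (fun e' => hx'.2 (e' ▸ b2)) e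
  have heven := even_sum_card (R := R) (S \ T)
    (fun x hx y hy => hsymm x (hlt hx) y (hlt hy)) fun x hx => hirr x (hlt hx)
  rw [Finset.sum_congr rfl hcard] at heven
  have hsplit : ∑ x ∈ S \ T, (if x = h then 1 else 2) + 1 = 2 * (S \ T).card := by
    have hmem : h ∈ S \ T := Finset.mem_sdiff.mpr ⟨a3, hhT⟩
    rw [← Finset.add_sum_erase _ _ hmem, if_pos rfl, Finset.sum_congr rfl (fun x hx =>
      if_neg (Finset.ne_of_mem_erase hx)), Finset.sum_const, Finset.card_erase_of_mem hmem, smul_eq_mul]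
    have := Finset.card_pos.mpr ⟨h, hmem⟩
    omega
  obtain ⟨r, hr⟩ := heven
  omega

/-- The vertices that may follow the first `i` ones in the greedy listing. -/
def ListCond (n : ℕ) (R : ℕ → ℕ → Prop) (out : ℕ → ℕ) (i y : ℕ) : Prop :=
  (∀ j < i, out j ≠ y) ∧ (0 < i ∧ R (out (i - 1)) y ∨
    (¬ ∃ z < n, (∀ j < i, out j ≠ z) ∧ 0 < i ∧ R (out (i - 1)) z) ∧ cn n (R y) ≤ 1)

lemma exists_forall_ne {i : ℕ} {W : Finset ℕ} (hi : i < W.card) (out : ℕ → ℕ) :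
    ∃ y ∈ W, ∀ j < i, out j ≠ y := by
  classical
  by_contra hc
  push Not at hc
  have hsub : W ⊆ (Finset.range i).image out := fun y hy => by
    obtain ⟨j, hj, e⟩ := hc y hy
    exact Finset.mem_image.mpr ⟨j, Finset.mem_range.mpr hj, e⟩
  have := (Finset.card_le_card hsub).trans Finset.card_image_le
  rw [Finset.card_range] at this
  omega

/-- An acyclic relation with degrees at most two is a union of paths. The rule follows a path while
it can and otherwise starts at an unlisted vertex of degree at most one, so each path is listed from
end to end; consecutive paths are joined by `hends`. -/
lemma listing {n : ℕ} {R A : ℕ → ℕ → Prop} {out : ℕ → ℕ} (hac : Acyclic n R)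
    (hsymm : ∀ x < n, ∀ y < n, R x y → R y x) (hirr : ∀ x < n, ¬ R x x)
    (hdeg : ∀ x < n, cn n (R x) ≤ 2) (hA : ∀ x < n, ∀ y < n, R x y → A x y)
    (hends : ∀ x < n, ∀ y < n, x ≠ y → cn n (R x) ≤ 1 → cn n (R y) ≤ 1 → A x y)
    (hout : ∀ i < n, (∃ y < n, ListCond n R out i y) → out i < n ∧ ListCond n R out i (out i))
    (hn : 2 ≤ n) :
    (∀ i < n, out i < n) ∧ (∀ i < n, ∀ j < n, out i = out j → i = j) ∧
      (∀ i, i + 1 < n → A (out i) (out (i + 1))) ∧ A (out (n - 1)) (out 0) := by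
  classical
  have base : out 0 < n ∧ cn n (R (out 0)) ≤ 1 := by
    obtain ⟨h1, h2⟩ := hout 0 (by omega) (by
      by_contra hno
      refine hac _ subset_rfl ⟨0, by simp; omega⟩ fun x hx => ?_
      by_contra hx2
      refine hno ⟨x, Finset.mem_range.mp hx, by simp, .inr ⟨by simp, ?_⟩⟩
      have : cn n (R x) = cn n fun y => y ∈ Finset.range n ∧ R x y :=
        cn_congr fun y hy => by simp [hy]
      omega)
    exact ⟨h1, (h2.2.resolve_left (by simp)).2⟩
  -- Invariant: all neighbours of the entries before the last are listed, and the last entry has at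
  -- most one listed and at most one unlisted neighbour.
  have key : ∀ i, i < n → (∀ j ≤ i, out j < n) ∧ (∀ j ≤ i, ∀ k < j, out k ≠ out j) ∧
      (∀ j < i, A (out j) (out (j + 1))) ∧
      (∀ j < i, ∀ y < n, R (out j) y → ∃ k ≤ i, out k = y) ∧
      (cn n (fun y => R (out i) y ∧ ∃ k ≤ i, out k = y) ≤ 1) ∧
      (cn n (fun y => R (out i) y ∧ ¬ ∃ k ≤ i, out k = y) ≤ 1) := by
    intro i
    induction i with
    | zero =>
      refine fun _ => ⟨?_, ?_, by simp, by simp, ?_, ?_⟩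
      · rintro j hj
        obtain rfl : j = 0 := by omega
        exact base.1
      · intro j hj k hk
        omega
      · exact (cn_mono fun y _ hy => hy.1).trans base.2
      · exact (cn_mono fun y _ hy => hy.1).trans base.2
    | succ i ih =>
      intro hi
      obtain ⟨h1, h2, h3, h4, h5, h6⟩ := ih (by omega)
      have hvis : ∀ y, (∀ j < i + 1, out j ≠ y) ↔ ¬ ∃ k ≤ i, out k = y := fun y => by
        constructor
        · rintro h ⟨k, hk, e⟩
          exact h k (by omega) e
        · intro h j hj e
          exact h ⟨j, by omega, e⟩
      have hc := h1 i le_rfl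
      by_cases hcase : ∃ z < n, (∀ j < i + 1, out j ≠ z) ∧ R (out i) z
      · obtain ⟨z, hz, hz1, hz2⟩ := hcase
        obtain ⟨o1, o2, o3⟩ := hout (i + 1) hi ⟨z, hz, hz1, .inl ⟨by omega, by simpa using hz2⟩⟩
        have o4 : R (out i) (out (i + 1)) := by
          rcases o3 with e | e
          · simpa using e.2
          · exact absurd ⟨z, hz, hz1, by omega, by simpa using hz2⟩ e.1
        have hback : ∀ k ≤ i, R (out (i + 1)) (out k) → k = i := by
          intro k hk hR
          by_contra hne
          obtain ⟨l, hl, e⟩ := h4 k (by omega) _ o1 (hsymm _ o1 _ (h1 k hk) hR)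
          exact o2 l (by omega) e
        refine ⟨fun j hj => ?_, fun j hj k hk => ?_, fun j hj => ?_, fun j hj y hy hR => ?_, ?_, ?_⟩
        · rcases Nat.le_succ_iff.mp hj with e | rfl
          exacts [h1 j e, o1]
        · rcases Nat.le_succ_iff.mp hj with e | rfl
          exacts [h2 j e k hk, o2 k hk]
        · rcases Nat.lt_succ_iff_lt_or_eq.mp hj with e | rfl
          exacts [h3 j e, hA _ hc _ o1 o4]
        · rcases Nat.lt_succ_iff_lt_or_eq.mp hj with e | rfl
          · obtain ⟨k, hk, e⟩ := h4 j e y hy hR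
            exact ⟨k, by omega, e⟩
          · by_cases hv : ∃ k ≤ j, out k = y
            · obtain ⟨k, hk, e⟩ := hv
              exact ⟨k, by omega, e⟩
            · exact ⟨j + 1, le_rfl, cn_le_one.mp h6 _ o1 _ hy ⟨o4, (hvis _).mp o2⟩ ⟨hR, hv⟩⟩
        · have hk' : ∀ y < n, R (out (i + 1)) y → (∃ k ≤ i + 1, out k = y) → y = out i := by
            rintro y hy hR ⟨k, hk, rfl⟩
            rcases Nat.le_succ_iff.mp hk with e | rfl
            · rw [hback k e hR]
            · exact absurd hR (hirr _ hy)
          exact cn_le_one.mpr fun a ha b hb e e' =>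
            (hk' a ha e.1 e.2).trans (hk' b hb e'.1 e'.2).symm
        · refine cn_le_one.mpr fun a ha b hb e e' => ?_
          by_contra hab
          have ho := hsymm _ hc _ o1 o4
          rcases cn_le_two (hdeg _ o1) ha hb hc e.1 e'.1 ho hab with r | r
          · exact e.2 ⟨i, by omega, r⟩
          · exact e'.2 ⟨i, by omega, r⟩
      · have hclosed : ∀ k ≤ i, ∀ y < n, R (out k) y → ∃ l ≤ i, out l = y := by
          intro k hk y hy hR
          rcases Nat.lt_or_eq_of_le hk with e | rfl
          · exact h4 k e y hy hR
          · by_contra hno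
            exact hcase ⟨y, hy, (hvis y).mpr hno, hR⟩
        obtain ⟨o1, o2, o3⟩ := hout (i + 1) hi (by
          by_contra hno
          -- No edge leads from the unlisted vertices to listed ones, so acyclicity provides an
          -- unlisted vertex of degree at most one in `R`.
          set U := (Finset.range n).filter fun y => ∀ j < i + 1, out j ≠ y with hU
          obtain ⟨y₀, hy₀, hy₁⟩ := exists_forall_ne (W := Finset.range n) (by simpa using hi) out
          refine hac U (Finset.filter_subset _ _) ⟨y₀, Finset.mem_filter.mpr ⟨hy₀, hy₁⟩⟩ fun x hx => ?_
          obtain ⟨hxn, hxv⟩ := Finset.mem_filter.mp hx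
          rw [Finset.mem_range] at hxn
          by_contra hx2
          refine hno ⟨x, hxn, hxv, .inr ⟨?_, ?_⟩⟩
          · rintro ⟨z, hz, hz1, -, hz2⟩
            exact hcase ⟨z, hz, hz1, by simpa using hz2⟩
          · have : cn n (R x) ≤ cn n fun y => y ∈ U ∧ R x y := by
              refine cn_mono fun y hy hR => ⟨Finset.mem_filter.mpr ⟨Finset.mem_range.mpr hy, ?_⟩, hR⟩
              rintro j hj rfl
              obtain ⟨l, hl, e⟩ := hclosed j (by omega) x hxn (hsymm _ hxn _ hy hR)
              exact hxv l (by omega) e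
            omega)
        have o4 : cn n (R (out (i + 1))) ≤ 1 := by
          rcases o3 with e | e
          · exact absurd ⟨_, o1, o2, by simpa using e.2⟩ hcase
          · exact e.2
        -- All neighbours of the last entry are listed and there is at most one of them: a path has
        -- been finished.
        have o5 : cn n (R (out i)) ≤ 1 :=
          (cn_mono fun y hy hR => ⟨hR, hclosed i le_rfl y hy hR⟩).trans h5
        refine ⟨fun j hj => ?_, fun j hj k hk => ?_, fun j hj => ?_, fun j hj y hy hR => ?_, ?_, ?_⟩
        · rcases Nat.le_succ_iff.mp hj with e | rfl
          exacts [h1 j e, o1]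
        · rcases Nat.le_succ_iff.mp hj with e | rfl
          exacts [h2 j e k hk, o2 k hk]
        · rcases Nat.lt_succ_iff_lt_or_eq.mp hj with e | rfl
          exacts [h3 j e, hends _ hc _ o1 (o2 j (by omega)) o5 o4]
        · obtain ⟨l, hl, e⟩ := hclosed j (by omega) y hy hR
          exact ⟨l, by omega, e⟩
        · exact (cn_mono fun y _ hy => hy.1).trans o4
        · exact (cn_mono fun y _ hy => hy.1).trans o4
  obtain ⟨h1, h2, h3, h4, h5, -⟩ := key (n - 1) (by omega)
  have hinj : ∀ i < n, ∀ j < n, out i = out j → i = j := by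
    intro i hi j hj e
    rcases lt_trichotomy i j with h | h | h
    · exact absurd e (h2 j (by omega) i h)
    · exact h
    · exact absurd e.symm (h2 i (by omega) j h)
  have hsurj : ∀ y < n, ∃ k ≤ n - 1, out k = y := by
    intro y hy
    have hsub : (Finset.range n).image out ⊆ Finset.range n := fun x hx => by
      obtain ⟨k, hk, rfl⟩ := Finset.mem_image.mp hx
      exact Finset.mem_range.mpr (h1 k (by have := Finset.mem_range.mp hk; omega))
    have hcard : ((Finset.range n).image out).card = n := by
      rw [Finset.card_image_of_injOn, Finset.card_range]
      intro a ha b hb e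
      exact hinj a (by simpa using ha) b (by simpa using hb) e
    have := Finset.eq_of_subset_of_card_le hsub (by rw [hcard, Finset.card_range])
    have hy' : y ∈ (Finset.range n).image out := by rw [this]; exact Finset.mem_range.mpr hy
    obtain ⟨k, hk, e⟩ := Finset.mem_image.mp hy'
    exact ⟨k, by have := Finset.mem_range.mp hk; omega, e⟩
  refine ⟨fun i hi => h1 i (by omega), hinj, fun i hi => h3 i (by omega), ?_⟩
  refine hends _ (h1 _ le_rfl) _ base.1 (fun e => ?_) ?_ base.2
  · have := hinj _ (by omega) _ (by omega) e
    omega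
  · exact (cn_mono fun y hy hR => ⟨hR, hsurj y hy⟩).trans h5

/-- Listing a minimal set in which all degrees are two. -/
lemma listing_cycle {n : ℕ} {R : ℕ → ℕ → Prop} {out : ℕ → ℕ} {W : Finset ℕ}
    (hW : W ⊆ Finset.range n) (hne : W.Nonempty)
    (hsymm : ∀ x < n, ∀ y < n, R x y → R y x) (hirr : ∀ x < n, ¬ R x x)
    (hdeg : ∀ x ∈ W, (cn n fun y => y ∈ W ∧ R x y) = 2)
    (hmin : ∀ S ⊆ W, S.Nonempty → TwoClosed n R S → S = W)
    (hout : ∀ i < W.card, (∃ y < n, y ∈ W ∧ (∀ j < i, out j ≠ y) ∧ (i = 0 ∨ R (out (i - 1)) y)) →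
      out i ∈ W ∧ (∀ j < i, out j ≠ out i) ∧ (i = 0 ∨ R (out (i - 1)) (out i))) :
    3 ≤ W.card ∧ (∀ i < W.card, out i ∈ W) ∧ (∀ i < W.card, ∀ j < W.card, out i = out j → i = j) ∧
      (∀ i, i + 1 < W.card → R (out i) (out (i + 1))) ∧ R (out (W.card - 1)) (out 0) := by
  classical
  have hlt : ∀ {x}, x ∈ W → x < n := fun hx => Finset.mem_range.mp (hW hx)
  have h3 : 3 ≤ W.card := by
    obtain ⟨x, hx⟩ := hne
    obtain ⟨i, hi, j, hj, hij, ⟨hiW, hxi⟩, hjW, hxj⟩ := two_le_cn.mp (hdeg x hx).ge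
    refine Finset.two_lt_card_iff.mpr ⟨x, i, j, hx, hiW, hjW, ?_, ?_, hij⟩
    · rintro rfl
      exact hirr _ hi hxi
    · rintro rfl
      exact hirr _ hj hxj
  have h0 : out 0 ∈ W := by
    obtain ⟨x, hx⟩ := hne
    exact (hout 0 (by omega) ⟨x, hlt hx, hx, by simp, .inl rfl⟩).1
  -- the only visited neighbour of the last vertex besides its predecessor is the first vertex
  have hback : ∀ i, i < W.card → (∀ j ≤ i, out j ∈ W) → (∀ j ≤ i, ∀ k < j, out k ≠ out j) →
      (∀ j < i, R (out j) (out (j + 1))) → ∀ k < i, R (out i) (out k) → k = 0 ∨ k + 1 = i := by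
    intro i hi h1 h2 h3 k hk hR
    by_contra hcon
    push Not at hcon
    have hnb := hsymm _ (hlt (h1 i le_rfl)) _ (hlt (h1 k (by omega))) hR
    have e1 : R (out k) (out (k - 1)) := by
      have := h3 (k - 1) (by omega)
      rw [show k - 1 + 1 = k by omega] at this
      exact hsymm _ (hlt (h1 _ (by omega))) _ (hlt (h1 _ (by omega))) this
    rcases cn_le_two (hdeg (out k) (h1 k (by omega))).le (hlt (h1 (k - 1) (by omega)))
      (hlt (h1 (k + 1) (by omega))) (hlt (h1 i le_rfl)) ⟨h1 _ (by omega), e1⟩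
      ⟨h1 _ (by omega), h3 k hk⟩ ⟨h1 i le_rfl, hnb⟩ (h2 (k + 1) (by omega) (k - 1) (by omega)) with r | r
    · exact h2 i le_rfl (k - 1) (by omega) r.symm
    · exact h2 i le_rfl (k + 1) (by omega) r.symm
  -- If the list cannot continue, both neighbours of the last entry are listed, and one of them is
  -- not its predecessor; by `hback` it is the first entry.
  have hclose : ∀ i, 2 ≤ i → i < W.card → (∀ j ≤ i, out j ∈ W) → (∀ j ≤ i, ∀ k < j, out k ≠ out j) →
      (∀ j < i, R (out j) (out (j + 1))) →
      (∀ y ∈ W, R (out i) y → ∃ k ≤ i, out k = y) → R (out i) (out 0) := by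
    intro i h2i hi h1 h2 h3 h4
    obtain ⟨a, ha, b, hb, hab, ⟨haW, hxa⟩, hbW, hxb⟩ := two_le_cn.mp (hdeg _ (h1 i le_rfl)).ge
    obtain ⟨k, hk, rfl⟩ := h4 a haW hxa
    obtain ⟨l, hl, rfl⟩ := h4 b hbW hxb
    have hk' : k < i := lt_of_le_of_ne hk (by rintro rfl; exact hirr _ ha hxa)
    have hl' : l < i := lt_of_le_of_ne hl (by rintro rfl; exact hirr _ hb hxb)
    rcases hback i hi h1 h2 h3 k hk' hxa with rfl | e
    · exact hxa
    rcases hback i hi h1 h2 h3 l hl' hxb with rfl | e'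
    · exact hxb
    · exact absurd (by rw [show k = l by omega]) hab
  have key : ∀ i, i < W.card → (∀ j ≤ i, out j ∈ W) ∧ (∀ j ≤ i, ∀ k < j, out k ≠ out j) ∧
      (∀ j < i, R (out j) (out (j + 1))) := by
    intro i
    induction i with
    | zero =>
      refine fun _ => ⟨?_, ?_, by simp⟩
      · rintro j hj
        obtain rfl : j = 0 := by omega
        exact h0
      · intro j hj k hk
        omega
    | succ i ih =>
      intro hi
      obtain ⟨h1, h2, h3'⟩ := ih (by omega)
      obtain ⟨o1, o2, o3⟩ := hout (i + 1) hi (by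
        by_contra hno
        have hall : ∀ y ∈ W, R (out i) y → ∃ k ≤ i, out k = y := by
          intro y hy hR
          by_contra hnv
          refine hno ⟨y, hlt hy, hy, fun j hj e => hnv ⟨j, by omega, e⟩, .inr (by simpa using hR)⟩
        have h2i : 2 ≤ i := by
          by_contra hlt2
          obtain ⟨a, ha, b, hb, hab, ⟨haW, hxa⟩, hbW, hxb⟩ := two_le_cn.mp (hdeg _ (h1 i le_rfl)).ge
          obtain ⟨k, hk, rfl⟩ := hall a haW hxa
          obtain ⟨l, hl, rfl⟩ := hall b hbW hxb
          have hk' : k ≠ i := by rintro rfl; exact hirr _ ha hxa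
          have hl' : l ≠ i := by rintro rfl; exact hirr _ hb hxb
          exact hab (by rw [show k = l by omega])
        have hcl := hclose i h2i (by omega) h1 h2 h3' hall
        -- A list that closes up early would be a proper subset of `W` with all degrees at least
        -- two, against minimality.
        set P := (Finset.range (i + 1)).image out with hP
        have hPm : ∀ k ≤ i, out k ∈ P := fun k hk =>
          Finset.mem_image.mpr ⟨k, Finset.mem_range.mpr (by omega), rfl⟩
        have hPW : P ⊆ W := fun x hx => by
          obtain ⟨k, hk, rfl⟩ := Finset.mem_image.mp hx
          exact h1 k (by have := Finset.mem_range.mp hk; omega)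
        have h2P : TwoClosed n R P := by
          intro x hx
          obtain ⟨k, hk, rfl⟩ := Finset.mem_image.mp hx
          have hk : k ≤ i := by have := Finset.mem_range.mp hk; omega
          have hprev : 0 < k → R (out k) (out (k - 1)) := fun h0 => by
            have := h3' (k - 1) (by omega)
            rw [show k - 1 + 1 = k by omega] at this
            exact hsymm _ (hlt (h1 _ (by omega))) _ (hlt (h1 _ (by omega))) this
          by_cases hk0 : k = 0
          · subst hk0
            refine two_le_cn.mpr ⟨out 1, hlt (h1 1 (by omega)), out i, hlt (h1 i le_rfl),
              h2 i le_rfl 1 (by omega), ⟨hPm 1 (by omega), h3' 0 (by omega)⟩, hPm i le_rfl,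
              hsymm _ (hlt (h1 i le_rfl)) _ (hlt h0) hcl⟩
          by_cases hki : k = i
          · subst hki
            exact two_le_cn.mpr ⟨out 0, hlt h0, out (k - 1), hlt (h1 _ (by omega)),
              h2 (k - 1) (by omega) 0 (by omega), ⟨hPm 0 (by omega), hcl⟩, hPm _ (by omega),
              hprev (by omega)⟩
          · exact two_le_cn.mpr ⟨out (k - 1), hlt (h1 _ (by omega)), out (k + 1),
              hlt (h1 _ (by omega)), h2 (k + 1) (by omega) (k - 1) (by omega),
              ⟨hPm _ (by omega), hprev (by omega)⟩, hPm _ (by omega), h3' k (by omega)⟩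
        have e := hmin P hPW ⟨out 0, hPm 0 (by omega)⟩ h2P
        have : P.card ≤ i + 1 := by
          have := Finset.card_image_le (s := Finset.range (i + 1)) (f := out)
          rwa [Finset.card_range] at this
        rw [e] at this
        omega)
      refine ⟨fun j hj => ?_, fun j hj k hk => ?_, fun j hj => ?_⟩
      · rcases Nat.le_succ_iff.mp hj with e | rfl
        exacts [h1 j e, o1]
      · rcases Nat.le_succ_iff.mp hj with e | rfl
        exacts [h2 j e k hk, o2 k hk]
      · rcases Nat.lt_succ_iff_lt_or_eq.mp hj with e | rfl
        · exact h3' j e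
        · simpa using o3
  obtain ⟨h1, h2, h3'⟩ := key (W.card - 1) (by omega)
  have hinj : ∀ i < W.card, ∀ j < W.card, out i = out j → i = j := by
    intro i hi j hj e
    rcases lt_trichotomy i j with h | h | h
    · exact absurd e (h2 j (by omega) i h)
    · exact h
    · exact absurd e.symm (h2 i (by omega) j h)
  refine ⟨h3, fun i hi => h1 i (by omega), hinj, fun i hi => h3' i (by omega), ?_⟩
  refine hclose _ (by omega) (by omega) h1 h2 h3' fun y hy _ => ?_
  have hsub : (Finset.range W.card).image out ⊆ W := fun x hx => by
    obtain ⟨k, hk, rfl⟩ := Finset.mem_image.mp hx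
    exact h1 k (by have := Finset.mem_range.mp hk; omega)
  have hcard : ((Finset.range W.card).image out).card = W.card := by
    rw [Finset.card_image_of_injOn, Finset.card_range]
    intro a ha b hb e
    exact hinj a (by simpa using ha) b (by simpa using hb) e
  have := Finset.eq_of_subset_of_card_le hsub hcard.ge
  rw [← this] at hy
  obtain ⟨k, hk, e⟩ := Finset.mem_image.mp hy
  exact ⟨k, by have := Finset.mem_range.mp hk; omega, e⟩

end RAM

/-! ### Finding a Hamiltonian cycle from bounded information -/

namespace SimpleGraph

variable {V : Type*} {G : SimpleGraph V} {K I : Finset V}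

/-- The neighbour relation of a Hamiltonian cycle. -/
lemma IsHamiltonian.exists_rel [Fintype V] [DecidableEq V] (h : G.IsHamiltonian)
    (h1 : 1 < Fintype.card V) :
    ∃ M : V → V → Prop, (∀ x y, M x y → M y x) ∧ (∀ x y, M x y → G.Adj x y) ∧
      (∀ x, ∃ a b, a ≠ b ∧ ∀ y, M x y ↔ y = a ∨ y = b) ∧
      ∀ S : Set V, S.Nonempty → (∀ x ∈ S, ∀ y, M x y → y ∈ S) → ∀ x, x ∈ S := by
  obtain ⟨b, p, hp⟩ := h (by omega)
  have hall : ∀ v, v ∈ p.support := fun v => hp.mem_support v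
  refine ⟨p.toSubgraph.Adj, fun x y h => h.symm, fun x y h => h.adj_sub, fun x => ?_, ?_⟩
  · obtain ⟨a, b, hab, e⟩ := Set.ncard_eq_two.mp
      (hp.isCycle.ncard_neighborSet_toSubgraph_eq_two (hall x))
    refine ⟨a, b, hab, fun y => ?_⟩
    rw [← Subgraph.mem_neighborSet, e]
    simp
  · rintro S ⟨a, ha⟩ hS x
    have haS := hall a
    refine Walk.mem_of_closed_edges (p.rotate a haS) ha (fun x y hxy hx => hS x hx y ?_) x
      (by rw [Walk.mem_support_rotate_iff]; exact hall x)
    rw [Walk.adj_toSubgraph_iff_mem_edges]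
    exact (p.rotate_edges a haS).mem_iff.mp hxy

/-- The edges between the two sides that are compatible with `F` at the vertices `z r`. -/
def restrictAdj (G : SimpleGraph V) (K I : Finset V) (F : V → V → Prop) (z : Fin 11 → V) (a b : V) :
    Prop :=
  G.crossAdj K I a b ∧ ∀ r, (a = z r → F a b) ∧ (b = z r → F a b)

/-- What a greedy choice of edges needs: a relation `F` and vertices `z r` such that every acyclic
selection of the edges compatible with `F` at the vertices `z r` extends to a Hamiltonian cycle. -/
structure IsGuide (G : SimpleGraph V) (K I : Finset V) (F : V → V → Prop) (z : Fin 11 → V) : Prop where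
  symm : ∀ x y, F x y → F y x
  deg : ∀ x, ∃ p q, ∀ y, F x y → y = p ∨ y = q
  acyclic : ∀ S : Finset V, S.Nonempty → ∃ x ∈ S, ∀ a ∈ S, ∀ b ∈ S, F x a → F x b → a = b
  degK : ∀ g ∈ K, ∀ a b c, G.restrictAdj K I F z g a → G.restrictAdj K I F z g b →
    G.restrictAdj K I F z g c → a = b ∨ a = c ∨ b = c
  forced : ∀ u ∈ I, (∀ a b c, G.restrictAdj K I F z u a → G.restrictAdj K I F z u b →
    G.restrictAdj K I F z u c → a = b ∨ a = c ∨ b = c) → ∀ g, G.restrictAdj K I F z u g → F u g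
  ends : ∀ F' : V → V → Prop, (∀ x y, F' x y → F' y x) →
    (∀ x y, F' x y → G.restrictAdj K I F z x y) →
    (∀ u ∈ I, ∀ a, G.restrictAdj K I F z u a → ∃ a, F' u a) →
    (∀ u ∈ I, ∀ a b, a ≠ b → G.restrictAdj K I F z u a → G.restrictAdj K I F z u b →
      ∃ a b, a ≠ b ∧ F' u a ∧ F' u b) →
    ∀ x y, x ≠ y → (∀ a b, F' x a → F' x b → a = b) → (∀ a b, F' y a → F' y b → a = b) → G.Adj x y

/-- Three admissible edges at `g` would be all its edges to `I`, among them the one to the hub `z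
r`. Being admissible it belongs to `F`, so `g` is itself some `z r'`, where only the at most two
edges of `F` are admissible. -/
lemma SplitFacts.degK_of_hub (h : G.SplitFacts K I) {F : V → V → Prop} {z : Fin 11 → V}
    (hdeg : ∀ x, ∃ p q, ∀ y, F x y → y = p ∨ y = q)
    (hub : ∀ g ∈ K, ∀ a ∈ I, ∀ b ∈ I, ∀ c ∈ I, G.Adj g a → G.Adj g b → G.Adj g c → a ≠ b → a ≠ c →
      b ≠ c → ∃ r, z r ∈ I ∧ G.Adj g (z r) ∧ (F g (z r) → ∃ r', g = z r')) :
    ∀ g ∈ K, ∀ a b c, G.restrictAdj K I F z g a → G.restrictAdj K I F z g b →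
      G.restrictAdj K I F z g c → a = b ∨ a = c ∨ b = c := by
  intro g hg a b c ha hb hc
  by_contra hcon
  push Not at hcon
  obtain ⟨hab, hac, hbc⟩ := hcon
  have haI := h.mem_right' ha.1 hg
  have hbI := h.mem_right' hb.1 hg
  have hcI := h.mem_right' hc.1 hg
  obtain ⟨r, hrI, hgr, hr⟩ := hub g hg a haI b hbI c hcI ha.1.1 hb.1.1 hc.1.1 hab hac hbc
  have hF : F g (z r) := by
    rcases h.four g hg a haI b hbI c hcI _ hrI ha.1.1 hb.1.1 hc.1.1 hgr hab hac hbc with e | e | e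
    · exact e ▸ (ha.2 r).2 e.symm
    · exact e ▸ (hb.2 r).2 e.symm
    · exact e ▸ (hc.2 r).2 e.symm
  obtain ⟨r', hr'⟩ := hr hF
  obtain ⟨p, q, hpq⟩ := hdeg g
  have ha' := hpq a ((ha.2 r').1 hr')
  have hb' := hpq b ((hb.2 r').1 hr')
  have hc' := hpq c ((hc.2 r').1 hr')
  grind

open scoped Classical in
lemma sum_card_filter_comm {F : V → V → Prop} (hs : ∀ x y, F x y → F y x) :
    ∑ u ∈ I, (K.filter (F u)).card = ∑ g ∈ K, (I.filter (F g)).card := by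
  simp only [Finset.card_filter]
  rw [Finset.sum_comm]
  refine Finset.sum_congr rfl fun g _ => Finset.sum_congr rfl fun u _ => ?_
  by_cases h : F u g
  · rw [if_pos h, if_pos (hs _ _ h)]
  · rw [if_neg h, if_neg fun hgu => h (hs _ _ hgu)]

/-- Vertices through which all clique vertices with three outer neighbours are controlled. -/
lemma SplitFacts.exists_hub (h : G.SplitFacts K I) {F : V → V → Prop} (hs : ∀ x y, F x y → F y x)
    (hdeg : ∀ x, ∃ p q, ∀ y, F x y → y = p ∨ y = q) (u₀ x₀ : V) :
    ∃ z : Fin 11 → V, z 9 = u₀ ∧ z 10 = x₀ ∧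
      ∀ g ∈ K, ∀ a ∈ I, ∀ b ∈ I, ∀ c ∈ I, G.Adj g a → G.Adj g b → G.Adj g c → a ≠ b → a ≠ c →
        b ≠ c → ∃ r, z r ∈ I ∧ G.Adj g (z r) ∧ (F g (z r) → ∃ r', g = z r') := by
  by_cases hT : ∃ v ∈ K, ∃ a ∈ I, ∃ b ∈ I, ∃ c ∈ I, G.Adj v a ∧ G.Adj v b ∧ G.Adj v c ∧ a ≠ b ∧
      a ≠ c ∧ b ≠ c
  · obtain ⟨v, hv, a, ha, b, hb, c, hc, va, vb, vc, hab, hac, hbc⟩ := hT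
    obtain ⟨p, q, hpq⟩ := hdeg a
    obtain ⟨p', q', hpq'⟩ := hdeg b
    obtain ⟨p'', q'', hpq''⟩ := hdeg c
    -- The three neighbours of one clique vertex meet the neighbourhood of every clique vertex;
    -- three hubs, their at most six neighbours in `F`, and two places for the removed edge make
    -- eleven.
    refine ⟨![a, b, c, p, q, p', q', p'', q'', u₀, x₀], rfl, rfl, ?_⟩
    intro g hg _ _ _ _ _ _ _ _ _ _ _ _
    rcases h.hit v hv a ha b hb c hc va vb vc hab hac hbc g hg with e | e | e
    · refine ⟨0, ha, e, fun hF => ?_⟩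
      rcases hpq g (hs _ _ hF) with e | e
      exacts [⟨3, e⟩, ⟨4, e⟩]
    · refine ⟨1, hb, e, fun hF => ?_⟩
      rcases hpq' g (hs _ _ hF) with e | e
      exacts [⟨5, e⟩, ⟨6, e⟩]
    · refine ⟨2, hc, e, fun hF => ?_⟩
      rcases hpq'' g (hs _ _ hF) with e | e
      exacts [⟨7, e⟩, ⟨8, e⟩]
  · refine ⟨![u₀, u₀, u₀, u₀, u₀, u₀, u₀, u₀, u₀, u₀, x₀], rfl, rfl, ?_⟩
    intro g hg a ha b hb c hc ga gb gc hab hac hbc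
    exact absurd ⟨g, hg, a, ha, b, hb, c, hc, ga, gb, gc, hab, hac, hbc⟩ hT

/-- `F` consists of the edges of a Hamiltonian cycle between `K` and `I`, less one edge if these
form the whole cycle. The greedy selection need not agree with `F` away from the hubs; only its
degrees matter. -/
lemma SplitFacts.exists_guide [Fintype V] [DecidableEq V] (h : G.SplitFacts K I)
    (hH : G.IsHamiltonian) : ∃ F z, G.IsGuide K I F z := by
  classical
  have h8 := h.eight_le
  have hcard : 1 < Fintype.card V := by
    have := Finset.card_le_univ I
    omega
  obtain ⟨M, hMs, hMA, hM2, hMc⟩ := hH.exists_rel hcard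
  set E : V → V → Prop := fun a b => G.crossAdj K I a b ∧ M a b with hE
  have hEs : ∀ x y, E x y → E y x := fun x y hxy => ⟨hxy.1.symm, hMs _ _ hxy.2⟩
  have hEd : ∀ x, ∃ p q, ∀ y, E x y → y = p ∨ y = q := fun x => by
    obtain ⟨a, b, -, hab⟩ := hM2 x
    exact ⟨a, b, fun y hy => (hab y).mp hy.2⟩
  have hE2 : ∀ u ∈ I, ∃ a b, a ≠ b ∧ ∀ y, E u y ↔ y = a ∨ y = b := by
    intro u hu
    obtain ⟨a, b, hab, hy⟩ := hM2 u
    refine ⟨a, b, hab, fun y => ⟨fun e => (hy y).mp e.2, fun e => ?_⟩⟩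
    have hm := (hy y).mpr e
    have hadj := hMA _ _ hm
    exact ⟨⟨hadj, .inl ⟨hu, (h.cover y).resolve_right fun hI => h.indep u hu y hI hadj⟩⟩, hm⟩
  -- Where two cross edges of the cycle stay in `S`, these are all its edges there, so a set with
  -- this property everywhere is closed under the cycle and contains every vertex.
  have hclosed : ∀ S : Finset V, S.Nonempty → (∀ x ∈ S, ∃ a ∈ S, ∃ b ∈ S, a ≠ b ∧ E x a ∧ E x b) →
      ∀ x, x ∈ S := by
    intro S hS h2 x
    refine hMc (S : Set V) (by exact_mod_cast hS) (fun x hx y hxy => ?_) x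
    obtain ⟨a, ha, b, hb, hab, ea, eb⟩ := h2 x hx
    obtain ⟨p, q, hpq, hy⟩ := hM2 x
    have h1 := (hy a).mp ea.2
    have h2 := (hy b).mp eb.2
    have h3 := (hy y).mp hxy
    have : y = a ∨ y = b := by grind
    rcases this with rfl | rfl <;> simpa
  have hKle : ∀ x, ∀ S : Finset V, ∀ F : V → V → Prop, (∃ p q, ∀ y, F x y → y = p ∨ y = q) →
      (S.filter (F x)).card ≤ 2 := by
    rintro x S F ⟨p, q, hpq⟩
    refine (Finset.card_le_card (t := {p, q}) fun y hy => ?_).trans Finset.card_le_two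
    simpa using hpq y (Finset.mem_filter.mp hy).2
  have hcount : ∀ F : V → V → Prop, (∀ x y, F x y → F y x) →
      (∀ x, ∃ p q, ∀ y, F x y → y = p ∨ y = q) →
      (∀ g ∈ K, ∃ a ∈ I, ∃ b ∈ I, a ≠ b ∧ F g a ∧ F g b) → K.card ≤ I.card := by
    intro F hs hd h2
    have hsum := sum_card_filter_comm (K := K) (I := I) hs
    have hI : ∑ u ∈ I, (K.filter (F u)).card ≤ ∑ u ∈ I, 2 :=
      Finset.sum_le_sum fun u _ => hKle u K F (hd u)
    have hK : ∑ u ∈ K, 2 ≤ ∑ g ∈ K, (I.filter (F g)).card := by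
      refine Finset.sum_le_sum fun g hg => ?_
      obtain ⟨a, ha, b, hb, hab, ea, eb⟩ := h2 g hg
      exact Finset.one_lt_card.mpr ⟨a, by simp [ea, ha], b, by simp [eb, hb], hab⟩
    simp only [Finset.sum_const, smul_eq_mul] at hI hK
    omega
  -- If `K` is larger, not all clique vertices have two cross edges on the cycle, so the cross edges
  -- form paths. Every vertex of `I` gets degree two in the selection, so vertices of lower degree
  -- are in the clique.
  by_cases hkm : I.card < K.card
  · obtain ⟨u₀, hu₀⟩ := Finset.card_pos.mp (show 0 < I.card by omega)
    obtain ⟨z, -, -, hub⟩ := h.exists_hub hEs hEd u₀ u₀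
    have hFB : ∀ x y, E x y → G.restrictAdj K I E z x y := fun x y hxy =>
      ⟨hxy.1, fun r => ⟨fun _ => hxy, fun _ => hxy⟩⟩
    refine ⟨E, z, hEs, hEd, ?_, h.degK_of_hub hEd hub, ?_, ?_⟩
    · intro S hS
      by_contra hcon
      push Not at hcon
      have hall := hclosed S hS fun x hx => by
        obtain ⟨a, ha, b, hb, ea, eb, hab⟩ := hcon x hx
        exact ⟨a, ha, b, hb, hab, ea, eb⟩
      refine absurd (hcount E hEs hEd fun g hg => ?_) (by omega)
      obtain ⟨a, -, b, -, ea, eb, hab⟩ := hcon g (hall g)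
      exact ⟨a, h.mem_right' ea.1 hg, b, h.mem_right' eb.1 hg, hab, ea, eb⟩
    · intro u hu hdeg g hg
      obtain ⟨a, b, hab, hy⟩ := hE2 u hu
      rw [hy]
      rcases hdeg a b g (hFB _ _ ((hy a).mpr (.inl rfl))) (hFB _ _ ((hy b).mpr (.inr rfl))) hg with
        e | e | e
      exacts [absurd e hab, .inl e.symm, .inr e.symm]
    · intro F hFs hFR h1 h2 x y hxy hx hy
      have hK : ∀ x, (∀ a b, F x a → F x b → a = b) → x ∈ K := by
        intro x hx
        refine (h.cover x).resolve_right fun hxI => ?_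
        obtain ⟨a, b, hab, e⟩ := hE2 x hxI
        obtain ⟨a', b', hab', e1, e2⟩ := h2 x hxI a b hab (hFB _ _ ((e a).mpr (.inl rfl)))
          (hFB _ _ ((e b).mpr (.inr rfl)))
        exact hab' (hx a' b' e1 e2)
      exact h.clique x (hK x hx) y (hK y hy) hxy
  · have hkm : K.card = I.card := le_antisymm (by omega) h.card_le
    obtain ⟨u₀, hu₀⟩ := Finset.card_pos.mp (show 0 < I.card by omega)
    obtain ⟨x₀, x₁, hx01, hux⟩ := hE2 u₀ hu₀
    have hEux : E u₀ x₀ := (hux x₀).mpr (.inl rfl)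
    have hx₀ : x₀ ∈ K := h.mem_right hEux.1 hu₀
    -- For `|K| = |I|` the cycle alternates and one edge `u₀x₀` must be left out to make it acyclic.
    -- Both ends are among the `z r`, so every selection leaves this edge out as well.
    set E₀ : V → V → Prop := fun a b => E a b ∧ ¬ (a = u₀ ∧ b = x₀) ∧ ¬ (a = x₀ ∧ b = u₀) with hE₀
    have hsub : ∀ x y, E₀ x y → E x y := fun x y hxy => hxy.1
    have hs₀ : ∀ x y, E₀ x y → E₀ y x := fun x y hxy =>
      ⟨hEs _ _ hxy.1, fun e => hxy.2.2 ⟨e.2, e.1⟩, fun e => hxy.2.1 ⟨e.2, e.1⟩⟩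
    have hd₀ : ∀ x, ∃ p q, ∀ y, E₀ x y → y = p ∨ y = q := fun x => by
      obtain ⟨p, q, hpq⟩ := hEd x
      exact ⟨p, q, fun y hy => hpq y hy.1⟩
    have hu01 : ∀ y, E₀ u₀ y ↔ y = x₁ := by
      intro y
      constructor
      · intro e
        rcases (hux y).mp e.1 with r | r
        · exact absurd ⟨rfl, r⟩ e.2.1
        · exact r
      · rintro rfl
        refine ⟨(hux y).mpr (.inr rfl), fun e => hx01 e.2.symm, fun e => ?_⟩
        exact h.notMem x₀ hx₀ (e.1 ▸ hu₀)
    have hne0 : ∀ u ∈ I, u ≠ u₀ → ∀ y, E₀ u y ↔ E u y := by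
      intro u hu hne y
      refine ⟨fun e => e.1, fun e => ⟨e, fun e' => hne e'.1, fun e' => h.notMem x₀ hx₀ (e'.1 ▸ hu)⟩⟩
    obtain ⟨z, hz9, hz10, hub⟩ := h.exists_hub hs₀ hd₀ u₀ x₀
    have hFB : ∀ x y, E₀ x y → G.restrictAdj K I E₀ z x y := fun x y hxy =>
      ⟨hxy.1.1, fun r => ⟨fun _ => hxy, fun _ => hxy⟩⟩
    have hdegK := h.degK_of_hub hd₀ hub
    refine ⟨E₀, z, hs₀, hd₀, ?_, hdegK, ?_, ?_⟩
    · intro S hS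
      by_contra hcon
      push Not at hcon
      have hall := hclosed S hS fun x hx => by
        obtain ⟨a, ha, b, hb, ea, eb, hab⟩ := hcon x hx
        exact ⟨a, ha, b, hb, hab, ea.1, eb.1⟩
      obtain ⟨a, -, b, -, ea, eb, hab⟩ := hcon u₀ (hall u₀)
      exact hab (((hu01 a).mp ea).trans ((hu01 b).mp eb).symm)
    · intro u hu hdeg g hg
      by_cases e0 : u = u₀
      · exact (hg.2 9).1 (e0.trans hz9.symm)
      obtain ⟨a, b, hab, hy⟩ := hE2 u hu
      have hy' : ∀ y, E₀ u y ↔ y = a ∨ y = b := fun y => (hne0 u hu e0 y).trans (hy y)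
      rw [hy']
      rcases hdeg a b g (hFB _ _ ((hy' a).mpr (.inl rfl))) (hFB _ _ ((hy' b).mpr (.inr rfl))) hg with
        e | e | e
      exacts [absurd e hab, .inl e.symm, .inr e.symm]
    · intro F hFs hFR h1 h2 x y hxy hx hy
      have hI2 : ∀ u ∈ I, u ≠ u₀ → ∃ a b, a ≠ b ∧ F u a ∧ F u b := by
        intro u hu hne
        obtain ⟨a, b, hab, e⟩ := hE2 u hu
        exact h2 u hu a b hab (hFB _ _ ((hne0 u hu hne a).mpr ((e a).mpr (.inl rfl))))
          (hFB _ _ ((hne0 u hu hne b).mpr ((e b).mpr (.inr rfl))))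
      have hsum := sum_card_filter_comm (K := K) (I := I) hFs
      have hIsum : 2 * I.card ≤ ∑ u ∈ I, (K.filter (F u)).card + 1 := by
        rw [← Finset.add_sum_erase _ _ hu₀]
        have e1 : 1 ≤ (K.filter (F u₀)).card := by
          obtain ⟨a, ha⟩ := h1 u₀ hu₀ x₁ (hFB _ _ ((hu01 x₁).mpr rfl))
          exact Finset.card_pos.mpr ⟨a, by simp [ha, h.mem_right (hFR _ _ ha).1 hu₀]⟩
        have e2 : ∑ u ∈ I.erase u₀, 2 ≤ ∑ u ∈ I.erase u₀, (K.filter (F u)).card := by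
          refine Finset.sum_le_sum fun u hu => ?_
          have huI := Finset.mem_of_mem_erase hu
          obtain ⟨a, b, hab, ha, hb⟩ := hI2 u huI (Finset.ne_of_mem_erase hu)
          exact Finset.one_lt_card.mpr ⟨a, by simp [ha, h.mem_right (hFR _ _ ha).1 huI], b,
            by simp [hb, h.mem_right (hFR _ _ hb).1 huI], hab⟩
        rw [Finset.sum_const, smul_eq_mul, Finset.card_erase_of_mem hu₀] at e2
        omega
      have hx₀1 : (I.filter (F x₀)).card ≤ 1 := by
        refine Finset.card_le_one.mpr fun a ha b hb => ?_
        have e1 := ((hFR _ _ (Finset.mem_filter.mp ha).2).2 10).1 hz10.symm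
        have e2 := ((hFR _ _ (Finset.mem_filter.mp hb).2).2 10).1 hz10.symm
        obtain ⟨p, q, hpq⟩ := hEd x₀
        have e3 := hpq _ (hEs _ _ hEux)
        have e4 := hpq a e1.1
        have e5 := hpq b e2.1
        have e6 : a ≠ u₀ := fun e => e1.2.2 ⟨rfl, e⟩
        have e7 : b ≠ u₀ := fun e => e2.2.2 ⟨rfl, e⟩
        grind
      have hK2 : ∀ g ∈ K, (I.filter (F g)).card ≤ 2 := by
        intro g hg
        by_contra hcon
        obtain ⟨a, b, c, ha, hb, hc, hab, hac, hbc⟩ := Finset.two_lt_card_iff.mp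
          (show 2 < (I.filter (F g)).card by omega)
        have := hdegK g hg a b c (hFR _ _ (Finset.mem_filter.mp ha).2)
          (hFR _ _ (Finset.mem_filter.mp hb).2) (hFR _ _ (Finset.mem_filter.mp hc).2)
        tauto
      -- The degree sum over `I` is at least `2 |I| - 1`, while over `K` it is at most `2 |K| - 1`
      -- because `x₀` has degree at most one. With `|K| = |I|` there is no room for another clique
      -- vertex of degree below two, so `u₀` and `x₀`, which are adjacent, are the only possible
      -- ends.
      have key : ∀ x, (∀ a b, F x a → F x b → a = b) → x = u₀ ∨ x = x₀ := by
        intro x hx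
        by_contra hcon
        push Not at hcon
        rcases h.cover x with hxK | hxI
        · have e1 : (I.filter (F x)).card ≤ 1 := Finset.card_le_one.mpr fun a ha b hb =>
            hx a b (Finset.mem_filter.mp ha).2 (Finset.mem_filter.mp hb).2
          have hx' : x ∈ K.erase x₀ := Finset.mem_erase.mpr ⟨hcon.2, hxK⟩
          have e2 : ∑ g ∈ (K.erase x₀).erase x, (I.filter (F g)).card ≤
              ∑ g ∈ (K.erase x₀).erase x, 2 := Finset.sum_le_sum fun g hg =>
            hK2 g (Finset.mem_of_mem_erase (Finset.mem_of_mem_erase hg))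
          rw [Finset.sum_const, smul_eq_mul, Finset.card_erase_of_mem hx',
            Finset.card_erase_of_mem hx₀] at e2
          have e3 := Finset.add_sum_erase K (fun g => (I.filter (F g)).card) hx₀
          have e4 := Finset.add_sum_erase (K.erase x₀) (fun g => (I.filter (F g)).card) hx'
          omega
        · obtain ⟨a, b, hab, ha, hb⟩ := hI2 x hxI hcon.1
          exact hab (hx a b ha hb)
      rcases key x hx with rfl | rfl <;> rcases key y hy with rfl | rfl
      · exact absurd rfl hxy
      · exact hEux.1.1
      · exact hEux.1.1.symm
      · exact absurd rfl hxy

end SimpleGraph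

/-! ### Closed lists in memory -/

namespace RAM

/-- The adjacency relation of a graph on `Fin n`, on numbers. -/
def liftAdj {n : ℕ} (R : Fin n → Fin n → Prop) (i j : ℕ) : Prop :=
  ∃ (hi : i < n) (hj : j < n), R ⟨i, hi⟩ ⟨j, hj⟩

/-- The numbers `out 0, …, out (k - 1)` are distinct, less than `n`, and form a closed chain. -/
structure ClosedList (n k : ℕ) (A : ℕ → ℕ → Prop) (out : ℕ → ℕ) : Prop where
  lt : ∀ i < k, out i < n
  inj : ∀ i < k, ∀ j < k, out i = out j → i = j
  step : ∀ i, i + 1 < k → A (out i) (out (i + 1))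
  close : A (out (k - 1)) (out 0)

lemma ClosedList.exists_list {n k : ℕ} {H : SimpleGraph (Fin n)} {out : ℕ → ℕ}
    (h : ClosedList n k (liftAdj H.Adj) out) (hk : 0 < k) :
    ∃ (a b : Fin n) (l : List (Fin n)), Seg H.Adj a b l ∧ H.Adj b a ∧ l.Nodup ∧ l.length = k ∧
      (a : ℕ) = out 0 ∧ ∀ (i : ℕ) (hi : i < l.length), (l[i] : ℕ) = out i := by
  obtain ⟨h1, h2, h3, h4, h5, h6⟩ := h
  let f : Fin k → Fin n := fun i => ⟨out i, h1 i i.2⟩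
  refine ⟨f ⟨0, hk⟩, f ⟨k - 1, by omega⟩, List.ofFn f, ⟨?_, ?_, ?_⟩, h6, ?_, by simp, rfl, by simp [f]⟩
  · rw [List.isChain_iff_getElem]
    intro i hi
    obtain ⟨_, _, h⟩ := h3 i (by simpa using hi)
    simpa [f] using h
  · rw [List.head?_eq_getElem?, List.getElem?_ofFn, dif_pos hk]
  · rw [List.getLast?_eq_getElem?, List.getElem?_ofFn, List.length_ofFn, dif_pos (by omega)]
  · rw [List.nodup_ofFn]
    intro i j e
    exact Fin.ext (h2 i i.2 j j.2 (congrArg Fin.val e))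

/-- The memory holds the answer `b` and a closed list of length `k`, with its first entry repeated. -/
def Found (n k : ℕ) (A : ℕ → ℕ → Prop) (b : ℕ) (m : Mem) : Prop :=
  m 6 0 0 = b ∧ m 6 1 0 = k + 1 ∧ ClosedList n k A (fun i => m 1 i 0) ∧ m 1 k 0 = m 1 0 0

lemma Found.exists_list {n k b : ℕ} {H : SimpleGraph (Fin n)} {m : Mem}
    (h : Found n k (liftAdj H.Adj) b m) (hk : 0 < k) :
    ∃ (a c : Fin n) (l : List (Fin n)), Seg H.Adj a c l ∧ H.Adj c a ∧ l.Nodup ∧ l.length = k ∧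
      (∀ (i : ℕ) (hi : i < l.length), (l[i] : ℕ) = m 1 i 0) ∧
      ∀ l' : List (Fin n), l' = l ++ [a] → m 6 1 0 = l'.length ∧
        ∀ (i : ℕ) (hi : i < l'.length), m 1 i 0 = (l'[i] : ℕ) := by
  obtain ⟨-, f2, f3, f4⟩ := h
  obtain ⟨a, c, l, hs, hca, hn, hlen, ha, hl⟩ := f3.exists_list hk
  refine ⟨a, c, l, hs, hca, hn, hlen, hl, ?_⟩
  rintro _ rfl
  refine ⟨by simp [f2, hlen], fun i hi => ?_⟩
  by_cases hil : i < l.length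
  · rw [List.getElem_append_left hil, hl i hil]
  · obtain rfl : i = l.length := by
      simp only [List.length_append, List.length_cons, List.length_nil] at hi
      omega
    simp only [List.getElem_concat_length]
    rw [ha, hlen, f4]

/-- Choose the entries of a list one after the other. -/
def St.list (e : Tm) : St := .forN 40 (.choose 1 40 41 e)

/-- The condition `C` may refer to earlier entries of the list only (`hC`). So what was true when an
entry was chosen is still true of the final list, and the conclusion speaks of that list alone. -/
lemma St.list_run {n : ℕ} {e : Tm} {env : ℕ → ℕ} {m : Mem} (C : (ℕ → ℕ) → ℕ → ℕ → Prop)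
    (hC : ∀ out out' i y, (∀ j < i, out j = out' j) → C out i y → C out' i y)
    (he : ∀ m' : Mem, (∀ b, b ≠ 1 → m' b = m b) → ∀ i < n, ∀ y < n,
      (e.tr n m' (Function.update (Function.update env 40 i) 41 y) ↔ C (fun j => m' 1 j 0) i y)) :
    (∀ b, b ≠ 1 → (St.list e).run n env m b = m b) ∧
      ∀ i < n, (∃ y < n, C (fun j => (St.list e).run n env m 1 j 0) i y) →
        (St.list e).run n env m 1 i 0 < n ∧
        C (fun j => (St.list e).run n env m 1 j 0) i ((St.list e).run n env m 1 i 0) := by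
  rw [St.list, St.run]
  refine iterN_induct (fun k (m' : Mem) => (∀ b, b ≠ 1 → m' b = m b) ∧
    ∀ i < k, (∃ y < n, C (fun j => m' 1 j 0) i y) →
      m' 1 i 0 < n ∧ C (fun j => m' 1 j 0) i (m' 1 i 0)) (by simp) ?_
  rintro k hk m₁ ⟨h1, h2⟩
  obtain ⟨c1, c2⟩ := St.choose_run (a := 1) (x := 40) (y := 41) (n := n) (e := e)
    (env := Function.update env 40 k) (m := m₁) (by decide) (fun m' hm' y hy => by
      rw [he m' (fun b hb => by
          rw [← h1 b hb]
          funext i j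
          exact hm' b i j fun h => hb h.1) k hk y hy, he m₁ h1 k hk y hy]
      have : ∀ j < k, m' 1 j 0 = m₁ 1 j 0 := fun j hj => hm' 1 j 0 (by simp; omega)
      exact ⟨hC _ _ _ _ this, hC _ _ _ _ fun j hj => (this j hj).symm⟩)
  simp only [Function.update_self] at c1 c2
  generalize (St.choose 1 40 41 e).run n (Function.update env 40 k) m₁ = m₂ at c1 c2
  have hpre : ∀ j < k, m₂ 1 j 0 = m₁ 1 j 0 := fun j hj => c1 1 j 0 (by simp; omega)
  refine ⟨fun b hb => ?_, fun i hi => ?_⟩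
  · rw [← h1 b hb]
    funext i j
    exact c1 b i j fun h => hb h.1
  rcases Nat.lt_succ_iff_lt_or_eq.mp hi with hi | rfl
  · rintro ⟨y, hy, hCy⟩
    have hp : ∀ j < i, m₂ 1 j 0 = m₁ 1 j 0 := fun j hj => hpre j (by omega)
    obtain ⟨g1, g2⟩ := h2 i hi ⟨y, hy, hC _ _ _ _ hp hCy⟩
    simp only [hpre i hi]
    exact ⟨g1, hC _ _ _ _ (fun j hj => (hp j hj).symm) g2⟩
  · rintro ⟨y, hy, hCy⟩
    obtain ⟨g1, g2⟩ := c2 ⟨y, hy, (he m₁ h1 i hk y hy).mpr (hC _ _ _ _ hpre hCy)⟩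
    exact ⟨g1, hC _ _ _ _ (fun j hj => (hpre j hj).symm) ((he m₁ h1 i hk _ g1).mp g2)⟩

/-- Nested loops over the variables of a list. -/
def St.nest (xs : List ℕ) (p : St) : St := xs.foldr .forN p

lemma St.nest_inv {n : ℕ} {p : St} {P : Mem → Prop} (hp : ∀ env m, P m → P (p.run n env m)) :
    ∀ (xs : List ℕ) env m, P m → P ((St.nest xs p).run n env m)
  | [], env, m => hp env m
  | x :: xs, env, m => fun h => by
    change P ((St.forN x (St.nest xs p)).run n env m)
    rw [St.run]
    exact iterN_induct (fun _ m => P m) h fun i _ m hm => St.nest_inv hp xs _ m hm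

/-- If the body succeeds for one value of the variables, then the nested loops succeed. -/
lemma St.nest_success {n : ℕ} {p : St} {P Q : Mem → Prop} (hp : ∀ env m, P m → P (p.run n env m))
    (hq : ∀ env m, P m → Q m → Q (p.run n env m)) {env' : ℕ → ℕ}
    (hgood : ∀ m, P m → Q (p.run n env' m)) : ∀ (xs : List ℕ) env m, P m → (∀ x ∈ xs, env' x < n) →
      (∀ x, x ∉ xs → env' x = env x) → Q ((St.nest xs p).run n env m)
  | [], env, m => fun h _ he => by
    rw [show env = env' from funext fun x => (he x (by simp)).symm]
    exact hgood m h
  | x :: xs, env, m => fun h hlt he => by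
    change Q ((St.forN x (St.nest xs p)).run n env m)
    rw [St.run]
    refine (iterN_induct (fun k m => P m ∧ (env' x < k → Q m)) ⟨h, by simp⟩ ?_).2 (hlt x (by simp))
    rintro i hi m ⟨h1, h2⟩
    refine ⟨St.nest_inv hp xs _ m h1, fun hk => ?_⟩
    rcases Nat.lt_succ_iff_lt_or_eq.mp hk with hk | rfl
    · exact (St.nest_inv (P := fun m => P m ∧ Q m) (fun env m hm => ⟨hp env m hm.1, hq env m hm.1 hm.2⟩)
        xs _ m ⟨h1, h2 hk⟩).2
    · refine St.nest_success hp hq hgood xs _ m h1 (fun y hy => hlt y (by simp [hy])) fun y hy => ?_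
      by_cases hyx : y = x
      · rw [hyx, Function.update_self]
      · rw [Function.update_of_ne hyx]
        exact he y (by simp [hy, hyx])

end RAM

/-! ### Choosing edges greedily -/

namespace RAM

lemma Acyclic.congr {n : ℕ} {R R' : ℕ → ℕ → Prop} (h : Acyclic n R)
    (hR : ∀ x < n, ∀ y < n, R' x y → R x y) : Acyclic n R' := fun S hS hne h2 =>
  h S hS hne (h2.mono fun x hx y hy => hR x (Finset.mem_range.mp (hS hx)) y (Finset.mem_range.mp (hS hy)))

/-- Write `c` at the four positions of the edges `ug` and `uh`; the variables `42`, `43`, `44` hold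
`u`, `g`, `h`. -/
def St.link (c : ℕ) : St :=
  .seq (.put 4 (.var 42) (.var 43) (.const c)) (.seq (.put 4 (.var 43) (.var 42) (.const c))
    (.seq (.put 4 (.var 42) (.var 44) (.const c)) (.put 4 (.var 44) (.var 42) (.const c))))

lemma St.link_run {n c : ℕ} {env : ℕ → ℕ} {m : Mem} :
    (∀ b, b ≠ 4 → (St.link c).run n env m b = m b) ∧ ∀ x y, (St.link c).run n env m 4 x y =
      if x = env 42 ∧ (y = env 43 ∨ y = env 44) ∨ y = env 42 ∧ (x = env 43 ∨ x = env 44) then c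
      else m 4 x y := by
  refine ⟨fun b hb => St.run_eq _ _ _ (by simp [St.link, St.writes, hb]), fun x y => ?_⟩
  simp only [St.link, St.run, Mem.upd_apply, Tm.eval, true_and]
  split_ifs <;> first | rfl | (exfalso; tauto)

/-- The edges `ug` and `uh` may be added. -/
def Tm.linkable : Tm :=
  .and (.get 2 (.var 42) (.const 0)) (.and (.not (.ex 45 (.get 4 (.var 42) (.var 45))))
    (.and (.get 3 (.var 42) (.var 43)) (.and (.get 3 (.var 42) (.var 44))
      (.not (.eq (.var 43) (.var 44))))))

/-- Add the edges `ug` and `uh` if possible, unless they close a cycle. -/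
def St.tryPair : St :=
  .ite .linkable (.seq (.link 1) (.seq (.core (.const 1))
    (.ite (.ex 46 (.get 5 (.var 46) (.const 0))) (.link 0) .skip))) .skip

/-- The edges are written first and tested afterwards: a nonempty core in array `5` means that they
close a cycle. -/
lemma St.tryPair_run {n : ℕ} {env : ℕ → ℕ} {m : Mem} {u g h : ℕ} (hu : env 42 = u) (hg : env 43 = g)
    (hh : env 44 = h) (hgn : g < n) (hhn : h < n) (hun : u < n)
    (hsymm : ∀ x < n, ∀ y < n, rel m 4 x y → rel m 4 y x) :
    (∀ b, b ≠ 4 → b ≠ 5 → St.tryPair.run n env m b = m b) ∧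
    ((∀ x < n, ∀ y < n, rel (St.tryPair.run n env m) 4 x y ↔ rel m 4 x y) ∧
      (m 2 u 0 ≠ 0 ∧ (∀ y < n, ¬ rel m 4 u y) ∧ rel m 3 u g ∧ rel m 3 u h ∧ g ≠ h →
        ¬ Acyclic n (addPair (rel m 4) u g h)) ∨
      (m 2 u 0 ≠ 0 ∧ (∀ y < n, ¬ rel m 4 u y) ∧ rel m 3 u g ∧ rel m 3 u h ∧ g ≠ h) ∧
        Acyclic n (addPair (rel m 4) u g h) ∧
        ∀ x < n, ∀ y < n, rel (St.tryPair.run n env m) 4 x y ↔ addPair (rel m 4) u g h x y) := by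
  subst hu hg hh
  refine ⟨fun b h4 h5 => St.run_eq _ _ _ (by
    simp [St.tryPair, St.link, St.core, St.fill, St.pruneStep, St.writes, h4, h5]), ?_⟩
  have hguard : Tm.linkable.tr n m env ↔ m 2 (env 42) 0 ≠ 0 ∧ (∀ y < n, ¬ rel m 4 (env 42) y) ∧
      rel m 3 (env 42) (env 43) ∧ rel m 3 (env 42) (env 44) ∧ env 43 ≠ env 44 := by
    simp [Tm.linkable, rel]
  by_cases hc : Tm.linkable.tr n m env
  · have hc' := hguard.mp hc
    obtain ⟨l1, l2⟩ := St.link_run (n := n) (c := 1) (env := env) (m := m)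
    rw [St.tryPair, St.run_ite_pos hc]
    simp only [St.run.eq_3]
    set m₁ := (St.link 1).run n env m with hm₁
    obtain ⟨c1, c2⟩ := St.core_run (n := n) (m := m₁) (env := env) (e := .const 1) (by simp [Tm.reads])
    set m₂ := (St.core (.const 1)).run n env m₁ with hm₂
    have hadd : ∀ x y, rel m₁ 4 x y ↔ addPair (rel m 4) (env 42) (env 43) (env 44) x y := by
      intro x y
      rw [rel, l2, addPair]
      split_ifs with hif
      · simp [hif]
      · simp only [hif, or_false]
        exact Iff.rfl
    have hcyc : (∃ i < n, m₂ 5 i 0 ≠ 0) ↔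
        ¬ Acyclic n (addPair (rel m 4) (env 42) (env 43) (env 44)) := by
      rw [c2]
      have e : rel m₁ 4 = addPair (rel m 4) (env 42) (env 43) (env 44) :=
        funext fun x => funext fun y => propext (hadd x y)
      rw [e]
      simp only [Acyclic, not_forall, not_not, exists_prop, Tm.tr, Tm.eval_const]
      simp
    by_cases ht : (Tm.ex 46 (.get 5 (.var 46) (.const 0))).tr n m₂ env
    · rw [St.run_ite_pos ht]
      left
      obtain ⟨k1, k2⟩ := St.link_run (n := n) (c := 0) (env := env) (m := m₂)
      refine ⟨fun x hx y hy => ?_, fun _ => hcyc.mp (by simpa using ht)⟩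
      rw [rel, k2, c1 4 (by decide)]
      -- Undoing by writing zeros is correct because `u` had no edges before.
      split_ifs with hif
      · simp only [ne_eq, not_true_eq_false, false_iff]
        intro hR
        rcases hif with ⟨rfl, -⟩ | ⟨rfl, -⟩
        · exact hc'.2.1 y hy hR
        · exact hc'.2.1 x hx (hsymm _ hx _ hy hR)
      · rw [l2, if_neg hif]
        exact Iff.rfl
    · rw [St.run_ite_neg ht, St.run]
      right
      refine ⟨hc', ?_, fun x _ y _ => ?_⟩
      · by_contra hac
        exact ht (by simpa using hcyc.mpr hac)
      · rw [← hadd, rel, c1 4 (by decide)]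
        exact Iff.rfl
  · rw [St.tryPair, St.run_ite_neg hc, St.run]
    exact .inl ⟨fun _ _ _ _ => Iff.rfl, fun h => absurd (hguard.mpr h) hc⟩

/-- Choose two edges at each vertex of the set in array `2`, among the edges in array `3`. -/
def St.greedy : St := .forN 42 (.forN 43 (.forN 44 .tryPair))

/-- The relations on which the greedy choice works: `J` is one side of the bipartite relation `B`,
and on the other side the degrees are at most two. -/
structure GreedyData (n : ℕ) (J : ℕ → Prop) (B : ℕ → ℕ → Prop) : Prop where
  symm : ∀ x < n, ∀ y < n, B x y → B y x
  side : ∀ x < n, ∀ y < n, B x y → (J x ↔ ¬ J y)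
  deg : ∀ x < n, ¬ J x → cn n (B x) ≤ 2

/-- What holds during the greedy choice. -/
structure GreedyInv (n : ℕ) (J : ℕ → Prop) (B R : ℕ → ℕ → Prop) : Prop where
  symm : ∀ x < n, ∀ y < n, R x y → R y x
  sub : ∀ x < n, ∀ y < n, R x y → B x y
  acyclic : Acyclic n R
  low : ∀ x < n, J x → cn n (B x) ≤ 2 → ∀ y < n, B x y → R x y
  high : ∀ x < n, J x → 3 ≤ cn n (B x) → (∀ y < n, ¬ R x y) ∨ cn n (R x) = 2

variable {n : ℕ} {J : ℕ → Prop} {B R R' : ℕ → ℕ → Prop}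

lemma GreedyInv.congr (h : GreedyInv n J B R) (hR : ∀ x < n, ∀ y < n, R' x y ↔ R x y) :
    GreedyInv n J B R' where
  symm x hx y hy e := (hR y hy x hx).mpr (h.symm x hx y hy ((hR x hx y hy).mp e))
  sub x hx y hy e := h.sub x hx y hy ((hR x hx y hy).mp e)
  acyclic := h.acyclic.congr fun x hx y hy => (hR x hx y hy).mp
  low x hx hJ h2 y hy e := (hR x hx y hy).mpr (h.low x hx hJ h2 y hy e)
  high x hx hJ h3 := (h.high x hx hJ h3).imp (fun e y hy e' => e y hy ((hR x hx y hy).mp e'))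
    fun e => (cn_congr (hR x hx)).trans e

lemma cn_addPair {u g h : ℕ} (hu : ∀ y < n, ¬ R u y) (hg : g < n) (hh : h < n) (hgh : g ≠ h)
    (hgu : g ≠ u) (hhu : h ≠ u) : cn n (addPair R u g h u) = 2 := by
  have h2 : 2 ≤ cn n (addPair R u g h u) := two_le_cn.mpr ⟨g, hg, h, hh, hgh,
    .inr (.inl ⟨rfl, .inl rfl⟩), .inr (.inl ⟨rfl, .inr rfl⟩)⟩
  refine le_antisymm ?_ h2
  by_contra hc
  obtain ⟨i, hi, j, hj, k, hk, hij, hik, hjk, h1, h2, h3⟩ := three_le_cn.mp (not_le.mp hc)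
  have key : ∀ y < n, addPair R u g h u y → y = g ∨ y = h := by
    rintro y hy (e | e | e)
    · exact absurd e (hu y hy)
    · exact e.2
    · rcases e.2 with e | e
      · exact absurd e.symm hgu
      · exact absurd e.symm hhu
  have := key i hi h1
  have := key j hj h2
  have := key k hk h3
  omega

lemma GreedyInv.addPair_iff (hd : GreedyData n J B) {u g h x y : ℕ} (hun : u < n)
    (hg : g < n) (hh : h < n) (hJ : J u) (hug : B u g) (huh : B u h) (hx : x < n) (hJx : J x)
    (hxu : x ≠ u) : addPair R u g h x y ↔ R x y := by
  refine ⟨?_, Or.inl⟩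
  rintro (e | e | e)
  · exact e
  · exact absurd e.1 hxu
  · rcases e.2 with rfl | rfl
    · exact absurd hJx ((hd.side u hun _ hx hug).mp hJ)
    · exact absurd hJx ((hd.side u hun _ hx huh).mp hJ)

lemma GreedyInv.addPair (hd : GreedyData n J B) (hi : GreedyInv n J B R) {u g h : ℕ} (hun : u < n)
    (hg : g < n) (hh : h < n) (hJ : J u) (hR : ∀ y < n, ¬ R u y) (hug : B u g) (huh : B u h)
    (hgh : g ≠ h) (hac : Acyclic n (addPair R u g h)) : GreedyInv n J B (addPair R u g h) := by
  have h2 : 2 ≤ cn n (B u) := two_le_cn.mpr ⟨g, hg, h, hh, hgh, hug, huh⟩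
  have hgu : g ≠ u := by rintro rfl; exact (hd.side _ hun _ hun hug).mp hJ hJ
  have hhu : h ≠ u := by rintro rfl; exact (hd.side _ hun _ hun huh).mp hJ hJ
  refine ⟨?_, ?_, hac, ?_, ?_⟩
  · rintro x hx y hy (e | e | e)
    · exact .inl (hi.symm x hx y hy e)
    · exact .inr (.inr e)
    · exact .inr (.inl e)
  · rintro x hx y hy (e | ⟨rfl, rfl | rfl⟩ | ⟨rfl, rfl | rfl⟩)
    · exact hi.sub x hx y hy e
    · exact hug
    · exact huh
    · exact hd.symm _ hun _ hx hug
    · exact hd.symm _ hun _ hx huh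
  · exact fun x hx hJx hle y hy e => .inl (hi.low x hx hJx hle y hy e)
  · intro x hx hJx h3
    by_cases hxu : x = u
    · subst hxu
      exact .inr (cn_addPair hR hg hh hgh hgu hhu)
    · have key : ∀ y, RAM.addPair R u g h x y ↔ R x y := fun y =>
        GreedyInv.addPair_iff hd hun hg hh hJ hug huh hx hJx hxu
      refine (hi.high x hx hJx h3).imp (fun e y hy e' => e y hy ((key y).mp e')) fun e => ?_
      rw [← e]
      exact cn_congr fun y _ => key y

/-- Some pair of edges at `u` does not close a cycle. -/
lemma GreedyInv.exists_acyclic (hd : GreedyData n J B) (hi : GreedyInv n J B R) {u : ℕ} (hun : u < n)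
    (hJ : J u) (h3 : 3 ≤ cn n (B u)) (hR : ∀ y < n, ¬ R u y) :
    ∃ g < n, ∃ h < n, B u g ∧ B u h ∧ g ≠ h ∧ Acyclic n (RAM.addPair R u g h) := by
  obtain ⟨g, hg, h, hh, k, hk, hgh, hgk, hhk, bg, bh, bk⟩ := three_le_cn.mp h3
  have hirr : ∀ x < n, ¬ R x x := fun x hx e => by
    have := hd.side x hx x hx (hi.sub x hx x hx e)
    tauto
  have hdeg : ∀ x < n, cn n (R x) ≤ 2 := by
    intro x hx
    have hle : cn n (R x) ≤ cn n (B x) := cn_mono fun y hy => hi.sub x hx y hy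
    by_cases hJx : J x
    · by_cases hx3 : 3 ≤ cn n (B x)
      · rcases hi.high x hx hJx hx3 with e | e
        · have : ¬ 0 < cn n (R x) := fun e' => by
            obtain ⟨y, hy, e'⟩ := cn_pos.mp e'
            exact e y hy e'
          omega
        · exact e.le
      · omega
    · exact hle.trans (hd.deg x hx hJx)
  -- `g` has at most two admissible edges, and the one to `u` is unused.
  have hone : ∀ g < n, B u g → cn n (R g) ≤ 1 := by
    intro g hg bg
    refine cn_le_one.mpr fun i hin j hjn ei ej => ?_
    by_contra hij
    have hJg := (hd.side u hun g hg bg).mp hJ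
    have hno : ¬ R g u := fun e => hR g hg (hi.symm g hg u hun e)
    rcases cn_le_two (hd.deg g hg hJg) hin hjn hun (hi.sub g hg i hin ei) (hi.sub g hg j hjn ej)
      (hd.symm u hun g hg bg) hij with rfl | rfl
    · exact hno ei
    · exact hno ej
  have hhu : h ≠ u := by rintro rfl; exact (hd.side _ hun _ hun bh).mp hJ hJ
  rcases acyclic_addPair hi.acyclic hi.symm hirr hdeg hR hhu (hone g hg bg) (hone h hh bh)
    (hone k hk bk) hgh hhk with e | e
  · exact ⟨g, hg, h, hh, bg, bh, hgh, e⟩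
  · exact ⟨g, hg, k, hk, bg, bk, hgk, e⟩

/-- One step of the greedy choice, for the pairs of edges at `u`; `R₀` is the relation before the
vertex `u`, and `D` holds for the pairs that have been tried. -/
def GreedyAt (n : ℕ) (J : ℕ → Prop) (B R₀ : ℕ → ℕ → Prop) (m₀ : Mem) (u : ℕ) (D : ℕ → ℕ → Prop)
    (m : Mem) : Prop :=
  (∀ b, b ≠ 4 → b ≠ 5 → m b = m₀ b) ∧ GreedyInv n J B (rel m 4) ∧
    (∀ x < u, J x → 3 ≤ cn n (B x) → cn n (rel m 4 x) = 2) ∧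
    (cn n (rel m 4 u) = 2 ∨ (∀ x < n, ∀ y < n, rel m 4 x y ↔ R₀ x y) ∧
      ∀ g < n, ∀ h < n, D g h → J u → (∀ y < n, ¬ R₀ u y) → B u g → B u h → g ≠ h →
        ¬ Acyclic n (RAM.addPair R₀ u g h))

lemma GreedyAt.tryPair {R₀ : ℕ → ℕ → Prop} {m₀ m : Mem} {u g h : ℕ} {D D' : ℕ → ℕ → Prop}
    {env : ℕ → ℕ} (hd : GreedyData n J B) (hun : u < n) (hg : g < n) (hh : h < n)
    (hJ : ∀ x < n, m₀ 2 x 0 ≠ 0 ↔ J x) (hB : ∀ x < n, ∀ y < n, rel m₀ 3 x y ↔ B x y)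
    (hm : GreedyAt n J B R₀ m₀ u D m) (eu : env 42 = u) (eg : env 43 = g) (eh : env 44 = h)
    (hD : ∀ x y, D' x y → D x y ∨ x = g ∧ y = h) :
    GreedyAt n J B R₀ m₀ u D' (St.tryPair.run n env m) := by
  obtain ⟨h1, h2, h3, h4⟩ := hm
  obtain ⟨t1, t2⟩ := St.tryPair_run eu eg eh hg hh hun h2.symm
  have e2 : m 2 u 0 ≠ 0 ↔ J u := by rw [h1 2 (by decide) (by decide)]; exact hJ u hun
  have e3 : ∀ y < n, rel m 3 u y ↔ B u y := fun y hy => by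
    rw [← hB u hun y hy, rel, rel, h1 3 (by decide) (by decide)]
  rw [e2, e3 g hg, e3 h hh] at t2
  generalize St.tryPair.run n env m = m' at t1 t2
  refine ⟨fun b b4 b5 => (t1 b b4 b5).trans (h1 b b4 b5), ?_⟩
  rcases t2 with ⟨s1, s2⟩ | ⟨⟨g1, g2, g3, g4, g5⟩, s2, s3⟩
  · refine ⟨h2.congr s1, fun x hx hJx hx3 => ?_, ?_⟩
    · rw [← h3 x hx hJx hx3]
      exact cn_congr fun y hy => s1 x (hx.trans hun) y hy
    · refine h4.imp (fun e => ?_) fun e => ?_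
      · rw [← e]
        exact cn_congr fun y hy => s1 u hun y hy
      · refine ⟨fun x hx y hy => (s1 x hx y hy).trans (e.1 x hx y hy), ?_⟩
        intro a ha b hb hab j1 j2 j3 j4 j5 j6
        rcases hD a b hab with hab | ⟨rfl, rfl⟩
        · exact e.2 a ha b hb hab j1 j2 j3 j4 j5 j6
        · refine s2 ⟨j1, fun y hy e' => j2 y hy ((e.1 u hun y hy).mp e'), j3, j4, j5⟩ ?_
          exact j6.congr fun x hx y hy => Or.imp_left (e.1 x hx y hy).mp
  · have hgu : g ≠ u := by rintro rfl; exact (hd.side _ hun _ hun g3).mp g1 g1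
    have hhu : h ≠ u := by rintro rfl; exact (hd.side _ hun _ hun g4).mp g1 g1
    refine ⟨(h2.addPair hd hun hg hh g1 g2 g3 g4 g5 s2).congr s3, fun x hx hJx hx3 => ?_, .inl ?_⟩
    · rw [← h3 x hx hJx hx3]
      refine cn_congr fun y hy => (s3 x (hx.trans hun) y hy).trans ?_
      exact GreedyInv.addPair_iff hd hun hg hh g1 g3 g4 (hx.trans hun) hJx hx.ne
    · rw [← cn_addPair g2 hg hh g5 hgu hhu]
      exact cn_congr fun y hy => s3 u hun y hy

/-- The greedy choice succeeds at every vertex. -/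
lemma St.greedy_run {m : Mem} {env : ℕ → ℕ} (hd : GreedyData n J B)
    (hJ : ∀ x < n, m 2 x 0 ≠ 0 ↔ J x) (hB : ∀ x < n, ∀ y < n, rel m 3 x y ↔ B x y)
    (hm : GreedyInv n J B (rel m 4)) :
    (∀ b, b ≠ 4 → b ≠ 5 → St.greedy.run n env m b = m b) ∧
      GreedyInv n J B (rel (St.greedy.run n env m) 4) ∧
      ∀ x < n, J x → 3 ≤ cn n (B x) → cn n (rel (St.greedy.run n env m) 4 x) = 2 := by
  rw [St.greedy, St.run]
  refine iterN_induct (fun u (m' : Mem) => (∀ b, b ≠ 4 → b ≠ 5 → m' b = m b) ∧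
    GreedyInv n J B (rel m' 4) ∧ ∀ x < u, J x → 3 ≤ cn n (B x) → cn n (rel m' 4 x) = 2)
    ⟨fun _ _ _ => rfl, hm, by simp⟩ ?_
  rintro u hun m₁ ⟨h1, h2, h3⟩
  rw [St.run]
  have key := iterN_induct (f := fun i m' => (St.forN 44 St.tryPair).run n
      (Function.update (Function.update env 42 u) 43 i) m') (n := n) (a := m₁)
    (fun g m' => GreedyAt n J B (rel m₁ 4) m u (fun x _ => x < g) m')
    ⟨h1, h2, h3, .inr ⟨fun _ _ _ _ => Iff.rfl, by simp⟩⟩ ?_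
  · obtain ⟨k1, k2, k3, k4⟩ := key
    refine ⟨k1, k2, fun x hx hJx hx3 => ?_⟩
    rcases Nat.lt_succ_iff_lt_or_eq.mp hx with hx | rfl
    · exact k3 x hx hJx hx3
    -- If no pair was accepted at this vertex, the relation is still the one from before and every
    -- pair has been refused, against `exists_acyclic`.
    · refine k4.elim id fun e => ?_
      rcases h2.high x hun hJx hx3 with hR | hR
      · obtain ⟨g, hg, h, hh, bg, bh, hgh, hac⟩ := h2.exists_acyclic hd hun hJx hx3 hR
        exact absurd hac (e.2 g hg h hh hg hJx hR bg bh hgh)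
      · rw [← hR]
        exact cn_congr fun y hy => e.1 x hun y hy
  intro g hg m₂ hm₂
  rw [St.run]
  have key := iterN_induct (f := fun i m' => St.tryPair.run n
      (Function.update (Function.update (Function.update env 42 u) 43 g) 44 i) m') (n := n) (a := m₂)
    (fun h m' => GreedyAt n J B (rel m₁ 4) m u (fun x y => x < g ∨ x = g ∧ y < h) m')
    ?_ ?_
  · obtain ⟨k1, k2, k3, k4⟩ := key
    refine ⟨k1, k2, k3, k4.imp_right fun e => ⟨e.1, fun a ha b hb hab => e.2 a ha b hb ?_⟩⟩
    omega
  · simpa using hm₂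
  · intro h hh m₃ hm₃
    refine hm₃.tryPair hd hun hg hh hJ hB (by simp) (by simp) (by simp) fun x y hxy => ?_
    omega

end RAM

/-! ### The search for a Hamiltonian cycle -/

namespace RAM

/-- Write the answer `b` and the length, and repeat the first entry of the list. -/
def St.report (e : Tm) (b : ℕ) : St :=
  .seq (.put 1 e (.const 0) (.get 1 (.const 0) (.const 0)))
    (.seq (.put 6 (.const 1) (.const 0) (.add e (.const 1))) (.put 6 (.const 0) (.const 0) (.const b)))

lemma St.report_run {n k b : ℕ} {e : Tm} {env : ℕ → ℕ} {m : Mem} {A : ℕ → ℕ → Prop}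
    (h1 : 1 ∉ e.reads) (hk : 0 < k) (he : e.eval n m env = k)
    (hl : ClosedList n k A fun i => m 1 i 0) : Found n k A b ((St.report e b).run n env m) := by
  have he' : e.eval n (m.upd 1 k 0 (m 1 0 0)) env = k := by
    rw [← he]
    refine Tm.eval_congr e env fun a ha => ?_
    have : a ≠ 1 := fun h => h1 (h ▸ ha)
    funext i j
    simp [Mem.upd_apply, this]
  simp only [St.report, St.run, Tm.eval, he, he']
  have hout : ∀ i < k, m.upd 1 k 0 (m 1 0 0) 1 i 0 = m 1 i 0 := fun i hi => by
    rw [Mem.upd_apply, if_neg (by omega)]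
  refine ⟨by simp [Mem.upd_apply], by simp [Mem.upd_apply], ?_, ?_⟩
  · have e1 : ∀ i, (((m.upd 1 k 0 (m 1 0 0)).upd 6 1 0 (k + 1)).upd 6 0 0 b) 1 i 0 =
        m.upd 1 k 0 (m 1 0 0) 1 i 0 := fun i => by simp [Mem.upd_apply]
    obtain ⟨g1, g2, g3, g4⟩ := hl
    refine ⟨fun i hi => ?_, fun i hi j hj => ?_, fun i hi => ?_, ?_⟩
    · simp only [e1, hout i hi, g1 i hi]
    · simp only [e1, hout i hi, hout j hj]
      exact g2 i hi j hj
    · simp only [e1, hout i (by omega), hout (i + 1) hi]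
      exact g3 i hi
    · simp only [e1, hout _ hk, hout (k - 1) (by omega)]
      exact g4
  · simp [Mem.upd_apply]

/-- The list in array `1` is closed and has all vertices. -/
def Tm.closed : Tm :=
  .and (.all 40 (.lt (.get 1 (.var 40) (.const 0)) .size))
    (.and (.all 40 (.all 41 (.add (.not (.eq (.get 1 (.var 40) (.const 0)) (.get 1 (.var 41) (.const 0))))
      (.eq (.var 40) (.var 41)))))
    (.and (.all 40 (.add (.not (.lt (.add (.var 40) (.const 1)) .size))
      (.get 0 (.get 1 (.var 40) (.const 0)) (.get 1 (.add (.var 40) (.const 1)) (.const 0)))))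
    (.get 0 (.get 1 (.sub .size (.const 1)) (.const 0)) (.get 1 (.const 0) (.const 0)))))

lemma Tm.tr_closed {n : ℕ} {env : ℕ → ℕ} {m : Mem} :
    Tm.closed.tr n m env ↔ ClosedList n n (rel m 0) fun i => m 1 i 0 := by
  simp only [Tm.closed, tr_and, tr_all, tr_lt, tr_add, tr_not, tr_eq, tr_get, eval_get, eval_var,
    eval_add, eval_sub, eval_const, eval_size, Function.update_self, Function.update_of_ne,
    ne_eq, show (40 : ℕ) ≠ 41 by decide, not_false_eq_true]
  constructor
  · rintro ⟨h1, h2, h3, h4⟩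
    exact ⟨h1, fun i hi j hj e => (h2 i hi j hj).resolve_left (not_not.mpr e),
      fun i hi => (h3 i (by omega)).resolve_left (not_not.mpr hi), h4⟩
  · rintro ⟨h1, h2, h3, h4⟩
    exact ⟨h1, fun i hi j hj => or_iff_not_imp_left.mpr fun e => h2 i hi j hj (not_not.mp e),
      fun i hi => or_iff_not_imp_left.mpr fun e => h3 i (not_not.mp e), h4⟩

/-- The value of `t` is not among the earlier entries of the list. -/
def Tm.unvisited (t : Tm) : Tm :=
  .all 45 (.not (.and (.lt (.var 45) (.var 40)) (.eq (.get 1 (.var 45) (.const 0)) t)))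

/-- The last entry of the list so far. -/
def Tm.prev : Tm := .get 1 (.sub (.var 40) (.const 1)) (.const 0)

/-- The condition under which a vertex may be the next entry of the list. -/
def Tm.listCond : Tm :=
  .and (.unvisited (.var 41)) (.add (.and (.lt (.const 0) (.var 40)) (.get 4 .prev (.var 41)))
    (.and (.not (.ex 46 (.and (.unvisited (.var 46)) (.and (.lt (.const 0) (.var 40))
      (.get 4 .prev (.var 46)))))) (.lt (.cnt 45 (.get 4 (.var 41) (.var 45))) (.const 2))))

lemma ListCond.congr {n : ℕ} {R : ℕ → ℕ → Prop} {out out' : ℕ → ℕ} {i y : ℕ}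
    (h : ∀ j < i, out j = out' j) (hl : ListCond n R out i y) : ListCond n R out' i y := by
  have e1 : ∀ z, (∀ j < i, out j ≠ z) ↔ ∀ j < i, out' j ≠ z := fun z =>
    forall₂_congr fun j hj => by rw [h j hj]
  have e2 : ∀ z, (0 < i ∧ R (out (i - 1)) z) ↔ (0 < i ∧ R (out' (i - 1)) z) := fun z =>
    and_congr_right fun hi => by rw [h (i - 1) (by omega)]
  simpa only [ListCond, e1, e2] using hl

lemma forall_lt_lt_iff {n i : ℕ} (hi : i < n) {p : ℕ → Prop} :
    (∀ j < n, ¬ (j < i ∧ p j)) ↔ ∀ j < i, ¬ p j :=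
  ⟨fun h j hj e => h j (by omega) ⟨hj, e⟩, fun h j _ e => h j e.1 e.2⟩

lemma Tm.tr_listCond {n i y : ℕ} (hi : i < n) {env : ℕ → ℕ} {m : Mem} (ei : env 40 = i)
    (ey : env 41 = y) :
    Tm.listCond.tr n m env ↔ ListCond n (rel m 4) (fun j => m 1 j 0) i y := by
  subst ei ey
  simp only [Tm.listCond, Tm.unvisited, Tm.prev, tr_and, tr_all, tr_lt, tr_add, tr_not, tr_eq, tr_get,
    tr_ex, eval_get, eval_var, eval_sub, eval_const, eval_cnt_tr, Function.update_self,
    Function.update_of_ne, ne_eq, show (40 : ℕ) ≠ 45 by decide, show (40 : ℕ) ≠ 46 by decide,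
    show (41 : ℕ) ≠ 45 by decide, show (46 : ℕ) ≠ 45 by decide, not_false_eq_true,
    forall_lt_lt_iff hi, Nat.lt_succ_iff]
  exact Iff.rfl

lemma St.listCond_run {n : ℕ} {env : ℕ → ℕ} {m : Mem} :
    (∀ b, b ≠ 1 → (St.list .listCond).run n env m b = m b) ∧
      ∀ i < n, (∃ y < n, ListCond n (rel m 4) (fun j => (St.list .listCond).run n env m 1 j 0) i y) →
        (St.list .listCond).run n env m 1 i 0 < n ∧
        ListCond n (rel m 4) (fun j => (St.list .listCond).run n env m 1 j 0) i
          ((St.list .listCond).run n env m 1 i 0) := by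
  refine St.list_run (ListCond n (rel m 4)) (fun out out' i y h hl => hl.congr h) ?_
  intro m' hm' i hi y hy
  rw [Tm.tr_listCond (i := i) (y := y) hi (by simp) (by simp)]
  have : rel m' 4 = rel m 4 := by
    funext x y
    rw [rel, rel, hm' 4 (by decide)]
  rw [this]

/-- The guessed independent set: the variables `1`, `2`, `3` hold the neighbours of the vertex in
variable `0` that belong to it. -/
def guessJ (A : ℕ → ℕ → Prop) (env : ℕ → ℕ) (w : ℕ) : Prop :=
  w ≠ env 0 ∧ ¬ A (env 0) w ∨ w = env 1 ∨ w = env 2 ∨ w = env 3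

/-- The guessed edges: at the vertex in variable `4 + 3 r` only the neighbours in the next two
variables are allowed. -/
def guessB (A : ℕ → ℕ → Prop) (env : ℕ → ℕ) (a b : ℕ) : Prop :=
  A a b ∧ (guessJ A env a ∨ guessJ A env b) ∧ ∀ r < 11,
    (a = env (4 + 3 * r) → b = env (5 + 3 * r) ∨ b = env (6 + 3 * r)) ∧
    (b = env (4 + 3 * r) → a = env (5 + 3 * r) ∨ a = env (6 + 3 * r))

/-- The edges that are taken before the greedy choice. -/
def forcedRel (n : ℕ) (J : ℕ → Prop) (B : ℕ → ℕ → Prop) (a b : ℕ) : Prop :=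
  B a b ∧ (J a ∧ cn n (B a) ≤ 2 ∨ J b ∧ cn n (B b) ≤ 2)

lemma GreedyInv.of_forcedRel {n : ℕ} {J : ℕ → Prop} {B : ℕ → ℕ → Prop} (hd : GreedyData n J B)
    (hac : Acyclic n (forcedRel n J B)) : GreedyInv n J B (forcedRel n J B) where
  symm x hx y hy h := ⟨hd.symm x hx y hy h.1, h.2.symm⟩
  sub x hx y hy h := h.1
  acyclic := hac
  low x hx hJ h2 y hy h := ⟨h, .inl ⟨hJ, h2⟩⟩
  high x hx hJ h3 := .inl fun y hy h => h.2.elim (fun e => by omega)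
    fun e => (hd.side x hx y hy h.1).mp hJ e.1

/-- The term for `guessJ`. -/
def Tm.guessJ : Tm :=
  .add (.and (.not (.eq (.var 40) (.var 0))) (.not (.get 0 (.var 0) (.var 40))))
    (.add (.eq (.var 40) (.var 1)) (.add (.eq (.var 40) (.var 2)) (.eq (.var 40) (.var 3))))

/-- The vertex in variable `x` is joined to the vertex in variable `y` only if the guess allows it. -/
def Tm.allowed (r x y : ℕ) : Tm :=
  .add (.not (.eq (.var x) (.var (4 + 3 * r))))
    (.add (.eq (.var y) (.var (5 + 3 * r))) (.eq (.var y) (.var (6 + 3 * r))))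

/-- The term for `guessB`. -/
def Tm.guessB : Tm :=
  .and (.get 0 (.var 40) (.var 41)) (.and (.add (.get 2 (.var 40) (.const 0)) (.get 2 (.var 41) (.const 0)))
    (.conj ((List.range 11).map fun r => .and (.allowed r 40 41) (.allowed r 41 40))))

/-- The degree in array `3` of the vertex in variable `x` is at most two. -/
def Tm.low (x : ℕ) : Tm :=
  .and (.get 2 (.var x) (.const 0)) (.lt (.cnt 45 (.get 3 (.var x) (.var 45))) (.const 3))

/-- The term for `forcedRel`. -/
def Tm.forced : Tm := .and (.get 3 (.var 40) (.var 41)) (.add (.low 40) (.low 41))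

/-- Build a list from the guess in the variables. -/
def St.attempt : St :=
  .seq (.fill 2 40 .guessJ) (.seq (.fillTable 3 40 41 .guessB) (.seq (.fillTable 4 40 41 .forced)
    (.seq .greedy (.list .listCond))))

/-- Try the guess in the variables, unless a Hamiltonian cycle has been found already. -/
def St.guess : St :=
  .ite (.get 6 (.const 0) (.const 0)) .skip
    (.seq .attempt (.ite .closed (.report .size 1) .skip))

/-- Try all guesses. -/
def St.search : St := .nest (List.range 37) .guess

/-- The state of the search: if the flag is set, then a Hamiltonian cycle is in memory. -/
def SearchInv (n : ℕ) (A : ℕ → ℕ → Prop) (m : Mem) : Prop :=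
  rel m 0 = A ∧ (m 6 0 0 ≠ 0 → Found n n A 1 m)

lemma St.attempt_run {n : ℕ} {env : ℕ → ℕ} {m : Mem} {b : ℕ} (hb : b = 0 ∨ b = 6) :
    St.attempt.run n env m b = m b := by
  refine St.run_eq _ _ _ ?_
  simp only [St.attempt, St.fill, St.fillTable, St.greedy, St.tryPair, St.link, St.core, St.pruneStep,
    St.list, St.choose, St.writes]
  rcases hb with rfl | rfl <;> decide

/-- Soundness does not depend on the quality of the guess: a list is reported only after `Tm.closed`
has verified it. -/
lemma SearchInv.guess {n : ℕ} {A : ℕ → ℕ → Prop} (hn : 0 < n) (env : ℕ → ℕ) (m : Mem)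
    (h : SearchInv n A m) : SearchInv n A (St.guess.run n env m) := by
  by_cases hf : (Tm.get 6 (.const 0) (.const 0)).tr n m env
  · rw [St.guess, St.run_ite_pos hf]
    exact h
  · rw [St.guess, St.run_ite_neg hf, St.run]
    have e0 := St.attempt_run (n := n) (env := env) (m := m) (.inl rfl)
    have e6 := St.attempt_run (n := n) (env := env) (m := m) (.inr rfl)
    generalize St.attempt.run n env m = m₁ at e0 e6
    have hA : rel m₁ 0 = A := by
      rw [← h.1]
      funext x y
      rw [rel, rel, e0]
    by_cases hc : Tm.closed.tr n m₁ env
    · rw [St.run_ite_pos hc]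
      rw [Tm.tr_closed, hA] at hc
      refine ⟨?_, fun _ => St.report_run (by simp [Tm.reads]) hn rfl hc⟩
      rw [← hA]
      funext x y
      rw [rel, rel, St.run_eq _ _ _ (by simp [St.report, St.writes])]
    · rw [St.run_ite_neg hc, St.run]
      refine ⟨hA, fun h6 => absurd ?_ hf⟩
      rw [e6] at h6
      exact h6

lemma SearchInv.guess_flag {n : ℕ} (env : ℕ → ℕ) (m : Mem)
    (hf : m 6 0 0 ≠ 0) : (St.guess.run n env m) 6 0 0 ≠ 0 := by
  rw [St.guess, St.run_ite_pos (show (Tm.get 6 (.const 0) (.const 0)).tr n m env from hf)]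
  exact hf

/-- A guess for which the greedy choice finds a Hamiltonian cycle. -/
structure GoodGuess (n : ℕ) (A : ℕ → ℕ → Prop) (J : ℕ → Prop) (B : ℕ → ℕ → Prop) : Prop where
  data : GreedyData n J B
  acyclic : Acyclic n (forcedRel n J B)
  adj : ∀ x < n, ∀ y < n, B x y → A x y
  ends : ∀ R : ℕ → ℕ → Prop, (∀ x < n, ∀ y < n, R x y → R y x) →
    (∀ x < n, ∀ y < n, R x y → B x y) →
    (∀ u < n, J u → 1 ≤ cn n (B u) → 1 ≤ cn n (R u)) →
    (∀ u < n, J u → 2 ≤ cn n (B u) → 2 ≤ cn n (R u)) →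
    ∀ x < n, ∀ y < n, x ≠ y → cn n (R x) ≤ 1 → cn n (R y) ≤ 1 → A x y

lemma Tm.tr_guessJ {n x : ℕ} {env : ℕ → ℕ} {m : Mem} :
    Tm.guessJ.tr n m (Function.update env 40 x) ↔ RAM.guessJ (rel m 0) env x := by
  simp [Tm.guessJ, RAM.guessJ, rel]

lemma Tm.tr_allowed {n r x y : ℕ} {env : ℕ → ℕ} {m : Mem} :
    (Tm.allowed r x y).tr n m env ↔
      (env x = env (4 + 3 * r) → env y = env (5 + 3 * r) ∨ env y = env (6 + 3 * r)) := by
  simp only [Tm.allowed, tr_add, tr_not, tr_eq, eval_var]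
  tauto

lemma Tm.tr_guessB {n x y : ℕ} {env : ℕ → ℕ} {m : Mem} {A : ℕ → ℕ → Prop} (hA : rel m 0 = A)
    (hx : m 2 x 0 ≠ 0 ↔ RAM.guessJ A env x) (hy : m 2 y 0 ≠ 0 ↔ RAM.guessJ A env y) :
    Tm.guessB.tr n m (Function.update (Function.update env 40 x) 41 y) ↔ RAM.guessB A env x y := by
  have e40 : Function.update (Function.update env 40 x) 41 y 40 = x := by simp
  have e41 : Function.update (Function.update env 40 x) 41 y 41 = y := by simp
  have ev : ∀ k, k < 40 → Function.update (Function.update env 40 x) 41 y k = env k := fun k hk => by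
    rw [Function.update_of_ne (by omega), Function.update_of_ne (by omega)]
  simp only [Tm.guessB, tr_and, tr_add, tr_get, eval_var, e40, e41, eval_const, hx, hy, tr_conj,
    List.forall_mem_map, List.mem_range, tr_allowed]
  rw [RAM.guessB, ← hA]
  refine and_congr Iff.rfl (and_congr Iff.rfl (forall₂_congr fun r hr => ?_))
  rw [ev _ (by omega), ev _ (by omega), ev _ (by omega)]

lemma Tm.tr_forced {n x y : ℕ} (hxn : x < n) (hyn : y < n) {env : ℕ → ℕ} {m : Mem} {J : ℕ → Prop}
    {B : ℕ → ℕ → Prop} (hJ : ∀ x < n, m 2 x 0 ≠ 0 ↔ J x) (hB : ∀ x < n, ∀ y < n, rel m 3 x y ↔ B x y) :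
    Tm.forced.tr n m (Function.update (Function.update env 40 x) 41 y) ↔ forcedRel n J B x y := by
  have hcn : ∀ x < n, cn n (fun i => m 3 x i ≠ 0) = cn n (B x) := fun x hx => cn_congr (hB x hx)
  simp only [Tm.forced, Tm.low, tr_and, tr_add, tr_get, tr_lt, eval_var, eval_const, eval_cnt_tr,
    Function.update_self, Function.update_of_ne, ne_eq, show (40 : ℕ) ≠ 45 by decide,
    show (40 : ℕ) ≠ 41 by decide, show (41 : ℕ) ≠ 45 by decide, not_false_eq_true]
  simp only [← ne_eq, hcn x hxn, hcn y hyn, hJ x hxn, hJ y hyn, Nat.lt_succ_iff]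
  rw [forcedRel, ← hB x hxn y hyn]
  exact Iff.rfl

/-- Follows the memory through the stages of `St.attempt`. The greedy result inherits the lower
degree bounds that `ends` asks for: vertices with at most two admissible edges keep all, the others
have exactly two. -/
lemma GoodGuess.attempt_run {n : ℕ} {A : ℕ → ℕ → Prop} {env : ℕ → ℕ}
    (h : GoodGuess n A (guessJ A env) (guessB A env)) (hn : 2 ≤ n) {m : Mem} (hA : rel m 0 = A) :
    ClosedList n n A fun i => St.attempt.run n env m 1 i 0 := by
  simp only [St.attempt, St.run.eq_3]
  obtain ⟨f1, f2⟩ := St.fill_run (n := n) (a := 2) (x := 40) (e := .guessJ) (env := env) (m := m)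
    (by decide)
  generalize (St.fill 2 40 Tm.guessJ).run n env m = m₁ at f1 f2
  have hA₁ : rel m₁ 0 = A := by
    rw [← hA]
    funext x y
    rw [rel, rel, f1 0 (by decide)]
  have hJ₁ : ∀ x < n, m₁ 2 x 0 ≠ 0 ↔ guessJ A env x := fun x hx => by
    rw [f2 x hx, ← hA]
    exact Tm.tr_guessJ
  obtain ⟨g1, g2⟩ := St.fillTable_run (n := n) (a := 3) (x := 40) (y := 41) (e := .guessB) (env := env)
    (m := m₁) (by decide) (by decide)
  generalize (St.fillTable 3 40 41 Tm.guessB).run n env m₁ = m₂ at g1 g2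
  have hJ₂ : ∀ x < n, m₂ 2 x 0 ≠ 0 ↔ guessJ A env x := fun x hx => by
    rw [g1 2 (by decide)]
    exact hJ₁ x hx
  have hB₂ : ∀ x < n, ∀ y < n, rel m₂ 3 x y ↔ guessB A env x y := fun x hx y hy => by
    rw [rel, g2 x hx y hy]
    exact Tm.tr_guessB hA₁ (hJ₁ x hx) (hJ₁ y hy)
  obtain ⟨k1, k2⟩ := St.fillTable_run (n := n) (a := 4) (x := 40) (y := 41) (e := .forced) (env := env)
    (m := m₂) (by decide) (by decide)
  generalize (St.fillTable 4 40 41 Tm.forced).run n env m₂ = m₃ at k1 k2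
  have hJ₃ : ∀ x < n, m₃ 2 x 0 ≠ 0 ↔ guessJ A env x := fun x hx => by
    rw [k1 2 (by decide)]
    exact hJ₂ x hx
  have hB₃ : ∀ x < n, ∀ y < n, rel m₃ 3 x y ↔ guessB A env x y := fun x hx y hy => by
    rw [← hB₂ x hx y hy, rel, rel, k1 3 (by decide)]
  have hR₃ : GreedyInv n (guessJ A env) (guessB A env) (rel m₃ 4) :=
    (GreedyInv.of_forcedRel h.data h.acyclic).congr fun x hx y hy => by
      rw [rel, k2 x hx y hy]
      exact Tm.tr_forced hx hy hJ₂ hB₂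
  obtain ⟨-, r2, r3⟩ := St.greedy_run (env := env) h.data hJ₃ hB₃ hR₃
  generalize St.greedy.run n env m₃ = m₄ at r2 r3
  obtain ⟨-, l2⟩ := St.listCond_run (n := n) (env := env) (m := m₄)
  generalize (St.list .listCond).run n env m₄ = m₅ at l2
  have hle : ∀ x < n, cn n (rel m₄ 4 x) ≤ cn n (guessB A env x) := fun x hx =>
    cn_mono fun y hy => r2.sub x hx y hy
  have hlow : ∀ x < n, guessJ A env x → cn n (guessB A env x) ≤ 2 →
      cn n (guessB A env x) = cn n (rel m₄ 4 x) := fun x hx hJ h2 =>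
    le_antisymm (cn_mono fun y hy => r2.low x hx hJ h2 y hy) (hle x hx)
  obtain ⟨o1, o2, o3, o4⟩ := listing (A := A) r2.acyclic r2.symm
    (fun x hx e => by
      have := h.data.side x hx x hx (r2.sub x hx x hx e)
      tauto)
    (fun x hx => by
      by_cases hJ : guessJ A env x
      · by_cases h3 : 3 ≤ cn n (guessB A env x)
        · exact (r3 x hx hJ h3).le
        · exact (hle x hx).trans (by omega)
      · exact (hle x hx).trans (h.data.deg x hx hJ))
    (fun x hx y hy e => h.adj x hx y hy (r2.sub x hx y hy e))
    (h.ends _ r2.symm r2.sub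
      (fun u hu hJ h1 => by
        by_cases h3 : 3 ≤ cn n (guessB A env u)
        · rw [r3 u hu hJ h3]
          decide
        · rwa [← hlow u hu hJ (by omega)])
      (fun u hu hJ h2 => by
        by_cases h3 : 3 ≤ cn n (guessB A env u)
        · exact (r3 u hu hJ h3).ge
        · rwa [← hlow u hu hJ (by omega)])) l2 hn
  exact ⟨o1, o2, o3, o4⟩

lemma GoodGuess.guess_flag {n : ℕ} {A : ℕ → ℕ → Prop} {env : ℕ → ℕ}
    (h : GoodGuess n A (guessJ A env) (guessB A env)) (hn : 2 ≤ n) {m : Mem} (hm : SearchInv n A m) :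
    St.guess.run n env m 6 0 0 ≠ 0 := by
  by_cases hf : (Tm.get 6 (.const 0) (.const 0)).tr n m env
  · exact SearchInv.guess_flag env m hf
  · rw [St.guess, St.run_ite_neg hf, St.run]
    have e0 := St.attempt_run (n := n) (env := env) (m := m) (.inl rfl)
    have hl := h.attempt_run hn hm.1
    generalize St.attempt.run n env m = m₁ at e0 hl
    have hA : rel m₁ 0 = A := by
      rw [← hm.1]
      funext x y
      rw [rel, rel, e0]
    rw [St.run_ite_pos (Tm.tr_closed.mpr (hA ▸ hl)),
      (St.report_run (by simp [Tm.reads]) (show 0 < n by omega) rfl hl).1]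
    exact one_ne_zero

/-- The search keeps its invariant, and it succeeds if there is a good guess. -/
lemma St.search_run {n : ℕ} {A : ℕ → ℕ → Prop} {m : Mem} (hn : 2 ≤ n) (hm : SearchInv n A m) :
    SearchInv n A (St.search.run n (fun _ => 0) m) ∧
      ((∃ env : ℕ → ℕ, (∀ x < 37, env x < n) ∧ (∀ x, 37 ≤ x → env x = 0) ∧
        GoodGuess n A (guessJ A env) (guessB A env)) → St.search.run n (fun _ => 0) m 6 0 0 ≠ 0) := by
  refine ⟨St.nest_inv (SearchInv.guess (by omega)) _ _ _ hm, ?_⟩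
  rintro ⟨env, h1, h2, hg⟩
  exact St.nest_success (Q := fun m => m 6 0 0 ≠ 0) (SearchInv.guess (by omega))
    (fun env m _ hf => SearchInv.guess_flag env m hf) (fun m hm => hg.guess_flag hn hm) _ _ _ hm
    (fun x hx => h1 x (List.mem_range.mp hx)) fun x hx => h2 x (by simpa using hx)

end RAM

/-! ### A good guess exists for Hamiltonian graphs -/

namespace RAM

lemma liftAdj_iff {n : ℕ} {R : Fin n → Fin n → Prop} (a b : Fin n) : liftAdj R a b ↔ R a b :=
  ⟨fun ⟨_, _, h⟩ => h, fun h => ⟨a.2, b.2, h⟩⟩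

/-- Values of the variables that describe a guess. -/
lemma exists_env {n : ℕ} (v x y w : Fin n) (z p q : Fin 11 → Fin n) :
    ∃ env : ℕ → ℕ, (∀ k < 37, env k < n) ∧ (∀ k, 37 ≤ k → env k = 0) ∧ env 0 = v ∧ env 1 = x ∧
      env 2 = y ∧ env 3 = w ∧ ∀ r : Fin 11, env (4 + 3 * r) = z r ∧ env (5 + 3 * r) = p r ∧
        env (6 + 3 * r) = q r := by
  -- Four variables describe the independent set and eleven blocks of three the vertices `z r` with
  -- their allowed neighbours, which makes 37.
  let f : ℕ → Fin n := fun k => if k = 0 then v else if k = 1 then x else if k = 2 then y else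
    if k = 3 then w else if k % 3 = 1 then z (Fin.ofNat 11 ((k - 4) / 3)) else
    if k % 3 = 2 then p (Fin.ofNat 11 ((k - 4) / 3)) else q (Fin.ofNat 11 ((k - 4) / 3))
  refine ⟨fun k => if k < 37 then f k else 0, fun k hk => ?_, fun k hk => if_neg (by omega), rfl, rfl,
    rfl, rfl, fun r => ?_⟩
  · simp only [hk, if_true]
    exact (f k).2
  · have hr := r.2
    have key : ∀ i < 3, Fin.ofNat 11 ((4 + i + 3 * r - 4) / 3) = r := fun i hi => by
      ext
      simp only [Fin.ofNat]
      rw [show (4 + i + 3 * r.val - 4) / 3 = r by omega, Nat.mod_eq_of_lt hr]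
    refine ⟨?_, ?_, ?_⟩
    · simp only
      rw [if_pos (by omega)]
      simp only [f]
      rw [if_neg (by omega), if_neg (by omega), if_neg (by omega), if_neg (by omega), if_pos (by omega)]
      exact congrArg (fun i => (z i : ℕ)) (key 0 (by decide))
    · simp only
      rw [if_pos (by omega)]
      simp only [f]
      rw [if_neg (by omega), if_neg (by omega), if_neg (by omega), if_neg (by omega), if_neg (by omega),
        if_pos (by omega)]
      exact congrArg (fun i => (p i : ℕ)) (key 1 (by decide))
    · simp only
      rw [if_pos (by omega)]
      simp only [f]
      rw [if_neg (by omega), if_neg (by omega), if_neg (by omega), if_neg (by omega), if_neg (by omega),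
        if_neg (by omega)]
      exact congrArg (fun i => (q i : ℕ)) (key 2 (by decide))

end RAM

namespace SimpleGraph

/-- The outer neighbours of a clique vertex are among three vertices of the independent set. -/
lemma SplitFacts.exists_three {V : Type*} {G : SimpleGraph V} {K I : Finset V} (h : G.SplitFacts K I)
    {v : V} (hv : v ∈ K) :
    ∃ x ∈ I, ∃ y ∈ I, ∃ w ∈ I, ∀ u ∈ I, G.Adj v u → u = x ∨ u = y ∨ u = w := by
  obtain ⟨i, hi⟩ := Finset.card_pos.mp (show 0 < I.card by have := h.eight_le; omega)
  by_cases h1 : ∃ x ∈ I, G.Adj v x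
  · obtain ⟨x, hx, vx⟩ := h1
    by_cases h2 : ∃ y ∈ I, G.Adj v y ∧ x ≠ y
    · obtain ⟨y, hy, vy, hxy⟩ := h2
      by_cases h3 : ∃ w ∈ I, G.Adj v w ∧ x ≠ w ∧ y ≠ w
      · obtain ⟨w, hw, vw, hxw, hyw⟩ := h3
        exact ⟨x, hx, y, hy, w, hw, fun u hu vu => h.four v hv x hx y hy w hw u hu vx vy vw vu hxy hxw hyw⟩
      · refine ⟨x, hx, y, hy, y, hy, fun u hu vu => ?_⟩
        by_contra hc
        push Not at hc
        exact h3 ⟨u, hu, vu, hc.1.symm, hc.2.1.symm⟩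
    · refine ⟨x, hx, x, hx, x, hx, fun u hu vu => ?_⟩
      by_contra hc
      push Not at hc
      exact h2 ⟨u, hu, vu, hc.1.symm⟩
  · exact ⟨i, hi, i, hi, i, hi, fun u hu vu => absurd ⟨u, hu, vu⟩ h1⟩

lemma IsGuide.exists_pair {V : Type*} {G : SimpleGraph V} {K I : Finset V} {F : V → V → Prop}
    {z : Fin 11 → V} (h : G.IsGuide K I F z) (a : V) :
    ∃ p q, ∀ b, G.crossAdj K I a b → ((b = p ∨ b = q) ↔ F a b) := by
  obtain ⟨p, q, hpq⟩ := h.deg a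
  by_cases hp : F a p
  · by_cases hq : F a q
    · exact ⟨p, q, fun b _ => ⟨by rintro (rfl | rfl) <;> assumption, hpq b⟩⟩
    · refine ⟨p, p, fun b _ => ⟨by rintro (rfl | rfl) <;> assumption, fun e => .inl ?_⟩⟩
      exact (hpq b e).resolve_right fun e' => hq (e' ▸ e)
  · by_cases hq : F a q
    · refine ⟨q, q, fun b _ => ⟨by rintro (rfl | rfl) <;> assumption, fun e => .inl ?_⟩⟩
      exact (hpq b e).resolve_left fun e' => hp (e' ▸ e)
    -- With no neighbour in `F`, the vertex `a` itself serves as a dummy, since it is not adjacent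
    -- to itself.
    · refine ⟨a, a, fun b hb => ⟨fun e => ?_, fun e => ?_⟩⟩
      · exact absurd (or_self_iff.mp e).symm hb.1.ne
      · rcases hpq b e with rfl | rfl
        · exact absurd e hp
        · exact absurd e hq

variable {n : ℕ} {G : SimpleGraph (Fin n)} {K I : Finset (Fin n)} {F : Fin n → Fin n → Prop}
  {z : Fin 11 → Fin n}

open RAM

lemma IsGuide.goodGuess (h : G.SplitFacts K I) (hg : G.IsGuide K I F z) {J : ℕ → Prop}
    {B : ℕ → ℕ → Prop} (hJ : ∀ a : Fin n, J a ↔ a ∈ I)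
    (hB : ∀ a b : Fin n, B a b ↔ G.restrictAdj K I F z a b) :
    GoodGuess n (liftAdj G.Adj) J B := by
  classical
  have hJ' : ∀ (x : ℕ) (hx : x < n), J x ↔ (⟨x, hx⟩ : Fin n) ∈ I := fun x hx => hJ ⟨x, hx⟩
  have hB' : ∀ (x y : ℕ) (hx : x < n) (hy : y < n), B x y ↔ G.restrictAdj K I F z ⟨x, hx⟩ ⟨y, hy⟩ :=
    fun x y hx hy => hB ⟨x, hx⟩ ⟨y, hy⟩
  have hsymm : ∀ a b, G.restrictAdj K I F z a b → G.restrictAdj K I F z b a := fun a b hab =>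
    ⟨hab.1.symm, fun r => ⟨fun e => hg.symm _ _ ((hab.2 r).2 e), fun e => hg.symm _ _ ((hab.2 r).1 e)⟩⟩
  have hlow : ∀ (a : Fin n), cn n (B a) ≤ 2 → ∀ p q r, G.restrictAdj K I F z a p →
      G.restrictAdj K I F z a q → G.restrictAdj K I F z a r → p = q ∨ p = r ∨ q = r := by
    intro a ha p q r hp hq hr
    by_contra hc
    push Not at hc
    have := three_le_cn.mpr ⟨p, p.2, q, q.2, r, r.2, fun e => hc.1 (Fin.ext e),
      fun e => hc.2.1 (Fin.ext e), fun e => hc.2.2 (Fin.ext e), (hB a p).mpr hp, (hB a q).mpr hq,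
      (hB a r).mpr hr⟩
    omega
  have hforced : ∀ a b : Fin n, forcedRel n J B a b → F a b := by
    rintro a b ⟨hab, ⟨ha, h2⟩ | ⟨hb, h2⟩⟩
    · exact hg.forced a ((hJ a).mp ha) (hlow a h2) b ((hB a b).mp hab)
    · exact hg.symm _ _ (hg.forced b ((hJ b).mp hb) (hlow b h2) a (hsymm _ _ ((hB a b).mp hab)))
  refine ⟨⟨fun x hx y hy => ?_, fun x hx y hy hxy => ?_, fun x hx hJx => ?_⟩, ?_, ?_, ?_⟩
  · rw [hB' x y hx hy, hB' y x hy hx]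
    exact hsymm _ _
  · rw [hJ' x hx, hJ' y hy]
    rcases ((hB' x y hx hy).mp hxy).1.2 with e | e
    · exact ⟨fun _ => h.notMem _ e.2, fun _ => e.1⟩
    · exact ⟨fun e' => absurd e' (h.notMem _ e.1), fun e' => absurd e.2 e'⟩
  · by_contra hc
    obtain ⟨i, hi, j, hj, k, hk, hij, hik, hjk, bi, bj, bk⟩ := three_le_cn.mp (not_le.mp hc)
    rw [hJ' x hx] at hJx
    have := hg.degK _ ((h.cover _).resolve_right hJx) _ _ _ ((hB' x i hx hi).mp bi)
      ((hB' x j hx hj).mp bj) ((hB' x k hx hk).mp bk)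
    simp only [Fin.mk.injEq] at this
    omega
  · intro S hS hne h2
    have hlt : ∀ x ∈ S, x < n := fun x hx => Finset.mem_range.mp (hS hx)
    obtain ⟨s, hs⟩ := hne
    obtain ⟨x, hx, hxu⟩ := hg.acyclic (Finset.univ.filter fun a : Fin n => (a : ℕ) ∈ S)
      ⟨⟨s, hlt s hs⟩, by simpa using hs⟩
    obtain ⟨i, hi, j, hj, hij, ⟨iS, ri⟩, jS, rj⟩ := two_le_cn.mp (h2 x (by simpa using hx))
    have := hxu ⟨i, hi⟩ (by simpa using iS) ⟨j, hj⟩ (by simpa using jS) (hforced x ⟨i, hi⟩ ri)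
      (hforced x ⟨j, hj⟩ rj)
    exact hij (congrArg Fin.val this)
  · exact fun x hx y hy hxy => ⟨hx, hy, ((hB' x y hx hy).mp hxy).1.1⟩
  · intro R hRs hRB h1 h2 x hx y hy hxy dx dy
    refine ⟨hx, hy, hg.ends (fun a b => R a b) (fun a b => hRs a a.2 b b.2)
      (fun a b hab => (hB a b).mp (hRB a a.2 b b.2 hab)) ?_ ?_ _ _ (fun e => hxy (congrArg Fin.val e))
      ?_ ?_⟩
    · intro u hu a ha
      obtain ⟨b, hb, e⟩ := cn_pos.mp (h1 u u.2 ((hJ u).mpr hu) (cn_pos.mpr ⟨a, a.2, (hB u a).mpr ha⟩))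
      exact ⟨⟨b, hb⟩, e⟩
    · intro u hu a b hab ha hb
      obtain ⟨i, hi, j, hj, hij, ri, rj⟩ := two_le_cn.mp (h2 u u.2 ((hJ u).mpr hu) (two_le_cn.mpr
        ⟨a, a.2, b, b.2, fun e => hab (Fin.ext e), (hB u a).mpr ha, (hB u b).mpr hb⟩))
      exact ⟨⟨i, hi⟩, ⟨j, hj⟩, fun e => hij (congrArg Fin.val e), ri, rj⟩
    · exact fun a b ha hb => Fin.ext (cn_le_one.mp dx a a.2 b b.2 ha hb)
    · exact fun a b ha hb => Fin.ext (cn_le_one.mp dy a a.2 b b.2 ha hb)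

/-- The independent set is recovered from one clique vertex `v`: its non-neighbours, and its at most
three neighbours in `I`, padded by other vertices of `I`. -/
lemma SplitFacts.exists_goodGuess (h : G.SplitFacts K I) (hH : G.IsHamiltonian) :
    ∃ env : ℕ → ℕ, (∀ x < 37, env x < n) ∧ (∀ x, 37 ≤ x → env x = 0) ∧
      GoodGuess n (liftAdj G.Adj) (guessJ (liftAdj G.Adj) env) (guessB (liftAdj G.Adj) env) := by
  obtain ⟨F, z, hg⟩ := h.exists_guide hH
  obtain ⟨v, hv⟩ := Finset.card_pos.mp (show 0 < K.card by
    have := h.eight_le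
    have := h.card_le
    omega)
  obtain ⟨x, hx, y, hy, w, hw, hxyw⟩ := h.exists_three hv
  choose p q hpq using hg.exists_pair
  obtain ⟨env, e1, e2, ev, ex, ey, ew, er⟩ := exists_env v x y w z (fun r => p (z r)) (fun r => q (z r))
  have hJ : ∀ a : Fin n, guessJ (liftAdj G.Adj) env a ↔ a ∈ I := by
    intro a
    simp only [guessJ, ev, ex, ey, ew, liftAdj_iff, ne_eq, Fin.val_inj]
    constructor
    · rintro (⟨h1, h2⟩ | rfl | rfl | rfl)
      · exact (h.cover a).resolve_left fun ha => h2 (h.clique v hv a ha (Ne.symm h1))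
      · exact hx
      · exact hy
      · exact hw
    · intro ha
      by_cases hva : G.Adj v a
      · exact .inr (hxyw a ha hva)
      · exact .inl ⟨fun e => h.notMem v hv (e ▸ ha), hva⟩
  refine ⟨env, e1, e2, hg.goodGuess h hJ fun a b => ?_⟩
  simp only [guessB, hJ, liftAdj_iff]
  have hcross : G.Adj a b ∧ (a ∈ I ∨ b ∈ I) ↔ G.crossAdj K I a b := by
    constructor
    · rintro ⟨hab, ha | hb⟩
      · exact ⟨hab, .inl ⟨ha, (h.cover b).resolve_right fun hb => h.indep a ha b hb hab⟩⟩
      · exact ⟨hab, .inr ⟨(h.cover a).resolve_right fun ha => h.indep a ha b hb hab, hb⟩⟩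
    · exact fun hab => ⟨hab.1, hab.2.imp And.left And.right⟩
  rw [← and_assoc, hcross, restrictAdj]
  refine and_congr_right fun hab => ⟨fun hr r => ?_, fun hr r hr11 => ?_⟩
  · obtain ⟨r1, r2⟩ := hr r r.2
    obtain ⟨e1, e2, e3⟩ := er r
    rw [e1, e2, e3] at r1 r2
    simp only [Fin.val_inj] at r1 r2
    refine ⟨fun e => ?_, fun e => ?_⟩
    · have := (hpq (z r) b (e ▸ hab)).mp (r1 e)
      rwa [e]
    · have := (hpq (z r) a (e ▸ hab.symm)).mp (r2 e)
      exact hg.symm _ _ (by rwa [e])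
  · obtain ⟨r1, r2⟩ := hr ⟨r, hr11⟩
    obtain ⟨e1, e2, e3⟩ := er ⟨r, hr11⟩
    simp only at e1 e2 e3
    rw [e1, e2, e3]
    simp only [Fin.val_inj]
    refine ⟨fun e => ?_, fun e => ?_⟩
    · exact (hpq _ b (e ▸ hab)).mpr (e ▸ r1 e)
    · exact (hpq _ a (e ▸ hab.symm)).mpr (e ▸ hg.symm _ _ (r2 e))

end SimpleGraph

/-! ### The search for a short cycle -/

namespace RAM

/-- The term for adjacency in the graph of degree-two vertices. -/
def Tm.degTwoAdj : Tm :=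
  .and (.get 0 (.var 40) (.var 41)) (.add (.eq (.cnt 45 (.get 0 (.var 40) (.var 45))) (.const 2))
    (.eq (.cnt 45 (.get 0 (.var 41) (.var 45))) (.const 2)))

/-- Remove the vertex in variable `42` from the set of array `7` if a cycle remains. -/
def St.shrinkStep : St :=
  .seq (.core (.and (.get 7 (.var 50) (.const 0)) (.not (.eq (.var 50) (.var 42)))))
    (.ite (.ex 46 (.get 5 (.var 46) (.const 0))) (.put 7 (.var 42) (.const 0) (.const 0)) .skip)

/-- Find a minimal set with all degrees at least two. -/
def St.shrink : St := .seq (.fill 7 40 (.const 1)) (.forN 42 .shrinkStep)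

/-- The size of the set of array `7`. -/
def Tm.setSize : Tm := .cnt 45 (.get 7 (.var 45) (.const 0))

/-- The condition under which a vertex may be the next entry of the short cycle. -/
def Tm.cycleCond : Tm :=
  .and (.lt (.var 40) .setSize) (.and (.get 7 (.var 41) (.const 0)) (.and (.unvisited (.var 41))
    (.add (.eq (.var 40) (.const 0)) (.get 4 .prev (.var 41)))))

/-- Find a short cycle. -/
def St.findCycle : St :=
  .seq (.fillTable 4 40 41 .degTwoAdj) (.seq .shrink (.seq (.list .cycleCond) (.report .setSize 0)))

open scoped Classical in
/-- The set stored in array `7`. -/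
noncomputable def setOf (n : ℕ) (m : Mem) : Finset ℕ := (Finset.range n).filter fun i => m 7 i 0 ≠ 0

lemma mem_setOf {n i : ℕ} {m : Mem} : i ∈ setOf n m ↔ i < n ∧ m 7 i 0 ≠ 0 := by
  simp [setOf]

lemma St.shrinkStep_run {n x : ℕ} (hx : x < n) {env : ℕ → ℕ} {m : Mem} (ex : env 42 = x) :
    (∀ b, b ≠ 5 → b ≠ 7 → St.shrinkStep.run n env m b = m b) ∧
      ((setOf n (St.shrinkStep.run n env m) = setOf n m ∧ ∀ S ⊆ setOf n m, S.Nonempty →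
          TwoClosed n (rel m 4) S → x ∈ S) ∨
        setOf n (St.shrinkStep.run n env m) = (setOf n m).erase x ∧
          ∃ S ⊆ (setOf n m).erase x, S.Nonempty ∧ TwoClosed n (rel m 4) S) := by
  subst ex
  refine ⟨fun b h5 h7 => St.run_eq _ _ _ (by
    simp [St.shrinkStep, St.core, St.fill, St.pruneStep, St.writes, h5, h7]), ?_⟩
  rw [St.shrinkStep, St.run]
  obtain ⟨c1, c2⟩ := St.core_run (n := n) (m := m) (env := env)
    (e := .and (.get 7 (.var 50) (.const 0)) (.not (.eq (.var 50) (.var 42)))) (by decide)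
  generalize (St.core (.and (.get 7 (.var 50) (.const 0)) (.not (.eq (.var 50) (.var 42))))).run n env m
    = m₁ at c1 c2
  have hsub : ∀ S ⊆ Finset.range n, (∀ i ∈ S, (Tm.and (.get 7 (.var 50) (.const 0))
      (.not (.eq (.var 50) (.var 42)))).tr n m (Function.update env 50 i)) ↔
      S ⊆ (setOf n m).erase (env 42) := by
    intro S hS
    simp only [Tm.tr_and, Tm.tr_get, Tm.eval_var, Tm.eval_const, Tm.tr_not, Tm.tr_eq,
      Function.update_self, Function.update_of_ne, ne_eq, show (42 : ℕ) ≠ 50 by decide,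
      not_false_eq_true, Finset.subset_iff, Finset.mem_erase, mem_setOf]
    refine forall₂_congr fun i hi => ?_
    have := Finset.mem_range.mp (hS hi)
    tauto
  have hset : setOf n m₁ = setOf n m := by
    ext i
    rw [mem_setOf, mem_setOf, c1 7 (by decide)]
  by_cases ht : (Tm.ex 46 (.get 5 (.var 46) (.const 0))).tr n m₁ env
  · rw [St.run_ite_pos ht]
    obtain ⟨S, hS, hne, hSe, h2⟩ := c2.mp (by simpa using ht)
    refine .inr ⟨?_, S, (hsub S hS).mp hSe, hne, h2⟩
    rw [← hset]
    ext i
    simp only [mem_setOf, Finset.mem_erase, St.run, Mem.upd_apply, Tm.eval_var, Tm.eval_const, true_and,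
      and_true]
    split_ifs with h
    · simp [h]
    · simp [h]
  · rw [St.run_ite_neg ht, St.run]
    refine .inl ⟨hset, fun S hS hne h2 => ?_⟩
    by_contra hxS
    have hS' : S ⊆ Finset.range n := fun i hi => Finset.mem_range.mpr (mem_setOf.mp (hS hi)).1
    refine ht ?_
    simpa using c2.mpr ⟨S, hS', hne, (hsub S hS').mpr (Finset.subset_erase.mpr ⟨hS, hxS⟩), h2⟩

/-- One pass over the vertices suffices: a vertex that could not be removed belongs to every
remaining set of minimum degree two, and this persists when the set shrinks further. -/
lemma St.shrink_run {n : ℕ} {env : ℕ → ℕ} {m : Mem}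
    (h : ∃ S ⊆ Finset.range n, S.Nonempty ∧ TwoClosed n (rel m 4) S) :
    (∀ b, b ≠ 5 → b ≠ 7 → St.shrink.run n env m b = m b) ∧
      (setOf n (St.shrink.run n env m)).Nonempty ∧
      TwoClosed n (rel m 4) (setOf n (St.shrink.run n env m)) ∧
      ∀ S ⊆ setOf n (St.shrink.run n env m), S.Nonempty → TwoClosed n (rel m 4) S →
        S = setOf n (St.shrink.run n env m) := by
  rw [St.shrink, St.run, St.run]
  obtain ⟨f1, f2⟩ := St.fill_run (n := n) (a := 7) (x := 40) (e := .const 1) (env := env) (m := m)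
    (by decide)
  generalize (St.fill 7 40 (.const 1)).run n env m = m₁ at f1 f2
  have key := iterN_induct (f := fun i m' => St.shrinkStep.run n (Function.update env 42 i) m') (n := n)
    (a := m₁) (fun k (m' : Mem) => (∀ b, b ≠ 5 → b ≠ 7 → m' b = m b) ∧
      (∃ S ⊆ setOf n m', S.Nonempty ∧ TwoClosed n (rel m 4) S) ∧
      ∀ x < k, x ∈ setOf n m' → ∀ S ⊆ setOf n m', S.Nonempty → TwoClosed n (rel m 4) S → x ∈ S)
    ⟨fun b _ h7 => f1 b h7, ?_, by simp⟩ ?_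
  · obtain ⟨k1, ⟨S, hS, hne, h2⟩, k3⟩ := key
    generalize iterN (fun i m' => St.shrinkStep.run n (Function.update env 42 i) m') n m₁ = m₂ at *
    have hmin : ∀ S ⊆ setOf n m₂, S.Nonempty → TwoClosed n (rel m 4) S → S = setOf n m₂ :=
      fun S hS hne h2 => hS.antisymm fun x hx => k3 x (mem_setOf.mp hx).1 hx S hS hne h2
    have e := hmin S hS hne h2
    exact ⟨k1, e ▸ hne, e ▸ h2, hmin⟩
  · obtain ⟨S, hS, hne, h2⟩ := h
    refine ⟨S, fun i hi => ?_, hne, h2⟩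
    have hi := Finset.mem_range.mp (hS hi)
    exact mem_setOf.mpr ⟨hi, by rw [f2 i hi]; exact one_ne_zero⟩
  · rintro k hk m' ⟨h1, ⟨S, hS, hne, h2⟩, h3⟩
    obtain ⟨s1, s2⟩ := St.shrinkStep_run hk (env := Function.update env 42 k) (m := m') (by simp)
    have hrel : rel m' 4 = rel m 4 := by
      funext x y
      rw [rel, rel, h1 4 (by decide) (by decide)]
    rw [hrel] at s2
    generalize St.shrinkStep.run n (Function.update env 42 k) m' = m'' at s1 s2
    refine ⟨fun b h5 h7 => (s1 b h5 h7).trans (h1 b h5 h7), ?_⟩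
    rcases s2 with ⟨e, s2⟩ | ⟨e, T, hT, hTne, hT2⟩
    · rw [e]
      refine ⟨⟨S, hS, hne, h2⟩, fun x hx hxm => ?_⟩
      rcases Nat.lt_succ_iff_lt_or_eq.mp hx with hx | rfl
      · exact h3 x hx hxm
      · exact s2
    · rw [e]
      refine ⟨⟨T, hT, hTne, hT2⟩, fun x hx hxm U hU hUne hU2 => ?_⟩
      have hxk : x ≠ k := (Finset.mem_erase.mp hxm).1
      exact h3 x (by omega) (Finset.mem_of_mem_erase hxm) U (hU.trans (Finset.erase_subset _ _)) hUne hU2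

lemma cn_setOf {n : ℕ} {m : Mem} : cn n (fun i => m 7 i 0 ≠ 0) = (setOf n m).card := by
  unfold cn setOf
  congr

lemma Tm.eval_setSize {n : ℕ} {env : ℕ → ℕ} {m : Mem} :
    Tm.setSize.eval n m env = (setOf n m).card := by
  rw [← cn_setOf]
  simp [Tm.setSize]

/-- The condition of `Tm.cycleCond`. -/
def CycleCond (W : Finset ℕ) (R : ℕ → ℕ → Prop) (out : ℕ → ℕ) (i y : ℕ) : Prop :=
  i < W.card ∧ y ∈ W ∧ (∀ j < i, out j ≠ y) ∧ (i = 0 ∨ R (out (i - 1)) y)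

lemma CycleCond.congr {W : Finset ℕ} {R : ℕ → ℕ → Prop} {out out' : ℕ → ℕ} {i y : ℕ}
    (h : ∀ j < i, out j = out' j) (hc : CycleCond W R out i y) : CycleCond W R out' i y := by
  refine ⟨hc.1, hc.2.1, fun j hj => h j hj ▸ hc.2.2.1 j hj, ?_⟩
  by_cases hi : i = 0
  · exact .inl hi
  · rw [← h (i - 1) (by omega)]
    exact hc.2.2.2

lemma Tm.tr_cycleCond {n i y : ℕ} (hi : i < n) (hy : y < n) {env : ℕ → ℕ} {m : Mem} (ei : env 40 = i)
    (ey : env 41 = y) :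
    Tm.cycleCond.tr n m env ↔ CycleCond (setOf n m) (rel m 4) (fun j => m 1 j 0) i y := by
  subst ei ey
  simp only [Tm.cycleCond, Tm.unvisited, Tm.prev, tr_and, tr_all, tr_lt, tr_add, tr_not, tr_eq, tr_get,
    eval_get, eval_var, eval_sub, eval_const, eval_setSize, Function.update_self,
    Function.update_of_ne, ne_eq, show (40 : ℕ) ≠ 45 by decide,
    show (41 : ℕ) ≠ 45 by decide, not_false_eq_true, forall_lt_lt_iff hi, CycleCond, mem_setOf, hy,
    true_and]
  exact Iff.rfl

/-- If the minimal sets with all degrees at least two have all degrees equal to two, then one of them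
is found and listed as a cycle. -/
lemma St.findCycle_run {n : ℕ} {env : ℕ → ℕ} {m : Mem} {R : ℕ → ℕ → Prop}
    (hR : ∀ x < n, ∀ y < n, Tm.degTwoAdj.tr n m (Function.update (Function.update env 40 x) 41 y) ↔ R x y)
    (hsymm : ∀ x < n, ∀ y < n, R x y → R y x) (hirr : ∀ x < n, ¬ R x x)
    (hdeg : ∀ W ⊆ Finset.range n, W.Nonempty → TwoClosed n R W →
      (∀ S ⊆ W, S.Nonempty → TwoClosed n R S → S = W) → ∀ x ∈ W, cn n (fun y => y ∈ W ∧ R x y) = 2)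
    (hex : ∃ S ⊆ Finset.range n, S.Nonempty ∧ TwoClosed n R S) :
    ∃ W ⊆ Finset.range n, W.Nonempty ∧ (∀ S ⊆ W, S.Nonempty → TwoClosed n R S → S = W) ∧
      3 ≤ W.card ∧ Found n W.card R 0 (St.findCycle.run n env m) ∧
      ∀ i < W.card, St.findCycle.run n env m 1 i 0 ∈ W := by
  simp only [St.findCycle, St.run.eq_3]
  obtain ⟨g1, g2⟩ := St.fillTable_run (n := n) (a := 4) (x := 40) (y := 41) (e := .degTwoAdj) (env := env)
    (m := m) (by decide) (by decide)
  generalize (St.fillTable 4 40 41 Tm.degTwoAdj).run n env m = m₁ at g1 g2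
  have hR₁ : ∀ x < n, ∀ y < n, rel m₁ 4 x y ↔ R x y := fun x hx y hy => by
    rw [rel, g2 x hx y hy]
    exact hR x hx y hy
  have h2 : ∀ S ⊆ Finset.range n, TwoClosed n (rel m₁ 4) S ↔ TwoClosed n R S := fun S hS => by
    have hlt : ∀ x ∈ S, x < n := fun x hx => Finset.mem_range.mp (hS hx)
    exact ⟨fun h => h.mono fun x hx y hy => (hR₁ x (hlt x hx) y (hlt y hy)).mp,
      fun h => h.mono fun x hx y hy => (hR₁ x (hlt x hx) y (hlt y hy)).mpr⟩
  obtain ⟨s1, s2, s3, s4⟩ := St.shrink_run (n := n) (env := env) (m := m₁) (by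
    obtain ⟨S, hS, hne, h⟩ := hex
    exact ⟨S, hS, hne, (h2 S hS).mpr h⟩)
  generalize St.shrink.run n env m₁ = m₂ at s1 s2 s3 s4
  set W := setOf n m₂ with hW
  have hWn : W ⊆ Finset.range n := fun i hi => Finset.mem_range.mpr (mem_setOf.mp hi).1
  have hmin : ∀ S ⊆ W, S.Nonempty → TwoClosed n R S → S = W := fun S hS hne h =>
    s4 S hS hne ((h2 S (hS.trans hWn)).mpr h)
  have hdW := hdeg W hWn s2 ((h2 W hWn).mp s3) hmin
  have hcard : W.card ≤ n := by simpa using Finset.card_le_card hWn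
  obtain ⟨l1, l2⟩ := St.list_run (n := n) (e := .cycleCond) (env := env) (m := m₂)
    (CycleCond W (rel m₂ 4)) (fun out out' i y h hc => hc.congr h) (by
      intro m' hm' i hi y hy
      rw [Tm.tr_cycleCond (i := i) (y := y) hi hy (by simp) (by simp)]
      have e1 : rel m' 4 = rel m₂ 4 := by
        funext x y
        rw [rel, rel, hm' 4 (by decide)]
      have e2 : setOf n m' = W := by
        ext i
        rw [hW, mem_setOf, mem_setOf, hm' 7 (by decide)]
      rw [e1, e2])
  generalize (St.list .cycleCond).run n env m₂ = m₃ at l1 l2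
  have hR₂ : rel m₂ 4 = rel m₁ 4 := by
    funext x y
    rw [rel, rel, s1 4 (by decide) (by decide)]
  rw [hR₂] at l2
  have hdW₁ : ∀ x ∈ W, cn n (fun y => y ∈ W ∧ rel m₁ 4 x y) = 2 := fun x hx => by
    rw [← hdW x hx]
    exact cn_congr fun y hy => and_congr_right fun _ => hR₁ x (Finset.mem_range.mp (hWn hx)) y hy
  obtain ⟨o1, o2, o3, o4, o5⟩ := listing_cycle (out := fun i => m₃ 1 i 0) hWn s2
    (fun x hx y hy => by rw [hR₁ x hx y hy, hR₁ y hy x hx]; exact hsymm x hx y hy)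
    (fun x hx => by rw [hR₁ x hx x hx]; exact hirr x hx) hdW₁ s4
    (fun i hi ⟨y, hy, hc⟩ => (l2 i (by omega) ⟨y, hy, hi, hc⟩).2.2)
  have hlt : ∀ i < W.card, m₃ 1 i 0 < n := fun i hi => Finset.mem_range.mp (hWn (o2 i hi))
  have hsize : Tm.setSize.eval n m₃ env = W.card := by
    rw [Tm.eval_setSize, hW]
    congr 1
    ext i
    rw [mem_setOf, mem_setOf, l1 7 (by decide)]
  refine ⟨W, hWn, s2, hmin, o1, St.report_run (by decide) (by omega) hsize ⟨hlt, o3,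
    fun i hi => (hR₁ _ (hlt _ (by omega)) _ (hlt _ hi)).mp (o4 i hi),
    (hR₁ _ (hlt _ (by omega)) _ (hlt _ (by omega))).mp o5⟩, fun i hi => ?_⟩
  have e1 : (St.report .setSize 0).run n env m₃ 1 i 0 = m₃ 1 i 0 := by
    simp only [St.report, St.run, Mem.upd_apply, hsize]
    simp [hi.ne]
  rw [e1]
  exact o2 i hi

end RAM

/-! ### Minimal sets of minimum degree two -/

namespace SimpleGraph

/-- If all degrees inside a finite set are at least two, then the set contains a cycle. -/
lemma exists_isCycle_of_two_neighbors {V : Type*} (H : SimpleGraph V) (W : Finset V)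
    (hne : W.Nonempty) (h2 : ∀ x ∈ W, ∃ p ∈ W, ∃ q ∈ W, p ≠ q ∧ H.Adj x p ∧ H.Adj x q) :
    ∃ (a : V) (c : H.Walk a a), c.IsCycle ∧ ∀ x ∈ c.support, x ∈ W := by
  classical
  set S : Set ℕ := {n | ∃ l : List V, l.Nodup ∧ (∀ x ∈ l, x ∈ W) ∧ l.IsChain H.Adj ∧ l.length = n}
    with hS
  have hbdd : BddAbove S := by
    refine ⟨W.card, ?_⟩
    rintro n ⟨l, hl, hlW, -, rfl⟩
    rw [← List.toFinset_card_of_nodup hl]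
    exact Finset.card_le_card fun x hx => hlW x (List.mem_toFinset.mp hx)
  obtain ⟨l, hn, hlW, hch, hlen⟩ := Nat.sSup_mem (s := S) ⟨0, [], by simp⟩ hbdd
  have hmax : ∀ l' : List V, l'.Nodup → (∀ x ∈ l', x ∈ W) → l'.IsChain H.Adj →
      l'.length ≤ l.length := by
    intro l' h1 h2 h3
    rw [hlen]
    exact le_csSup hbdd ⟨l', h1, h2, h3, rfl⟩
  cases l with
  | nil =>
    obtain ⟨x, hx⟩ := hne
    have := hmax [x] (by simp) (by simpa using hx) (by simp)
    simp at this
  | cons a t =>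
    have hmem : ∀ y ∈ W, H.Adj a y → y ∈ t := by
      intro y hy hay
      by_contra hyt
      have hyl : y ∉ a :: t := by
        simp only [List.mem_cons, not_or]
        exact ⟨hay.ne', hyt⟩
      have := hmax (y :: a :: t) (List.nodup_cons.mpr ⟨hyl, hn⟩)
        (fun x hx => (List.mem_cons.mp hx).elim (fun e => e ▸ hy) (hlW x))
        (List.isChain_cons_cons.mpr ⟨hay.symm, hch⟩)
      simp at this
    obtain ⟨p, hp, q, hq, hpq, ap, aq⟩ := h2 a (hlW a (by simp))
    -- Of the two neighbours of the first vertex of a longest chain, one is not its successor; it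
    -- closes a cycle of length at least three.
    obtain ⟨y, hy, ay, t₁, t₂, ht, ht₁⟩ : ∃ y ∈ W, H.Adj a y ∧ ∃ t₁ t₂, t = t₁ ++ y :: t₂ ∧ t₁ ≠ [] := by
      obtain ⟨t₁, t₂, ht⟩ := List.append_of_mem (hmem p hp ap)
      obtain ⟨t₃, t₄, ht'⟩ := List.append_of_mem (hmem q hq aq)
      by_cases h1 : t₁ = []
      · refine ⟨q, hq, aq, t₃, t₄, ht', ?_⟩
        rintro rfl
        rw [h1] at ht
        rw [ht] at ht'
        simp only [List.nil_append, List.cons.injEq] at ht'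
        exact hpq ht'.1
      · exact ⟨p, hp, ap, t₁, t₂, ht, h1⟩
    have hpre : (a :: t₁ ++ [y]) <+: (a :: t) := ⟨t₂, by simp [ht]⟩
    obtain ⟨c, hc, hs⟩ := exists_isCycle_of_list (G := H) (a := a) (b := y) (l := a :: t₁ ++ [y])
      ⟨hch.prefix hpre, by simp, List.getLast?_concat⟩ ay.symm (hn.sublist hpre.sublist) (by
        have := List.length_pos_of_ne_nil ht₁
        simp only [List.length_append, List.length_cons, List.length_nil]
        omega)
    refine ⟨a, c, hc, fun x hx => ?_⟩
    rw [hs, List.mem_append, List.mem_singleton] at hx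
    rcases hx with hx | rfl
    · exact hlW x (hpre.subset hx)
    · exact hlW x (by simp)

open RAM

variable {n : ℕ} {G : SimpleGraph (Fin n)} {K I : Finset (Fin n)}

lemma cn_liftAdj (a : Fin n) : cn n (liftAdj G.Adj a) = (G.neighborSet a).ncard := by
  classical
  rw [← Set.ncard_image_of_injective _ Fin.val_injective, cn, ← Set.ncard_coe_finset]
  congr 1
  ext i
  simp only [Finset.coe_filter, Finset.mem_range, Set.mem_image, mem_neighborSet, Set.mem_ofPred_eq]
  constructor
  · rintro ⟨hi, _, _, h⟩
    exact ⟨⟨i, hi⟩, h, rfl⟩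
  · rintro ⟨b, hb, rfl⟩
    exact ⟨b.2, a.2, b.2, hb⟩

/-- The vertices of a cycle, as numbers. -/
lemma twoClosed_support {H : SimpleGraph (Fin n)} {a : Fin n} {c : H.Walk a a} (hc : c.IsCycle) :
    TwoClosed n (liftAdj H.Adj) (c.support.toFinset.image Fin.val) := by
  intro x hx
  obtain ⟨x, hxs, rfl⟩ := Finset.mem_image.mp hx
  rw [List.mem_toFinset] at hxs
  obtain ⟨p, q, hpq, e⟩ := Set.ncard_eq_two.mp (hc.ncard_neighborSet_toSubgraph_eq_two hxs)
  have key : ∀ y, y ∈ c.toSubgraph.neighborSet x →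
      (y : ℕ) ∈ c.support.toFinset.image Fin.val ∧ liftAdj H.Adj x y := by
    intro y hy
    have hys : y ∈ c.support := c.mem_verts_toSubgraph.mp (c.toSubgraph.edge_vert hy.symm)
    exact ⟨Finset.mem_image_of_mem _ (List.mem_toFinset.mpr hys),
      (liftAdj_iff x y).mpr (c.toSubgraph.adj_sub hy)⟩
  exact two_le_cn.mpr ⟨p, p.2, q, q.2, fun h => hpq (Fin.ext h), key p (by simp [e]), key q (by simp [e])⟩

/-- In the graph of degree-two vertices, a minimal set with degrees at least two is a cycle. -/
lemma cn_eq_two_of_minimal {W : Finset ℕ} (hW : W ⊆ Finset.range n) (hne : W.Nonempty)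
    (h2 : TwoClosed n (liftAdj (G.degTwoGraph I).Adj) W)
    (hmin : ∀ S ⊆ W, S.Nonempty → TwoClosed n (liftAdj (G.degTwoGraph I).Adj) S → S = W) :
    ∀ x ∈ W, cn n (fun y => y ∈ W ∧ liftAdj (G.degTwoGraph I).Adj x y) = 2 := by
  classical
  have hlt : ∀ x ∈ W, x < n := fun x hx => Finset.mem_range.mp (hW hx)
  obtain ⟨a, c, hc, hcW⟩ := exists_isCycle_of_two_neighbors (G.degTwoGraph I)
    (Finset.univ.filter fun a : Fin n => (a : ℕ) ∈ W) (by
      obtain ⟨x, hx⟩ := hne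
      exact ⟨⟨x, hlt x hx⟩, by simpa using hx⟩) (by
      intro x hx
      obtain ⟨i, hi, j, hj, hij, ⟨iW, ri⟩, jW, rj⟩ := two_le_cn.mp (h2 x (by simpa using hx))
      exact ⟨⟨i, hi⟩, by simpa using iW, ⟨j, hj⟩, by simpa using jW, fun e => hij (congrArg Fin.val e),
        (liftAdj_iff x ⟨i, hi⟩).mp ri, (liftAdj_iff x ⟨j, hj⟩).mp rj⟩)
  have hWc : c.support.toFinset.image Fin.val = W := by
    refine hmin _ (fun x hx => ?_) ?_ (twoClosed_support hc)
    · obtain ⟨x, hxs, rfl⟩ := Finset.mem_image.mp hx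
      simpa using hcW x (List.mem_toFinset.mp hxs)
    · exact ⟨a, Finset.mem_image_of_mem _ (by simp)⟩
  intro x hx
  refine le_antisymm ?_ (h2 x hx)
  rw [← hWc] at hx ⊢
  obtain ⟨x, hxs, rfl⟩ := Finset.mem_image.mp hx
  rw [List.mem_toFinset] at hxs
  obtain ⟨p, q, -, e⟩ := Set.ncard_eq_two.mp (hc.ncard_neighborSet_toSubgraph_eq_two hxs)
  have key : ∀ y < n, y ∈ c.support.toFinset.image Fin.val ∧ liftAdj (G.degTwoGraph I).Adj x y →
      y = p ∨ y = q := by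
    rintro y - ⟨hy, hxy⟩
    obtain ⟨y, hys, rfl⟩ := Finset.mem_image.mp hy
    -- Cycles of this graph are induced, so neighbours inside `W` are neighbours along the cycle.
    have hm := mem_edges_of_isCycle_degTwoGraph hc hxs (List.mem_toFinset.mp hys) ((liftAdj_iff x y).mp hxy)
    have : y ∈ c.toSubgraph.neighborSet x := Walk.adj_toSubgraph_iff_mem_edges.mpr hm
    rw [e] at this
    rcases this with rfl | rfl
    exacts [.inl rfl, .inr rfl]
  by_contra hcon
  obtain ⟨i, hi, j, hj, k, hk, hij, hik, hjk, ri, rj, rk⟩ := three_le_cn.mp (not_le.mp hcon)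
  have := key i hi ri
  have := key j hj rj
  have := key k hk rk
  omega

lemma SplitFacts.tr_degTwoAdj (h : G.SplitFacts K I) {env : ℕ → ℕ} {m : Mem}
    (hA : rel m 0 = liftAdj G.Adj) : ∀ x < n, ∀ y < n,
      Tm.degTwoAdj.tr n m (Function.update (Function.update env 40 x) 41 y) ↔
        liftAdj (G.degTwoGraph I).Adj x y := by
  intro x hx y hy
  have hcn : ∀ a : Fin n, cn n (fun i => m 0 a i ≠ 0) = (G.neighborSet a).ncard := fun a => by
    rw [← cn_liftAdj, ← hA]
    rfl
  simp only [Tm.degTwoAdj, Tm.tr_and, Tm.tr_add, Tm.tr_get, Tm.tr_eq, Tm.eval_var, Tm.eval_const,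
    Tm.eval_cnt_tr, Function.update_self, Function.update_of_ne, ne_eq, show (40 : ℕ) ≠ 45 by decide,
    show (40 : ℕ) ≠ 41 by decide, show (41 : ℕ) ≠ 45 by decide, not_false_eq_true]
  rw [← ne_eq, hcn ⟨x, hx⟩, hcn ⟨y, hy⟩, show m 0 x y ≠ 0 ↔ liftAdj G.Adj x y by rw [← hA]; rfl,
    liftAdj_iff (R := G.Adj) ⟨x, hx⟩ ⟨y, hy⟩, liftAdj_iff (R := (G.degTwoGraph I).Adj) ⟨x, hx⟩ ⟨y, hy⟩]
  change _ ↔ G.Adj _ _ ∧ (_ ∈ G.degTwoPart I ∨ _ ∈ G.degTwoPart I)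
  rw [h.degTwoPart_eq]
  rfl

/-- If `G` is not Hamiltonian, then the program finds a short cycle. -/
lemma SplitFacts.findCycle_run (h : G.SplitFacts K I) (hH : ¬ G.IsHamiltonian) {env : ℕ → ℕ} {m : Mem}
    (hA : rel m 0 = liftAdj G.Adj) :
    ∃ (a : Fin n) (c : (G.degTwoGraph I).Walk a a), G.IsShortCycle K I c ∧
      St.findCycle.run n env m 6 0 0 = 0 ∧ St.findCycle.run n env m 6 1 0 = c.support.length ∧
      ∀ (i : ℕ) (hi : i < c.support.length), St.findCycle.run n env m 1 i 0 = (c.support[i] : ℕ) := by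
  classical
  rw [h.isHamiltonian_iff, not_not] at hH
  obtain ⟨a₀, c₀, hc₀⟩ := hH
  set S₀ := c₀.support.toFinset.image Fin.val with hS₀
  have hS₀n : S₀ ⊆ Finset.range n := fun x hx => by
    obtain ⟨x, -, rfl⟩ := Finset.mem_image.mp hx
    exact Finset.mem_range.mpr x.2
  have hS₀2 := twoClosed_support hc₀.isCycle
  obtain ⟨W, hWn, -, hmin, h3, hF, hout⟩ := St.findCycle_run (env := env) (h.tr_degTwoAdj hA)
    (fun x hx y hy ⟨_, _, e⟩ => ⟨hy, hx, e.symm⟩) (fun x hx ⟨_, _, e⟩ => e.ne rfl)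
    (fun W hW hne h2 hmin => cn_eq_two_of_minimal hW hne h2 hmin)
    ⟨S₀, hS₀n, ⟨a₀, Finset.mem_image_of_mem _ (by simp)⟩, hS₀2⟩
  generalize St.findCycle.run n env m = m' at hF hout
  obtain ⟨a, b, l, hs, hba, hn, hlen, hl, ho⟩ := hF.exists_list (by omega)
  obtain ⟨c, hc, hsupp⟩ := exists_isCycle_of_list hs hba hn (by omega)
  refine ⟨a, c, ⟨hc, fun u hu v hv huv => mem_edges_of_isCycle_degTwoGraph hc hu hv huv, ?_⟩, hF.1,
    ho _ hsupp⟩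
  -- If the cycle found contained all of `K`, it would contain every vertex, and `W` would be
  -- everything. By minimality the support of the short cycle `c₀` would equal `W`, yet it misses a
  -- vertex.
  by_contra hcon
  push Not at hcon
  have hcross : ∀ x y, (G.degTwoGraph I).Adj x y → G.crossAdj K I x y := by
    rintro x y ⟨hxy, hx | hy⟩
    · exact ⟨hxy, .inl ⟨hx.1, (h.cover y).resolve_right fun hy => h.indep x hx.1 y hy hxy⟩⟩
    · exact ⟨hxy, .inr ⟨(h.cover x).resolve_right fun hx => h.indep x hx y hy.1 hxy, hy.1⟩⟩
  have hall := h.mem_of_forall_mem (hs.mono hcross) (hcross _ _ hba) hn (fun g hg => by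
    have := hcon g hg
    rw [hsupp, List.mem_append, List.mem_singleton] at this
    rcases this with e | rfl
    · exact e
    · exact hs.head_mem)
  have hW : ∀ v : Fin n, (v : ℕ) ∈ W := by
    intro v
    obtain ⟨i, hi, e⟩ := List.getElem_of_mem (hall v)
    rw [← e, hl i hi]
    exact hout i (by omega)
  obtain ⟨k, -, hk⟩ := hc₀.misses
  have e := hmin S₀ (fun x hx => hW ⟨x, Finset.mem_range.mp (hS₀n hx)⟩)
    ⟨a₀, Finset.mem_image_of_mem _ (by simp)⟩ hS₀2
  have hkS := hW k
  rw [← e, hS₀, Finset.mem_image] at hkS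
  obtain ⟨k', hk', e'⟩ := hkS
  rw [Fin.val_inj.mp e', List.mem_toFinset] at hk'
  exact hk hk'

/-- If the search has succeeded, then a Hamiltonian cycle is in memory. -/
lemma exists_isHamiltonianCycle_of_found (hn : 3 ≤ n) {m : Mem} (hF : Found n n (liftAdj G.Adj) 1 m) :
    ∃ (a : Fin n) (c : G.Walk a a), c.IsHamiltonianCycle ∧
      m 6 0 0 = 1 ∧ m 6 1 0 = c.support.length ∧
      ∀ (i : ℕ) (hi : i < c.support.length), m 1 i 0 = (c.support[i] : ℕ) := by
  classical
  obtain ⟨a, b, l, hs, hba, hnd, hlen, -, ho⟩ := hF.exists_list (by omega)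
  have hall : ∀ v, v ∈ l := by
    have : l.toFinset = Finset.univ := Finset.eq_univ_of_card _ (by
      rw [List.toFinset_card_of_nodup hnd, hlen, Fintype.card_fin])
    intro v
    rw [← List.mem_toFinset, this]
    exact Finset.mem_univ v
  obtain ⟨c, hc, hsupp⟩ := exists_isHamiltonianCycle_of_list hs hba hnd (by omega) hall
  exact ⟨a, c, by convert hc, hF.1, ho _ hsupp⟩

end SimpleGraph

/-! ### The whole algorithm -/

namespace RAM

/-- Search for a Hamiltonian cycle, then, if there is none, for a short cycle. -/
def St.main : St := .seq .search (.ite (.get 6 (.const 0) (.const 0)) .skip .findCycle)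

/-- The machine program: after the search, the answer and the length are moved to registers. -/
def mainProg : Prog :=
  .seq (St.main.code 0) (.seq (.assign 1 (.get 6 (.const 1) (.const 0)))
    (.assign 0 (.get 6 (.const 0) (.const 0))))

/-- The memory presents the answer `b` and the list `l`. -/
def Mem.Outputs {n : ℕ} (m : Mem) (b : ℕ) (l : List (Fin n)) : Prop :=
  m 6 0 0 = b ∧ m 6 1 0 = l.length ∧ ∀ (i : ℕ) (hi : i < l.length), m 1 i 0 = (l[i] : ℕ)

/-- The answer is kept in array `6` until the end, because during the run register `0` holds the
size and register `1` is the bottom of the result stack. -/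
lemma exec_mainProg {n : ℕ} (G : SimpleGraph (Fin n)) :
    ∃ (s : State) (t : ℕ), Exec mainProg (input G) s t ∧ t ≤ (St.main.cost + 2).eval n ∧
      ∀ {b : ℕ} {l : List (Fin n)}, (St.main.run n (fun _ => 0) (input G).mem).Outputs b l →
        Outputs s b l := by
  obtain ⟨s, t, hx, ht, hm, -⟩ := St.main.correct 0 (input G)
  have h0 : (input G).reg 0 = n := rfl
  have henv : (input G).env = fun _ => 0 := by
    funext x
    simp [State.env, input, vreg_ne_zero]
  rw [h0] at ht hm
  rw [henv] at hm
  refine ⟨_, _, .seq hx (.seq (.assign _ _ _) (.assign _ _ _)), ?_, fun {b l} h => ?_⟩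
  · simp only [Polynomial.eval_add, Polynomial.eval_ofNat]
    omega
  · rw [← hm] at h
    refine ⟨?_, ?_, h.2.2⟩
    · rw [setReg_reg_self]
      exact h.1
    · rw [setReg_reg_ne _ _ one_ne_zero, setReg_reg_self]
      exact h.2.1

end RAM

namespace SimpleGraph

open RAM

/-- The flag is set exactly for Hamiltonian graphs: a set flag comes with a verified cycle, and for
a Hamiltonian graph some guess is good. -/
lemma SplitFacts.main_run {n : ℕ} {G : SimpleGraph (Fin n)} {K I : Finset (Fin n)}
    (h : G.SplitFacts K I) :
    (G.IsHamiltonian → ∃ (a : Fin n) (c : G.Walk a a), c.IsHamiltonianCycle ∧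
      (St.main.run n (fun _ => 0) (input G).mem).Outputs 1 c.support) ∧
    (¬ G.IsHamiltonian → ∃ (a : Fin n) (c : (G.degTwoGraph I).Walk a a), G.IsShortCycle K I c ∧
      (St.main.run n (fun _ => 0) (input G).mem).Outputs 0 c.support) := by
  have hn : 8 ≤ n := by
    have h1 := h.eight_le
    have h2 := Finset.card_le_univ I
    rw [Fintype.card_fin] at h2
    omega
  have hinv : SearchInv n (liftAdj G.Adj) (input G).mem := by
    refine ⟨?_, fun h6 => absurd (by simp [input]) h6⟩
    funext i j
    rw [eq_iff_iff]
    simp only [rel, input, true_and, ne_eq, ite_eq_right_iff, one_ne_zero, imp_false, not_not]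
    constructor
    · rintro ⟨u, v, rfl, rfl, huv⟩
      exact (liftAdj_iff u v).mpr huv
    · rintro ⟨hi, hj, hij⟩
      exact ⟨_, _, rfl, rfl, hij⟩
  obtain ⟨s1, s2⟩ := St.search_run (by omega) hinv
  rw [St.main, St.run]
  generalize St.search.run n (fun _ => 0) (input G).mem = m at s1 s2
  by_cases hf : m 6 0 0 = 0
  · rw [St.run_ite_neg (show ¬ (Tm.get 6 (.const 0) (.const 0)).tr n m _ from not_not.mpr hf)]
    have hH : ¬ G.IsHamiltonian := fun hH => s2 (h.exists_goodGuess hH) hf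
    exact ⟨fun hH' => absurd hH' hH, fun _ => h.findCycle_run hH s1.1⟩
  · rw [St.run_ite_pos (show (Tm.get 6 (.const 0) (.const 0)).tr n m _ from hf), St.run]
    obtain ⟨a, c, hc, ho⟩ := exists_isHamiltonianCycle_of_found (by omega) (s1.2 hf)
    exact ⟨fun _ => ⟨a, c, hc, ho⟩, fun hH => absurd (fun _ => ⟨a, c, hc⟩) hH⟩

end SimpleGraph

theorem mainTheorem2 :
    (∀ (V : Type*) [Fintype V] [DecidableEq V] (G : SimpleGraph V) (K I : Finset V),
      G.IsAdmissible K I →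
        (G.IsHamiltonian ↔
          ¬ ∃ (a : V) (c : (G.degTwoGraph I).Walk a a), G.IsShortCycle K I c)) ∧
    (∃ (P : RAM.Prog) (p : Polynomial ℕ),
      ∀ (n : ℕ) (G : SimpleGraph (Fin n)) (K I : Finset (Fin n)), G.IsAdmissible K I →
        ∃ (s : RAM.State) (t : ℕ), RAM.Exec P (RAM.input G) s t ∧ t ≤ p.eval n ∧
          (G.IsHamiltonian →
            ∃ (a : Fin n) (c : G.Walk a a), c.IsHamiltonianCycle ∧ RAM.Outputs s 1 c.support) ∧
          (¬ G.IsHamiltonian →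
            ∃ (a : Fin n) (c : (G.degTwoGraph I).Walk a a),
              G.IsShortCycle K I c ∧ RAM.Outputs s 0 c.support)) := by
  refine ⟨fun V _ _ G K I h => h.splitFacts.isHamiltonian_iff, RAM.mainProg,
    RAM.St.main.cost + 2, fun n G K I h => ?_⟩
  obtain ⟨s, t, hx, ht, hs⟩ := RAM.exec_mainProg G
  exact ⟨s, t, hx, ht, fun hH => (h.splitFacts.main_run.1 hH).imp fun a => Exists.imp
    fun c hc => ⟨hc.1, hs hc.2⟩, fun hH => (h.splitFacts.main_run.2 hH).imp fun a => Exists.imp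
    fun c hc => ⟨hc.1, hs hc.2⟩⟩
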